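/- Call a lattice point $(x,y)\in\mathbb{Z}^2$ primitive if $\gcd(x,y)=1$. There are a single random access machine program (with integer registers and memory cells, operations $+,-,\times$, integer division, indirect load and store, and jumps, under the logarithmic cost criterion: each instruction costs one unit plus the bit lengths of the integers that it reads, writes or uses as addresses) and a constant $C$ with the following property. Let $k, b$ be natural numbers and let $P$ be a simple polygon in the plane with $k\ge 3$ vertices, given in cyclic order by rational coordinates whose numerators and denominators (in lowest terms) have at most $b$ bits, such that the closed region bounded by $P$ contains the origin, and let $D$ be the (Euclidean) diameter of that region. On the list consisting of $k$ followed by the numerators and denominators of the coordinates of the vertices, the program halts and outputs the exact number of primitive lattice points in the closed region bounded by $P$, after running time at most $$C\cdot\max(1,D)^{6/7}\cdot k\cdot b^{C}.$$ -/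

import Mathlib

/-! ### Random access machines with logarithmic cost -/

namespace Ram

/-- Instructions of a random access machine. The machine has registers, named directly by the
instructions, and a random access memory, reached only through `load` and `store`. Registers and
memory cells hold arbitrary integers; the cost of an instruction depends on their bit lengths. -/
inductive Instr
  /-- `reg[dst] := c` -/
  | const (dst : ℕ) (c : ℤ)
  /-- `reg[dst] := reg[x] + reg[y]` -/
  | add (dst x y : ℕ)
  /-- `reg[dst] := reg[x] - reg[y]` -/
  | sub (dst x y : ℕ)
  /-- `reg[dst] := reg[x] * reg[y]` -/
  | mul (dst x y : ℕ)
  /-- `reg[dst] := reg[x] / reg[y]`, integer quotient with nonnegative remainder;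
  the quotient by `0` is `0` -/
  | div (dst x y : ℕ)
  /-- `reg[dst] := mem[reg[ptr]]` -/
  | load (dst ptr : ℕ)
  /-- `mem[reg[ptr]] := reg[src]` -/
  | store (ptr src : ℕ)
  /-- continue at instruction number `target` -/
  | jump (target : ℕ)
  /-- continue at instruction number `target` if `reg[x]` is positive, else at the next one -/
  | jumpPos (x target : ℕ)

/-- A program is a finite list of instructions, numbered from `0`. -/
abbrev Program := List Instr

/-- Program counter, contents of the registers, contents of the memory cells
(which are addressed by integers). -/
structure State where
  pc : ℕ
  reg : ℕ → ℤ
  mem : ℤ → ℤ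

/-- The number of binary digits of `|z|`. -/
def bitLength (z : ℤ) : ℕ := z.natAbs.size

/-- Write `z` into register `dst` and pass on to the next instruction. -/
def State.write (s : State) (dst : ℕ) (z : ℤ) : State :=
  { pc := s.pc + 1, reg := Function.update s.reg dst z, mem := s.mem }

/-- The effect of one instruction. -/
def exec : Instr → State → State
  | .const dst c, s => s.write dst c
  | .add dst x y, s => s.write dst (s.reg x + s.reg y)
  | .sub dst x y, s => s.write dst (s.reg x - s.reg y)
  | .mul dst x y, s => s.write dst (s.reg x * s.reg y)
  | .div dst x y, s => s.write dst (s.reg x / s.reg y)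
  | .load dst ptr, s => s.write dst (s.mem (s.reg ptr))
  | .store ptr src, s =>
      { pc := s.pc + 1, reg := s.reg, mem := Function.update s.mem (s.reg ptr) (s.reg src) }
  | .jump target, s => { s with pc := target }
  | .jumpPos x target, s => { s with pc := if 0 < s.reg x then target else s.pc + 1 }

/-- The logarithmic cost of one instruction: one unit, plus the bit lengths of all integers that
are read, written, or used as a memory address. -/
def cost : Instr → State → ℕ
  | .const _ c, _ => 1 + bitLength c
  | .add _ x y, s =>
      1 + bitLength (s.reg x) + bitLength (s.reg y) + bitLength (s.reg x + s.reg y)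
  | .sub _ x y, s =>
      1 + bitLength (s.reg x) + bitLength (s.reg y) + bitLength (s.reg x - s.reg y)
  | .mul _ x y, s =>
      1 + bitLength (s.reg x) + bitLength (s.reg y) + bitLength (s.reg x * s.reg y)
  | .div _ x y, s =>
      1 + bitLength (s.reg x) + bitLength (s.reg y) + bitLength (s.reg x / s.reg y)
  | .load _ ptr, s => 1 + bitLength (s.reg ptr) + bitLength (s.mem (s.reg ptr))
  | .store ptr src, s => 1 + bitLength (s.reg ptr) + bitLength (s.reg src)
  | .jump _, _ => 1
  | .jumpPos x _, s => 1 + bitLength (s.reg x)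

/-- `HaltsIn prog s t s'`: started in state `s`, the program halts in state `s'`, and the total
cost of the executed instructions is `t`. The machine halts when the program counter leaves the
program. -/
inductive HaltsIn (prog : Program) : State → ℕ → State → Prop
  | halt {s : State} : prog[s.pc]? = none → HaltsIn prog s 0 s
  | step {s s' : State} {i : Instr} {t : ℕ} : prog[s.pc]? = some i →
      HaltsIn prog (exec i s) t s' → HaltsIn prog s (cost i s + t) s'

/-- The initial state: the input list stands in the memory cells `0, 1, 2, …`; all other cells and
all registers are `0`. -/
def init (input : List ℤ) : State where
  pc := 0
  reg := fun _ => 0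
  mem := fun z => if 0 ≤ z then input.getD z.toNat 0 else 0

/-- On the given input, the program halts at cost `t` with the integer `out` in register `0`. -/
def Outputs (prog : Program) (input : List ℤ) (out : ℤ) (t : ℕ) : Prop :=
  ∃ s : State, HaltsIn prog (init input) t s ∧ s.reg 0 = out

end Ram

/-! ### Simple polygons, their regions, and primitive lattice points -/

/-- The Euclidean plane. -/
abbrev Plane := EuclideanSpace ℝ (Fin 2)

namespace Polygon

/-- A polygon in the plane is simple if it has at least three vertices, the vertices are distinct,
and two different edges meet only if they are consecutive, and then only in their common vertex.
The edge number `i` runs from vertex `i` to its cyclic successor. -/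
def IsSimple {k : ℕ} (P : Polygon Plane k) : Prop :=
  3 ≤ k ∧ Function.Injective P.vertices ∧
    ∀ i j : Fin k, i ≠ j → ∀ x ∈ P.edgeSet ℝ i ∩ P.edgeSet ℝ j,
      (j = finRotate k i ∧ x = P j) ∨ (i = finRotate k j ∧ x = P i)

/-- The closed region of a polygon: its boundary, together with the bounded connected components
of the complement of the boundary. -/
def region {k : ℕ} (P : Polygon Plane k) : Set Plane :=
  P.boundary ℝ ∪
    {p | p ∉ P.boundary ℝ ∧ Bornology.IsBounded (connectedComponentIn (P.boundary ℝ)ᶜ p)}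

/-- The polygon in the Euclidean plane with the given rational vertices. -/
noncomputable def toPlane {k : ℕ} (P : Polygon (ℚ × ℚ) k) : Polygon Plane k where
  vertices := fun i => !₂[((P i).1 : ℝ), ((P i).2 : ℝ)]

/-- All coordinates of the vertices are fractions, in lowest terms, whose numerator (up to sign)
and denominator have at most `b` binary digits. -/
def HasBits {k : ℕ} (P : Polygon (ℚ × ℚ) k) (b : ℕ) : Prop :=
  ∀ i : Fin k, (P i).1.num.natAbs < 2 ^ b ∧ (P i).1.den < 2 ^ b ∧
    (P i).2.num.natAbs < 2 ^ b ∧ (P i).2.den < 2 ^ b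

/-- The input that describes a polygon: the number of vertices, followed by the numerators and
denominators of both coordinates of each vertex, in cyclic order. -/
def encode {k : ℕ} (P : Polygon (ℚ × ℚ) k) : List ℤ :=
  (k : ℤ) :: (List.ofFn fun i : Fin k =>
    [(P i).1.num, ((P i).1.den : ℤ), (P i).2.num, ((P i).2.den : ℤ)]).flatten

end Polygon

/-- The primitive lattice points in a planar set: integer points with coprime coordinates. -/
def primitivePoints (S : Set Plane) : Set (ℤ × ℤ) :=
  {z | Int.gcd z.1 z.2 = 1 ∧ (!₂[(z.1 : ℝ), (z.2 : ℝ)] : Plane) ∈ S}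

/-!
Let `B` be a bound for the coordinates of the vertices, and let `r` be about the seventh root of
`B`. By Möbius inversion, the number of primitive points in the region is the sum over `1 ≤ d ≤ B`
of `μ d` times the number of the lattice points `z ≠ 0` for which `d • z` lies in the region. The
divisors are split at `T = r ^ 6` (`Slab.prim`, `Slab.sum_prim`).

* For `d ≤ T` the lattice points in the region shrunk by `d` are counted edge by edge. The points
  below an edge are counted by a sum of integer parts of a linear function, which the Euclidean
  algorithm evaluates (`linSum`, `linSum_swap`). This makes `r ^ 6` such sums for an edge.
* For `d > T` the points `z` have coordinates at most `r`, so there are about `r ^ 2` of them. For a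
  given `z` the divisors `d` for which `d • z` lies below an edge form an interval, so that `z`
  contributes a difference of two values of the Mertens function at arguments up to `r ^ 7`.
  A double application of the inversion formula expresses such a value by the values up to `r ^ 6`
  (`mertens_eq_sum`), with about `r ^ 4` operations (`fast_queryTerm`). The values up to `r ^ 6`
  come from a sieve (`ensures_sieve`). Again the total for an edge is of the order `r ^ 6`.

The signed sum over the edges yields the sum of the crossing numbers of the primitive points, where
the crossing number of a point is the signed number of the edges above it. In the interior of a
simple polygon the crossing number is `1` or `-1`, depending only on the orientation, and it
vanishes outside of the region; on the boundary it depends on whether the edge runs upwards or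
downwards in the lexicographic order (`Polygon.IsSimple.exists_winding`). The points on the boundary
are counted separately, as differences of slabs, to correct the sum
(`Polygon.encard_primitivePoints`).
The statement about the crossing number is proved without the Jordan curve theorem: a locally
constant function on the complement of the polygon takes one value near the polygon on each of its
sides (`Polygon.exists_collar`), so that, if its support is bounded, it is a multiple of the
crossing number (`Polygon.IsSimple.eq_mul_winding`). Applied to the indicator functions of the
bounded components, this shows that the components are exactly what the crossing number says.

The algorithm is written in a small functional language (`Term`, `Stmt`) with a compiler to
machine programs. The number of machine instructions is defined by recursion over the terms, and
the compiler is proved correct with respect to values and numbers of instructions (`Term.spec`,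
`Stmt.spec`, `fullProgram_outputs`). All integers that occur have at most a constant times `b`
digits (`Term.PBd`): in particular `k` is below a power of `2` with exponent linear in `b`, as the
vertices are distinct (`card_le_of_hasBits`). Finally `B` is at most twice `max 1 D`, where `D` is
the diameter, since the region contains the origin, so that `r ^ 6` is at most a constant times
`max 1 D ^ (6 / 7)` (`root_pow_le`).
-/

namespace Ram

/-! ### Bounded runs of the machine -/

/-- `Run prog κ n s s'`: the program leads from `s` to `s'` in at most `n` instructions, each of
cost at most `κ`. -/
inductive Run (prog : Program) (κ : ℕ) : ℕ → State → State → Prop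
  | refl (n : ℕ) (s : State) : Run prog κ n s s
  | step {n : ℕ} {s s' : State} {i : Instr} : prog[s.pc]? = some i → cost i s ≤ κ →
      Run prog κ n (exec i s) s' → Run prog κ (n + 1) s s'

section Run
variable {prog : Program} {κ n n' : ℕ} {s s' s'' : State}

theorem Run.mono (h : Run prog κ n s s') (hn : n ≤ n') : Run prog κ n' s s' := by
  induction h generalizing n' with
  | refl => exact .refl _ _
  | step h1 h2 _ ih =>
    obtain ⟨k, rfl⟩ : ∃ k, n' = k + 1 := ⟨n' - 1, by omega⟩
    exact .step h1 h2 (ih (by omega))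

theorem Run.trans (h : Run prog κ n s s') (h' : Run prog κ n' s' s'') :
    Run prog κ (n + n') s s'' := by
  induction h with
  | refl => exact h'.mono (by omega)
  | step h1 h2 _ ih => exact (Run.step h1 h2 (ih h')).mono (by omega)

theorem Run.one {i : Instr} (h : prog[s.pc]? = some i) (hc : cost i s ≤ κ) :
    Run prog κ 1 s (exec i s) := .step h hc (.refl _ _)

theorem Run.haltsIn (h : Run prog κ n s s') (hs : prog[s'.pc]? = none) :
    ∃ t ≤ n * κ, HaltsIn prog s t s' := by
  induction h with
  | refl => exact ⟨0, Nat.zero_le _, .halt hs⟩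
  | step h1 h2 _ ih =>
    obtain ⟨t, ht, h⟩ := ih hs
    exact ⟨_, by rw [Nat.succ_mul]; omega, .step h1 h⟩

end Run

/-- The instructions `code` stand in `prog` from address `o` on. -/
def At (prog : Program) (o : ℕ) (code : List Instr) : Prop :=
  ∀ j < code.length, prog[o + j]? = code[j]?

@[simp] theorem at_nil (prog : Program) (o : ℕ) : At prog o [] := by simp [At]

@[simp] theorem at_cons (prog : Program) (o : ℕ) (i : Instr) (l : List Instr) :
    At prog o (i :: l) ↔ prog[o]? = some i ∧ At prog (o + 1) l := by
  constructor
  · intro h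
    refine ⟨by simpa using h 0 (by simp), fun j hj => ?_⟩
    have := h (j + 1) (by simpa using hj)
    simpa [add_assoc, add_comm, add_left_comm] using this
  · rintro ⟨h0, h⟩ j hj
    rcases j with _ | j
    · simpa using h0
    · have := h j (by simpa using hj)
      simpa [add_assoc, add_comm, add_left_comm] using this

@[simp] theorem at_append (prog : Program) (o : ℕ) (l l' : List Instr) :
    At prog o (l ++ l') ↔ At prog o l ∧ At prog (o + l.length) l' := by
  induction l generalizing o with
  | nil => simp
  | cons i l ih =>
    simp only [List.cons_append, at_cons, ih, List.length_cons, and_assoc]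
    rw [show o + 1 + l.length = o + (l.length + 1) by omega]

theorem at_self (prog suffix : Program) : At (prog ++ suffix) 0 prog := by
  intro j hj
  simp [List.getElem?_append_left hj]

/-! ### A functional language and its compiler -/

/-- The arithmetic operations of the machine. -/
inductive Op
  | add | sub | mul | div

/-- The function computed by an operation. -/
def Op.fn : Op → ℤ → ℤ → ℤ
  | .add, x, y => x + y
  | .sub, x, y => x - y
  | .mul, x, y => x * y
  | .div, x, y => x / y

/-- The machine instruction of an operation. -/
def Op.instr : Op → ℕ → ℕ → ℕ → Instr
  | .add => .add
  | .sub => .sub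
  | .mul => .mul
  | .div => .div

mutual
/-- Terms of a small functional language, with de Bruijn indices. A term denotes an integer that
depends on an environment (the list of the values of the variables) and on the memory. -/
inductive Term
  /-- the variable with the given de Bruijn index -/
  | var (i : ℕ)
  /-- an integer constant -/
  | const (c : ℤ)
  /-- an arithmetic operation -/
  | op (o : Op) (a b : Term)
  /-- the content of a memory cell -/
  | load (a : Term)
  /-- `a` if `c` is positive, else `b` -/
  | ite (c a b : Term)
  /-- the value of `b` where the variable `0` stands for the value of `a` -/
  | letE (a b : Term)
  /-- the sum of `body` over the values `0, …, n - 1` of the variable `0` -/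
  | sum (n body : Term)
  /-- starting with the tuple `init` in the first variables, replace the tuple by `upd` as long as
  `cond` is positive, but at most `fuel` times; then return `res` -/
  | loop (fuel : Term) (init : Terms) (cond : Term) (upd : Terms) (res : Term)
/-- Tuples of terms. -/
inductive Terms
  | nil
  | cons (e : Term) (es : Terms)
end

/-- The number of terms in a tuple. -/
def Terms.length : Terms → ℕ
  | .nil => 0
  | .cons _ es => es.length + 1

/-- At most `n` iterations of `u`, as long as `c` is positive. -/
def loopVal (c : List ℤ → ℤ) (u : List ℤ → List ℤ) : ℕ → List ℤ → List ℤ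
  | 0, st => st
  | n + 1, st => if 0 < c st then loopVal c u n (u st) else st

/-- The number of machine instructions of a loop on a tuple of length `k`. -/
def loopSteps (c : List ℤ → ℤ) (u : List ℤ → List ℤ) (sc su : List ℤ → ℕ) (k : ℕ) :
    ℕ → List ℤ → ℕ
  | 0, _ => 2
  | n + 1, st => 5 + sc st + if 0 < c st then su st + 2 * k + loopSteps c u sc su k n (u st) else 0

mutual
/-- The value of a term. -/
def Term.eval : Term → List ℤ → (ℤ → ℤ) → ℤ
  | .var i, env, _ => env.getD i 0
  | .const c, _, _ => c
  | .op o a b, env, m => o.fn (a.eval env m) (b.eval env m)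
  | .load a, env, m => m (a.eval env m)
  | .ite c a b, env, m => if 0 < c.eval env m then a.eval env m else b.eval env m
  | .letE a b, env, m => b.eval (a.eval env m :: env) m
  | .sum n body, env, m =>
      ∑ i ∈ Finset.range (n.eval env m).toNat, body.eval ((i : ℤ) :: env) m
  | .loop f is c us res, env, m =>
      res.eval (loopVal (fun st => c.eval (st ++ env) m) (fun st => us.evals (st ++ env) m)
        (f.eval env m).toNat (is.evals env m) ++ env) m
/-- The values of a tuple of terms. -/
def Terms.evals : Terms → List ℤ → (ℤ → ℤ) → List ℤ
  | .nil, _, _ => []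
  | .cons e es, env, m => e.eval env m :: es.evals env m
end

mutual
/-- The number of machine instructions that the evaluation of a term takes. -/
def Term.steps : Term → List ℤ → (ℤ → ℤ) → ℕ
  | .var _, _, _ => 2
  | .const _, _, _ => 1
  | .op _ a b, env, m => a.steps env m + b.steps env m + 1
  | .load a, env, m => a.steps env m + 1
  | .ite c a b, env, m =>
      c.steps env m + 2 + if 0 < c.eval env m then a.steps env m else b.steps env m
  | .letE a b, env, m => a.steps env m + b.steps (a.eval env m :: env) m + 2
  | .sum n body, env, m => n.steps env m + 7 +
      ∑ i ∈ Finset.range (n.eval env m).toNat, (body.steps ((i : ℤ) :: env) m + 6)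
  | .loop f is c us res, env, m =>
      f.steps env m + is.stepss env m +
      loopSteps (fun st => c.eval (st ++ env) m) (fun st => us.evals (st ++ env) m)
        (fun st => c.steps (st ++ env) m) (fun st => us.stepss (st ++ env) m) is.length
        (f.eval env m).toNat (is.evals env m) +
      res.steps (loopVal (fun st => c.eval (st ++ env) m) (fun st => us.evals (st ++ env) m)
        (f.eval env m).toNat (is.evals env m) ++ env) m + 2
/-- The number of machine instructions for a tuple of terms. -/
def Terms.stepss : Terms → List ℤ → (ℤ → ℤ) → ℕ
  | .nil, _, _ => 0
  | .cons e es, env, m => e.steps env m + es.stepss env m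
end

mutual
/-- All integers that occur in the evaluation of a term have at most `W` binary digits. -/
def Term.Bd (W : ℕ) : Term → List ℤ → (ℤ → ℤ) → Prop
  | .var i, env, _ => bitLength (env.getD i 0) ≤ W
  | .const c, _, _ => bitLength c ≤ W
  | .op o a b, env, m => a.Bd W env m ∧ b.Bd W env m ∧
      bitLength (o.fn (a.eval env m) (b.eval env m)) ≤ W
  | .load a, env, m => a.Bd W env m ∧ bitLength (m (a.eval env m)) ≤ W
  | .ite c a b, env, m => c.Bd W env m ∧
      if 0 < c.eval env m then a.Bd W env m else b.Bd W env m
  | .letE a b, env, m => a.Bd W env m ∧ b.Bd W (a.eval env m :: env) m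
  | .sum n body, env, m => n.Bd W env m ∧
      (∀ i < (n.eval env m).toNat, body.Bd W ((i : ℤ) :: env) m) ∧
      ∀ j ≤ (n.eval env m).toNat,
        bitLength (∑ i ∈ Finset.range j, body.eval ((i : ℤ) :: env) m) ≤ W
  | .loop f is c us res, env, m =>
      us.length = is.length ∧ f.Bd W env m ∧ is.Bds W env m ∧
      (∀ j ≤ (f.eval env m).toNat,
        let st := loopVal (fun st => c.eval (st ++ env) m) (fun st => us.evals (st ++ env) m) j
          (is.evals env m)
        c.Bd W (st ++ env) m ∧ us.Bds W (st ++ env) m) ∧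
      res.Bd W (loopVal (fun st => c.eval (st ++ env) m) (fun st => us.evals (st ++ env) m)
        (f.eval env m).toNat (is.evals env m) ++ env) m
/-- The same for a tuple of terms. -/
def Terms.Bds (W : ℕ) : Terms → List ℤ → (ℤ → ℤ) → Prop
  | .nil, _, _ => True
  | .cons e es, env, m => e.Bd W env m ∧ es.Bds W env m
end

/-- Copy the `k` registers from `src` on to the `k` registers from `dst` on. -/
def moves (dst src : ℕ) : ℕ → List Instr
  | 0 => []
  | k + 1 => .const dst 0 :: .add dst dst src :: moves (dst + 1) (src + 1) k

mutual
/-- The code of a term. The list `ρ` gives the registers of the variables, `d` is the first free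
register, which receives the value, and `o` is the address of the code. -/
def Term.compile : Term → List ℕ → ℕ → ℕ → List Instr
  | .var i, ρ, d, _ => [.const d 0] ++ match ρ[i]? with
      | some x => [.add d d x]
      | none => []
  | .const c, _, d, _ => [.const d c]
  | .op f a b, ρ, d, o =>
      let ca := a.compile ρ d o
      let cb := b.compile ρ (d + 1) (o + ca.length)
      ca ++ cb ++ [f.instr d d (d + 1)]
  | .load a, ρ, d, o => a.compile ρ d o ++ [.load d d]
  | .ite c a b, ρ, d, o =>
      let cc := c.compile ρ d o
      let cb := b.compile ρ d (o + cc.length + 1)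
      let ca := a.compile ρ d (o + cc.length + 1 + cb.length + 1)
      cc ++ [.jumpPos d (o + cc.length + 1 + cb.length + 1)] ++ cb ++
        [.jump (o + cc.length + 1 + cb.length + 1 + ca.length)] ++ ca
  | .letE a b, ρ, d, o =>
      let ca := a.compile ρ d o
      let cb := b.compile (d :: ρ) (d + 1) (o + ca.length)
      ca ++ cb ++ [.const d 0, .add d d (d + 1)]
  | .sum n body, ρ, d, o =>
      let cn := n.compile ρ d o
      let l := o + cn.length + 2
      let cb := body.compile ((d + 1) :: ρ) (d + 3) (l + 3)
      cn ++ [.const (d + 1) 0, .const (d + 2) 0] ++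
        [.sub (d + 3) d (d + 1), .jumpPos (d + 3) (l + 3), .jump (l + 3 + cb.length + 4)] ++ cb ++
        [.add (d + 2) (d + 2) (d + 3), .const (d + 3) 1, .add (d + 1) (d + 1) (d + 3), .jump l] ++
        [.const d 0, .add d d (d + 2)]
  | .loop f is c us res, ρ, d, o =>
      let k := is.length
      let cf := f.compile ρ d o
      let ci := is.compiles ρ (d + 1) (o + cf.length)
      let l := o + cf.length + ci.length
      let ρ' := List.range' (d + 1) k ++ ρ
      let d' := d + 1 + k
      let cc := c.compile ρ' d' (l + 4)
      let cu := us.compiles ρ' d' (l + 4 + cc.length + 2)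
      let e := l + 4 + cc.length + 2 + cu.length + (moves (d + 1) d' k).length + 1
      let cr := res.compile ρ' d' e
      cf ++ ci ++ [.jumpPos d (l + 2), .jump e, .const d' 1, .sub d d d'] ++ cc ++
        [.jumpPos d' (l + 4 + cc.length + 2), .jump e] ++ cu ++ moves (d + 1) d' k ++ [.jump l] ++
        cr ++ [.const d 0, .add d d d']
/-- The code of a tuple of terms, whose values go to the registers from `d` on. -/
def Terms.compiles : Terms → List ℕ → ℕ → ℕ → List Instr
  | .nil, _, _, _ => []
  | .cons e es, ρ, d, o =>
      let ce := e.compile ρ d o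
      ce ++ es.compiles ρ (d + 1) (o + ce.length)
end

/-- The compiled code of a term computes its value in the announced number of steps. -/
def Term.Spec (prog : Program) (W : ℕ) (e : Term) : Prop :=
  ∀ (ρ : List ℕ) (d o : ℕ) (s : State), At prog o (e.compile ρ d o) → s.pc = o →
    (∀ x ∈ ρ, x < d) → e.Bd W (ρ.map s.reg) s.mem →
    ∃ s', Run prog (3 * W + 1) (e.steps (ρ.map s.reg) s.mem) s s' ∧
      s'.pc = o + (e.compile ρ d o).length ∧ s'.mem = s.mem ∧
      s'.reg d = e.eval (ρ.map s.reg) s.mem ∧ ∀ x < d, s'.reg x = s.reg x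

/-- The same for a tuple of terms. -/
def Terms.Specs (prog : Program) (W : ℕ) (es : Terms) : Prop :=
  ∀ (ρ : List ℕ) (d o : ℕ) (s : State), At prog o (es.compiles ρ d o) → s.pc = o →
    (∀ x ∈ ρ, x < d) → es.Bds W (ρ.map s.reg) s.mem →
    ∃ s', Run prog (3 * W + 1) (es.stepss (ρ.map s.reg) s.mem) s s' ∧
      s'.pc = o + (es.compiles ρ d o).length ∧ s'.mem = s.mem ∧
      (List.range' d es.length).map s'.reg = es.evals (ρ.map s.reg) s.mem ∧
      ∀ x < d, s'.reg x = s.reg x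

@[simp] theorem bitLength_zero : bitLength 0 = 0 := rfl
@[simp] theorem bitLength_one : bitLength 1 = 1 := by decide

theorem bitLength_le {z : ℤ} {W : ℕ} : bitLength z ≤ W ↔ |z| < 2 ^ W := by
  rw [bitLength, Nat.size_le, Int.abs_eq_natAbs]
  exact_mod_cast Iff.rfl

theorem bitLength_mono {z z' : ℤ} (h : |z| ≤ |z'|) : bitLength z ≤ bitLength z' := by
  apply Nat.size_le_size
  rw [Int.abs_eq_natAbs, Int.abs_eq_natAbs] at h
  exact_mod_cast h

theorem Term.Bd.eval_le {W : ℕ} : ∀ {e : Term} {env : List ℤ} {m : ℤ → ℤ}, e.Bd W env m →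
    bitLength (e.eval env m) ≤ W
  | .var _, _, _, h => by simpa [Term.Bd, Term.eval] using h
  | .const _, _, _, h => by simpa [Term.Bd, Term.eval] using h
  | .op _ _ _, _, _, h => by simp only [Term.Bd, Term.eval] at h ⊢; exact h.2.2
  | .load _, _, _, h => by simp only [Term.Bd, Term.eval] at h ⊢; exact h.2
  | .ite _ a b, _, _, h => by
    simp only [Term.Bd, Term.eval] at h ⊢
    split_ifs at h ⊢
    · exact Term.Bd.eval_le h.2
    · exact Term.Bd.eval_le h.2
  | .letE _ b, _, _, h => by
    simp only [Term.Bd, Term.eval] at h ⊢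
    exact Term.Bd.eval_le h.2
  | .sum _ _, _, _, h => by
    simp only [Term.Bd, Term.eval] at h ⊢
    exact h.2.2 _ le_rfl
  | .loop _ _ _ _ r, _, _, h => by
    simp only [Term.Bd, Term.eval] at h ⊢
    exact Term.Bd.eval_le h.2.2.2.2

theorem map_reg_congr {ρ : List ℕ} {d : ℕ} {f g : ℕ → ℤ} (hρ : ∀ x ∈ ρ, x < d)
    (h : ∀ x < d, f x = g x) : ρ.map f = ρ.map g :=
  List.map_congr_left fun x hx => h x (hρ x hx)

@[simp] theorem write_pc (s : State) (d : ℕ) (z : ℤ) : (s.write d z).pc = s.pc + 1 := rfl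
@[simp] theorem write_mem (s : State) (d : ℕ) (z : ℤ) : (s.write d z).mem = s.mem := rfl
theorem write_reg (s : State) (d : ℕ) (z : ℤ) (x : ℕ) :
    (s.write d z).reg x = if x = d then z else s.reg x := by
  simp [State.write, Function.update_apply]
@[simp] theorem write_reg_self (s : State) (d : ℕ) (z : ℤ) : (s.write d z).reg d = z := by
  simp [write_reg]

section
variable {prog : Program} {W : ℕ}

theorem run_const {s : State} {d : ℕ} {c : ℤ} (h : prog[s.pc]? = some (.const d c))
    (hc : bitLength c ≤ W) : Run prog (3 * W + 1) 1 s (s.write d c) :=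
  .one h (by simp only [cost]; omega)

theorem run_op {s : State} (o : Op) {d x y : ℕ} (h : prog[s.pc]? = some (o.instr d x y))
    (hx : bitLength (s.reg x) ≤ W) (hy : bitLength (s.reg y) ≤ W)
    (hz : bitLength (o.fn (s.reg x) (s.reg y)) ≤ W) :
    Run prog (3 * W + 1) 1 s (s.write d (o.fn (s.reg x) (s.reg y))) := by
  cases o <;> exact .one h (by simp only [cost, Op.instr]; simp only [Op.fn] at hz; omega)

theorem run_load {s : State} {d x : ℕ} (h : prog[s.pc]? = some (.load d x))
    (hx : bitLength (s.reg x) ≤ W) (hz : bitLength (s.mem (s.reg x)) ≤ W) :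
    Run prog (3 * W + 1) 1 s (s.write d (s.mem (s.reg x))) :=
  .one h (by simp only [cost]; omega)

theorem run_move {s : State} {d x : ℕ} (h : prog[s.pc]? = some (.const d 0))
    (h' : prog[s.pc + 1]? = some (.add d d x)) (hxd : x ≠ d) (hx : bitLength (s.reg x) ≤ W) :
    Run prog (3 * W + 1) 2 s ((s.write d 0).write d (s.reg x)) := by
  have h2 := run_op (prog := prog) (W := W) (s := s.write d 0) .add (d := d) (x := d) (y := x) h'
    (by simp) (by simpa [write_reg, hxd] using hx) (by simpa [Op.fn, write_reg, hxd] using hx)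
  simp only [Op.fn, write_reg_self, zero_add] at h2
  rw [write_reg, if_neg hxd] at h2
  exact (run_const h (by simp)).trans h2

theorem run_jump {s : State} {t : ℕ} (h : prog[s.pc]? = some (.jump t)) :
    Run prog (3 * W + 1) 1 s { s with pc := t } :=
  .one h (by simp [cost])

theorem run_jumpPos {s : State} {x t : ℕ} (h : prog[s.pc]? = some (.jumpPos x t))
    (hx : bitLength (s.reg x) ≤ W) :
    Run prog (3 * W + 1) 1 s { s with pc := if 0 < s.reg x then t else s.pc + 1 } :=
  .one h (by simp only [cost]; omega)

theorem spec_var (i : ℕ) : (Term.var i).Spec prog W := by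
  intro ρ d o s hat hpc hρ hB
  simp only [Term.compile, Term.Bd, Term.eval, Term.steps] at *
  subst hpc
  rcases h : ρ[i]? with _ | x
  · simp only [h, List.append_nil, at_cons, at_nil, and_true] at hat ⊢
    refine ⟨s.write d 0, (run_const hat (by simp)).mono (by omega), by simp, rfl, ?_, ?_⟩
    · simp [List.getD, h]
    · intro x hx; simp [write_reg, hx.ne]
  · simp only [h, List.cons_append, List.nil_append, at_cons, at_nil, and_true] at hat ⊢
    have hx : x < d := hρ x (List.mem_of_getElem? h)
    have hB' : (List.map s.reg ρ).getD i 0 = s.reg x := by simp [List.getD, h]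
    rw [hB'] at hB ⊢
    refine ⟨_, run_move hat.1 hat.2 hx.ne hB, by simp, rfl, by simp, ?_⟩
    intro y hy; simp [write_reg, hy.ne]

theorem spec_const (c : ℤ) : (Term.const c).Spec prog W := by
  intro ρ d o s hat hpc hρ hB
  simp only [Term.compile, Term.Bd, Term.eval, Term.steps, at_cons, at_nil, and_true] at *
  subst hpc
  exact ⟨_, run_const hat hB, by simp, rfl, by simp, fun x hx => by simp [write_reg, hx.ne]⟩

theorem spec_op (f : Op) {a b : Term} (ha : a.Spec prog W) (hb : b.Spec prog W) :
    (Term.op f a b).Spec prog W := by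
  intro ρ d o s hat hpc hρ hB
  simp only [Term.compile, Term.Bd, Term.eval, Term.steps, at_append, at_cons, at_nil,
    and_true] at *
  obtain ⟨s1, r1, p1, m1, v1, f1⟩ := ha ρ d o s hat.1.1 hpc hρ hB.1
  have e1 : ρ.map s1.reg = ρ.map s.reg := map_reg_congr hρ f1
  obtain ⟨s2, r2, p2, m2, v2, f2⟩ := hb ρ (d + 1) _ s1 hat.1.2 p1 (fun x hx => (hρ x hx).trans
    (by omega)) (by rw [e1, m1]; exact hB.2.1)
  rw [e1, m1] at v2 r2
  have hd : s2.reg d = s1.reg d := f2 d (by omega)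
  have r3 := run_op (prog := prog) (W := W) (s := s2) f (d := d) (x := d) (y := d + 1)
    (by rw [p2]; simpa [add_assoc] using hat.2)
    (by rw [hd, v1]; exact hB.1.eval_le) (by rw [v2]; exact hB.2.1.eval_le)
    (by rw [hd, v1, v2]; exact hB.2.2)
  refine ⟨_, (r1.trans r2).trans r3, ?_, ?_, ?_, ?_⟩
  · simp [p2]; omega
  · simp [m2, m1]
  · simp [hd, v1, v2]
  · intro x hx
    simp [write_reg, hx.ne, f2 x (by omega), f1 x hx]

theorem spec_load {a : Term} (ha : a.Spec prog W) : (Term.load a).Spec prog W := by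
  intro ρ d o s hat hpc hρ hB
  simp only [Term.compile, Term.Bd, Term.eval, Term.steps, at_append, at_cons, at_nil,
    and_true] at *
  obtain ⟨s1, r1, p1, m1, v1, f1⟩ := ha ρ d o s hat.1 hpc hρ hB.1
  have r2 := run_load (prog := prog) (W := W) (s := s1) (d := d) (x := d) (by rw [p1]; exact hat.2)
    (by rw [v1]; exact hB.1.eval_le) (by rw [v1, m1]; exact hB.2)
  refine ⟨_, r1.trans r2, ?_, ?_, ?_, ?_⟩
  · simp [p1]; omega
  · simp [m1]
  · simp [v1, m1]
  · intro x hx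
    simp [write_reg, hx.ne, f1 x hx]

theorem spec_ite {c a b : Term} (hc : c.Spec prog W) (ha : a.Spec prog W) (hb : b.Spec prog W) :
    (Term.ite c a b).Spec prog W := by
  intro ρ d o s hat hpc hρ hB
  simp only [Term.compile, Term.Bd, Term.eval, Term.steps, at_append, at_cons, at_nil,
    and_true, List.length_append, List.length_cons, List.length_nil] at *
  obtain ⟨⟨⟨⟨hat1, hat2⟩, hat3⟩, hat4⟩, hat5⟩ := hat
  obtain ⟨s1, r1, p1, m1, v1, f1⟩ := hc ρ d o s hat1 hpc hρ hB.1
  have r2 := run_jumpPos (prog := prog) (W := W) (s := s1) (by rw [p1]; exact hat2)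
    (by rw [v1]; exact hB.1.eval_le)
  have e1 : ρ.map s1.reg = ρ.map s.reg := map_reg_congr hρ f1
  simp only [v1, m1] at r2
  split_ifs at hB r2 ⊢ with h
  · obtain ⟨s3, r3, p3, m3, v3, f3⟩ := ha ρ d _
      { s1 with pc := o + (c.compile ρ d o).length + 1 +
        (b.compile ρ d (o + (c.compile ρ d o).length + 1)).length + 1 }
      (by simpa [add_assoc] using hat5) (by simp [add_assoc]) hρ
      (by simp only [e1, m1]; exact hB.2)
    simp only [e1, m1] at r3 v3 m3
    have r := (r1.trans r2).trans r3
    refine ⟨s3, r.mono (by omega), ?_, m3, v3, fun x hx => ?_⟩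
    · rw [p3]; simp only [add_assoc, zero_add]
    · rw [f3 x hx]; exact f1 x hx
  · obtain ⟨s3, r3, p3, m3, v3, f3⟩ := hb ρ d _ { s1 with pc := s1.pc + 1 }
      (by simpa [add_assoc] using hat3) (by simp [add_assoc, p1]) hρ
      (by simp only [e1, m1]; exact hB.2)
    simp only [e1, m1] at r3 v3 m3
    have r4 := run_jump (prog := prog) (W := W) (s := s3)
      (by rw [p3]; simpa [add_assoc] using hat4)
    have r := ((r1.trans r2).trans r3).trans r4
    refine ⟨_, r.mono (by omega), ?_, m3, v3, fun x hx => ?_⟩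
    · simp only [add_assoc, zero_add]
    · rw [← f1 x hx]; exact f3 x hx

theorem spec_letE {a b : Term} (ha : a.Spec prog W) (hb : b.Spec prog W) :
    (Term.letE a b).Spec prog W := by
  intro ρ d o s hat hpc hρ hB
  simp only [Term.compile, Term.Bd, Term.eval, Term.steps, at_append, at_cons, at_nil,
    and_true, List.length_append, List.length_cons, List.length_nil] at *
  obtain ⟨s1, r1, p1, m1, v1, f1⟩ := ha ρ d o s hat.1.1 hpc hρ hB.1
  have e1 : (d :: ρ).map s1.reg = a.eval (ρ.map s.reg) s.mem :: ρ.map s.reg := by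
    rw [List.map_cons, v1, map_reg_congr hρ f1]
  obtain ⟨s2, r2, p2, m2, v2, f2⟩ := hb (d :: ρ) (d + 1) _ s1 hat.1.2 p1 (by
    intro x hx
    rcases List.mem_cons.1 hx with rfl | hx
    · omega
    · have := hρ x hx; omega) (by rw [e1, m1]; exact hB.2)
  rw [e1, m1] at v2 r2
  have r3 := run_move (prog := prog) (W := W) (s := s2) (d := d) (x := d + 1)
    (by rw [p2]; simpa [add_assoc] using hat.2.1)
    (by rw [p2]; simpa [add_assoc] using hat.2.2) (by omega)
    (by rw [v2]; exact hB.2.eval_le)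
  refine ⟨_, (r1.trans r2).trans r3, ?_, ?_, ?_, ?_⟩
  · simp [p2]; omega
  · simp [m2, m1]
  · simp [v2]
  · intro x hx
    simp [write_reg, hx.ne, f2 x (by omega), f1 x hx]

theorem spec_sum (hW : 1 ≤ W) {n b : Term} (hn : n.Spec prog W) (hb : b.Spec prog W) :
    (Term.sum n b).Spec prog W := by
  intro ρ d o s hat hpc hρ hB
  simp only [Term.compile, Term.Bd, Term.eval, Term.steps, at_append, at_cons, at_nil,
    and_true, List.length_append, List.length_cons, List.length_nil] at *
  obtain ⟨⟨⟨⟨⟨hat1, hat2, hat2'⟩, hat3, hat3', hat3''⟩, hat4⟩, hat5, hat5', hat5'', hat5'''⟩,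
    hat6, hat6'⟩ := hat
  obtain ⟨s1, r1, p1, m1, v1, f1⟩ := hn ρ d o s hat1 hpc hρ hB.1
  obtain ⟨hB1, hB2, hB3⟩ := hB
  set env := ρ.map s.reg with henv
  set cn := n.compile ρ d o
  set l := o + cn.length + 2 with hl
  set cb := b.compile ((d + 1) :: ρ) (d + 3) (l + 3) with hcb
  set v := n.eval env s.mem with hv
  have hvW := hB1.eval_le
  have r2 := run_const (prog := prog) (W := W) (s := s1) (d := d + 1) (c := 0)
    (by rw [p1]; exact hat2) (by simp)
  have r3 := run_const (prog := prog) (W := W) (s := s1.write (d + 1) 0) (d := d + 2) (c := 0)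
    (by rw [write_pc, p1]; exact hat2') (by simp)
  -- one test of the loop
  have test : ∀ (j : ℕ) (t : State), t.pc = l → t.reg d = v → t.reg (d + 1) = j → j ≤ v.toNat →
      Run prog (3 * W + 1) 2 t
        { t.write (d + 3) (v - j) with pc := if 0 < v - j then l + 3 else l + 2 } := by
    intro j t hp h0 h1 hj
    have a1 := run_op (prog := prog) (W := W) (s := t) .sub (d := d + 3) (x := d) (y := d + 1)
      (by rw [hp]; simpa [Op.instr, hl, add_assoc] using hat3)
      (by rw [h0]; exact hvW)
      (by
        rw [h1]
        refine le_trans (bitLength_mono ?_) hvW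
        rw [abs_of_nonneg (by positivity), ← hv]
        rcases le_or_gt 0 v with h | h
        · rw [abs_of_nonneg h]; omega
        · rw [abs_of_neg h]; omega)
      (by
        rw [h0, h1]
        refine le_trans (bitLength_mono ?_) hvW
        rw [← hv]
        simp only [Op.fn]
        rcases le_or_gt 0 v with h | h
        · rw [abs_of_nonneg h, abs_of_nonneg (by omega)]; omega
        · have : j = 0 := by omega
          subst this; simp)
    simp only [Op.fn, h0, h1] at a1
    have a2 := run_jumpPos (prog := prog) (W := W) (s := t.write (d + 3) (v - j)) (x := d + 3)
      (t := l + 3) (by rw [write_pc, hp]; simpa [hl, add_assoc] using hat3')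
      (by
        rw [write_reg_self]
        refine le_trans (bitLength_mono ?_) hvW
        rw [← hv]
        rcases le_or_gt 0 v with h | h
        · rw [abs_of_nonneg h, abs_of_nonneg (by omega)]; omega
        · have : j = 0 := by omega
          subst this; simp)
    have a3 := a1.trans a2
    simpa [hp, add_assoc] using a3
  -- the loop invariant
  have inv : ∀ j : ℕ, j ≤ v.toNat → ∃ t : State,
      Run prog (3 * W + 1)
        (∑ i ∈ Finset.range j, (b.steps ((i : ℤ) :: env) s.mem + 6))
        ((s1.write (d + 1) 0).write (d + 2) 0) t ∧ t.pc = l ∧ t.mem = s.mem ∧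
      t.reg d = v ∧ t.reg (d + 1) = j ∧
      t.reg (d + 2) = ∑ i ∈ Finset.range j, b.eval ((i : ℤ) :: env) s.mem ∧
      ∀ x < d, t.reg x = s.reg x := by
    intro j
    induction j with
    | zero =>
      intro _
      refine ⟨_, .refl _ _, ?_, ?_, ?_, ?_, ?_, ?_⟩
      · simp [p1, hl]
      · simp [m1]
      · simp [write_reg, v1]
      · simp [write_reg]
      · simp
      · intro x hx
        have h1 : x ≠ d + 2 := by omega
        have h2 : x ≠ d + 1 := by omega
        simp [write_reg, h1, h2, f1 x hx]
    | succ j ih =>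
      intro hj
      obtain ⟨t, rt, pt, mt, t0, t1, t2, ft⟩ := ih (by omega)
      have q1 := test j t pt t0 t1 (by omega)
      rw [if_pos (by omega)] at q1
      set t' : State := { t.write (d + 3) (v - j) with pc := l + 3 } with ht'
      have et : ((d + 1) :: ρ).map t'.reg = (j : ℤ) :: env := by
        rw [List.map_cons]
        congr 1
        · simp [ht', write_reg, t1]
        · refine map_reg_congr hρ fun x hx => ?_
          have h1 : x ≠ d + 3 := by omega
          simp [ht', write_reg, h1, ft x hx]
      have mt' : t'.mem = s.mem := by simp [ht', mt]
      obtain ⟨u, ru, pu, mu, vu, fu⟩ := hb ((d + 1) :: ρ) (d + 3) (l + 3) t'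
        (by rw [← hcb]; simpa [hl, add_assoc] using hat4) rfl
        (by
          intro x hx
          rcases List.mem_cons.1 hx with rfl | hx
          · omega
          · have := hρ x hx; omega)
        (by rw [et, mt']; exact hB2 j (by omega))
      rw [et, mt'] at ru vu
      rw [← hcb] at pu
      have u0 : u.reg d = v := by rw [fu d (by omega)]; simp [ht', write_reg, t0]
      have u1 : u.reg (d + 1) = j := by rw [fu _ (by omega)]; simp [ht', write_reg, t1]
      have u2 : u.reg (d + 2) = ∑ i ∈ Finset.range j, b.eval ((i : ℤ) :: env) s.mem := by
        rw [fu _ (by omega)]; simp [ht', write_reg, t2]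
      have q2 := run_op (prog := prog) (W := W) (s := u) .add (d := d + 2) (x := d + 2)
        (y := d + 3) (by rw [pu]; simpa [Op.instr, hl, add_assoc] using hat5)
        (by rw [u2]; exact hB3 j (by omega))
        (by rw [vu]; exact (hB2 j (by omega)).eval_le)
        (by
          rw [u2, vu]
          have := hB3 (j + 1) hj
          rw [Finset.sum_range_succ] at this
          exact this)
      simp only [Op.fn, u2, vu, ← Finset.sum_range_succ] at q2
      set S := ∑ i ∈ Finset.range (j + 1), b.eval ((i : ℤ) :: env) s.mem with hS
      have q3 := run_const (prog := prog) (W := W) (s := u.write (d + 2) S) (d := d + 3) (c := 1)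
        (by rw [write_pc, pu]; simpa [hl, add_assoc] using hat5') (by simpa using hW)
      have hj1 : bitLength ((j : ℤ) + 1) ≤ W := by
        refine le_trans (bitLength_mono ?_) hvW
        rw [abs_of_nonneg (by positivity), ← hv, abs_of_nonneg (by omega)]
        omega
      have hj0 : bitLength (j : ℤ) ≤ W := by
        refine le_trans (bitLength_mono ?_) hj1
        rw [abs_of_nonneg (by positivity), abs_of_nonneg (by positivity)]
        omega
      have q4 := run_op (prog := prog) (W := W) (s := (u.write (d + 2) S).write (d + 3) 1) .add
        (d := d + 1) (x := d + 1) (y := d + 3)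
        (by rw [write_pc, write_pc, pu]; simpa [Op.instr, hl, add_assoc] using hat5'')
        (by simpa [write_reg, u1] using hj0) (by simpa [write_reg] using hW)
        (by simpa [Op.fn, write_reg, u1] using hj1)
      have q5 := run_jump (prog := prog) (W := W) (t := l)
        (s := ((u.write (d + 2) S).write (d + 3) 1).write (d + 1)
          (Op.add.fn (((u.write (d + 2) S).write (d + 3) 1).reg (d + 1))
            (((u.write (d + 2) S).write (d + 3) 1).reg (d + 3))))
        (by rw [write_pc, write_pc, write_pc, pu]; simpa [hl, add_assoc] using hat5''')
      refine ⟨_, ((rt.trans q1).trans ((((ru.trans q2).trans q3).trans q4).trans q5)).mono ?_,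
        rfl, ?_, ?_, ?_, ?_, ?_⟩
      · rw [Finset.sum_range_succ]; omega
      · simp [mu, mt']
      · simp [write_reg, u0]
      · simp [write_reg, u1, Op.fn]
      · simp [write_reg]
      · intro x hx
        have h1 : x ≠ d + 2 := by omega
        have h2 : x ≠ d + 1 := by omega
        have h3 : x ≠ d + 3 := by omega
        simp only [write_reg, h1, h2, h3, if_false, fu x (by omega)]
        simp [ht', write_reg, h3, ft x hx]
  obtain ⟨t, rt, pt, mt, t0, t1, t2, ft⟩ := inv _ le_rfl
  have q1 := test _ t pt t0 t1 le_rfl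
  rw [if_neg (by omega)] at q1
  set t' : State := { t.write (d + 3) (v - v.toNat) with pc := l + 2 } with ht'
  have q2 := run_jump (prog := prog) (W := W) (s := t') (t := l + 3 + cb.length + 4)
    (by simp only [ht']; simpa [hl, add_assoc] using hat3'')
  have h2 : t'.reg (d + 2) = ∑ i ∈ Finset.range v.toNat, b.eval ((i : ℤ) :: env) s.mem := by
    simp [ht', write_reg, t2]
  have q3 := run_move (prog := prog) (W := W) (s := { t' with pc := l + 3 + cb.length + 4 })
    (d := d) (x := d + 2) (by simpa [hl, add_assoc] using hat6)
    (by simpa [hl, add_assoc] using hat6') (by omega)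
    (by simp only [h2]; exact hB3 _ le_rfl)
  refine ⟨_, (((((r1.trans r2).trans r3).trans rt).trans q1).trans (q2.trans q3)).mono (by omega),
    ?_, ?_, ?_, ?_⟩
  · simp [hl]; omega
  · simp [ht', mt]
  · simp [h2]
  · intro x hx
    have h3 : x ≠ d + 3 := by omega
    simp [write_reg, hx.ne, ht', h3, ft x hx]

end

section
variable {prog : Program} {W : ℕ}

@[simp] theorem length_moves (dst src k : ℕ) : (moves dst src k).length = 2 * k := by
  induction k generalizing dst src with
  | zero => rfl
  | succ k ih => simp [moves, ih]; omega

theorem run_moves (dst src k : ℕ) (s : State) (hat : At prog s.pc (moves dst src k))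
    (hds : dst + k ≤ src) (hb : ∀ j < k, bitLength (s.reg (src + j)) ≤ W) :
    ∃ s', Run prog (3 * W + 1) (2 * k) s s' ∧ s'.pc = s.pc + 2 * k ∧ s'.mem = s.mem ∧
      (List.range' dst k).map s'.reg = (List.range' src k).map s.reg ∧
      ∀ x, (x < dst ∨ dst + k ≤ x) → s'.reg x = s.reg x := by
  induction k generalizing dst src s with
  | zero => exact ⟨s, .refl _ _, by simp, rfl, by simp, fun _ _ => rfl⟩
  | succ k ih =>
    simp only [moves, at_cons] at hat
    have r1 := run_move (prog := prog) (W := W) (s := s) hat.1 hat.2.1 (by omega)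
      (by simpa using hb 0 (by omega))
    obtain ⟨s', r2, p2, m2, v2, f2⟩ := ih (dst + 1) (src + 1)
      ((s.write dst 0).write dst (s.reg src)) (by simpa using hat.2.2) (by omega) (by
        intro j hj
        have h1 : src + 1 + j ≠ dst := by omega
        have := hb (j + 1) (by omega)
        rwa [write_reg, if_neg h1, write_reg, if_neg h1, add_assoc, add_comm 1 j])
    refine ⟨s', (r1.trans r2).mono (by omega), by rw [p2]; simp; omega, by simp [m2], ?_, ?_⟩
    · simp only [List.range'_succ, List.map_cons]
      congr 1
      · rw [f2 dst (by omega)]; simp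
      · rw [v2]
        refine List.map_congr_left fun x hx => ?_
        rw [List.mem_range'_1] at hx
        have h1 : x ≠ dst := by omega
        simp [write_reg, h1]
    · intro x hx
      rw [f2 x (by omega)]
      have h1 : x ≠ dst := by omega
      simp [write_reg, h1]

theorem specs_nil : Terms.nil.Specs prog W := by
  intro ρ d o s _ hpc _ _
  exact ⟨s, .refl _ _, by simp [Terms.compiles, hpc], rfl, by simp [Terms.length, Terms.evals],
    fun _ _ => rfl⟩

theorem specs_cons {e : Term} {es : Terms} (he : e.Spec prog W) (hes : es.Specs prog W) :
    (Terms.cons e es).Specs prog W := by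
  intro ρ d o s hat hpc hρ hB
  simp only [Terms.compiles, Terms.Bds, Terms.evals, Terms.stepss, Terms.length, at_append] at *
  obtain ⟨s1, r1, p1, m1, v1, f1⟩ := he ρ d o s hat.1 hpc hρ hB.1
  have e1 : ρ.map s1.reg = ρ.map s.reg := map_reg_congr hρ f1
  obtain ⟨s2, r2, p2, m2, v2, f2⟩ := hes ρ (d + 1) _ s1 hat.2 p1 (fun x hx => (hρ x hx).trans
    (by omega)) (by rw [e1, m1]; exact hB.2)
  rw [e1, m1] at v2 r2
  refine ⟨s2, r1.trans r2, by rw [p2]; simp; omega, by rw [m2, m1], ?_, ?_⟩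
  · rw [List.range'_succ, List.map_cons, v2, f2 d (by omega), v1]
  · intro x hx; rw [f2 x (by omega), f1 x hx]

theorem Terms.length_evals : ∀ (es : Terms) (env : List ℤ) (m : ℤ → ℤ),
    (es.evals env m).length = es.length
  | .nil, _, _ => rfl
  | .cons _ es, env, m => by simp [Terms.evals, Terms.length, es.length_evals env m]

theorem Terms.Bds.evals_le {W : ℕ} : ∀ {es : Terms} {env : List ℤ} {m : ℤ → ℤ}, es.Bds W env m →
    ∀ z ∈ es.evals env m, bitLength z ≤ W
  | .nil, _, _, _ => by simp [Terms.evals]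
  | .cons _ es, _, _, h => by
    simp only [Terms.Bds, Terms.evals, List.mem_cons, forall_eq_or_imp] at h ⊢
    exact ⟨h.1.eval_le, Terms.Bds.evals_le h.2⟩

theorem spec_loop (hW : 1 ≤ W) {f c r : Term} {is us : Terms} (hf : f.Spec prog W)
    (his : is.Specs prog W) (hc : c.Spec prog W) (hus : us.Specs prog W) (hr : r.Spec prog W) :
    (Term.loop f is c us r).Spec prog W := by
  intro ρ d o s hat hpc hρ hB
  simp only [Term.compile, Term.Bd, Term.eval, Term.steps, at_append, at_cons, at_nil,
    and_true, List.length_append, List.length_cons, List.length_nil, length_moves] at *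
  obtain ⟨⟨⟨⟨⟨⟨⟨⟨⟨hat1, hat2⟩, hat3, hat4, hat5, hat6⟩, hat7⟩, hat8, hat9⟩, hat10⟩, hat11⟩, hat12⟩,
    hat13⟩, hat14, hat15⟩ := hat
  obtain ⟨hlen, hB1, hB2, hB3, hB4⟩ := hB
  set env := ρ.map s.reg with henv
  set k := is.length with hk
  set cf := f.compile ρ d o with hcf
  set ci := is.compiles ρ (d + 1) (o + cf.length) with hci
  set l := o + cf.length + ci.length with hl
  set d' := d + 1 + k with hd'
  set ρ' := List.range' (d + 1) k ++ ρ with hρ'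
  set cc := c.compile ρ' d' (l + 4) with hcc
  set cu := us.compiles ρ' d' (l + 4 + cc.length + 2) with hcu
  set e := l + 4 + cc.length + 2 + cu.length + 2 * k + 1 with he
  set cr := r.compile ρ' d' e with hcr
  set C : List ℤ → ℤ := fun st => c.eval (st ++ env) s.mem with hC
  set U : List ℤ → List ℤ := fun st => us.evals (st ++ env) s.mem with hU
  set SC : List ℤ → ℕ := fun st => c.steps (st ++ env) s.mem with hSC
  set SU : List ℤ → ℕ := fun st => us.stepss (st ++ env) s.mem with hSU
  have hρ'd : ∀ x ∈ ρ', x < d' := by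
    intro x hx
    rcases List.mem_append.1 hx with hx | hx
    · rw [List.mem_range'_1] at hx; omega
    · have := hρ x hx; omega
  obtain ⟨s1, r1, p1, m1, v1, f1⟩ := hf ρ d o s hat1 hpc hρ hB1
  have e1 : ρ.map s1.reg = env := map_reg_congr hρ f1
  rw [← henv] at r1
  obtain ⟨s2, r2, p2, m2, v2, f2⟩ := his ρ (d + 1) _ s1 (by rw [← hci]; exact hat2) p1
    (fun x hx => (hρ x hx).trans (by omega)) (by rw [e1, m1]; exact hB2)
  rw [e1, m1] at v2 r2
  have e2 : ∀ t : State, (∀ x < d, t.reg x = s.reg x) → ρ'.map t.reg =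
      (List.range' (d + 1) k).map t.reg ++ env := by
    intro t ht
    rw [hρ', List.map_append, map_reg_congr hρ ht]
  -- the loop, for an arbitrary remaining fuel
  have main : ∀ (n : ℕ) (st : List ℤ) (t : State), t.pc = l → t.mem = s.mem → t.reg d = n →
      bitLength (n : ℤ) ≤ W → (List.range' (d + 1) k).map t.reg = st →
      (∀ x < d, t.reg x = s.reg x) →
      (∀ j ≤ n, c.Bd W (loopVal C U j st ++ env) s.mem ∧
        us.Bds W (loopVal C U j st ++ env) s.mem) →
      ∃ t', Run prog (3 * W + 1) (loopSteps C U SC SU k n st) t t' ∧ t'.pc = e ∧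
        t'.mem = s.mem ∧ (List.range' (d + 1) k).map t'.reg = loopVal C U n st ∧
        ∀ x < d, t'.reg x = s.reg x := by
    intro n
    induction n with
    | zero =>
      intro st t tp tm td _ tst tf _
      have q1 := run_jumpPos (prog := prog) (W := W) (s := t) (x := d) (t := l + 2)
        (by rw [tp]; simpa [hl, add_assoc] using hat3) (by rw [td]; simp)
      rw [td, if_neg (by simp)] at q1
      have q2 := run_jump (prog := prog) (W := W) (s := { t with pc := t.pc + 1 }) (t := e)
        (by simp only [tp]; simpa [hl, add_assoc] using hat4)
      exact ⟨_, q1.trans q2, rfl, tm, tst, tf⟩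
    | succ n ih =>
      intro st t tp tm td hn tst tf hB
      have q1 := run_jumpPos (prog := prog) (W := W) (s := t) (x := d) (t := l + 2)
        (by rw [tp]; simpa [hl, add_assoc] using hat3) (by rw [td]; exact hn)
      rw [td, if_pos (by positivity)] at q1
      set t1 : State := { t with pc := l + 2 } with ht1
      have q2 := run_const (prog := prog) (W := W) (s := t1) (d := d') (c := 1)
        (by simpa [ht1, hl, add_assoc] using hat5) (by simpa using hW)
      have hdd : d ≠ d' := by omega
      have hnle : bitLength (n : ℤ) ≤ W := by
        refine le_trans (bitLength_mono ?_) hn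
        rw [abs_of_nonneg (by positivity), abs_of_nonneg (by positivity)]
        push_cast; omega
      have q3 := run_op (prog := prog) (W := W) (s := t1.write d' 1) .sub
        (d := d) (x := d) (y := d') (by simpa [Op.instr, ht1, hl, add_assoc] using hat6)
        (by simpa [write_reg, hdd, ht1, td] using hn) (by simpa using hW)
        (by simpa [Op.fn, write_reg, hdd, ht1, td] using hnle)
      set t3 := (t1.write d' 1).write d (Op.sub.fn ((t1.write d' 1).reg d)
        ((t1.write d' 1).reg d')) with ht3
      have t3d : t3.reg d = n := by simp [ht3, Op.fn, write_reg, hdd, ht1, td]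
      have t3f : ∀ x < d', x ≠ d → t3.reg x = t.reg x := by
        intro x hx hxd
        simp [ht3, write_reg, hxd, hx.ne, ht1]
      have t3st : (List.range' (d + 1) k).map t3.reg = st := by
        rw [← tst]
        refine List.map_congr_left fun x hx => ?_
        rw [List.mem_range'_1] at hx
        exact t3f x (by omega) (by omega)
      have t3e := e2 t3 (fun x hx => by rw [t3f x (by omega) hx.ne]; exact tf x hx)
      rw [t3st] at t3e
      have t3m : t3.mem = s.mem := by simp [ht3, ht1, tm]
      obtain ⟨s4, r4, p4, m4, v4, f4⟩ := hc ρ' d' (l + 4) t3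
        (by rw [← hcc]; simpa [hl, add_assoc] using hat7) (by simp [ht3, ht1]) hρ'd
        (by rw [t3e, t3m]; exact (hB 0 (by omega)).1)
      rw [t3e, t3m] at r4 v4
      rw [t3m] at m4
      have hBc := (hB 0 (by omega)).1.eval_le
      have q5 := run_jumpPos (prog := prog) (W := W) (s := s4) (x := d')
        (t := l + 4 + cc.length + 2)
        (by rw [p4, ← hcc]; simpa [hl, add_assoc] using hat8) (by rw [v4]; exact hBc)
      have s4f : ∀ x < d, s4.reg x = s.reg x := fun x hx => by
        rw [f4 x (by omega), t3f x (by omega) hx.ne]; exact tf x hx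
      have s4st : (List.range' (d + 1) k).map s4.reg = st := by
        rw [← t3st]
        refine List.map_congr_left fun x hx => ?_
        rw [List.mem_range'_1] at hx
        exact f4 x (by omega)
      rw [v4] at q5
      simp only [loopSteps, loopVal]
      by_cases hpos : 0 < C st
      · rw [if_pos hpos] at q5
        rw [if_pos hpos, if_pos hpos]
        set t5 : State := { s4 with pc := l + 4 + cc.length + 2 } with ht5
        have t5e := e2 t5 s4f
        have t5m : t5.mem = s.mem := m4
        rw [show (List.range' (d + 1) k).map t5.reg = st from s4st] at t5e
        obtain ⟨s6, r6, p6, m6, v6, f6⟩ := hus ρ' d' (l + 4 + cc.length + 2) t5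
          (by rw [← hcu]; simpa [hl, add_assoc] using hat10) rfl hρ'd
          (by rw [t5e, t5m]; exact (hB 0 (by omega)).2)
        rw [t5e, t5m] at r6 v6
        rw [t5m] at m6
        rw [← hcu] at p6
        rw [hlen] at v6
        obtain ⟨s7, r7, p7, m7, v7, f7⟩ := run_moves (prog := prog) (W := W) (d + 1) d' k s6
          (by rw [p6]; simpa [hl, add_assoc] using hat11) (by omega) (by
            intro j hj
            have hmem : s6.reg (d' + j) ∈ (List.range' d' k).map s6.reg :=
              List.mem_map_of_mem (by rw [List.mem_range'_1]; omega)
            rw [v6] at hmem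
            exact (hB 0 (by omega)).2.evals_le _ hmem)
        have q8 := run_jump (prog := prog) (W := W) (s := s7) (t := l)
          (by rw [p7, p6]; simpa [hl, add_assoc] using hat12)
        have s7f : ∀ x ≤ d, s7.reg x = s4.reg x := fun x hx => by
          rw [f7 x (by omega), f6 x (by omega)]
        obtain ⟨t', rt, pt, mt, vt, ft⟩ := ih (U st) { s7 with pc := l } rfl (by simp [m7, m6])
          (by simp only; rw [s7f d le_rfl, f4 d (by omega), t3d]) hnle (by rw [v7, v6])
          (fun x hx => by simp only; rw [s7f x hx.le]; exact s4f x hx) (by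
            intro j hj
            have := hB (j + 1) (by omega)
            simpa only [loopVal, if_pos hpos] using this)
        exact ⟨t', ((((((((q1.trans q2).trans q3).trans r4).trans q5).trans r6).trans r7).trans
          q8).trans rt).mono (by simp only [hSC, hSU]; omega), pt, mt, vt, ft⟩
      · rw [if_neg hpos] at q5
        rw [if_neg hpos, if_neg hpos]
        have q6 := run_jump (prog := prog) (W := W) (s := { s4 with pc := s4.pc + 1 }) (t := e)
          (by simp only [p4, ← hcc]; simpa [hl, add_assoc] using hat9)
        exact ⟨_, (((((q1.trans q2).trans q3).trans r4).trans q5).trans q6).mono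
          (by simp only [hSC]; omega), rfl, m4, s4st, s4f⟩
  -- negative fuel counts as zero
  have hs2d : s2.reg d = f.eval env s.mem := by rw [f2 d (by omega), v1]
  have hs2f : ∀ x < d, s2.reg x = s.reg x := fun x hx => by rw [f2 x (by omega), f1 x hx]
  have hmain : ∃ t', Run prog (3 * W + 1)
      (loopSteps C U SC SU k (f.eval env s.mem).toNat (is.evals env s.mem)) s2 t' ∧ t'.pc = e ∧
      t'.mem = s.mem ∧ (List.range' (d + 1) k).map t'.reg =
        loopVal C U (f.eval env s.mem).toNat (is.evals env s.mem) ∧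
      ∀ x < d, t'.reg x = s.reg x := by
    rcases le_or_gt 0 (f.eval env s.mem) with hpos | hneg
    · refine main _ _ s2 p2 (by rw [m2, m1]) ?_ ?_ v2 hs2f hB3
      · rw [hs2d, Int.toNat_of_nonneg hpos]
      · rw [Int.toNat_of_nonneg hpos]; exact hB1.eval_le
    · rw [Int.toNat_of_nonpos hneg.le]
      have q1 := run_jumpPos (prog := prog) (W := W) (s := s2) (x := d) (t := l + 2)
        (by rw [p2]; simpa [hl, add_assoc] using hat3) (by rw [hs2d]; exact hB1.eval_le)
      rw [hs2d, if_neg (by omega)] at q1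
      have q2 := run_jump (prog := prog) (W := W) (s := { s2 with pc := s2.pc + 1 }) (t := e)
        (by simp only [p2]; simpa [hl, add_assoc] using hat4)
      exact ⟨_, q1.trans q2, rfl, by simp [m2, m1], v2, hs2f⟩
  obtain ⟨t, rt, pt, mt, vt, ft⟩ := hmain
  have te := e2 t ft
  rw [vt] at te
  obtain ⟨s9, r9, p9, m9, v9, f9⟩ := hr ρ' d' e t
    (by rw [← hcr]; simpa [hl, he, add_assoc] using hat13) pt hρ'd
    (by rw [te, mt]; exact hB4)
  rw [te, mt] at r9 v9
  rw [← hcr] at p9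
  have q10 := run_move (prog := prog) (W := W) (s := s9) (d := d) (x := d')
    (by rw [p9]; simpa [hl, he, add_assoc] using hat14)
    (by rw [p9]; simpa [hl, he, add_assoc] using hat15) (by omega)
    (by rw [v9]; exact hB4.eval_le)
  refine ⟨_, ((((r1.trans r2).trans rt).trans r9).trans q10).mono (by omega), ?_, ?_, ?_, ?_⟩
  · simp [p9]; omega
  · simp [m9, mt]
  · simp [v9]
  · intro x hx
    simp [write_reg, hx.ne, f9 x (by omega), ft x hx]

mutual
theorem Term.spec (hW : 1 ≤ W) : ∀ e : Term, e.Spec prog W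
  | .var i => spec_var i
  | .const c => spec_const c
  | .op f a b => spec_op f (a.spec hW) (b.spec hW)
  | .load a => spec_load (a.spec hW)
  | .ite c a b => spec_ite (c.spec hW) (a.spec hW) (b.spec hW)
  | .letE a b => spec_letE (a.spec hW) (b.spec hW)
  | .sum n b => spec_sum hW (n.spec hW) (b.spec hW)
  | .loop f is c us r =>
    spec_loop hW (f.spec hW) (is.specs hW) (c.spec hW) (us.specs hW) (r.spec hW)
theorem Terms.specs (hW : 1 ≤ W) : ∀ es : Terms, es.Specs prog W
  | .nil => specs_nil
  | .cons e es => specs_cons (e.spec hW) (es.specs hW)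
end

end

/-! ### Programs that write to the memory -/

/-- Statements that change the memory, in an environment that only loops extend. -/
inductive Stmt
  /-- write the value of `v` into the cell with address `p` -/
  | store (p v : Term)
  /-- first `a`, then `b` -/
  | seq (a b : Stmt)
  /-- `b`, for the values `0, …, n - 1` of the variable `0` -/
  | forE (n : Term) (b : Stmt)

/-- Apply `f 0, f 1, …, f (n - 1)` one after the other. -/
def forMem (f : ℕ → (ℤ → ℤ) → ℤ → ℤ) : ℕ → (ℤ → ℤ) → ℤ → ℤ
  | 0, m => m
  | n + 1, m => f n (forMem f n m)

/-- The memory after a statement. -/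
def Stmt.exec : Stmt → List ℤ → (ℤ → ℤ) → ℤ → ℤ
  | .store p v, env, m => Function.update m (p.eval env m) (v.eval env m)
  | .seq a b, env, m => b.exec env (a.exec env m)
  | .forE n b, env, m =>
      forMem (fun j m => b.exec ((j : ℤ) :: env) m) (n.eval env m).toNat m

/-- The number of machine instructions of a statement. -/
def Stmt.steps : Stmt → List ℤ → (ℤ → ℤ) → ℕ
  | .store p v, env, m => p.steps env m + v.steps env m + 1
  | .seq a b, env, m => a.steps env m + b.steps env (a.exec env m)
  | .forE n b, env, m => n.steps env m + 4 + ∑ j ∈ Finset.range (n.eval env m).toNat,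
      (b.steps ((j : ℤ) :: env) (forMem (fun j m => b.exec ((j : ℤ) :: env) m) j m) + 5)

/-- All integers that occur in a statement have at most `W` binary digits. -/
def Stmt.Bd (W : ℕ) : Stmt → List ℤ → (ℤ → ℤ) → Prop
  | .store p v, env, m => p.Bd W env m ∧ v.Bd W env m
  | .seq a b, env, m => a.Bd W env m ∧ b.Bd W env (a.exec env m)
  | .forE n b, env, m => n.Bd W env m ∧ ∀ j < (n.eval env m).toNat,
      b.Bd W ((j : ℤ) :: env) (forMem (fun j m => b.exec ((j : ℤ) :: env) m) j m)

/-- The code of a statement, with the same conventions as for terms. -/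
def Stmt.compile : Stmt → List ℕ → ℕ → ℕ → List Instr
  | .store p v, ρ, d, o =>
      let cp := p.compile ρ d o
      let cv := v.compile ρ (d + 1) (o + cp.length)
      cp ++ cv ++ [.store d (d + 1)]
  | .seq a b, ρ, d, o =>
      let ca := a.compile ρ d o
      ca ++ b.compile ρ d (o + ca.length)
  | .forE n b, ρ, d, o =>
      let cn := n.compile ρ d o
      let l := o + cn.length + 1
      let cb := b.compile ((d + 1) :: ρ) (d + 2) (l + 3)
      cn ++ [.const (d + 1) 0] ++
        [.sub (d + 2) d (d + 1), .jumpPos (d + 2) (l + 3), .jump (l + 3 + cb.length + 3)] ++ cb ++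
        [.const (d + 2) 1, .add (d + 1) (d + 1) (d + 2), .jump l]

/-- The compiled code of a statement has the announced effect and number of steps. -/
def Stmt.Spec (prog : Program) (W : ℕ) (e : Stmt) : Prop :=
  ∀ (ρ : List ℕ) (d o : ℕ) (s : State), At prog o (e.compile ρ d o) → s.pc = o →
    (∀ x ∈ ρ, x < d) → e.Bd W (ρ.map s.reg) s.mem →
    ∃ s', Run prog (3 * W + 1) (e.steps (ρ.map s.reg) s.mem) s s' ∧
      s'.pc = o + (e.compile ρ d o).length ∧ s'.mem = e.exec (ρ.map s.reg) s.mem ∧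
      ∀ x < d, s'.reg x = s.reg x

section
variable {prog : Program} {W : ℕ}

theorem spec_store (hW : 1 ≤ W) (p v : Term) : (Stmt.store p v).Spec prog W := by
  intro ρ d o s hat hpc hρ hB
  simp only [Stmt.compile, Stmt.Bd, Stmt.exec, Stmt.steps, at_append, at_cons, at_nil,
    and_true] at *
  obtain ⟨s1, r1, p1, m1, v1, f1⟩ := p.spec hW ρ d o s hat.1.1 hpc hρ hB.1
  have e1 : ρ.map s1.reg = ρ.map s.reg := map_reg_congr hρ f1
  obtain ⟨s2, r2, p2, m2, v2, f2⟩ := v.spec hW ρ (d + 1) _ s1 hat.1.2 p1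
    (fun x hx => (hρ x hx).trans (by omega)) (by rw [e1, m1]; exact hB.2)
  rw [e1, m1] at v2 r2
  have hd : s2.reg d = s1.reg d := f2 d (by omega)
  have r3 := Run.one (prog := prog) (κ := 3 * W + 1) (s := s2) (i := .store d (d + 1))
    (by rw [p2]; simpa [add_assoc] using hat.2) (by
      have h1 := hB.1.eval_le
      have h2 := hB.2.eval_le
      simp only [cost, hd, v1, v2]; omega)
  refine ⟨_, (r1.trans r2).trans r3, ?_, ?_, ?_⟩
  · simp [exec, p2]; omega
  · simp [exec, hd, v1, v2, m2, m1]
  · intro x hx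
    simp [exec, f2 x (by omega), f1 x hx]

theorem spec_seq {a b : Stmt} (ha : a.Spec prog W) (hb : b.Spec prog W) :
    (Stmt.seq a b).Spec prog W := by
  intro ρ d o s hat hpc hρ hB
  simp only [Stmt.compile, Stmt.Bd, Stmt.exec, Stmt.steps, at_append] at *
  obtain ⟨s1, r1, p1, m1, f1⟩ := ha ρ d o s hat.1 hpc hρ hB.1
  have e1 : ρ.map s1.reg = ρ.map s.reg := map_reg_congr hρ f1
  obtain ⟨s2, r2, p2, m2, f2⟩ := hb ρ d _ s1 hat.2 p1 hρ (by rw [e1, m1]; exact hB.2)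
  rw [e1, m1] at r2 m2
  exact ⟨s2, r1.trans r2, by rw [p2]; simp; omega, m2, fun x hx => by rw [f2 x hx, f1 x hx]⟩

theorem spec_forE (hW : 1 ≤ W) (n : Term) {b : Stmt} (hb : b.Spec prog W) :
    (Stmt.forE n b).Spec prog W := by
  intro ρ d o s hat hpc hρ hB
  simp only [Stmt.compile, Stmt.Bd, Stmt.exec, Stmt.steps, at_append, at_cons, at_nil,
    and_true, List.length_append, List.length_cons, List.length_nil] at *
  obtain ⟨⟨⟨⟨hat1, hat2⟩, hat3, hat3', hat3''⟩, hat4⟩, hat5, hat5', hat5''⟩ := hat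
  obtain ⟨s1, r1, p1, m1, v1, f1⟩ := n.spec hW ρ d o s hat1 hpc hρ hB.1
  obtain ⟨hB1, hB2⟩ := hB
  set env := ρ.map s.reg with henv
  set cn := n.compile ρ d o
  set l := o + cn.length + 1 with hl
  set cb := b.compile ((d + 1) :: ρ) (d + 2) (l + 3) with hcb
  set v := n.eval env s.mem with hv
  set F : ℕ → (ℤ → ℤ) → ℤ → ℤ := fun j m => b.exec ((j : ℤ) :: env) m with hF
  have hvW := hB1.eval_le
  rw [← hv] at hvW
  have hle : ∀ z : ℤ, 0 ≤ z → z ≤ v.toNat → bitLength z ≤ W := by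
    intro z h0 h1
    refine le_trans (bitLength_mono ?_) hvW
    rw [abs_of_nonneg h0]
    have := le_abs_self v
    have := abs_nonneg v
    omega
  have r2 := run_const (prog := prog) (W := W) (s := s1) (d := d + 1) (c := 0)
    (by rw [p1]; exact hat2) (by simp)
  have test : ∀ (j : ℕ) (t : State), t.pc = l → t.reg d = v → t.reg (d + 1) = j → j ≤ v.toNat →
      Run prog (3 * W + 1) 2 t
        { t.write (d + 2) (v - j) with pc := if 0 < v - j then l + 3 else l + 2 } := by
    intro j t hp h0 h1 hj
    have hvj : bitLength (v - j) ≤ W := by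
      rcases Nat.eq_zero_or_pos j with rfl | h
      · simpa using hvW
      · exact hle _ (by omega) (by omega)
    have a1 := run_op (prog := prog) (W := W) (s := t) .sub (d := d + 2) (x := d) (y := d + 1)
      (by rw [hp]; simpa [Op.instr, hl, add_assoc] using hat3)
      (by rw [h0]; exact hvW) (by rw [h1]; exact hle _ (by positivity) (by omega))
      (by rw [h0, h1]; exact hvj)
    simp only [Op.fn, h0, h1] at a1
    have a2 := run_jumpPos (prog := prog) (W := W) (s := t.write (d + 2) (v - j)) (x := d + 2)
      (t := l + 3) (by rw [write_pc, hp]; simpa [hl, add_assoc] using hat3')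
      (by rw [write_reg_self]; exact hvj)
    have a3 := a1.trans a2
    simpa [hp, add_assoc] using a3
  have inv : ∀ j : ℕ, j ≤ v.toNat → ∃ t : State,
      Run prog (3 * W + 1)
        (∑ i ∈ Finset.range j, (b.steps ((i : ℤ) :: env) (forMem F i s.mem) + 5))
        (s1.write (d + 1) 0) t ∧ t.pc = l ∧ t.mem = forMem F j s.mem ∧
      t.reg d = v ∧ t.reg (d + 1) = j ∧ ∀ x < d, t.reg x = s.reg x := by
    intro j
    induction j with
    | zero =>
      intro _
      refine ⟨_, .refl _ _, ?_, ?_, ?_, ?_, ?_⟩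
      · simp [p1, hl]
      · simp [m1, forMem]
      · simp [write_reg, v1]
      · simp
      · intro x hx
        have h2 : x ≠ d + 1 := by omega
        simp [write_reg, h2, f1 x hx]
    | succ j ih =>
      intro hj
      obtain ⟨t, rt, pt, mt, t0, t1, ft⟩ := ih (by omega)
      have q1 := test j t pt t0 t1 (by omega)
      rw [if_pos (by omega)] at q1
      set t' : State := { t.write (d + 2) (v - j) with pc := l + 3 } with ht'
      have et : ((d + 1) :: ρ).map t'.reg = (j : ℤ) :: env := by
        rw [List.map_cons]
        congr 1
        · simp [ht', write_reg, t1]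
        · refine map_reg_congr hρ fun x hx => ?_
          have h1 : x ≠ d + 2 := by omega
          simp [ht', write_reg, h1, ft x hx]
      have mt' : t'.mem = forMem F j s.mem := by simp [ht', mt]
      obtain ⟨u, ru, pu, mu, fu⟩ := hb ((d + 1) :: ρ) (d + 2) (l + 3) t'
        (by rw [← hcb]; simpa [hl, add_assoc] using hat4) rfl
        (by
          intro x hx
          rcases List.mem_cons.1 hx with rfl | hx
          · omega
          · have := hρ x hx; omega)
        (by rw [et, mt']; exact hB2 j (by omega))
      rw [et, mt'] at ru mu
      rw [← hcb] at pu
      have u0 : u.reg d = v := by rw [fu d (by omega)]; simp [ht', write_reg, t0]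
      have u1 : u.reg (d + 1) = j := by rw [fu _ (by omega)]; simp [ht', write_reg, t1]
      have q3 := run_const (prog := prog) (W := W) (s := u) (d := d + 2) (c := 1)
        (by rw [pu]; simpa [hl, add_assoc] using hat5) (by simpa using hW)
      have q4 := run_op (prog := prog) (W := W) (s := u.write (d + 2) 1) .add
        (d := d + 1) (x := d + 1) (y := d + 2)
        (by rw [write_pc, pu]; simpa [Op.instr, hl, add_assoc] using hat5')
        (by simpa [write_reg, u1] using hle j (by positivity) (by omega)) (by simpa using hW)
        (by simpa [Op.fn, write_reg, u1] using hle (j + 1) (by positivity) (by omega))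
      have q5 := run_jump (prog := prog) (W := W) (t := l)
        (s := (u.write (d + 2) 1).write (d + 1)
          (Op.add.fn ((u.write (d + 2) 1).reg (d + 1)) ((u.write (d + 2) 1).reg (d + 2))))
        (by rw [write_pc, write_pc, pu]; simpa [hl, add_assoc] using hat5'')
      refine ⟨_, ((rt.trans q1).trans (((ru.trans q3).trans q4).trans q5)).mono ?_,
        rfl, ?_, ?_, ?_, ?_⟩
      · rw [Finset.sum_range_succ]; omega
      · simp [mu, forMem, hF]
      · simp [write_reg, u0]
      · simp [write_reg, u1, Op.fn]
      · intro x hx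
        have h1 : x ≠ d + 2 := by omega
        have h2 : x ≠ d + 1 := by omega
        simp only [write_reg, h1, h2, if_false, fu x (by omega)]
        simp [ht', write_reg, h1, ft x hx]
  obtain ⟨t, rt, pt, mt, t0, t1, ft⟩ := inv _ le_rfl
  have q1 := test _ t pt t0 t1 le_rfl
  rw [if_neg (by omega)] at q1
  set t' : State := { t.write (d + 2) (v - v.toNat) with pc := l + 2 } with ht'
  have q2 := run_jump (prog := prog) (W := W) (s := t') (t := l + 3 + cb.length + 3)
    (by simp only [ht']; simpa [hl, add_assoc] using hat3'')
  refine ⟨_, ((((r1.trans r2).trans rt).trans q1).trans q2).mono (by omega), ?_, ?_, ?_⟩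
  · simp only [hl]; omega
  · simp [ht', mt]
  · intro x hx
    have h3 : x ≠ d + 2 := by omega
    simp [write_reg, ht', h3, ft x hx]

theorem Stmt.spec (hW : 1 ≤ W) : ∀ e : Stmt, e.Spec prog W
  | .store p v => spec_store hW p v
  | .seq a b => spec_seq (a.spec hW) (b.spec hW)
  | .forE n b => spec_forE hW n (b.spec hW)

end

/-- The program that executes a statement and then computes the value of a term. -/
def fullProgram (a : Stmt) (e : Term) : Program :=
  a.compile [] 0 0 ++ e.compile [] 0 (a.compile [] 0 0).length

/-- An instruction involves at most three integers, whence the cost `3 * W + 1`. -/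
theorem fullProgram_outputs {W : ℕ} (hW : 1 ≤ W) (a : Stmt) (e : Term) (input : List ℤ)
    (ha : a.Bd W [] (init input).mem) (he : e.Bd W [] (a.exec [] (init input).mem)) :
    ∃ t ≤ (a.steps [] (init input).mem + e.steps [] (a.exec [] (init input).mem)) * (3 * W + 1),
      Outputs (fullProgram a e) input (e.eval [] (a.exec [] (init input).mem)) t := by
  have hat : At (fullProgram a e) 0 (fullProgram a e) := by
    simpa using at_self (fullProgram a e) []
  obtain ⟨h1, h2⟩ := (at_append _ _ _ _).1 hat
  obtain ⟨s1, r1, p1, m1, -⟩ := a.spec hW [] 0 0 (init input) h1 rfl (by simp) ha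
  simp only [List.map_nil] at r1 m1
  obtain ⟨s2, r2, p2, m2, v2, -⟩ := e.spec hW [] 0 _ s1 (by simpa using h2)
    p1 (by simp) (by simpa [m1] using he)
  simp only [List.map_nil, m1] at r2 v2
  obtain ⟨t, ht, h⟩ := (r1.trans r2).haltsIn (by
    rw [p2, List.getElem?_eq_none_iff, fullProgram, List.length_append]
    simp)
  exact ⟨t, ht, s2, h, v2⟩

/-! ### Size and time bounds up to constants -/

mutual
theorem Term.Bd.mono {W W' : ℕ} (h : W ≤ W') : ∀ {e : Term} {env : List ℤ} {m : ℤ → ℤ},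
    e.Bd W env m → e.Bd W' env m
  | .var _, _, _, hB => by simp only [Term.Bd] at hB ⊢; exact hB.trans h
  | .const _, _, _, hB => by simp only [Term.Bd] at hB ⊢; exact hB.trans h
  | .op _ _ _, _, _, hB => by
    simp only [Term.Bd] at hB ⊢; exact ⟨hB.1.mono h, hB.2.1.mono h, hB.2.2.trans h⟩
  | .load _, _, _, hB => by simp only [Term.Bd] at hB ⊢; exact ⟨hB.1.mono h, hB.2.trans h⟩
  | .ite c a b, env, m, hB => by
    simp only [Term.Bd] at hB ⊢
    refine ⟨hB.1.mono h, ?_⟩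
    have := hB.2
    split_ifs at this ⊢
    · exact Term.Bd.mono h (e := a) this
    · exact Term.Bd.mono h (e := b) this
  | .letE _ _, _, _, hB => by simp only [Term.Bd] at hB ⊢; exact ⟨hB.1.mono h, hB.2.mono h⟩
  | .sum _ _, _, _, hB => by
    simp only [Term.Bd] at hB ⊢
    exact ⟨hB.1.mono h, fun i hi => (hB.2.1 i hi).mono h, fun j hj => (hB.2.2 j hj).trans h⟩
  | .loop _ _ _ _ _, _, _, hB => by
    simp only [Term.Bd] at hB ⊢
    exact ⟨hB.1, hB.2.1.mono h, hB.2.2.1.mono h,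
      fun j hj => ⟨(hB.2.2.2.1 j hj).1.mono h, (hB.2.2.2.1 j hj).2.mono h⟩, hB.2.2.2.2.mono h⟩
theorem Terms.Bds.mono {W W' : ℕ} (h : W ≤ W') : ∀ {es : Terms} {env : List ℤ} {m : ℤ → ℤ},
    es.Bds W env m → es.Bds W' env m
  | .nil, _, _, _ => by simp only [Terms.Bds]
  | .cons _ _, _, _, hB => by
    simp only [Terms.Bds] at hB ⊢; exact ⟨hB.1.mono h, hB.2.mono h⟩
end

theorem bitLength_fn (o : Op) (x y : ℤ) :
    bitLength (o.fn x y) ≤ bitLength x + bitLength y + 1 := by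
  rw [bitLength_le]
  have hx := bitLength_le.1 (le_refl (bitLength x))
  have hy := bitLength_le.1 (le_refl (bitLength y))
  set a := bitLength x
  set b := bitLength y
  have h1 : (1 : ℤ) ≤ 2 ^ a := one_le_pow₀ (by norm_num)
  have h2 : (1 : ℤ) ≤ 2 ^ b := one_le_pow₀ (by norm_num)
  have e : (2 : ℤ) ^ (a + b + 1) = 2 * (2 ^ a * 2 ^ b) := by ring
  have h3 : (2 : ℤ) ^ a ≤ 2 ^ a * 2 ^ b := le_mul_of_one_le_right (by positivity) h2
  have h4 : (2 : ℤ) ^ b ≤ 2 ^ a * 2 ^ b := le_mul_of_one_le_left (by positivity) h1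
  rw [e]
  cases o
  · exact (abs_add_le x y).trans_lt (by omega)
  · exact (abs_sub x y).trans_lt (by omega)
  · simp only [Op.fn]
    rw [abs_mul]
    have := mul_lt_mul'' hx hy (abs_nonneg _) (abs_nonneg _)
    omega
  · have : |x / y| ≤ |x| := by
      rw [Int.abs_eq_natAbs, Int.abs_eq_natAbs]
      exact_mod_cast Int.natAbs_ediv_le_natAbs x y
    exact this.trans_lt (by omega)

theorem bitLength_sum_le {j a b : ℕ} {f : ℕ → ℤ} (hj : j < 2 ^ a)
    (hf : ∀ i < j, bitLength (f i) ≤ b) : bitLength (∑ i ∈ Finset.range j, f i) ≤ a + b := by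
  rw [bitLength_le]
  calc |∑ i ∈ Finset.range j, f i| ≤ ∑ i ∈ Finset.range j, |f i| := Finset.abs_sum_le_sum_abs _ _
    _ ≤ ∑ _i ∈ Finset.range j, (2 : ℤ) ^ b :=
        Finset.sum_le_sum fun i hi => (bitLength_le.1 (hf i (Finset.mem_range.1 hi))).le
    _ = j * 2 ^ b := by simp
    _ < 2 ^ (a + b) := by
        rw [pow_add]
        exact mul_lt_mul_of_pos_right (by exact_mod_cast hj) (by positivity)

/-- All variables and all memory cells have at most `w` binary digits. -/
def Small (w : ℕ) (env : List ℤ) (m : ℤ → ℤ) : Prop :=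
  1 ≤ w ∧ (∀ z ∈ env, bitLength z ≤ w) ∧ ∀ a, bitLength (m a) ≤ w

theorem Small.mono {w w' : ℕ} {env : List ℤ} {m : ℤ → ℤ} (h : Small w env m) (hw : w ≤ w') :
    Small w' env m :=
  ⟨h.1.trans hw, fun z hz => (h.2.1 z hz).trans hw, fun a => (h.2.2 a).trans hw⟩

theorem Small.append {w : ℕ} {l env : List ℤ} {m : ℤ → ℤ} (h : Small w env m)
    (hl : ∀ z ∈ l, bitLength z ≤ w) : Small w (l ++ env) m := by
  refine ⟨h.1, fun z hz => ?_, h.2.2⟩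
  rcases List.mem_append.1 hz with hz | hz
  exacts [hl z hz, h.2.1 z hz]

theorem Small.cons {w : ℕ} {z : ℤ} {env : List ℤ} {m : ℤ → ℤ} (h : Small w env m)
    (hz : bitLength z ≤ w) : Small w (z :: env) m :=
  h.append (l := [z]) (by simpa using hz)

/-- The numbers in the evaluation of the term have at most a constant times as many digits as the
variables and the memory cells. -/
def Term.PBd (e : Term) : Prop := ∃ c, ∀ w env m, Small w env m → e.Bd (c * w) env m

/-- The same for a tuple of terms. -/
def Terms.PBds (e : Terms) : Prop := ∃ c, ∀ w env m, Small w env m → e.Bds (c * w) env m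

theorem Term.PBd.var (i : ℕ) : (Term.var i).PBd := by
  refine ⟨1, fun w env m h => ?_⟩
  simp only [Term.Bd, one_mul]
  rcases lt_or_ge i env.length with hi | hi
  · rw [List.getD_eq_getElem _ _ hi]
    exact h.2.1 _ (List.getElem_mem hi)
  · rw [List.getD_eq_default _ _ hi]; simp

theorem Term.PBd.const (z : ℤ) : (Term.const z).PBd :=
  ⟨bitLength z, fun w _ _ h => by
    simp only [Term.Bd]; exact Nat.le_mul_of_pos_right _ h.1⟩

theorem Term.PBd.op (o : Op) {a b : Term} : a.PBd → b.PBd → (Term.op o a b).PBd := by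
  rintro ⟨ca, ha⟩ ⟨cb, hb⟩
  refine ⟨ca + cb + 1, fun w env m h => ?_⟩
  have e : (ca + cb + 1) * w = ca * w + cb * w + w := by ring
  have ha := ha w env m h
  have hb := hb w env m h
  have := h.1
  exact ⟨ha.mono (by omega), hb.mono (by omega), (bitLength_fn _ _ _).trans (by
    have := ha.eval_le; have := hb.eval_le; omega)⟩

theorem Term.PBd.load {a : Term} : a.PBd → (Term.load a).PBd := by
  rintro ⟨ca, ha⟩
  refine ⟨ca + 1, fun w env m h => ?_⟩
  have e : (ca + 1) * w = ca * w + w := by ring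
  exact ⟨(ha w env m h).mono (by omega), (h.2.2 _).trans (by omega)⟩

theorem Term.PBd.ite {c a b : Term} : c.PBd → a.PBd → b.PBd → (Term.ite c a b).PBd := by
  rintro ⟨cc, hc⟩ ⟨ca, ha⟩ ⟨cb, hb⟩
  refine ⟨cc + ca + cb, fun w env m h => ?_⟩
  have e : (cc + ca + cb) * w = cc * w + ca * w + cb * w := by ring
  refine ⟨(hc w env m h).mono (by omega), ?_⟩
  split_ifs
  · exact (ha w env m h).mono (by omega)
  · exact (hb w env m h).mono (by omega)

theorem Term.PBd.letE {a b : Term} : a.PBd → b.PBd → (Term.letE a b).PBd := by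
  rintro ⟨ca, ha⟩ ⟨cb, hb⟩
  refine ⟨ca + cb * (ca + 1), fun w env m h => ?_⟩
  have h1 := ha w env m h
  have h2 := hb ((ca + 1) * w) (a.eval env m :: env) m
    ((h.mono (by nlinarith)).cons (h1.eval_le.trans (by nlinarith)))
  have e : (ca + cb * (ca + 1)) * w = ca * w + cb * ((ca + 1) * w) := by ring
  exact ⟨h1.mono (by omega), h2.mono (by omega)⟩

theorem Term.PBd.sum {n b : Term} : n.PBd → b.PBd → (Term.sum n b).PBd := by
  rintro ⟨cn, hn⟩ ⟨cb, hb⟩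
  refine ⟨cn + cb * (cn + 1), fun w env m h => ?_⟩
  have h1 := hn w env m h
  have hlt : (n.eval env m).toNat < 2 ^ (cn * w) := by
    have h3 := bitLength_le.1 h1.eval_le
    have := le_abs_self (n.eval env m)
    zify
    rcases le_or_gt 0 (n.eval env m) with h | h
    · rw [Int.toNat_of_nonneg h]; omega
    · rw [Int.toNat_of_nonpos h.le]; simp
  have h2 : ∀ i < (n.eval env m).toNat, b.Bd (cb * ((cn + 1) * w)) ((i : ℤ) :: env) m := by
    intro i hi
    refine hb _ _ m ((h.mono (by nlinarith)).cons (le_trans ?_ (show cn * w ≤ _ by nlinarith)))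
    rw [bitLength_le, abs_of_nonneg (by positivity)]
    exact_mod_cast hi.trans hlt
  have e : (cn + cb * (cn + 1)) * w = cn * w + cb * ((cn + 1) * w) := by ring
  refine ⟨h1.mono (by omega), fun i hi => (h2 i hi).mono (by omega), fun j hj => ?_⟩
  rw [e]
  exact bitLength_sum_le (by omega) fun i hi => (h2 i (by omega)).eval_le

theorem Terms.PBds.nil : Terms.nil.PBds := ⟨0, fun _ _ _ _ => by simp only [Terms.Bds]⟩

theorem Terms.PBds.cons {a : Term} {b : Terms} : a.PBd → b.PBds → (Terms.cons a b).PBds := by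
  rintro ⟨ca, ha⟩ ⟨cb, hb⟩
  refine ⟨ca + cb, fun w env m h => ?_⟩
  have e : (ca + cb) * w = ca * w + cb * w := by ring
  exact ⟨(ha w env m h).mono (by omega), (hb w env m h).mono (by omega)⟩

/-- A loop has the size bound if its states have. -/
theorem Term.PBd.loop {f c r : Term} {is us : Terms} (hlen : us.length = is.length) :
    f.PBd → is.PBds → c.PBd → us.PBds → r.PBd →
    (∃ k, ∀ w env m, Small w env m → ∀ j ≤ (f.eval env m).toNat,
      ∀ z ∈ loopVal (fun st => c.eval (st ++ env) m) (fun st => us.evals (st ++ env) m) j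
        (is.evals env m), bitLength z ≤ k * w) →
    (Term.loop f is c us r).PBd := by
  rintro ⟨cf, hf⟩ ⟨ci, hi⟩ ⟨cc, hc⟩ ⟨cu, hu⟩ ⟨cr, hr⟩ ⟨k, hk⟩
  refine ⟨cf + ci + (cc + cu + cr) * (k + 1), fun w env m h => ?_⟩
  have e : (cf + ci + (cc + cu + cr) * (k + 1)) * w = cf * w + ci * w + cc * ((k + 1) * w) +
    cu * ((k + 1) * w) + cr * ((k + 1) * w) := by ring
  have key : ∀ j ≤ (f.eval env m).toNat, Small ((k + 1) * w)
      (loopVal (fun st => c.eval (st ++ env) m) (fun st => us.evals (st ++ env) m) j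
        (is.evals env m) ++ env) m := fun j hj =>
    (h.mono (by nlinarith)).append fun z hz => (hk w env m h j hj z hz).trans (by nlinarith)
  refine ⟨hlen, (hf w env m h).mono (by omega), (hi w env m h).mono (by omega),
    fun j hj => ⟨(hc _ _ m (key j hj)).mono (by omega), (hu _ _ m (key j hj)).mono (by omega)⟩,
    (hr _ _ m (key _ le_rfl)).mono (by omega)⟩

/-- Evaluation of `body` with the given values of the first variables. -/
def Term.call (args : Terms) (body : Term) : Term :=
  .loop (.const 0) args (.const 0) args body

theorem Term.eval_call (args : Terms) (body : Term) (env : List ℤ) (m : ℤ → ℤ) :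
    (Term.call args body).eval env m = body.eval (args.evals env m ++ env) m := by
  simp [Term.call, Term.eval, loopVal]

theorem Term.PBd.call {args : Terms} {body : Term} (ha : args.PBds) (hb : body.PBd) :
    (Term.call args body).PBd := by
  obtain ⟨c, hc⟩ := ha
  obtain ⟨k, hk⟩ := hb
  refine ⟨c + c * (c + 1) + k * (c + 1) + 0, fun w env m h => ?_⟩
  have h1 := hc w env m h
  have hS : Small ((c + 1) * w) (args.evals env m ++ env) m :=
    (h.mono (by nlinarith)).append fun z hz => (h1.evals_le z hz).trans (by nlinarith)
  have e : (c + c * (c + 1) + k * (c + 1) + 0) * w =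
    c * w + c * ((c + 1) * w) + k * ((c + 1) * w) := by ring
  rw [e]
  refine ⟨rfl, by simp [Term.Bd], h1.mono (by omega), fun j hj => ?_, ?_⟩
  · simp only [Term.eval, Int.toNat_zero, nonpos_iff_eq_zero] at hj
    subst hj
    exact ⟨by simp [Term.Bd], (hc _ _ m hS).mono (by omega)⟩
  · simpa [Term.eval, loopVal] using (hk _ _ m hS).mono (by omega)

/-- Under the condition `H` on the memory and a parameter `r`, the evaluation of the term takes at
most a constant times `w * G m r` instructions, where `w` bounds the number of digits. -/
def Term.Fast (H : (ℤ → ℤ) → ℕ → Prop) (G : (ℤ → ℤ) → ℕ → ℕ) (e : Term) : Prop :=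
  ∃ c, ∀ w env m r, Small w env m → H m r → 1 ≤ G m r → e.steps env m ≤ c * w * G m r

/-- The same for a tuple of terms. -/
def Terms.Fasts (H : (ℤ → ℤ) → ℕ → Prop) (G : (ℤ → ℤ) → ℕ → ℕ) (e : Terms) : Prop :=
  ∃ c, ∀ w env m r, Small w env m → H m r → 1 ≤ G m r → e.stepss env m ≤ c * w * G m r

section Fast
variable {H : (ℤ → ℤ) → ℕ → Prop} {G G' : (ℤ → ℤ) → ℕ → ℕ}

theorem one_le_mul_of_small {w g : ℕ} {env : List ℤ} {m : ℤ → ℤ} (h : Small w env m)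
    (hg : 1 ≤ g) : 1 ≤ w * g :=
  Nat.mul_pos h.1 hg

theorem Term.Fast.mono {e : Term} (he : e.Fast H G)
    (h : ∀ m r, H m r → 1 ≤ G' m r → 1 ≤ G m r ∧ G m r ≤ G' m r) : e.Fast H G' := by
  obtain ⟨c, hc⟩ := he
  refine ⟨c, fun w env m r hs hH hG => (hc w env m r hs hH (h m r hH hG).1).trans ?_⟩
  exact Nat.mul_le_mul_left _ (h m r hH hG).2

theorem Term.Fast.var (i : ℕ) : (Term.var i).Fast H G :=
  ⟨2, fun w _ m r h _ hG => by
    simp only [Term.steps]; have := one_le_mul_of_small h hG; rw [mul_assoc]; omega⟩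

theorem Term.Fast.const (z : ℤ) : (Term.const z).Fast H G :=
  ⟨1, fun w _ m r h _ hG => by
    simp only [Term.steps]; have := one_le_mul_of_small h hG; rw [mul_assoc]; omega⟩

theorem Term.Fast.op (o : Op) {a b : Term} :
    a.Fast H G → b.Fast H G → (Term.op o a b).Fast H G := by
  rintro ⟨ca, ha⟩ ⟨cb, hb⟩
  refine ⟨ca + cb + 1, fun w env m r h hH hG => ?_⟩
  have := ha w env m r h hH hG
  have := hb w env m r h hH hG
  have := one_le_mul_of_small h hG
  simp only [Term.steps]
  have e : (ca + cb + 1) * w * G m r = ca * w * G m r + cb * w * G m r + w * G m r := by ring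
  omega

theorem Term.Fast.load {a : Term} : a.Fast H G → (Term.load a).Fast H G := by
  rintro ⟨ca, ha⟩
  refine ⟨ca + 1, fun w env m r h hH hG => ?_⟩
  have := ha w env m r h hH hG
  have := one_le_mul_of_small h hG
  simp only [Term.steps]
  have e : (ca + 1) * w * G m r = ca * w * G m r + w * G m r := by ring
  omega

theorem Term.Fast.ite {c a b : Term} :
    c.Fast H G → a.Fast H G → b.Fast H G → (Term.ite c a b).Fast H G := by
  rintro ⟨cc, hc⟩ ⟨ca, ha⟩ ⟨cb, hb⟩
  refine ⟨cc + ca + cb + 2, fun w env m r h hH hG => ?_⟩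
  have := hc w env m r h hH hG
  have := ha w env m r h hH hG
  have := hb w env m r h hH hG
  have := one_le_mul_of_small h hG
  simp only [Term.steps]
  have e : (cc + ca + cb + 2) * w * G m r = cc * w * G m r + ca * w * G m r + cb * w * G m r +
    2 * (w * G m r) := by ring
  split_ifs <;> omega

theorem Term.Fast.letE {a b : Term} (hp : a.PBd) :
    a.Fast H G → b.Fast H G → (Term.letE a b).Fast H G := by
  rintro ⟨ca, ha⟩ ⟨cb, hb⟩
  obtain ⟨k, hk⟩ := hp
  refine ⟨ca + cb * (k + 1) + 2, fun w env m r h hH hG => ?_⟩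
  have := ha w env m r h hH hG
  have := hb ((k + 1) * w) (a.eval env m :: env) m r ((h.mono (by nlinarith)).cons
    ((hk w env m h).eval_le.trans (by nlinarith))) hH hG
  have := one_le_mul_of_small h hG
  simp only [Term.steps]
  have e : (ca + cb * (k + 1) + 2) * w * G m r = ca * w * G m r + cb * ((k + 1) * w) * G m r +
    2 * (w * G m r) := by ring
  omega

theorem Term.Fast.sum {q : (ℤ → ℤ) → ℕ → ℕ} {n b : Term} (hp : n.PBd)
    (hq : ∃ k, ∀ w env m r, Small w env m → H m r → (n.eval env m).toNat ≤ k * q m r) :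
    n.Fast H G → b.Fast H G → (Term.sum n b).Fast H (fun m r => q m r * G m r) := by
  rintro ⟨cn, hn⟩ ⟨cb, hb⟩
  obtain ⟨k, hk⟩ := hp
  obtain ⟨K, hK⟩ := hq
  refine ⟨cn + 7 + K * (cb * (k + 1) + 6), fun w env m r h hH hG => ?_⟩
  have hq1 : 1 ≤ q m r := Nat.pos_of_mul_pos_right hG
  have hG1 : 1 ≤ G m r := Nat.pos_of_mul_pos_left hG
  have h1 := hn w env m r h hH hG1
  have h0 := one_le_mul_of_small h hG1
  have h2 := hK w env m r h hH
  simp only [Term.steps]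
  have h3 : ∀ i ∈ Finset.range (n.eval env m).toNat, b.steps ((i : ℤ) :: env) m + 6 ≤
      (cb * (k + 1) + 6) * (w * G m r) := by
    intro i hi
    rw [Finset.mem_range] at hi
    have := hb ((k + 1) * w) ((i : ℤ) :: env) m r ((h.mono (by nlinarith)).cons
      ((bitLength_mono (z' := n.eval env m) (by
        rw [abs_of_nonneg (by positivity)]
        have := le_abs_self (n.eval env m)
        omega)).trans ((hk w env m h).eval_le.trans (by nlinarith)))) hH hG1
    have e : (cb * (k + 1) + 6) * (w * G m r) = cb * ((k + 1) * w) * G m r + 6 * (w * G m r) := by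
      ring
    omega
  have h4 := Finset.sum_le_card_nsmul _ _ _ h3
  rw [Finset.card_range, smul_eq_mul] at h4
  have h5 : (n.eval env m).toNat * ((cb * (k + 1) + 6) * (w * G m r)) ≤
      K * q m r * ((cb * (k + 1) + 6) * (w * G m r)) := Nat.mul_le_mul_right _ h2
  have h6 : cn * w * G m r + 7 ≤ (cn + 7) * (w * G m r) := by nlinarith
  have h7 : (cn + 7) * (w * G m r) ≤ (cn + 7) * (w * G m r) * q m r :=
    Nat.le_mul_of_pos_right _ hq1
  calc _ ≤ (cn + 7) * (w * G m r) * q m r + K * q m r * ((cb * (k + 1) + 6) * (w * G m r)) := by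
        omega
    _ = _ := by ring

theorem Terms.Fasts.nil : Terms.nil.Fasts H G := ⟨0, fun _ _ _ _ _ _ _ => by simp [Terms.stepss]⟩

theorem Terms.Fasts.cons {a : Term} {b : Terms} :
    a.Fast H G → b.Fasts H G → (Terms.cons a b).Fasts H G := by
  rintro ⟨ca, ha⟩ ⟨cb, hb⟩
  refine ⟨ca + cb, fun w env m r h hH hG => ?_⟩
  have := ha w env m r h hH hG
  have := hb w env m r h hH hG
  simp only [Terms.stepss]
  have e : (ca + cb) * w * G m r = ca * w * G m r + cb * w * G m r := by ring
  omega

theorem Term.Fast.call {args : Terms} {body : Term} (hp : args.PBds) :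
    args.Fasts H G → body.Fast H G → (Term.call args body).Fast H G := by
  rintro ⟨ca, ha⟩ ⟨cb, hb⟩
  obtain ⟨k, hk⟩ := hp
  refine ⟨ca + cb * (k + 1) + 5, fun w env m r h hH hG => ?_⟩
  have := ha w env m r h hH hG
  have := hb ((k + 1) * w) (args.evals env m ++ env) m r ((h.mono (by nlinarith)).append
    fun z hz => ((hk w env m h).evals_le z hz).trans (by nlinarith)) hH hG
  have := one_le_mul_of_small h hG
  simp only [Term.call, Term.steps, Term.eval, Int.toNat_zero, loopVal, loopSteps]
  have e : (ca + cb * (k + 1) + 5) * w * G m r = ca * w * G m r + cb * ((k + 1) * w) * G m r +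
    5 * (w * G m r) := by ring
  omega

end Fast
end Ram

/-! ### Summatory functions of the Möbius function -/

open ArithmeticFunction in
/-- The Mertens function, the sum of the Möbius function over `1, …, n`. -/
def mertens (n : ℕ) : ℤ := ∑ d ∈ Finset.Ioc 0 n, moebius d

@[simp] theorem mertens_zero : mertens 0 = 0 := by simp [mertens]

theorem mertens_succ (n : ℕ) :
    mertens (n + 1) = mertens n + ArithmeticFunction.moebius (n + 1) := by
  rw [mertens, mertens, Finset.sum_Ioc_succ_top (Nat.zero_le n)]

theorem sum_moebius_divisors (n : ℕ) :
    ∑ d ∈ n.divisors, ArithmeticFunction.moebius d = if n = 1 then 1 else 0 := by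
  rw [← ArithmeticFunction.coe_mul_zeta_apply, ArithmeticFunction.moebius_mul_coe_zeta,
    ArithmeticFunction.one_apply]

theorem sum_Ioc_div_eq_sum_divisors (N : ℕ) (g : ℕ → ℕ → ℤ) :
    ∑ d ∈ Finset.Ioc 0 N, ∑ e ∈ Finset.Ioc 0 (N / d), g d (d * e) =
      ∑ n ∈ Finset.Ioc 0 N, ∑ d ∈ n.divisors, g d n := by
  have h : ∀ d ∈ Finset.Ioc 0 N, ∑ e ∈ Finset.Ioc 0 (N / d), g d (d * e) =
      ∑ n ∈ Finset.Ioc 0 N with d ∣ n, g d n := by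
    intro d hd
    rw [Finset.mem_Ioc] at hd
    refine Finset.sum_nbij' (fun e => d * e) (fun n => n / d) ?_ ?_ ?_ ?_ ?_
    · intro e he
      simp only [Finset.mem_Ioc, Finset.mem_filter] at he ⊢
      refine ⟨⟨Nat.mul_pos hd.1 he.1, ?_⟩, dvd_mul_right _ _⟩
      have := (Nat.le_div_iff_mul_le hd.1).1 he.2
      linarith
    · intro n hn
      simp only [Finset.mem_Ioc, Finset.mem_filter] at hn ⊢
      exact ⟨Nat.div_pos (Nat.le_of_dvd hn.1.1 hn.2) hd.1, Nat.div_le_div_right hn.1.2⟩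
    · intro e _
      exact Nat.mul_div_cancel_left _ hd.1
    · intro n hn
      exact Nat.mul_div_cancel' (Finset.mem_filter.1 hn).2
    · intros; rfl
  rw [Finset.sum_congr rfl h]
  simp_rw [Finset.sum_filter]
  rw [Finset.sum_comm]
  refine Finset.sum_congr rfl fun n hn => ?_
  rw [Finset.mem_Ioc] at hn
  rw [← Finset.sum_filter]
  refine Finset.sum_congr ?_ fun _ _ => rfl
  ext d
  simp only [Finset.mem_filter, Finset.mem_Ioc, Nat.mem_divisors]
  constructor
  · rintro ⟨-, h⟩; exact ⟨h, by omega⟩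
  · rintro ⟨h, -⟩
    have := Nat.le_of_dvd hn.1 h
    have := Nat.pos_of_dvd_of_pos h hn.1
    exact ⟨⟨by omega, by omega⟩, h⟩

/-- Möbius inversion: the sum over the multiples of all `d`, weighted by the Möbius function, leaves
only the term at `1`. -/
theorem sum_moebius_mul_sum (N : ℕ) (hN : 1 ≤ N) (f : ℕ → ℤ) :
    ∑ d ∈ Finset.Ioc 0 N, ArithmeticFunction.moebius d *
      ∑ e ∈ Finset.Ioc 0 (N / d), f (d * e) = f 1 := by
  simp_rw [Finset.mul_sum]
  rw [sum_Ioc_div_eq_sum_divisors N fun d n => ArithmeticFunction.moebius d * f n]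
  simp_rw [← Finset.sum_mul]
  rw [Finset.sum_eq_single 1]
  · simp
  · intro n hn h1
    rw [Finset.mem_Ioc] at hn
    rw [sum_moebius_divisors n, if_neg h1, zero_mul]
  · intro h; simp at h; omega

theorem sum_mertens_div (y : ℕ) (hy : 1 ≤ y) : ∑ e ∈ Finset.Ioc 0 y, mertens (y / e) = 1 := by
  have h1 := sum_moebius_mul_sum y hy fun _ => 1
  have h2 := sum_Ioc_div_eq_sum_divisors y fun d _ => ArithmeticFunction.moebius d
  have h3 := sum_Ioc_div_eq_sum_divisors y fun d n => ArithmeticFunction.moebius (n / d)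
  simp only [mertens]
  have h4 : ∑ e ∈ Finset.Ioc 0 y, ∑ d ∈ Finset.Ioc 0 (y / e), ArithmeticFunction.moebius d =
      ∑ d ∈ Finset.Ioc 0 y, ∑ e ∈ Finset.Ioc 0 (y / d),
        ArithmeticFunction.moebius (d * e / d) := by
    refine Finset.sum_congr rfl fun d hd => Finset.sum_congr rfl fun e _ => ?_
    rw [Nat.mul_div_cancel_left _ (Finset.mem_Ioc.1 hd).1]
  rw [h4, h3]
  simp_rw [Nat.sum_div_divisors]
  rw [← h2]
  simpa [Finset.mul_sum, mul_comm] using h1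

/-- The quotient `y / e` takes a given value `v` for the `e` in the interval
`(y / (v + 1), y / v]`. -/
theorem sum_mertens_div_group (y V : ℕ) (hV : 1 ≤ V) :
    ∑ e ∈ Finset.Ioc (y / V) y, mertens (y / e) =
      ∑ v ∈ Finset.Ico 1 V, mertens v * ((y / v : ℕ) - (y / (v + 1) : ℕ) : ℤ) := by
  induction V, hV using Nat.le_induction with
  | base => simp
  | succ V hV ih =>
    have hle : y / (V + 1) ≤ y / V := Nat.div_le_div_left (by omega) hV
    rw [Finset.sum_Ico_succ_top hV, ← ih, ← Finset.sum_Ioc_consecutive _ hle (Nat.div_le_self y V),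
      add_comm]
    congr 1
    have h : ∀ e ∈ Finset.Ioc (y / (V + 1)) (y / V), mertens (y / e) = mertens V := by
      intro e he
      rw [Finset.mem_Ioc] at he
      congr 1
      have he0 : 0 < e := Nat.pos_of_ne_zero (by rintro rfl; simp at he)
      have h1 := (Nat.div_lt_iff_lt_mul (Nat.succ_pos V)).1 he.1
      have h2 := (Nat.le_div_iff_mul_le hV).1 he.2
      rw [mul_comm] at h1 h2
      exact Nat.div_eq_of_lt_le h2 (by linarith)
    rw [Finset.sum_congr rfl h, Finset.sum_const, Nat.card_Ioc, nsmul_eq_mul, mul_comm]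
    push_cast [Nat.cast_sub hle]
    ring

/-- The Mertens function at `x`, computed from its values below `T`. This is a double application
of the Möbius inversion formula: the bracket is the sum of `mertens (x / (d * e))` over those `e`
for which `T ≤ x / (d * e)`, and in it the terms with `x / (d * e) < V` are grouped by value. -/
theorem mertens_eq_sum {x T V : ℕ} (hV : 1 ≤ V) (hVT : V ≤ T) (hx : T ≤ x) :
    mertens x = ∑ d ∈ Finset.Ioc 0 (x / T), ArithmeticFunction.moebius d *
      (1 - ∑ e ∈ Finset.Ioc (x / d / T) (x / d / V), mertens (x / d / e) -
        ∑ v ∈ Finset.Ico 1 V, mertens v * ((x / d / v : ℕ) - (x / d / (v + 1) : ℕ) : ℤ)) := by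
  have hN : 1 ≤ x / T := Nat.div_pos hx (by omega)
  have h := sum_moebius_mul_sum (x / T) hN fun n => mertens (x / n)
  rw [Nat.div_one] at h
  rw [← h]
  refine Finset.sum_congr rfl fun d hd => ?_
  rw [Finset.mem_Ioc] at hd
  congr 1
  have hy : 1 ≤ x / d := Nat.div_pos (hd.2.trans (Nat.div_le_self _ _)) hd.1
  rw [← sum_mertens_div_group _ V hV, ← sum_mertens_div _ hy]
  rw [← Finset.sum_Ioc_consecutive _ (Nat.zero_le (x / d / T)) (Nat.div_le_self _ T),
    ← Finset.sum_Ioc_consecutive _ (Nat.div_le_div_left hVT hV) (Nat.div_le_self _ V)]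
  have e : x / T / d = x / d / T := by rw [Nat.div_div_eq_div_mul, Nat.div_div_eq_div_mul, mul_comm]
  rw [e]
  simp_rw [← Nat.div_div_eq_div_mul]
  ring

/-! ### Primitive points by Möbius inversion -/

/-- The lattice points of the square `[-B, B]²`. -/
noncomputable def box (B : ℕ) : Finset (ℤ × ℤ) := Finset.Icc (-(B : ℤ)) B ×ˢ Finset.Icc (-(B : ℤ)) B

theorem mem_box {B : ℕ} {z : ℤ × ℤ} : z ∈ box B ↔ |z.1| ≤ B ∧ |z.2| ≤ B := by
  simp [box, abs_le]

/-- The multiple `d • z` of a lattice point. -/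
def scale (d : ℕ) (z : ℤ × ℤ) : ℤ × ℤ := (d * z.1, d * z.2)

theorem scale_mem_box {B d : ℕ} {z : ℤ × ℤ} (h : scale d z ∈ box B) :
    d * |z.1| ≤ B ∧ d * |z.2| ≤ B := by
  rw [mem_box] at h
  simpa [scale, abs_mul] using h

theorem mem_box_of_scale {B d : ℕ} (hd : 0 < d) {z : ℤ × ℤ} (h : scale d z ∈ box B) :
    z ∈ box B := by
  obtain ⟨h1, h2⟩ := scale_mem_box h
  have : (1 : ℤ) ≤ d := by exact_mod_cast hd
  exact mem_box.2 ⟨le_trans (le_mul_of_one_le_left (abs_nonneg _) this) h1,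
    le_trans (le_mul_of_one_le_left (abs_nonneg _) this) h2⟩

/-- Möbius inversion for functions on the plane lattice: the non-zero points are sorted by their
primitive parts. -/
theorem sum_moebius_scale {V : ℤ × ℤ → ℤ} {B N : ℕ} (hV : ∀ z, V z ≠ 0 → z ∈ box B)
    (hN : B ≤ N) :
    ∑ d ∈ Finset.Ioc 0 N, ArithmeticFunction.moebius d * ∑ z ∈ (box B).erase 0, V (scale d z) =
      ∑ z ∈ box B with Int.gcd z.1 z.2 = 1, V z := by
  have h : ∀ d ∈ Finset.Ioc 0 N, ∑ z ∈ (box B).erase 0, V (scale d z) =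
      ∑ w ∈ (box B).erase 0 with d ∣ Int.gcd w.1 w.2, V w := by
    intro d hd
    rw [Finset.mem_Ioc] at hd
    have hd0 : (d : ℤ) ≠ 0 := by exact_mod_cast hd.1.ne'
    have h1 : ∑ z ∈ (box B).erase 0, V (scale d z) =
        ∑ z ∈ (box B).erase 0 with scale d z ∈ box B, V (scale d z) := by
      rw [Finset.sum_filter_of_ne]
      exact fun z _ hz => hV _ hz
    rw [h1]
    refine Finset.sum_nbij' (scale d) (fun w => (w.1 / d, w.2 / d)) ?_ ?_ ?_ ?_ ?_
    · intro z hz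
      simp only [Finset.mem_filter, Finset.mem_erase] at hz ⊢
      refine ⟨⟨fun h0 => hz.1.1 ?_, hz.2⟩, ?_⟩
      · simp only [scale, Prod.mk_eq_zero, mul_eq_zero, hd0, false_or] at h0
        exact Prod.ext h0.1 h0.2
      · exact Int.dvd_gcd (dvd_mul_right _ _) (dvd_mul_right _ _)
    · intro w hw
      simp only [Finset.mem_filter, Finset.mem_erase] at hw ⊢
      have h1 : (d : ℤ) ∣ w.1 := (Int.natCast_dvd_natCast.2 hw.2).trans (Int.gcd_dvd_left _ _)
      have h2 : (d : ℤ) ∣ w.2 := (Int.natCast_dvd_natCast.2 hw.2).trans (Int.gcd_dvd_right _ _)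
      have e : scale d (w.1 / d, w.2 / d) = w := by
        simp [scale, Int.mul_ediv_cancel' h1, Int.mul_ediv_cancel' h2]
      refine ⟨⟨fun h0 => hw.1.1 ?_, mem_box_of_scale hd.1 (by rw [e]; exact hw.1.2)⟩,
        by rw [e]; exact hw.1.2⟩
      rw [← e, h0]; simp [scale]
    · intro z _
      simp only [scale, Int.mul_ediv_cancel_left _ hd0]
    · intro w hw
      simp only [Finset.mem_filter] at hw
      have h1 : (d : ℤ) ∣ w.1 := (Int.natCast_dvd_natCast.2 hw.2).trans (Int.gcd_dvd_left _ _)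
      have h2 : (d : ℤ) ∣ w.2 := (Int.natCast_dvd_natCast.2 hw.2).trans (Int.gcd_dvd_right _ _)
      simp [scale, Int.mul_ediv_cancel' h1, Int.mul_ediv_cancel' h2]
    · intros; rfl
  rw [Finset.sum_congr rfl fun d hd => by rw [h d hd]]
  simp_rw [Finset.mul_sum, Finset.sum_filter]
  rw [Finset.sum_comm]
  rw [← Finset.sum_erase (a := (0 : ℤ × ℤ)) (box B) (by simp)]
  refine Finset.sum_congr rfl fun w hw => ?_
  rw [Finset.mem_erase, mem_box, Int.abs_eq_natAbs, Int.abs_eq_natAbs] at hw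
  rw [← Finset.sum_filter, ← Finset.sum_mul]
  have hg : Int.gcd w.1 w.2 ≠ 0 := by
    rw [Ne, Int.gcd_eq_zero_iff]
    rintro ⟨h1, h2⟩
    exact hw.1 (Prod.ext h1 h2)
  have hgB : Int.gcd w.1 w.2 ≤ B := by
    by_cases h1 : w.1 = 0
    · have h2 : w.2 ≠ 0 := fun h2 => hg (by rw [h1, h2]; rfl)
      have := Nat.le_of_dvd (Int.natAbs_pos.2 h2) (Int.gcd_dvd_natAbs_right w.1 w.2)
      omega
    · have := Nat.le_of_dvd (Int.natAbs_pos.2 h1) (Int.gcd_dvd_natAbs_left w.1 w.2)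
      omega
  have hs : (Finset.Ioc 0 N).filter (fun d => d ∣ Int.gcd w.1 w.2) =
      (Int.gcd w.1 w.2).divisors := by
    ext d
    simp only [Finset.mem_filter, Finset.mem_Ioc, Nat.mem_divisors]
    constructor
    · rintro ⟨-, h⟩; exact ⟨h, hg⟩
    · rintro ⟨h, -⟩
      have := Nat.le_of_dvd (Nat.pos_of_ne_zero hg) h
      exact ⟨⟨Nat.pos_of_dvd_of_pos h (Nat.pos_of_ne_zero hg), by omega⟩, h⟩
  rw [hs, sum_moebius_divisors]
  split_ifs <;> simp

/-! ### Lattice points under a line -/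

/-- The data of the set of points `(x, y)` with `lo ≤ Q * x < hi` and `m * y ≤ a * x + c`: the part
of a vertical strip below a line. -/
structure Slab where
  lo : ℤ
  hi : ℤ
  Q : ℤ
  a : ℤ
  c : ℤ
  m : ℤ

namespace Slab

/-- The indicator function of the strip. -/
def strip (S : Slab) (x : ℤ) : ℤ := if S.lo ≤ S.Q * x ∧ S.Q * x < S.hi then 1 else 0

/-- The indicator function of the lattice points of the slab. -/
def ind (S : Slab) (z : ℤ × ℤ) : ℤ :=
  if S.lo ≤ S.Q * z.1 ∧ S.Q * z.1 < S.hi ∧ S.m * z.2 ≤ S.a * z.1 + S.c then 1 else 0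

/-- The signed number of lattice points between the first axis and the upper line of the slab
shrunk by the factor `d`. -/
def count (S : Slab) (d : ℤ) : ℤ :=
  ∑ i ∈ Finset.range ((-((-S.hi) / (S.Q * d)) - -((-S.lo) / (S.Q * d))).toNat),
    ((S.a * d * i + (S.a * d * -((-S.lo) / (S.Q * d)) + S.c)) / (S.m * d))

theorem neg_neg_ediv_le_iff {p q x : ℤ} (hq : 0 < q) : -((-p) / q) ≤ x ↔ p ≤ q * x := by
  have := Int.le_ediv_iff_mul_le (a := -x) (b := -p) hq
  constructor
  · intro h
    have := this.1 (by omega)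
    linarith [mul_comm x q]
  · intro h
    have := this.2 (by linarith [mul_comm x q])
    omega

/-- The sum in `count` runs over the integers in the strip shrunk by the factor `d`. -/
theorem count_eq (S : Slab) (hQ : 0 < S.Q) {d : ℕ} (hd : 0 < d) {K : ℕ}
    (hK : |S.lo| + |S.hi| ≤ K) :
    S.count d = ∑ x ∈ Finset.Icc (-(K : ℤ)) K,
      S.strip (d * x) * ((S.a * (d * x) + S.c) / (S.m * d)) := by
  have hQd : 0 < S.Q * d := mul_pos hQ (by exact_mod_cast hd)
  set x0 := -((-S.lo) / (S.Q * d)) with hx0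
  set x1 := -((-S.hi) / (S.Q * d)) with hx1
  have h1 : S.count d = ∑ x ∈ Finset.Ico x0 x1, (S.a * (d * x) + S.c) / (S.m * d) := by
    unfold count
    rw [← hx0, ← hx1]
    refine Finset.sum_nbij' (fun i => x0 + i) (fun x => (x - x0).toNat) ?_ ?_ ?_ ?_ ?_
    · intro i hi; simp only [Finset.mem_range, Finset.mem_Ico] at hi ⊢; omega
    · intro i hi; simp only [Finset.mem_range, Finset.mem_Ico] at hi ⊢; omega
    · intro i hi; simp
    · intro i hi; simp only [Finset.mem_Ico] at hi; rw [Int.toNat_of_nonneg (by omega)]; ring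
    · intro i _; congr 1; ring
  rw [h1]
  have h2 : ∀ x : ℤ, x ∈ Finset.Ico x0 x1 ↔ S.lo ≤ S.Q * (d * x) ∧ S.Q * (d * x) < S.hi := by
    intro x
    rw [Finset.mem_Ico, ← not_le (a := x1), hx0, hx1, neg_neg_ediv_le_iff hQd,
      neg_neg_ediv_le_iff hQd, not_le, mul_assoc]
  have h3 : Finset.Ico x0 x1 = (Finset.Icc (-(K : ℤ)) K).filter
      (fun x => S.lo ≤ S.Q * (d * x) ∧ S.Q * (d * x) < S.hi) := by
    ext x
    rw [h2, Finset.mem_filter, iff_and_self, Finset.mem_Icc, ← abs_le]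
    rintro ⟨h3, h4⟩
    have h5 : |x| ≤ |S.Q * d * x| := by
      rw [abs_mul, abs_of_pos hQd]
      exact le_mul_of_one_le_left (abs_nonneg _) hQd
    rw [mul_assoc] at h5
    have h6 : |S.Q * (d * x)| ≤ |S.lo| + |S.hi| := by
      rw [abs_le]
      have := neg_abs_le S.lo
      have := le_abs_self S.hi
      have := abs_nonneg S.lo
      have := abs_nonneg S.hi
      constructor <;> linarith
    exact h5.trans (h6.trans hK)
  rw [h3, Finset.sum_filter]
  refine Finset.sum_congr rfl fun x _ => ?_
  rw [strip]
  split_ifs <;> simp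

/-- A column of the shrunk slab from height `-H` on: its number of points exceeds the height of the
line by `H`. -/
theorem strip_mul_div (S : Slab) (hm : 0 < S.m) {d : ℕ} (hd : 0 < d) {x : ℤ} {H : ℕ}
    (hH : |(S.a * (d * x) + S.c) / (S.m * d)| ≤ H) :
    S.strip (d * x) * ((S.a * (d * x) + S.c) / (S.m * d)) =
      ∑ y ∈ Finset.Ioc (-(H : ℤ)) H, S.ind (scale d (x, y)) - H * S.strip (d * x) := by
  set L := (S.a * (d * x) + S.c) / (S.m * d) with hL
  have hmd : 0 < S.m * d := mul_pos hm (by exact_mod_cast hd)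
  rw [abs_le] at hH
  have h1 : ∑ y ∈ Finset.Ioc (-(H : ℤ)) H, S.ind (scale d (x, y)) =
      S.strip (d * x) * (L + H) := by
    have h2 : ∀ y ∈ Finset.Ioc (-(H : ℤ)) H, S.ind (scale d (x, y)) =
        S.strip (d * x) * if y ≤ L then 1 else 0 := by
      intro y _
      have h3 : y ≤ L ↔ S.m * (d * y) ≤ S.a * (d * x) + S.c := by
        rw [hL, Int.le_ediv_iff_mul_le hmd, show y * (S.m * d) = S.m * (d * y) by ring]
      simp only [ind, strip, scale, h3, ← and_assoc]
      split_ifs <;> simp_all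
    rw [Finset.sum_congr rfl h2, ← Finset.mul_sum, ← Finset.sum_filter, Finset.sum_const,
      nsmul_one]
    have h4 : (Finset.Ioc (-(H : ℤ)) H).filter (fun y => y ≤ L) = Finset.Ioc (-(H : ℤ)) L := by
      ext y; simp only [Finset.mem_filter, Finset.mem_Ioc]; omega
    rw [h4, Int.card_Ioc]
    congr 1
    rw [Int.toNat_of_nonneg (by omega)]
    ring
  rw [h1]; ring

variable {ι : Type*} {s : Finset ι} {w : ι → ℤ} {S : ι → Slab} {B : ℕ}

/-- In a weighted sum of slabs in which the strips cancel, the lattice points of the plane can be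
counted column by column. -/
theorem sum_count (hQ : ∀ i ∈ s, 0 < (S i).Q) (hm : ∀ i ∈ s, 0 < (S i).m)
    (h0 : ∀ x, ∑ i ∈ s, w i * (S i).strip x = 0)
    (hV : ∀ z, ∑ i ∈ s, w i * (S i).ind z ≠ 0 → z ∈ box B) {d : ℕ} (hd : 0 < d) :
    ∑ i ∈ s, w i * (S i).count d = ∑ z ∈ box B, ∑ i ∈ s, w i * (S i).ind (scale d z) := by
  set K : ℕ := B + ∑ i ∈ s, ((S i).lo.natAbs + (S i).hi.natAbs) with hK
  set g : ι → ℤ → ℤ := fun i x => ((S i).a * (d * x) + (S i).c) / ((S i).m * d) with hg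
  set H : ℕ := B + 1 + ∑ i ∈ s, ∑ x ∈ Finset.Icc (-(K : ℤ)) K, (g i x).natAbs with hH
  have hKi : ∀ i ∈ s, |(S i).lo| + |(S i).hi| ≤ K := by
    intro i hi
    have := Finset.single_le_sum (f := fun i => (S i).lo.natAbs + (S i).hi.natAbs)
      (fun _ _ => Nat.zero_le _) hi
    rw [Int.abs_eq_natAbs, Int.abs_eq_natAbs]
    omega
  have hHi : ∀ i ∈ s, ∀ x ∈ Finset.Icc (-(K : ℤ)) K, |g i x| ≤ H := by
    intro i hi x hx
    have h1 := Finset.single_le_sum (f := fun i => ∑ x ∈ Finset.Icc (-(K : ℤ)) K, (g i x).natAbs)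
      (fun _ _ => Nat.zero_le _) hi
    have h2 := Finset.single_le_sum (f := fun x => (g i x).natAbs)
      (fun _ _ => Nat.zero_le _) hx
    rw [Int.abs_eq_natAbs]
    omega
  have h1 : ∑ i ∈ s, w i * (S i).count d = ∑ x ∈ Finset.Icc (-(K : ℤ)) K,
      ∑ y ∈ Finset.Ioc (-(H : ℤ)) H, ∑ i ∈ s, w i * (S i).ind (scale d (x, y)) := by
    have h2 : ∀ i ∈ s, w i * (S i).count d = ∑ x ∈ Finset.Icc (-(K : ℤ)) K,
        (∑ y ∈ Finset.Ioc (-(H : ℤ)) H, w i * (S i).ind (scale d (x, y)) -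
          H * (w i * (S i).strip (d * x))) := by
      intro i hi
      rw [(S i).count_eq (hQ i hi) hd (hKi i hi), Finset.mul_sum]
      refine Finset.sum_congr rfl fun x hx => ?_
      rw [(S i).strip_mul_div (hm i hi) hd (hHi i hi x hx), ← Finset.mul_sum]
      ring
    rw [Finset.sum_congr rfl h2, Finset.sum_comm]
    refine Finset.sum_congr rfl fun x _ => ?_
    rw [Finset.sum_sub_distrib, ← Finset.mul_sum, h0, mul_zero, sub_zero, Finset.sum_comm]
  rw [h1, ← Finset.sum_product']
  symm
  refine Finset.sum_subset ?_ ?_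
  · intro z hz
    rw [mem_box, abs_le, abs_le] at hz
    simp only [Finset.mem_product, Finset.mem_Icc, Finset.mem_Ioc]
    omega
  · intro z _ hz
    by_contra h
    exact hz (mem_box_of_scale hd (hV _ h))

/-- The number of primitive points in a slab, up to terms that cancel in suitable weighted sums of
slabs. Multiples of primitive points are sorted by whether the factor `d` is at most `T`. -/
noncomputable def prim (B r T : ℕ) (S : Slab) : ℤ :=
  ∑ d ∈ Finset.Ioc 0 T, ArithmeticFunction.moebius d * (S.count d - S.ind 0) +
    ∑ z ∈ (box r).erase 0, ∑ d ∈ Finset.Ioc T B, ArithmeticFunction.moebius d * S.ind (scale d z)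

/-- If the strips cancel in a weighted sum of slabs, the sum of `prim` counts primitive points. The
condition on `T` ensures that only points of `box r` have multiples with a factor beyond `T` in
`box B`. -/
theorem sum_prim {r T : ℕ} (hrT : B ≤ r * T) (hQ : ∀ i ∈ s, 0 < (S i).Q)
    (hm : ∀ i ∈ s, 0 < (S i).m) (h0 : ∀ x, ∑ i ∈ s, w i * (S i).strip x = 0)
    (hV : ∀ z, ∑ i ∈ s, w i * (S i).ind z ≠ 0 → z ∈ box B) :
    ∑ i ∈ s, w i * (S i).prim B r T =
      ∑ z ∈ box B with Int.gcd z.1 z.2 = 1, ∑ i ∈ s, w i * (S i).ind z := by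
  rw [← sum_moebius_scale (N := max T B) hV (le_max_right _ _)]
  have h00 : (0 : ℤ × ℤ) ∈ box B := by simp [mem_box]
  have e1 : ∀ d ∈ Finset.Ioc 0 T, ∑ i ∈ s, w i * ((S i).count d - (S i).ind 0) =
      ∑ z ∈ (box B).erase 0, ∑ i ∈ s, w i * (S i).ind (scale d z) := by
    intro d hd
    simp_rw [mul_sub]
    rw [Finset.sum_sub_distrib, sum_count hQ hm h0 hV (Finset.mem_Ioc.1 hd).1,
      ← Finset.add_sum_erase _ _ h00]
    have h1 : scale d 0 = 0 := by simp [scale]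
    rw [h1]
    ring
  have e2 : ∀ d ∈ Finset.Ioc T B, ∑ z ∈ (box r).erase 0, ∑ i ∈ s, w i * (S i).ind (scale d z) =
      ∑ z ∈ (box B).erase 0, ∑ i ∈ s, w i * (S i).ind (scale d z) := by
    intro d hd
    rw [Finset.mem_Ioc] at hd
    have hd0 : 0 < d := by omega
    have hr : ∀ z, scale d z ∈ box B → z ∈ box r := by
      intro z hz
      obtain ⟨h1, h2⟩ := scale_mem_box hz
      have h3 : (B : ℤ) ≤ d * r := by
        have : r * T ≤ d * r := by nlinarith
        exact_mod_cast hrT.trans this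
      have hd' : (0 : ℤ) < d := by exact_mod_cast hd0
      exact mem_box.2 ⟨le_of_mul_le_mul_left (h1.trans h3) hd',
        le_of_mul_le_mul_left (h2.trans h3) hd'⟩
    have h1 : ∀ C : ℕ, (∀ z, scale d z ∈ box B → z ∈ box C) →
        ∑ z ∈ (box C).erase 0, ∑ i ∈ s, w i * (S i).ind (scale d z) =
        ∑ z ∈ (box (max r B)).erase 0, ∑ i ∈ s, w i * (S i).ind (scale d z) := by
      intro C hC
      have hsub : ∀ z, z ∈ box B → z ∈ box (max r B) := by
        intro z hz
        rw [mem_box] at hz ⊢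
        push_cast
        exact ⟨hz.1.trans (le_max_right _ _), hz.2.trans (le_max_right _ _)⟩
      rw [← Finset.sum_filter_ne_zero, ← Finset.sum_filter_ne_zero (s := (box (max r B)).erase 0)]
      refine Finset.sum_congr ?_ fun _ _ => rfl
      ext z
      simp only [Finset.mem_filter, Finset.mem_erase]
      constructor
      · rintro ⟨⟨h1, -⟩, h2⟩
        exact ⟨⟨h1, hsub _ (mem_box_of_scale hd0 (hV _ h2))⟩, h2⟩
      · rintro ⟨⟨h1, -⟩, h2⟩
        exact ⟨⟨h1, hC _ (hV _ h2)⟩, h2⟩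
    rw [h1 r hr, h1 B fun z => mem_box_of_scale hd0]
  have e3 : ∑ i ∈ s, w i * (S i).prim B r T =
      ∑ d ∈ Finset.Ioc 0 T, ArithmeticFunction.moebius d *
        ∑ i ∈ s, w i * ((S i).count d - (S i).ind 0) +
      ∑ d ∈ Finset.Ioc T B, ArithmeticFunction.moebius d *
        ∑ z ∈ (box r).erase 0, ∑ i ∈ s, w i * (S i).ind (scale d z) := by
    simp only [prim, mul_add, Finset.sum_add_distrib, Finset.mul_sum]
    congr 1
    · rw [Finset.sum_comm]
      refine Finset.sum_congr rfl fun d _ => Finset.sum_congr rfl fun i _ => ?_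
      ring
    · rw [Finset.sum_congr rfl fun i _ => Finset.sum_comm, Finset.sum_comm]
      refine Finset.sum_congr rfl fun d _ => ?_
      rw [Finset.sum_comm]
      refine Finset.sum_congr rfl fun d _ => Finset.sum_congr rfl fun i _ => ?_
      ring
  rw [e3, Finset.sum_congr rfl fun d hd => by rw [e1 d hd],
    Finset.sum_congr (s₁ := Finset.Ioc T B) rfl fun d hd => by rw [e2 d hd]]
  rcases le_total T B with h | h
  · rw [max_eq_right h, Finset.sum_Ioc_consecutive _ (Nat.zero_le _) h]
  · rw [max_eq_left h, Finset.Ioc_eq_empty_of_le h, Finset.sum_empty, add_zero]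

end Slab

/-! ### Crossing numbers of closed polygons -/

section Plane
open Filter Topology

/-- The determinant of two vectors of the plane. -/
def det2 (a b : Plane) : ℝ := a 0 * b 1 - a 1 * b 0

theorem continuous_coord (j : Fin 2) : Continuous fun q : Plane => q j := by fun_prop

/-- The height at abscissa `x` of the line through `u` and `v`. -/
noncomputable def lineHeight (u v : Plane) (x : ℝ) : ℝ :=
  u 1 + (v 1 - u 1) / (v 0 - u 0) * (x - u 0)

theorem lineHeight_left (u v : Plane) : lineHeight u v (u 0) = u 1 := by simp [lineHeight]

theorem lineHeight_right {u v : Plane} (h : u 0 ≠ v 0) : lineHeight u v (v 0) = v 1 := by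
  have : v 0 - u 0 ≠ 0 := sub_ne_zero.2 h.symm
  simp only [lineHeight]; field_simp; ring

theorem continuous_lineHeight (u v : Plane) : Continuous (lineHeight u v) := by
  unfold lineHeight; fun_prop

open Classical in
/-- The contribution of the directed edge from `u` to `v` to the crossing number of the upward
vertical ray that starts at `p`: `1` if the edge passes over `p` to the right, `-1` if it passes
over `p` to the left. The edge contains its left endpoint, but not its right one. An edge through `p`
counts as passing over `p`; a vertical edge contributes nothing. -/
noncomputable def crossing (u v p : Plane) : ℤ :=
  ((if u 0 ≤ p 0 then 1 else 0) - (if v 0 ≤ p 0 then 1 else 0)) *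
    if p 1 ≤ lineHeight u v (p 0) then 1 else 0

open Classical in
/-- The part of the change of a crossing number from `p` to `q` that is due to the vertex `a`. -/
noncomputable def vertexTerm (p q a : Plane) : ℤ :=
  ((if a 0 ≤ q 0 then 1 else 0) - (if a 0 ≤ p 0 then 1 else 0)) * if p 1 < a 1 then 1 else 0

theorem eventually_le_iff {f g : Plane → ℝ} (hf : Continuous f) (hg : Continuous g) {p : Plane}
    (h : f p ≠ g p) : ∀ᶠ q in 𝓝 p, (f q ≤ g q ↔ f p ≤ g p) := by
  rcases lt_or_gt_of_ne h with h | h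
  · filter_upwards [hf.continuousAt.eventually_lt hg.continuousAt h] with q hq
    exact ⟨fun _ => h.le, fun _ => hq.le⟩
  · filter_upwards [hg.continuousAt.eventually_lt hf.continuousAt h] with q hq
    exact ⟨fun h' => absurd h' hq.not_ge, fun h' => absurd h' h.not_ge⟩

theorem mem_segment_of_coord {u v p : Plane} {t : ℝ} (h0 : 0 ≤ t) (h1 : t ≤ 1)
    (e0 : p 0 = u 0 + t * (v 0 - u 0)) (e1 : p 1 = u 1 + t * (v 1 - u 1)) : p ∈ segment ℝ u v := by
  rw [segment_eq_image']
  refine ⟨t, ⟨h0, h1⟩, ?_⟩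
  ext j
  fin_cases j
  · simpa using e0.symm
  · simpa using e1.symm

theorem eventually_abscissa (p a : Plane) (h : a 0 ≠ p 0) :
    ∀ᶠ q in 𝓝 p, (a 0 ≤ q 0 ↔ a 0 ≤ p 0) :=
  eventually_le_iff continuous_const (continuous_coord 0) h

/-- Near a point off the edge, the contribution of an edge changes by a difference of contributions
of its endpoints. -/
theorem crossing_sub (u v p : Plane) (hp : p ∉ segment ℝ u v) : ∀ᶠ q in 𝓝 p,
    crossing u v q - crossing u v p = vertexTerm p q u - vertexTerm p q v := by
  by_cases huv : u 0 = v 0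
  · have hc : ∀ q, crossing u v q = 0 := by intro q; simp [crossing, huv]
    by_cases hup : u 0 = p 0
    · have hside : p 1 < u 1 ↔ p 1 < v 1 := by
        by_contra hne
        apply hp
        have h1 : v 1 - u 1 ≠ 0 := by
          intro h; apply hne
          rw [show v 1 = u 1 by linarith]
        have h2 : p 1 = u 1 + (p 1 - u 1) / (v 1 - u 1) * (v 1 - u 1) := by field_simp; ring
        refine mem_segment_of_coord (t := (p 1 - u 1) / (v 1 - u 1)) ?_ ?_ (by rw [← huv, hup]; ring)
          h2
        · by_cases h : p 1 < u 1
          · have : v 1 ≤ p 1 := by by_contra h3; exact hne ⟨fun _ => by linarith, fun _ => h⟩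
            exact div_nonneg_of_nonpos (by linarith) (by linarith)
          · have : p 1 < v 1 := by by_contra h3; exact hne ⟨fun h4 => absurd h4 h, fun h4 => absurd h4 h3⟩
            exact div_nonneg (by linarith) (by linarith)
        · by_cases h : p 1 < u 1
          · have : v 1 ≤ p 1 := by by_contra h3; exact hne ⟨fun _ => by linarith, fun _ => h⟩
            rw [div_le_one_of_neg (by linarith)]; linarith
          · have : p 1 < v 1 := by by_contra h3; exact hne ⟨fun h4 => absurd h4 h, fun h4 => absurd h4 h3⟩
            rw [div_le_one (by linarith)]; linarith
      filter_upwards with q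
      simp only [hc, vertexTerm, hside, ← huv, sub_self]
    · filter_upwards [eventually_abscissa p u hup] with q hq
      simp [hc, vertexTerm, ← huv, hq]
  · have hd : v 0 - u 0 ≠ 0 := sub_ne_zero.2 (Ne.symm huv)
    by_cases hl : p 1 = lineHeight u v (p 0)
    · have hout : (u 0 < p 0 ∧ v 0 < p 0) ∨ (p 0 < u 0 ∧ p 0 < v 0) := by
        by_contra hcon
        apply hp
        have h2 : p 1 = u 1 + (p 0 - u 0) / (v 0 - u 0) * (v 1 - u 1) := by
          rw [hl, lineHeight]; ring
        refine mem_segment_of_coord (t := (p 0 - u 0) / (v 0 - u 0)) ?_ ?_ (by field_simp; ring) h2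
        · rcases lt_or_gt_of_ne huv with h | h
          · refine div_nonneg ?_ (by linarith)
            by_contra h3
            exact hcon (Or.inr ⟨by linarith, by linarith⟩)
          · refine div_nonneg_of_nonpos ?_ (by linarith)
            by_contra h3
            exact hcon (Or.inl ⟨by linarith, by linarith⟩)
        · rcases lt_or_gt_of_ne huv with h | h
          · rw [div_le_one (by linarith)]
            by_contra h3
            exact hcon (Or.inl ⟨by linarith, by linarith⟩)
          · rw [div_le_one_of_neg (by linarith)]
            by_contra h3
            exact hcon (Or.inr ⟨by linarith, by linarith⟩)
      have hu : u 0 ≠ p 0 := by rcases hout with h | h <;> [exact h.1.ne; exact h.1.ne']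
      have hv : v 0 ≠ p 0 := by rcases hout with h | h <;> [exact h.2.ne; exact h.2.ne']
      have huv' : u 0 ≤ p 0 ↔ v 0 ≤ p 0 := by
        rcases hout with h | h
        · exact ⟨fun _ => h.2.le, fun _ => h.1.le⟩
        · exact ⟨fun h' => absurd h' h.1.not_ge, fun h' => absurd h' h.2.not_ge⟩
      filter_upwards [eventually_abscissa p u hu, eventually_abscissa p v hv] with q h1 h2
      simp [crossing, vertexTerm, h1, h2, huv']
    · have hl' : ∀ᶠ q in 𝓝 p, (q 1 ≤ lineHeight u v (q 0) ↔ p 1 ≤ lineHeight u v (p 0)) :=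
        eventually_le_iff (continuous_coord 1)
          ((continuous_lineHeight u v).comp (continuous_coord 0)) hl
      have key : ∀ a : Plane, lineHeight u v (a 0) = a 1 → ∀ᶠ q in 𝓝 p,
          vertexTerm p q a = ((if a 0 ≤ q 0 then 1 else 0) - (if a 0 ≤ p 0 then 1 else 0)) *
            if p 1 ≤ lineHeight u v (p 0) then 1 else 0 := by
        intro a ha
        by_cases hap : a 0 = p 0
        · filter_upwards with q
          rw [← hap, ha] at hl
          have : p 1 < a 1 ↔ p 1 ≤ a 1 := ⟨le_of_lt, fun h => lt_of_le_of_ne h hl⟩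
          simp only [vertexTerm, this, ← hap, ha]
        · filter_upwards [eventually_abscissa p a hap] with q hq
          simp [vertexTerm, hq]
      filter_upwards [hl', key u (lineHeight_left u v), key v (lineHeight_right huv)]
        with q h1 h2 h3
      rw [h2, h3]
      simp only [crossing, h1]
      ring

/-- The contribution of an edge does not change if the point moves a little along the parabola
`(t ^ 2, -t)`. -/
theorem crossing_shift (u v p : Plane) : ∀ᶠ t in 𝓝[>] (0 : ℝ),
    crossing u v (p + !₂[t ^ 2, -t]) = crossing u v p := by
  have h0 : ∀ᶠ t in 𝓝[>] (0 : ℝ), 0 < t := eventually_mem_nhdsWithin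
  have hx : ∀ a : ℝ, ∀ᶠ t in 𝓝[>] (0 : ℝ), (a ≤ p 0 + t ^ 2 ↔ a ≤ p 0) := by
    intro a
    rcases le_or_gt a (p 0) with h | h
    · filter_upwards with t
      exact ⟨fun _ => h, fun _ => by nlinarith [sq_nonneg t]⟩
    · have hc : ContinuousAt (fun t : ℝ => p 0 + t ^ 2) 0 := by fun_prop
      have : ∀ᶠ t in 𝓝 (0 : ℝ), p 0 + t ^ 2 < a :=
        hc.eventually_lt continuousAt_const (by simpa using h)
      filter_upwards [this.filter_mono nhdsWithin_le_nhds] with t ht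
      exact ⟨fun h' => absurd h' ht.not_ge, fun h' => absurd h' h.not_ge⟩
  have hy : ∀ᶠ t in 𝓝[>] (0 : ℝ),
      (p 1 + -t ≤ lineHeight u v (p 0 + t ^ 2) ↔ p 1 ≤ lineHeight u v (p 0)) := by
    set σ := (v 1 - u 1) / (v 0 - u 0) with hσ
    have hL : ∀ t : ℝ, lineHeight u v (p 0 + t ^ 2) = lineHeight u v (p 0) + σ * t ^ 2 := by
      intro t; simp only [lineHeight, ← hσ]; ring
    simp only [hL]
    rcases le_or_gt (p 1) (lineHeight u v (p 0)) with h | h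
    · have hc : ContinuousAt (fun t : ℝ => -1 - σ * t) 0 := by fun_prop
      have : ∀ᶠ t in 𝓝 (0 : ℝ), -1 - σ * t < 0 :=
        hc.eventually_lt continuousAt_const (by simp)
      filter_upwards [this.filter_mono nhdsWithin_le_nhds, h0] with t ht ht0
      exact ⟨fun _ => h, fun _ => by nlinarith⟩
    · have hc : ContinuousAt (fun t : ℝ => lineHeight u v (p 0) + σ * t ^ 2 + t) 0 := by fun_prop
      have : ∀ᶠ t in 𝓝 (0 : ℝ), lineHeight u v (p 0) + σ * t ^ 2 + t < p 1 :=
        hc.eventually_lt continuousAt_const (by simpa using h)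
      filter_upwards [this.filter_mono nhdsWithin_le_nhds] with t ht
      exact ⟨fun h' => by linarith, fun h' => absurd h' h.not_ge⟩
  filter_upwards [hx (u 0), hx (v 0), hy] with t h1 h2 h3
  simp only [crossing, PiLp.add_apply]
  simp [h1, h2, h3]

namespace Polygon
variable {k : ℕ} (P : Polygon Plane k)

/-- The crossing number of a polygon: the signed number of the edges that pass over a point. -/
noncomputable def winding (p : Plane) : ℤ := ∑ i, crossing (P i) (P (finRotate k i)) p

theorem sum_vertexTerm (p q : Plane) :
    ∑ i, (vertexTerm p q (P i) - vertexTerm p q (P (finRotate k i))) = 0 := by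
  rw [Finset.sum_sub_distrib, Equiv.sum_comp (finRotate k) fun i => vertexTerm p q (P i), sub_self]

theorem winding_locallyConst {p : Plane} (hp : p ∉ P.boundary ℝ) :
    ∀ᶠ q in 𝓝 p, P.winding q = P.winding p := by
  have h : ∀ i, p ∉ segment ℝ (P i) (P (finRotate k i)) := by
    intro i hi
    rw [← affineSegment_eq_segment] at hi
    exact hp (Set.mem_iUnion.2 ⟨i, hi⟩)
  filter_upwards [eventually_all.2 fun i => crossing_sub _ _ p (h i)] with q hq
  rw [← sub_eq_zero, winding, winding, ← Finset.sum_sub_distrib, Finset.sum_congr rfl fun i _ => hq i,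
    sum_vertexTerm]

theorem winding_shift (p : Plane) :
    ∀ᶠ t in 𝓝[>] (0 : ℝ), P.winding (p + !₂[t ^ 2, -t]) = P.winding p := by
  filter_upwards [eventually_all.2 fun i => crossing_shift (P i) (P (finRotate k i)) p] with t ht
  exact Finset.sum_congr rfl fun i _ => ht i

/-- Near a point that lies on the edge number `i` only, the crossing number changes like the
contribution of that edge. -/
theorem winding_sub {p : Plane} {i : Fin k}
    (hp : ∀ j ≠ i, p ∉ segment ℝ (P j) (P (finRotate k j))) : ∀ᶠ q in 𝓝 p,
    P.winding q - P.winding p =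
      crossing (P i) (P (finRotate k i)) q - crossing (P i) (P (finRotate k i)) p -
        (vertexTerm p q (P i) - vertexTerm p q (P (finRotate k i))) := by
  have h : ∀ᶠ q in 𝓝 p, ∀ j, j ≠ i →
      crossing (P j) (P (finRotate k j)) q - crossing (P j) (P (finRotate k j)) p =
      vertexTerm p q (P j) - vertexTerm p q (P (finRotate k j)) := by
    refine eventually_all.2 fun j => ?_
    by_cases hj : j = i
    · filter_upwards with q h; exact absurd hj h
    · filter_upwards [crossing_sub _ _ p (hp j hj)] with q hq _; exact hq
  filter_upwards [h] with q hq
  have h1 := P.sum_vertexTerm p q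
  rw [winding, winding, ← Finset.sum_sub_distrib]
  rw [← Finset.add_sum_erase _ _ (Finset.mem_univ i)] at h1 ⊢
  rw [Finset.sum_congr rfl fun j hj => hq j (Finset.ne_of_mem_erase hj)]
  omega

/-- The crossing number vanishes outside of every axis-parallel square around the vertices. -/
theorem winding_eq_zero {M : ℝ} (hM : ∀ i, |P i 0| ≤ M ∧ |P i 1| ≤ M) {p : Plane}
    (hp : P.winding p ≠ 0) : |p 0| ≤ M ∧ |p 1| ≤ M := by
  have hh : ∀ i, ∀ x, (P i 0 ≤ x ∧ x < P (finRotate k i) 0) ∨ (P (finRotate k i) 0 ≤ x ∧ x < P i 0) →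
      |lineHeight (P i) (P (finRotate k i)) x| ≤ M := by
    intro i x hx
    have h1 := hM i
    have h2 := hM (finRotate k i)
    set u := P i
    set v := P (finRotate k i)
    have hd : v 0 - u 0 ≠ 0 := by rcases hx with h | h <;> intro h0 <;> linarith
    have ht : 0 ≤ (x - u 0) / (v 0 - u 0) ∧ (x - u 0) / (v 0 - u 0) ≤ 1 := by
      rcases hx with h | h
      · exact ⟨div_nonneg (by linarith) (by linarith), by rw [div_le_one (by linarith)]; linarith⟩
      · exact ⟨div_nonneg_of_nonpos (by linarith) (by linarith), by
          rw [div_le_one_of_neg (by linarith)]; linarith⟩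
    have e : lineHeight u v x = (1 - (x - u 0) / (v 0 - u 0)) * u 1 +
        (x - u 0) / (v 0 - u 0) * v 1 := by rw [lineHeight]; ring
    rw [e]
    set t := (x - u 0) / (v 0 - u 0)
    have h3 := abs_le.1 h1.2
    have h4 := abs_le.1 h2.2
    rw [abs_le]
    constructor <;> nlinarith
  obtain ⟨i, -, hi⟩ := Finset.exists_ne_zero_of_sum_ne_zero hp
  have hx : ∀ i, crossing (P i) (P (finRotate k i)) p ≠ 0 →
      ((P i 0 ≤ p 0 ∧ p 0 < P (finRotate k i) 0) ∨ (P (finRotate k i) 0 ≤ p 0 ∧ p 0 < P i 0)) ∧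
      p 1 ≤ lineHeight (P i) (P (finRotate k i)) (p 0) := by
    intro i hi
    simp only [crossing] at hi
    split_ifs at hi with h1 h2 h3 h3 h2 h3
    all_goals first
      | (exfalso; apply hi; norm_num; done)
      | skip
    · exact ⟨Or.inl ⟨h1, not_le.1 h2⟩, h3⟩
    · exact ⟨Or.inr ⟨h2, not_le.1 h1⟩, h3⟩
  have hi' := hx i hi
  have h1 := abs_le.1 (hM i).1
  have h2 := abs_le.1 (hM (finRotate k i)).1
  have h3 := abs_le.1 (hh i _ hi'.1)
  refine ⟨abs_le.2 ?_, abs_le.2 ⟨?_, by linarith [hi'.2]⟩⟩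
  · rcases hi'.1 with h | h <;> constructor <;> linarith
  · by_contra hlow
    apply hp
    have h4 : ∀ i, crossing (P i) (P (finRotate k i)) p =
        (fun j => if P j 0 ≤ p 0 then (1 : ℤ) else 0) i -
        (fun j => if P j 0 ≤ p 0 then (1 : ℤ) else 0) (finRotate k i) := by
      intro i
      simp only [crossing]
      by_cases hc : (P i 0 ≤ p 0 ∧ p 0 < P (finRotate k i) 0) ∨
          (P (finRotate k i) 0 ≤ p 0 ∧ p 0 < P i 0)
      · have := abs_le.1 (hh i _ hc)
        rw [if_pos (show p 1 ≤ lineHeight (P i) (P (finRotate k i)) (p 0) by linarith)]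
        simp
      · have : P i 0 ≤ p 0 ↔ P (finRotate k i) 0 ≤ p 0 := by
          constructor
          · intro h; by_contra h'; exact hc (Or.inl ⟨h, not_le.1 h'⟩)
          · intro h; by_contra h'; exact hc (Or.inr ⟨h, not_le.1 h'⟩)
        simp [this]
    rw [winding, Finset.sum_congr rfl fun i _ => h4 i, Finset.sum_sub_distrib,
      Equiv.sum_comp (finRotate k) fun j => if P j 0 ≤ p 0 then (1 : ℤ) else 0]
    exact sub_self _

end Polygon

/-! ### The two sides of a simple polygon -/

/-- The function `f` is locally constant on `Ω`. -/
def LocConstOn (f : Plane → ℤ) (Ω : Set Plane) : Prop := ∀ p ∈ Ω, ∀ᶠ q in 𝓝 p, f q = f p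

theorem LocConstOn.eq_of_isPreconnected {f : Plane → ℤ} {Ω K : Set Plane} (hf : LocConstOn f Ω)
    (hK : IsPreconnected K) (hKΩ : K ⊆ Ω) {x y : Plane} (hx : x ∈ K) (hy : y ∈ K) : f x = f y :=
  hK.induction₂ (fun a b => f a = f b)
    (fun a ha => ((hf a (hKΩ ha)).filter_mono nhdsWithin_le_nhds).mono fun _ h => h.symm)
    (fun _ _ _ _ _ _ h h' => h.trans h') (fun _ _ _ _ h => h.symm) hx hy

theorem LocConstOn.exists_const {f : Plane → ℤ} {Ω K : Set Plane} (hf : LocConstOn f Ω)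
    (hK : IsPreconnected K) (hKΩ : K ⊆ Ω) : ∃ c, ∀ q ∈ K, f q = c := by
  rcases K.eq_empty_or_nonempty with rfl | ⟨x, hx⟩
  · exact ⟨0, by simp⟩
  · exact ⟨f x, fun q hq => hf.eq_of_isPreconnected hK hKΩ hq hx⟩

theorem det2_sub (d p q : Plane) : det2 d (p - q) = det2 d p - det2 d q := by
  simp [det2]; ring

theorem det2_add (d p q : Plane) : det2 d (p + q) = det2 d p + det2 d q := by
  simp [det2]; ring

theorem det2_smul (d p : Plane) (t : ℝ) : det2 d (t • p) = t * det2 d p := by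
  simp [det2]; ring

theorem det2_smul_left (d p : Plane) (t : ℝ) : det2 (t • d) p = t * det2 d p := by
  simp [det2]; ring

theorem det2_self (d : Plane) : det2 d d = 0 := by simp [det2]; ring

theorem continuous_det2 (d u : Plane) : Continuous fun q : Plane => det2 d (q - u) := by
  unfold det2; fun_prop

/-- The vector `d` rotated by a right angle to the left. -/
noncomputable def leftNormal (d : Plane) : Plane := !₂[-d 1, d 0]

theorem det2_leftNormal_pos {d : Plane} (hd : d ≠ 0) : 0 < det2 d (leftNormal d) := by
  have h : det2 d (leftNormal d) = d 0 ^ 2 + d 1 ^ 2 := by simp [det2, leftNormal]; ring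
  rw [h]
  by_contra hcon
  apply hd
  have h0 : d 0 = 0 := by nlinarith [sq_nonneg (d 0), sq_nonneg (d 1)]
  have h1 : d 1 = 0 := by nlinarith [sq_nonneg (d 0), sq_nonneg (d 1)]
  ext j
  fin_cases j
  · exact h0
  · exact h1

theorem convex_halfPlane (s : ℝ) (d u : Plane) : Convex ℝ {q : Plane | 0 < s * det2 d (q - u)} := by
  intro x hx y hy a b ha hb hab
  simp only [Set.mem_ofPred_eq] at *
  have e : s * det2 d (a • x + b • y - u) =
      a * (s * det2 d (x - u)) + b * (s * det2 d (y - u)) := by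
    have : b = 1 - a := by linarith
    subst this
    simp [det2]; ring
  rw [e]
  rcases ha.eq_or_lt with rfl | ha'
  · have : b = 1 := by linarith
    subst this; linarith
  · have := mul_pos ha' hx
    have := mul_nonneg hb hy.le
    linarith

/-- Every neighbourhood of a point of a line meets both sides of the line. -/
theorem frequently_side {s : ℝ} (hs : s ≠ 0) {d u z : Plane} (hd : d ≠ 0) (hz : det2 d (z - u) = 0) :
    ∃ᶠ q in 𝓝 z, 0 < s * det2 d (q - u) := by
  have ht : Tendsto (fun t : ℝ => z + (t * s) • leftNormal d) (𝓝[>] 0) (𝓝 z) := by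
    have : ContinuousAt (fun t : ℝ => z + (t * s) • leftNormal d) 0 := by fun_prop
    have h := this.tendsto
    simp only [zero_mul, zero_smul, add_zero] at h
    exact h.mono_left nhdsWithin_le_nhds
  refine ht.frequently ?_
  refine Eventually.frequently ?_
  filter_upwards [eventually_mem_nhdsWithin] with t ht
  have ht : 0 < t := ht
  rw [add_sub_right_comm, det2_add, hz, zero_add, det2_smul]
  have := det2_leftNormal_pos hd
  have := mul_pos ht (mul_pos (mul_self_pos.2 hs) this)
  nlinarith

theorem mem_openSegment_iff {u v z : Plane} : z ∈ openSegment ℝ u v ↔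
    ∃ t : ℝ, 0 < t ∧ t < 1 ∧ z = u + t • (v - u) := by
  rw [openSegment_eq_image']
  constructor
  · rintro ⟨t, ht, rfl⟩; exact ⟨t, ht.1, ht.2, rfl⟩
  · rintro ⟨t, h0, h1, rfl⟩; exact ⟨t, ⟨h0, h1⟩, rfl⟩

theorem det2_of_mem_segment {u v z : Plane} (hz : z ∈ segment ℝ u v) :
    det2 (v - u) (z - u) = 0 := by
  rw [segment_eq_image'] at hz
  obtain ⟨t, -, rfl⟩ := hz
  simp only
  rw [add_sub_cancel_left, det2_smul, det2_self, mul_zero]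

/-- Near an inner point of a segment, the line through the segment belongs to the segment. -/
theorem eventually_mem_segment {u v z : Plane} (huv : u ≠ v) (hz : z ∈ openSegment ℝ u v) :
    ∀ᶠ q in 𝓝 z, det2 (v - u) (q - u) = 0 → q ∈ segment ℝ u v := by
  obtain ⟨t, h0, h1, rfl⟩ := mem_openSegment_iff.1 hz
  set d := v - u with hd
  have hN : 0 < d 0 ^ 2 + d 1 ^ 2 := by
    have := det2_leftNormal_pos (sub_ne_zero.2 huv.symm)
    simp only [det2, leftNormal] at this
    simp at this
    simp only [hd, PiLp.sub_apply]
    nlinarith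
  set F : Plane → ℝ := fun q => ((q 0 - u 0) * d 0 + (q 1 - u 1) * d 1) / (d 0 ^ 2 + d 1 ^ 2) with hF
  have hFc : Continuous F := by simp only [hF]; fun_prop
  have hFz : F (u + t • d) = t := by
    simp only [hF, PiLp.add_apply, PiLp.smul_apply, smul_eq_mul]
    field_simp
    ring
  have e1 : ∀ᶠ q in 𝓝 (u + t • d), 0 < F q :=
    continuousAt_const.eventually_lt hFc.continuousAt (by rw [hFz]; exact h0)
  have e2 : ∀ᶠ q in 𝓝 (u + t • d), F q < 1 :=
    hFc.continuousAt.eventually_lt continuousAt_const (by rw [hFz]; exact h1)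
  filter_upwards [e1, e2] with q q1 q2 hq
  simp only [det2, PiLp.sub_apply] at hq
  refine mem_segment_of_coord (t := F q) q1.le q2.le ?_ ?_
  · change q 0 = u 0 + F q * d 0
    simp only [hF]
    field_simp
    linear_combination (-d 1) * hq
  · change q 1 = u 1 + F q * d 1
    simp only [hF]
    field_simp
    linear_combination (d 0) * hq

namespace Polygon
variable {k : ℕ} {P : Polygon Plane k}

theorem edgeSet_eq (i : Fin k) : P.edgeSet ℝ i = segment ℝ (P i) (P (finRotate k i)) :=
  affineSegment_eq_segment ℝ _ _

theorem isClosed_edgeSet (i : Fin k) : IsClosed (P.edgeSet ℝ i) := by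
  rw [edgeSet_eq, segment_eq_image']
  exact (isCompact_Icc.image (by fun_prop)).isClosed

theorem isClosed_boundary : IsClosed (P.boundary ℝ) :=
  isClosed_iUnion_of_finite fun i => isClosed_edgeSet i

theorem finRotate_val (i : Fin k) :
    (finRotate k i).1 = if i.1 + 1 = k then 0 else i.1 + 1 := by
  obtain ⟨m, rfl⟩ : ∃ m, k = m + 1 := ⟨k - 1, by have := i.2; omega⟩
  rw [coe_finRotate]
  simp only [Fin.ext_iff, Fin.val_last, Nat.add_right_cancel_iff]

theorem finRotate_ne (hk : 2 ≤ k) (i : Fin k) : finRotate k i ≠ i := by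
  intro h
  have := congrArg Fin.val h
  rw [finRotate_val] at this
  split_ifs at this <;> omega

theorem finRotate_finRotate_ne (hk : 3 ≤ k) (i : Fin k) : finRotate k (finRotate k i) ≠ i := by
  intro h
  have := congrArg Fin.val h
  rw [finRotate_val, finRotate_val] at this
  have := i.2
  split_ifs at * <;> omega

section Simple
variable (hP : P.IsSimple)
include hP

theorem IsSimple.vertex_ne (i : Fin k) : P i ≠ P (finRotate k i) := fun h =>
  finRotate_ne (by have := hP.1; omega) i (hP.2.1 h).symm

theorem IsSimple.dir_ne (i : Fin k) : P (finRotate k i) - P i ≠ 0 :=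
  sub_ne_zero.2 (hP.vertex_ne i).symm

theorem IsSimple.not_mem_of_mem_openSegment {i j : Fin k} (hj : j ≠ i) {z : Plane}
    (hz : z ∈ openSegment ℝ (P i) (P (finRotate k i))) :
    z ∉ segment ℝ (P j) (P (finRotate k j)) := by
  intro h
  have h1 := hP.2.2 i j hj.symm z ⟨by rw [edgeSet_eq]; exact openSegment_subset_segment _ _ _ hz,
    by rw [edgeSet_eq]; exact h⟩
  have hne := hP.vertex_ne i
  obtain ⟨t, h0, h1', rfl⟩ := mem_openSegment_iff.1 hz
  rcases h1 with ⟨rfl, h2⟩ | ⟨-, h2⟩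
  · have : (1 - t) • (P (finRotate k i) - P i) = 0 := by
      rw [sub_smul, one_smul, sub_eq_zero]
      nth_rewrite 1 [← h2]
      abel
    rcases smul_eq_zero.1 this with h3 | h3
    · linarith
    · exact hP.dir_ne i h3
  · rw [add_eq_left, smul_eq_zero] at h2
    rcases h2 with h3 | h3
    · linarith
    · exact hP.dir_ne i h3

theorem IsSimple.vertex_not_mem {i j : Fin k} (h1 : j ≠ i) (h2 : j ≠ finRotate k i) :
    P (finRotate k i) ∉ segment ℝ (P j) (P (finRotate k j)) := by
  intro h
  rcases hP.2.2 i j h1.symm _ ⟨by rw [edgeSet_eq]; exact right_mem_segment _ _ _,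
    by rw [edgeSet_eq]; exact h⟩ with ⟨h3, -⟩ | ⟨-, h3⟩
  · exact h2 h3
  · exact hP.vertex_ne i h3.symm

/-- Two consecutive edges with parallel directions have the same direction. -/
theorem IsSimple.same_dir (i : Fin k)
    (h : det2 (P (finRotate k i) - P i)
      (P (finRotate k (finRotate k i)) - P (finRotate k i)) = 0) :
    ∃ κ : ℝ, 0 < κ ∧
      P (finRotate k (finRotate k i)) - P (finRotate k i) = κ • (P (finRotate k i) - P i) := by
  set d := P (finRotate k i) - P i with hd
  set e := P (finRotate k (finRotate k i)) - P (finRotate k i) with he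
  have hd0 : d ≠ 0 := hP.dir_ne i
  have he0 : e ≠ 0 := hP.dir_ne (finRotate k i)
  have hN : 0 < d 0 ^ 2 + d 1 ^ 2 := by
    have := det2_leftNormal_pos hd0
    simp only [det2, leftNormal] at this
    simp at this
    nlinarith
  obtain ⟨κ, hκ⟩ : ∃ κ : ℝ, e = κ • d := by
    refine ⟨(d 0 * e 0 + d 1 * e 1) / (d 0 ^ 2 + d 1 ^ 2), ?_⟩
    simp only [det2] at h
    ext j
    fin_cases j
    · simp only [Fin.zero_eta, PiLp.smul_apply, smul_eq_mul]
      field_simp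
      linear_combination (-d 1) * h
    · simp only [Fin.mk_one, PiLp.smul_apply, smul_eq_mul]
      field_simp
      linear_combination (d 0) * h
  refine ⟨κ, ?_, hκ⟩
  by_contra hneg
  have hκ0 : κ ≠ 0 := by rintro rfl; rw [zero_smul] at hκ; exact he0 hκ
  have hκneg : κ < 0 := lt_of_le_of_ne (not_lt.1 hneg) hκ0
  -- a common point of the two edges next to their common vertex
  set t : ℝ := min 1 (-1 / κ) with ht
  have hκ' : 0 < -1 / κ := div_pos_of_neg_of_neg (by norm_num) hκneg
  have ht0 : 0 < t := lt_min one_pos hκ'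
  have ht1 : t ≤ 1 := min_le_left _ _
  have htκ : t * -κ ≤ 1 := by
    have : t ≤ -1 / κ := min_le_right _ _
    calc t * -κ ≤ (-1 / κ) * -κ := mul_le_mul_of_nonneg_right this (by linarith)
      _ = 1 := by field_simp
  have hx1 : P (finRotate k i) + t • e ∈
      segment ℝ (P (finRotate k i)) (P (finRotate k (finRotate k i))) := by
    rw [segment_eq_image']
    exact ⟨t, ⟨ht0.le, ht1⟩, rfl⟩
  have hx2 : P (finRotate k i) + t • e ∈ segment ℝ (P i) (P (finRotate k i)) := by
    rw [segment_eq_image']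
    refine ⟨1 - t * -κ, ⟨by linarith, by nlinarith⟩, ?_⟩
    simp only [← hd]
    rw [hκ, smul_smul, sub_smul, one_smul, hd]
    module
  rcases hP.2.2 i (finRotate k i) (finRotate_ne (by have := hP.1; omega) i).symm _
    ⟨by rw [edgeSet_eq]; exact hx2, by rw [edgeSet_eq]; exact hx1⟩ with ⟨-, h3⟩ | ⟨h3, -⟩
  · rw [add_eq_left, smul_eq_zero] at h3
    rcases h3 with h3 | h3
    · linarith
    · exact he0 h3
  · exact finRotate_finRotate_ne hP.1 i h3.symm

end Simple

/-- The value `c` is taken on side `s` of the edge number `i` near the point `z`. The left side is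
`s = 1`, the right side `s = -1`. -/
def SideVal (P : Polygon Plane k) (f : Plane → ℤ) (s : ℝ) (i : Fin k) (c : ℤ) (z : Plane) : Prop :=
  ∀ᶠ q in 𝓝 z, 0 < s * det2 (P (finRotate k i) - P i) (q - P i) → f q = c

/-- The point `q` lies on side `s` of the path that consists of the edge number `i` and the next
edge. If the path turns towards that side, or does not turn, the sector is the intersection of two
half-planes, else their union. -/
def VertexSide (P : Polygon Plane k) (s : ℝ) (i : Fin k) (q : Plane) : Prop :=
  let v := P (finRotate k i)
  let d := v - P i
  let e := P (finRotate k (finRotate k i)) - v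
  if 0 ≤ s * det2 d e then 0 < s * det2 d (q - v) ∧ 0 < s * det2 e (q - v)
  else 0 < s * det2 d (q - v) ∨ 0 < s * det2 e (q - v)

section Collar
variable (hP : P.IsSimple) {f : Plane → ℤ} (hf : LocConstOn f (P.boundary ℝ)ᶜ)
include hP hf

/-- Near an inner point of an edge, each of the two open sides is convex and misses the polygon. -/
theorem exists_sideVal_at (s : ℝ) (i : Fin k) {z : Plane}
    (hz : z ∈ openSegment ℝ (P i) (P (finRotate k i))) : ∃ c, P.SideVal f s i c z := by
  have hopen : ∀ᶠ q in 𝓝 z, ∀ j, j ≠ i → q ∉ P.edgeSet ℝ j := by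
    refine eventually_all.2 fun j => ?_
    by_cases hj : j = i
    · filter_upwards with q h; exact absurd hj h
    · have : z ∉ P.edgeSet ℝ j := by
        rw [edgeSet_eq]; exact hP.not_mem_of_mem_openSegment hj hz
      filter_upwards [(isClosed_edgeSet j).isOpen_compl.mem_nhds this] with q hq _
      exact hq
  obtain ⟨ρ, hρ, hb⟩ := Metric.eventually_nhds_iff_ball.1 hopen
  obtain ⟨c, hc⟩ := hf.exists_const
    (((convex_ball z ρ).inter (convex_halfPlane s (P (finRotate k i) - P i) (P i))).isPreconnected)
    (by
      rintro q ⟨hq1, hq2⟩ hq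
      obtain ⟨j, hj⟩ := Set.mem_iUnion.1 hq
      by_cases hji : j = i
      · subst hji
        rw [edgeSet_eq] at hj
        simp only [Set.mem_ofPred_eq, det2_of_mem_segment hj, mul_zero, lt_irrefl] at hq2
      · exact hb q hq1 j hji hj)
  refine ⟨c, ?_⟩
  filter_upwards [Metric.ball_mem_nhds z hρ] with q hq h
  exact hc q ⟨hq, h⟩

omit hf in
theorem SideVal.unique {s : ℝ} (hs : s ≠ 0) {i : Fin k} {z : Plane} {c c' : ℤ}
    (hz : z ∈ openSegment ℝ (P i) (P (finRotate k i))) (h : P.SideVal f s i c z)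
    (h' : P.SideVal f s i c' z) : c = c' := by
  obtain ⟨q, hq, h1, h2⟩ := ((frequently_side hs (hP.dir_ne i)
    (det2_of_mem_segment (openSegment_subset_segment _ _ _ hz))).and_eventually
    (h.and h')).exists
  exact (h1 hq).symm.trans (h2 hq)

/-- The value on a side does not change along an edge, as the open edge is connected. -/
theorem exists_sideVal_edge {s : ℝ} (hs : s ≠ 0) (i : Fin k) : ∃ c,
    ∀ z ∈ openSegment ℝ (P i) (P (finRotate k i)), P.SideVal f s i c z := by
  have hpre : IsPreconnected (openSegment ℝ (P i) (P (finRotate k i))) :=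
    (convex_openSegment _ _).isPreconnected
  have hmid : midpoint ℝ (P i) (P (finRotate k i)) ∈ openSegment ℝ (P i) (P (finRotate k i)) := by
    rw [mem_openSegment_iff]
    refine ⟨1 / 2, by norm_num, by norm_num, ?_⟩
    rw [midpoint_eq_smul_add, invOf_eq_inv]
    module
  obtain ⟨c, hc⟩ := exists_sideVal_at hP hf s i hmid
  refine ⟨c, fun z hz => ?_⟩
  refine (hpre.induction₂ (fun a b => ∀ c, P.SideVal f s i c a ↔ P.SideVal f s i c b)
    (fun a ha => ?_) (fun _ _ _ _ _ _ h h' c => (h c).trans (h' c))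
    (fun _ _ _ _ h c => (h c).symm) hmid hz c).1 hc
  obtain ⟨c0, h0⟩ := exists_sideVal_at hP hf s i ha
  have h1 : ∀ᶠ b in 𝓝 a, P.SideVal f s i c0 b := eventually_eventually_nhds.2 h0
  filter_upwards [h1.filter_mono nhdsWithin_le_nhds, self_mem_nhdsWithin] with b hb hbs c
  constructor
  · intro h; rwa [SideVal.unique hP hs ha h h0]
  · intro h; rwa [SideVal.unique hP hs hbs h hb]

/-- Near a vertex, each of the two sectors between the adjacent edges is connected: it is an
intersection of half-planes or a union of two half-planes that meet. -/
theorem exists_vertexSide_val (s : ℝ) (i : Fin k) : ∃ c,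
    ∀ᶠ q in 𝓝 (P (finRotate k i)), P.VertexSide s i q → f q = c := by
  set v := P (finRotate k i) with hv
  set d := v - P i with hd
  set e := P (finRotate k (finRotate k i)) - v with he
  have hd0 : d ≠ 0 := hP.dir_ne i
  have he0 : e ≠ 0 := hP.dir_ne (finRotate k i)
  have hopen : ∀ᶠ q in 𝓝 v, ∀ j, j ≠ i → j ≠ finRotate k i → q ∉ P.edgeSet ℝ j := by
    refine eventually_all.2 fun j => ?_
    by_cases hj : j = i
    · filter_upwards with q h; exact absurd hj h
    by_cases hj' : j = finRotate k i
    · filter_upwards with q _ h; exact absurd hj' h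
    have : v ∉ P.edgeSet ℝ j := by rw [edgeSet_eq]; exact hP.vertex_not_mem hj hj'
    filter_upwards [(isClosed_edgeSet j).isOpen_compl.mem_nhds this] with q hq _ _
    exact hq
  obtain ⟨ρ, hρ, hb⟩ := Metric.eventually_nhds_iff_ball.1 hopen
  have hball := Metric.ball_mem_nhds v hρ
  -- the points of the two edges at `v`
  have e1 : ∀ q ∈ P.edgeSet ℝ i, ∃ t : ℝ, 0 ≤ t ∧ q - v = (-t) • d := by
    intro q hq
    rw [edgeSet_eq, segment_eq_image'] at hq
    obtain ⟨t, ht, rfl⟩ := hq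
    refine ⟨1 - t, by linarith [ht.2], ?_⟩
    simp only [hd, hv]
    module
  have e2 : ∀ q ∈ P.edgeSet ℝ (finRotate k i), ∃ t : ℝ, 0 ≤ t ∧ q - v = t • e := by
    intro q hq
    rw [edgeSet_eq, segment_eq_image'] at hq
    obtain ⟨t, ht, rfl⟩ := hq
    exact ⟨t, ht.1, by simp only [he, hv]; module⟩
  have hanti : det2 e d = -det2 d e := by simp only [det2]; ring
  have hsub : ∀ q ∈ Metric.ball v ρ, P.VertexSide s i q → q ∉ P.boundary ℝ := by
    intro q hq hside hbd
    obtain ⟨j, hj⟩ := Set.mem_iUnion.1 hbd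
    simp only [VertexSide, ← hv, ← hd, ← he] at hside
    by_cases hji : j = i
    · subst hji
      obtain ⟨t, ht, h1⟩ := e1 q hj
      simp only [h1, det2_smul, det2_self, hanti] at hside
      split_ifs at hside with h2
      · have := hside.1; simp at this
      · rcases hside with h3 | h3
        · simp at h3
        · nlinarith
    by_cases hji' : j = finRotate k i
    · subst hji'
      obtain ⟨t, ht, h1⟩ := e2 q hj
      simp only [h1, det2_smul, det2_self] at hside
      split_ifs at hside with h2
      · have := hside.2; simp at this
      · rcases hside with h3 | h3
        · nlinarith
        · simp at h3
    exact hb q hq j hji hji' hj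
  by_cases hturn : 0 ≤ s * det2 d e
  · obtain ⟨c, hc⟩ := hf.exists_const (K := Metric.ball v ρ ∩
        ({q | 0 < s * det2 d (q - v)} ∩ {q | 0 < s * det2 e (q - v)}))
      (((convex_ball v ρ).inter ((convex_halfPlane s d v).inter
        (convex_halfPlane s e v))).isPreconnected)
      (fun q hq => hsub q hq.1 (by simp only [VertexSide, ← hv, ← hd, ← he, if_pos hturn]; exact hq.2))
    refine ⟨c, ?_⟩
    filter_upwards [hball] with q hq hside
    simp only [VertexSide, ← hv, ← hd, ← he, if_pos hturn] at hside
    exact hc q ⟨hq, hside⟩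
  · -- the two half discs overlap
    have hmeet : ∃ x ∈ Metric.ball v ρ, 0 < s * det2 d (x - v) ∧ 0 < s * det2 e (x - v) := by
      have ht : Tendsto (fun t : ℝ => v + t • (d - e)) (𝓝[>] 0) (𝓝 v) := by
        have : ContinuousAt (fun t : ℝ => v + t • (d - e)) 0 := by fun_prop
        have h := this.tendsto
        simp only [zero_smul, add_zero] at h
        exact h.mono_left nhdsWithin_le_nhds
      obtain ⟨t, h1, h2⟩ := ((ht.eventually hball).and eventually_mem_nhdsWithin).exists
      have h2 : 0 < t := h2
      have h3 := mul_pos h2 (neg_pos.2 (not_le.1 hturn))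
      refine ⟨_, h1, ?_, ?_⟩
      · rw [add_sub_cancel_left, det2_smul, det2_sub, det2_self]; nlinarith
      · rw [add_sub_cancel_left, det2_smul, det2_sub, det2_self, hanti]; nlinarith
    obtain ⟨x, hx, hx1, hx2⟩ := hmeet
    have hpre : IsPreconnected ((Metric.ball v ρ ∩ {q | 0 < s * det2 d (q - v)}) ∪
        (Metric.ball v ρ ∩ {q | 0 < s * det2 e (q - v)})) :=
      IsPreconnected.union x ⟨hx, hx1⟩ ⟨hx, hx2⟩
        ((convex_ball v ρ).inter (convex_halfPlane s d v)).isPreconnected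
        ((convex_ball v ρ).inter (convex_halfPlane s e v)).isPreconnected
    obtain ⟨c, hc⟩ := hf.exists_const hpre (by
      intro q hq
      refine hsub q (hq.elim And.left And.left) ?_
      simp only [VertexSide, ← hv, ← hd, ← he, if_neg hturn]
      exact hq.imp And.right And.right)
    refine ⟨c, ?_⟩
    filter_upwards [hball] with q hq hside
    simp only [VertexSide, ← hv, ← hd, ← he, if_neg hturn] at hside
    exact hc q (hside.imp (fun h => ⟨hq, h⟩) fun h => ⟨hq, h⟩)

end Collar
end Polygon

/-! ### The crossing number and the region of a simple polygon -/

open Classical in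
/-- `1` for an edge that runs downwards in the lexicographic order, else `0`. -/
noncomputable def descent (u v : Plane) : ℤ :=
  if v 0 < u 0 ∨ (v 0 = u 0 ∧ v 1 < u 1) then 1 else 0

open Classical in
/-- The value that replaces `descent` at the common vertex of the edges from `u` to `v` and from `v`
to `w`. Just to the left of a left turn means to the left of both edges, and just to the left of a
right turn means to the left of one of them. -/
noncomputable def vertexDescent (u v w : Plane) : ℤ :=
  if 0 ≤ det2 (v - u) (w - v) then min (descent u v) (descent v w)
  else max (descent u v) (descent v w)

theorem descent_eq (u v : Plane) : descent u v = 0 ∨ descent u v = 1 := by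
  unfold descent; split_ifs <;> simp

theorem vertexDescent_eq (u v w : Plane) : vertexDescent u v w = 0 ∨ vertexDescent u v w = 1 := by
  unfold vertexDescent
  have h1 := descent_eq u v
  have h2 := descent_eq v w
  split_ifs <;> omega

theorem eventually_det2_pos {s : ℝ} {d u z : Plane} (h : 0 < s * det2 d (z - u)) :
    ∀ᶠ q in 𝓝 z, 0 < s * det2 d (q - u) := by
  have hc : Continuous fun q => s * det2 d (q - u) := continuous_const.mul (continuous_det2 d u)
  exact continuousAt_const.eventually_lt hc.continuousAt h

/-- Along the parabola `(t ^ 2, -t)` a point moves to the left of each descending edge, and to the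
right of each other edge. -/
theorem eventually_det2_shift {u v : Plane} (h : u ≠ v) : ∀ᶠ t in 𝓝[>] (0 : ℝ),
    (descent u v = 1 ∧ 0 < det2 (v - u) !₂[t ^ 2, -t]) ∨
    (descent u v = 0 ∧ det2 (v - u) !₂[t ^ 2, -t] < 0) := by
  have h0 : ∀ᶠ t in 𝓝[>] (0 : ℝ), 0 < t := eventually_mem_nhdsWithin
  have e : ∀ t : ℝ, det2 (v - u) !₂[t ^ 2, -t] = -t * ((v 0 - u 0) + t * (v 1 - u 1)) := by
    intro t; simp [det2]; ring
  have hc : ContinuousAt (fun t : ℝ => (v 0 - u 0) + t * (v 1 - u 1)) 0 := by fun_prop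
  simp only [e]
  rcases lt_trichotomy (v 0) (u 0) with h1 | h1 | h1
  · have h2 : ∀ᶠ t in 𝓝 (0 : ℝ), (v 0 - u 0) + t * (v 1 - u 1) < 0 :=
      hc.eventually_lt continuousAt_const (by simp; linarith)
    filter_upwards [h0, h2.filter_mono nhdsWithin_le_nhds] with t ht h3
    exact Or.inl ⟨by simp [descent, h1], mul_pos_of_neg_of_neg (by linarith) h3⟩
  · have h2 : v 1 ≠ u 1 := by
      intro h2; apply h; ext j; fin_cases j
      · exact h1.symm
      · exact h2.symm
    filter_upwards [h0] with t ht
    rcases lt_or_gt_of_ne h2 with h3 | h3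
    · exact Or.inl ⟨by simp [descent, h1, h3], by
        rw [h1, sub_self, zero_add]
        exact mul_pos_of_neg_of_neg (by linarith) (mul_neg_of_pos_of_neg ht (by linarith))⟩
    · exact Or.inr ⟨by simp [descent, h1, h3.le], by
        rw [h1, sub_self, zero_add]
        exact mul_neg_of_neg_of_pos (by linarith) (mul_pos ht (by linarith))⟩
  · have h2 : ∀ᶠ t in 𝓝 (0 : ℝ), 0 < (v 0 - u 0) + t * (v 1 - u 1) :=
      continuousAt_const.eventually_lt hc (by simp; linarith)
    filter_upwards [h0, h2.filter_mono nhdsWithin_le_nhds] with t ht h3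
    exact Or.inr ⟨by simp [descent, h1.not_gt, h1.ne'], mul_neg_of_neg_of_pos (by linarith) h3⟩

namespace Polygon
variable {k : ℕ} {P : Polygon Plane k}

theorem eq_of_finRotate {α : Type*} {c : Fin k → α} (h : ∀ i, c (finRotate k i) = c i) (i j : Fin k) :
    c i = c j := by
  have h0 : ∀ n, ∀ hn : n < k, c ⟨n, hn⟩ = c ⟨0, by omega⟩ := by
    intro n
    induction n with
    | zero => intro _; rfl
    | succ n ih =>
      intro hn
      rw [← ih (by omega), ← h ⟨n, by omega⟩]
      congr 1
      ext
      rw [finRotate_val, if_neg (by simp; omega)]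
  rw [h0 i.1 i.2, h0 j.1 j.2]

section Collar
variable (hP : P.IsSimple) {f : Plane → ℤ}
include hP

/-- A function that is locally constant off a simple polygon takes only one value near the polygon
on each of its sides. -/
theorem exists_collar (hf : LocConstOn f (P.boundary ℝ)ᶜ) {s : ℝ} (hs : s ≠ 0) : ∃ c, ∀ i,
    (∀ z ∈ openSegment ℝ (P i) (P (finRotate k i)), P.SideVal f s i c z) ∧
      ∀ᶠ q in 𝓝 (P (finRotate k i)), P.VertexSide s i q → f q = c := by
  choose c hc using exists_sideVal_edge hP hf hs
  choose c' hc' using exists_vertexSide_val hP hf s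
  have line : ∀ (i : Fin k) (q : Plane), det2 (P (finRotate k i) - P i) (q - P i) =
      det2 (P (finRotate k i) - P i) (q - P (finRotate k i)) := by
    intro i q
    have := det2_self (P (finRotate k i) - P i)
    rw [← sub_eq_zero, ← det2_sub, ← this]
    congr 1; abel
  have h1 : ∀ i, c' i = c i := by
    intro i
    set v := P (finRotate k i) with hv
    set d := v - P i with hd
    set e := P (finRotate k (finRotate k i)) - v with he
    have hanti : det2 e d = -det2 d e := by simp only [det2]; ring
    have ht : Tendsto (fun t : ℝ => v + (-t) • d) (𝓝[>] 0) (𝓝 v) := by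
      have : ContinuousAt (fun t : ℝ => v + (-t) • d) 0 := by fun_prop
      have h := this.tendsto
      simp only [neg_zero, zero_smul, add_zero] at h
      exact h.mono_left nhdsWithin_le_nhds
    have hlt : ∀ᶠ t in 𝓝[>] (0 : ℝ), t < 1 := (gt_mem_nhds one_pos).filter_mono nhdsWithin_le_nhds
    obtain ⟨t, ⟨h3, h4⟩, h5⟩ := (((ht.eventually (eventually_eventually_nhds.2 (hc' i))).and
      hlt).and eventually_mem_nhdsWithin).exists
    have h5 : 0 < t := h5
    set z := v + (-t) • d with hz
    have hzo : z ∈ openSegment ℝ (P i) v := by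
      rw [mem_openSegment_iff]
      exact ⟨1 - t, by linarith, by linarith, by simp only [hz, hd]; module⟩
    have hside : ∀ᶠ q in 𝓝 z, 0 < s * det2 d (q - v) → P.VertexSide s i q := by
      simp only [VertexSide, ← hv, ← hd, ← he]
      by_cases h6 : 0 ≤ s * det2 d e
      · simp only [if_pos h6]
        rcases h6.eq_or_lt with h7 | h7
        · have h8 : det2 d e = 0 := by
            rcases mul_eq_zero.1 h7.symm with h | h
            · exact absurd h hs
            · exact h
          obtain ⟨κ, hκ, hκe⟩ := hP.same_dir i h8
          filter_upwards with q hq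
          refine ⟨hq, ?_⟩
          rw [he, hv, hκe, ← hv, ← hd, det2_smul_left]
          have := mul_pos hκ hq
          nlinarith
        · have h8 : 0 < s * det2 e (z - v) := by
            rw [hz, add_sub_cancel_left, det2_smul, hanti]
            have := mul_pos h5 h7
            nlinarith
          filter_upwards [eventually_det2_pos h8] with q hq h9
          exact ⟨h9, hq⟩
      · simp only [if_neg h6]
        filter_upwards with q hq
        exact Or.inl hq
    have hfr := frequently_side hs (hP.dir_ne i)
      (det2_of_mem_segment (openSegment_subset_segment _ _ _ hzo))
    obtain ⟨q, hq, h7, h8, h9⟩ := (hfr.and_eventually (h3.and ((hc i z hzo).and hside))).exists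
    rw [← h7 (h9 (by rwa [line] at hq)), ← h8 hq]
  have h2 : ∀ i, c' i = c (finRotate k i) := by
    intro i
    set v := P (finRotate k i) with hv
    set d := v - P i with hd
    set e := P (finRotate k (finRotate k i)) - v with he
    have ht : Tendsto (fun t : ℝ => v + t • e) (𝓝[>] 0) (𝓝 v) := by
      have : ContinuousAt (fun t : ℝ => v + t • e) 0 := by fun_prop
      have h := this.tendsto
      simp only [zero_smul, add_zero] at h
      exact h.mono_left nhdsWithin_le_nhds
    have hlt : ∀ᶠ t in 𝓝[>] (0 : ℝ), t < 1 := (gt_mem_nhds one_pos).filter_mono nhdsWithin_le_nhds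
    obtain ⟨t, ⟨h3, h4⟩, h5⟩ := (((ht.eventually (eventually_eventually_nhds.2 (hc' i))).and
      hlt).and eventually_mem_nhdsWithin).exists
    have h5 : 0 < t := h5
    set z := v + t • e with hz
    have hzo : z ∈ openSegment ℝ v (P (finRotate k (finRotate k i))) := by
      rw [mem_openSegment_iff]
      exact ⟨t, by linarith, by linarith, hz⟩
    have hside : ∀ᶠ q in 𝓝 z, 0 < s * det2 e (q - v) → P.VertexSide s i q := by
      simp only [VertexSide, ← hv, ← hd, ← he]
      by_cases h6 : 0 ≤ s * det2 d e
      · simp only [if_pos h6]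
        rcases h6.eq_or_lt with h7 | h7
        · have h8 : det2 d e = 0 := by
            rcases mul_eq_zero.1 h7.symm with h | h
            · exact absurd h hs
            · exact h
          obtain ⟨κ, hκ, hκe⟩ := hP.same_dir i h8
          filter_upwards with q hq
          refine ⟨?_, hq⟩
          rw [he, hv, hκe, ← hv, ← hd, det2_smul_left] at hq
          have : 0 < κ * (s * det2 d (q - v)) := by linarith
          exact (mul_pos_iff_of_pos_left hκ).1 this
        · have h8 : 0 < s * det2 d (z - v) := by
            rw [hz, add_sub_cancel_left, det2_smul]
            have := mul_pos h5 h7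
            nlinarith
          filter_upwards [eventually_det2_pos h8] with q hq h9
          exact ⟨hq, h9⟩
      · simp only [if_neg h6]
        filter_upwards with q hq
        exact Or.inr hq
    have hfr := frequently_side hs (hP.dir_ne (finRotate k i))
      (det2_of_mem_segment (openSegment_subset_segment _ _ _ hzo))
    obtain ⟨q, hq, h7, h8, h9⟩ := (hfr.and_eventually (h3.and ((hc _ z hzo).and hside))).exists
    rw [← h7 (h9 hq), ← h8 hq]
  have hk : 0 < k := by have := hP.1; omega
  have h3 : ∀ i, c i = c ⟨0, hk⟩ := fun i =>
    eq_of_finRotate (fun i => (h2 i).symm.trans (h1 i)) i _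
  refine ⟨c ⟨0, hk⟩, fun i => ⟨fun z hz => ?_, ?_⟩⟩
  · rw [← h3 i]; exact hc i z hz
  · rw [← h3 i, ← h1 i]; exact hc' i

/-- The crossing number near an inner point of an edge. -/
theorem winding_side (i : Fin k) {z : Plane} (hz : z ∈ openSegment ℝ (P i) (P (finRotate k i))) :
    ∀ᶠ q in 𝓝 z,
      (0 < det2 (P (finRotate k i) - P i) (q - P i) →
        P.winding q = P.winding z + descent (P i) (P (finRotate k i)) - 1) ∧
      (det2 (P (finRotate k i) - P i) (q - P i) < 0 →
        P.winding q = P.winding z + descent (P i) (P (finRotate k i))) := by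
  have hw := P.winding_sub (i := i) fun j hj => hP.not_mem_of_mem_openSegment hj hz
  have hne := hP.vertex_ne i
  set u := P i
  set v := P (finRotate k i)
  obtain ⟨t, h0, h1, hzt⟩ := mem_openSegment_iff.1 hz
  have z0 : z 0 = u 0 + t * (v 0 - u 0) := by simp [hzt]
  have z1 : z 1 = u 1 + t * (v 1 - u 1) := by simp [hzt]
  by_cases huv : u 0 = v 0
  · have h2 : u 1 ≠ v 1 := by
      intro h2; apply hne; ext j; fin_cases j
      · exact huv
      · exact h2
    have hz0 : z 0 = v 0 := by rw [z0, huv]; ring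
    filter_upwards [hw] with q hq
    have hd : det2 (v - u) (q - u) = -(v 1 - u 1) * (q 0 - v 0) := by
      simp only [det2, PiLp.sub_apply, huv]; ring
    rw [hd]
    have hc : ∀ q, crossing u v q = 0 := by intro q; simp [crossing, huv]
    simp only [hc, vertexTerm, huv, hz0, le_refl, if_true] at hq
    rcases lt_or_gt_of_ne h2 with h3 | h3
    · have h4 : ¬ z 1 < u 1 := by rw [z1]; nlinarith
      have h5 : z 1 < v 1 := by rw [z1]; nlinarith
      have h6 : descent u v = 0 := by simp [descent, huv, h3.le]
      rw [h6]
      rw [if_neg h4, if_pos h5] at hq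
      constructor
      · intro h
        have : ¬ v 0 ≤ q 0 := by intro h'; nlinarith
        rw [if_neg this] at hq; omega
      · intro h
        have : v 0 ≤ q 0 := by nlinarith
        rw [if_pos this] at hq; omega
    · have h4 : z 1 < u 1 := by rw [z1]; nlinarith
      have h5 : ¬ z 1 < v 1 := by rw [z1]; nlinarith
      have h6 : descent u v = 1 := by simp [descent, huv, h3]
      rw [h6]
      rw [if_pos h4, if_neg h5] at hq
      constructor
      · intro h
        have : v 0 ≤ q 0 := by nlinarith
        rw [if_pos this] at hq; omega
      · intro h
        have : ¬ v 0 ≤ q 0 := by intro h'; nlinarith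
        rw [if_neg this] at hq; omega
  · have hd0 : v 0 - u 0 ≠ 0 := sub_ne_zero.2 (Ne.symm huv)
    have hu : u 0 ≠ z 0 := by
      intro h
      rw [h] at z0
      rcases mul_eq_zero.1 (show t * (v 0 - z 0) = 0 by linarith) with h | h
      · linarith
      · apply hd0; linarith
    have hv : v 0 ≠ z 0 := by
      intro h
      rcases mul_eq_zero.1 (show (1 - t) * (v 0 - u 0) = 0 by linarith) with h | h
      · linarith
      · exact hd0 h
    have hline : z 1 = lineHeight u v (z 0) := by
      rw [lineHeight, z0, z1]; field_simp; ring
    filter_upwards [hw, eventually_abscissa z u hu, eventually_abscissa z v hv] with q hq hqu hqv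
    have hd : det2 (v - u) (q - u) = (v 0 - u 0) * (q 1 - lineHeight u v (q 0)) := by
      simp only [det2, PiLp.sub_apply, lineHeight]; field_simp; ring
    rw [hd]
    simp only [crossing, vertexTerm, hqu, hqv, ← hline, le_refl, if_true, sub_self, zero_mul,
      sub_zero] at hq
    rcases lt_or_gt_of_ne huv with h3 | h3
    · have h4 : u 0 ≤ z 0 := by rw [z0]; nlinarith
      have h5 : ¬ v 0 ≤ z 0 := by rw [z0]; nlinarith
      have h6 : descent u v = 0 := by simp [descent, h3.not_gt, h3.ne']
      rw [h6]
      rw [if_pos h4, if_neg h5] at hq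
      constructor
      · intro h
        have : ¬ q 1 ≤ lineHeight u v (q 0) := by intro h'; nlinarith
        rw [if_neg this] at hq; omega
      · intro h
        have : q 1 ≤ lineHeight u v (q 0) := by nlinarith
        rw [if_pos this] at hq; omega
    · have h4 : ¬ u 0 ≤ z 0 := by rw [z0]; nlinarith
      have h5 : v 0 ≤ z 0 := by rw [z0]; nlinarith
      have h6 : descent u v = 1 := by simp [descent, h3]
      rw [h6]
      rw [if_neg h4, if_pos h5] at hq
      constructor
      · intro h
        have : q 1 ≤ lineHeight u v (q 0) := by nlinarith
        rw [if_pos this] at hq; omega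
      · intro h
        have : ¬ q 1 ≤ lineHeight u v (q 0) := by intro h'; nlinarith
        rw [if_neg this] at hq; omega

end Collar

theorem locConstOn_winding : LocConstOn P.winding (P.boundary ℝ)ᶜ := fun _ hp =>
  P.winding_locallyConst hp

theorem exists_mem_openSegment (i : Fin k) : ∃ z, z ∈ openSegment ℝ (P i) (P (finRotate k i)) :=
  ⟨_, mem_openSegment_iff.2 ⟨1 / 2, by norm_num, by norm_num, rfl⟩⟩

/-- The values of the crossing number on the edges, at the vertices, and on both sides of the
polygon are determined by its value `h` on the right side. -/
theorem IsSimple.exists_winding_boundary (hP : P.IsSimple) : ∃ h : ℤ, ∀ i,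
    (∀ z ∈ openSegment ℝ (P i) (P (finRotate k i)),
      P.winding z = h - descent (P i) (P (finRotate k i)) ∧
      P.SideVal P.winding (-1) i h z ∧ P.SideVal P.winding 1 i (h - 1) z) ∧
    P.winding (P (finRotate k i)) =
      h - vertexDescent (P i) (P (finRotate k i)) (P (finRotate k (finRotate k i))) := by
  obtain ⟨a, ha⟩ := exists_collar hP (locConstOn_winding (P := P)) one_ne_zero
  obtain ⟨h, hh⟩ := exists_collar hP (locConstOn_winding (P := P)) (neg_ne_zero.2 one_ne_zero)
  have hval : ∀ i, ∀ z ∈ openSegment ℝ (P i) (P (finRotate k i)),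
      P.winding z = h - descent (P i) (P (finRotate k i)) ∧ a = h - 1 := by
    intro i z hz
    have hs := winding_side hP i hz
    have hz' := det2_of_mem_segment (openSegment_subset_segment _ _ _ hz)
    obtain ⟨q, hq, h1, h2⟩ := ((frequently_side (neg_ne_zero.2 one_ne_zero) (hP.dir_ne i)
      hz').and_eventually (hs.and ((hh i).1 z hz))).exists
    obtain ⟨q', hq', h3, h4⟩ := ((frequently_side one_ne_zero (hP.dir_ne i)
      hz').and_eventually (hs.and ((ha i).1 z hz))).exists
    have e1 := h2 hq
    have e2 := h1.2 (by linarith)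
    have e3 := h4 hq'
    have e4 := h3.1 (by linarith)
    constructor <;> omega
  have hk : 0 < k := by have := hP.1; omega
  have hah : a = h - 1 := by
    obtain ⟨z, hz⟩ := exists_mem_openSegment (P := P) ⟨0, hk⟩
    exact (hval _ z hz).2
  refine ⟨h, fun i => ⟨fun z hz => ⟨(hval i z hz).1, (hh i).1 z hz, hah ▸ (ha i).1 z hz⟩, ?_⟩⟩
  have e1 := eventually_det2_shift (hP.vertex_ne i)
  have e2 := eventually_det2_shift (hP.vertex_ne (finRotate k i))
  have hsame := hP.same_dir i
  have hA := (ha i).2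
  have hH := (hh i).2
  simp only [VertexSide] at hA hH
  set v := P (finRotate k i) with hv
  set w := P (finRotate k (finRotate k i)) with hw
  have ht : Tendsto (fun t : ℝ => v + !₂[t ^ 2, -t]) (𝓝[>] 0) (𝓝 v) := by
    have : ContinuousAt (fun t : ℝ => v + !₂[t ^ 2, -t]) 0 := by fun_prop
    have h := this.tendsto
    have hz : (!₂[(0:ℝ) ^ 2, -0] : Plane) = 0 := by ext j; fin_cases j <;> simp
    rw [hz, add_zero] at h
    exact h.mono_left nhdsWithin_le_nhds
  obtain ⟨t, ⟨h1, h2⟩, ⟨h3, h4⟩, h5⟩ := ((e1.and e2).and (((ht.eventually hA).and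
    (ht.eventually hH)).and (P.winding_shift v))).exists
  simp only [add_sub_cancel_left] at h3 h4
  rw [← h5, vertexDescent]
  have hle : ∀ x : ℝ, (0 ≤ -1 * x ↔ x ≤ 0) := fun x => by constructor <;> intro h <;> linarith
  have hlt : ∀ x : ℝ, (0 < -1 * x ↔ x < 0) := fun x => by constructor <;> intro h <;> linarith
  simp only [one_mul, hle, hlt] at h3 h4
  subst hah
  rcases lt_trichotomy (det2 (v - P i) (w - v)) 0 with h6 | h6 | h6
  · rw [if_neg h6.not_ge] at h3 ⊢
    rw [if_pos h6.le] at h4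
    rcases h1 with ⟨g1, g2⟩ | ⟨g1, g2⟩
    · rw [h3 (Or.inl g2), g1]
      rcases h2 with ⟨g3, g4⟩ | ⟨g3, g4⟩ <;> rw [g3] <;> rfl
    · rcases h2 with ⟨g3, g4⟩ | ⟨g3, g4⟩
      · rw [h3 (Or.inr g4), g1, g3]; rfl
      · rw [h4 ⟨g2, g4⟩, g1, g3]; simp
  · rw [if_pos h6.ge] at h3 ⊢
    rw [if_pos h6.le] at h4
    obtain ⟨κ, hκ, hκe⟩ := hsame h6
    rw [hκe, det2_smul_left] at h2
    rcases h1 with ⟨g1, g2⟩ | ⟨g1, g2⟩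
    · rcases h2 with ⟨g3, g4⟩ | ⟨g3, g4⟩
      · rw [h3 ⟨g2, by rw [hκe, det2_smul_left]; exact g4⟩, g1, g3]; rfl
      · have := mul_pos hκ g2; linarith
    · rcases h2 with ⟨g3, g4⟩ | ⟨g3, g4⟩
      · have := mul_neg_of_pos_of_neg hκ g2; linarith
      · rw [h4 ⟨g2, by rw [hκe, det2_smul_left]; exact g4⟩, g1, g3]; simp
  · rw [if_pos h6.le] at h3 ⊢
    rw [if_neg h6.not_ge] at h4
    rcases h1 with ⟨g1, g2⟩ | ⟨g1, g2⟩
    · rcases h2 with ⟨g3, g4⟩ | ⟨g3, g4⟩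
      · rw [h3 ⟨g2, g4⟩, g1, g3]; rfl
      · rw [h4 (Or.inr g4), g1, g3]; simp
    · rw [h4 (Or.inl g2), g1]
      rcases h2 with ⟨g3, g4⟩ | ⟨g3, g4⟩ <;> rw [g3] <;> simp

theorem isBounded_boundary : Bornology.IsBounded (P.boundary ℝ) := by
  refine (isCompact_iUnion fun i => ?_).isBounded
  rw [edgeSet_eq, segment_eq_image']
  exact isCompact_Icc.image (by fun_prop)

theorem isBounded_winding : Bornology.IsBounded {p | P.winding p ≠ 0} := by
  obtain ⟨M, hM⟩ : ∃ M : ℝ, ∀ i, |P i 0| ≤ M ∧ |P i 1| ≤ M := by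
    refine ⟨∑ i, (|P i 0| + |P i 1|), fun i => ?_⟩
    have := Finset.single_le_sum (f := fun i => |P i 0| + |P i 1|) (fun i _ => by positivity)
      (Finset.mem_univ i)
    have h1 := abs_nonneg (P i 0)
    have h2 := abs_nonneg (P i 1)
    simp only at this
    constructor <;> linarith
  refine (Metric.isBounded_closedBall (x := (0 : Plane)) (r := √(M ^ 2 + M ^ 2))).subset ?_
  intro p hp
  obtain ⟨h0, h1⟩ := P.winding_eq_zero hM hp
  rw [mem_closedBall_zero_iff, EuclideanSpace.norm_eq]
  apply Real.sqrt_le_sqrt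
  simp only [Fin.sum_univ_two, Real.norm_eq_abs]
  gcongr

/-- Every function with bounded support that is locally constant off a simple polygon is, off the
polygon, a multiple of the crossing number: after subtraction of that multiple it extends to a
locally constant function on the complement of the set of vertices, which is connected. -/
theorem IsSimple.eq_mul_winding (hP : P.IsSimple) {f : Plane → ℤ}
    (hf : LocConstOn f (P.boundary ℝ)ᶜ) (hb : Bornology.IsBounded {p | f p ≠ 0}) : ∃ j : ℤ,
    ∀ p ∉ P.boundary ℝ, f p = j * P.winding p := by
  obtain ⟨h, hh⟩ := hP.exists_winding_boundary
  obtain ⟨a, ha⟩ := exists_collar hP hf one_ne_zero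
  obtain ⟨b, hb'⟩ := exists_collar hP hf (neg_ne_zero.2 one_ne_zero)
  refine ⟨b - a, ?_⟩
  classical
  set g : Plane → ℤ := fun p => if p ∈ P.boundary ℝ then b - (b - a) * h else
    f p - (b - a) * P.winding p with hg
  have hloc : LocConstOn g (Set.range P.vertices)ᶜ := by
    intro z hz
    by_cases hzb : z ∈ P.boundary ℝ
    · obtain ⟨i, hi⟩ := Set.mem_iUnion.1 hzb
      have hzo : z ∈ openSegment ℝ (P i) (P (finRotate k i)) := by
        rw [edgeSet_eq] at hi
        refine mem_openSegment_of_ne_left_right ?_ ?_ hi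
        · rintro h; exact hz ⟨i, h⟩
        · rintro h; exact hz ⟨finRotate k i, h⟩
      filter_upwards [eventually_mem_segment (hP.vertex_ne i) hzo, (ha i).1 z hzo, (hb' i).1 z hzo,
        ((hh i).1 z hzo).2.1, ((hh i).1 z hzo).2.2] with q h1 h2 h3 h4 h5
      simp only [hg, if_pos hzb]
      by_cases hqb : q ∈ P.boundary ℝ
      · rw [if_pos hqb]
      · rw [if_neg hqb]
        rcases lt_trichotomy (det2 (P (finRotate k i) - P i) (q - P i)) 0 with h6 | h6 | h6
        · rw [h3 (by linarith), h4 (by linarith)]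
        · exact absurd (Set.mem_iUnion.2 ⟨i, by rw [edgeSet_eq]; exact h1 h6⟩) hqb
        · rw [h2 (by linarith), h5 (by linarith)]; ring
    · filter_upwards [hf z hzb, P.winding_locallyConst hzb,
        (isClosed_boundary (P := P)).isOpen_compl.mem_nhds hzb] with q h1 h2 h3
      have h3 : q ∉ P.boundary ℝ := h3
      simp only [hg, if_neg hzb, if_neg h3, h1, h2]
  have hrank : 1 < Module.rank ℝ Plane := by
    rw [← Module.finrank_eq_rank, finrank_euclideanSpace_fin]; norm_num
  have hconn := (Set.finite_range P.vertices).countable.isConnected_compl_of_one_lt_rank hrank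
  obtain ⟨q, hq⟩ : ∃ q, q ∉ ({p | f p ≠ 0} ∪ {p | P.winding p ≠ 0}) ∪ P.boundary ℝ := by
    by_contra hcon
    push Not at hcon
    have := ((hb.union (isBounded_winding (P := P))).union (isBounded_boundary (P := P)))
    rw [Set.eq_univ_of_forall hcon] at this
    exact (NormedSpace.unbounded_univ ℝ Plane) this
  simp only [Set.mem_union, Set.mem_ofPred_eq, not_or, not_not] at hq
  have hvert : ∀ p ∉ P.boundary ℝ, p ∈ (Set.range P.vertices)ᶜ := by
    rintro p hp ⟨i, rfl⟩
    exact hp (Set.mem_iUnion.2 ⟨i, by rw [edgeSet_eq]; exact left_mem_segment _ _ _⟩)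
  intro p hp
  have := hloc.eq_of_isPreconnected hconn.isPreconnected subset_rfl (hvert p hp) (hvert q hq.2)
  simp only [hg, if_neg hp, if_neg hq.2, hq.1.1, hq.1.2] at this
  linarith

/-- The crossing number of a simple polygon vanishes outside of the region, and is `2 * h - 1` in
the interior, where `h` is `1` or `0` according to the orientation. -/
theorem IsSimple.exists_winding (hP : P.IsSimple) : ∃ h : ℤ, (h = 0 ∨ h = 1) ∧
    (∀ p ∉ P.boundary ℝ, (p ∈ P.region ∧ P.winding p = 2 * h - 1) ∨
      (p ∉ P.region ∧ P.winding p = 0)) ∧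
    ∀ i, (∀ z ∈ openSegment ℝ (P i) (P (finRotate k i)),
        P.winding z = h - descent (P i) (P (finRotate k i))) ∧
      P.winding (P (finRotate k i)) =
        h - vertexDescent (P i) (P (finRotate k i)) (P (finRotate k (finRotate k i))) := by
  obtain ⟨h, hh⟩ := hP.exists_winding_boundary
  have hk : 0 < k := by have := hP.1; omega
  obtain ⟨z, hz⟩ := exists_mem_openSegment (P := P) ⟨0, hk⟩
  have hz' := det2_of_mem_segment (openSegment_subset_segment _ _ _ hz)
  have hopen : ∀ᶠ q in 𝓝 z, det2 (P (finRotate k ⟨0, hk⟩) - P ⟨0, hk⟩) (q - P ⟨0, hk⟩) ≠ 0 →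
      q ∉ P.boundary ℝ := by
    have : ∀ᶠ q in 𝓝 z, ∀ j, j ≠ ⟨0, hk⟩ → q ∉ P.edgeSet ℝ j := by
      refine eventually_all.2 fun j => ?_
      by_cases hj : j = ⟨0, hk⟩
      · filter_upwards with q h; exact absurd hj h
      · have : z ∉ P.edgeSet ℝ j := by
          rw [edgeSet_eq]; exact hP.not_mem_of_mem_openSegment hj hz
        filter_upwards [(isClosed_edgeSet j).isOpen_compl.mem_nhds this] with q hq _
        exact hq
    filter_upwards [this] with q hq h1 h2
    obtain ⟨j, hj⟩ := Set.mem_iUnion.1 h2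
    by_cases hj0 : j = ⟨0, hk⟩
    · subst hj0
      rw [edgeSet_eq] at hj
      exact h1 (det2_of_mem_segment hj)
    · exact hq j hj0 hj
  -- points next to the polygon on either side
  obtain ⟨r, hr, hr1, hr2⟩ := ((frequently_side (neg_ne_zero.2 one_ne_zero) (hP.dir_ne _)
    hz').and_eventually (((hh _).1 z hz).2.1.and hopen)).exists
  obtain ⟨l, hl, hl1, hl2⟩ := ((frequently_side one_ne_zero (hP.dir_ne _)
    hz').and_eventually (((hh _).1 z hz).2.2.and hopen)).exists
  have hr1 := hr1 hr
  have hl1 := hl1 hl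
  have hr2 := hr2 (by intro h; rw [h] at hr; simp at hr)
  have hl2 := hl2 (by intro h; rw [h] at hl; simp at hl)
  have hΩ : IsOpen (P.boundary ℝ)ᶜ := isClosed_boundary.isOpen_compl
  have hin : ∀ p ∉ P.boundary ℝ, p ∈ P.region → (h = 0 ∨ h = 1) ∧ P.winding p = 2 * h - 1 := by
    intro p hp hreg
    have hbd : Bornology.IsBounded (connectedComponentIn (P.boundary ℝ)ᶜ p) :=
      (hreg.resolve_left hp).2
    classical
    set f : Plane → ℤ := fun q => if q ∈ connectedComponentIn (P.boundary ℝ)ᶜ p then 1 else 0 with hf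
    have hf01 : ∀ q, f q = 0 ∨ f q = 1 := by intro q; simp only [hf]; split_ifs <;> simp
    have hfp : f p = 1 := if_pos (mem_connectedComponentIn hp)
    have hloc : LocConstOn f (P.boundary ℝ)ᶜ := by
      intro q hq
      filter_upwards [hΩ.connectedComponentIn.mem_nhds (mem_connectedComponentIn hq)] with x hx
      have e := connectedComponentIn_eq hx
      have : x ∈ connectedComponentIn (P.boundary ℝ)ᶜ p ↔
          q ∈ connectedComponentIn (P.boundary ℝ)ᶜ p := by
        constructor
        · intro h1
          rw [connectedComponentIn_eq h1, ← e]
          exact mem_connectedComponentIn hq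
        · intro h1
          rw [connectedComponentIn_eq h1]
          exact hx
      simp only [hf, this]
    obtain ⟨j, hj⟩ := hP.eq_mul_winding hloc (hbd.subset (by
      intro q hq
      by_contra h1
      exact hq (if_neg h1)))
    have e1 := hj p hp
    have e2 := hj r hr2
    have e3 := hj l hl2
    rw [hfp] at e1
    rw [hr1] at e2
    rw [hl1] at e3
    have hj1 : j = 1 ∨ j = -1 := Int.isUnit_iff.1 (IsUnit.of_mul_eq_one _ e1.symm)
    have := hf01 r
    have := hf01 l
    rcases hj1 with rfl | rfl <;> constructor <;> omega
  have hout : ∀ p ∉ P.boundary ℝ, p ∉ P.region → P.winding p = 0 := by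
    intro p hp hreg
    by_contra hne
    apply hreg
    refine Or.inr ⟨hp, (isBounded_winding (P := P)).subset fun q hq => ?_⟩
    have := (locConstOn_winding (P := P)).eq_of_isPreconnected isPreconnected_connectedComponentIn
      (connectedComponentIn_subset _ _) hq (mem_connectedComponentIn hp)
    simpa [this] using hne
  refine ⟨h, ?_, fun p hp => ?_, fun i => ⟨fun z hz => ((hh i).1 z hz).1, (hh i).2⟩⟩
  · by_cases h1 : r ∈ P.region
    · exact (hin r hr2 h1).1
    · by_cases h2 : l ∈ P.region
      · exact (hin l hl2 h2).1
      · have := hout r hr2 h1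
        have := hout l hl2 h2
        omega
  · by_cases h1 : p ∈ P.region
    · exact Or.inl ⟨h1, (hin p hp h1).2⟩
    · exact Or.inr ⟨h1, hout p hp h1⟩

end Polygon

end Plane

namespace Ram

/-! ### Arithmetic terms and short loops -/

instance : Add Term := ⟨.op .add⟩
instance : Sub Term := ⟨.op .sub⟩
instance : Mul Term := ⟨.op .mul⟩
instance : Div Term := ⟨.op .div⟩
instance (n : ℕ) : OfNat Term n := ⟨.const n⟩
instance : Neg Term := ⟨fun a => 0 - a⟩

section eval
variable (a b c : Term) (env : List ℤ) (m : ℤ → ℤ)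

@[simp] theorem Term.eval_add : (a + b).eval env m = a.eval env m + b.eval env m := rfl
@[simp] theorem Term.eval_sub : (a - b).eval env m = a.eval env m - b.eval env m := rfl
@[simp] theorem Term.eval_mul : (a * b).eval env m = a.eval env m * b.eval env m := rfl
@[simp] theorem Term.eval_div : (a / b).eval env m = a.eval env m / b.eval env m := rfl
@[simp] theorem Term.eval_two : (2 : Term).eval env m = 2 := rfl
@[simp] theorem Term.eval_three : (3 : Term).eval env m = 3 := rfl
@[simp] theorem Term.eval_four : (4 : Term).eval env m = 4 := rfl
@[simp] theorem Term.eval_zero : (0 : Term).eval env m = 0 := rfl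
@[simp] theorem Term.eval_one : (1 : Term).eval env m = 1 := rfl
@[simp] theorem Term.eval_neg : (-a).eval env m = -a.eval env m := zero_sub _
@[simp] theorem Term.eval_const (z : ℤ) : (Term.const z).eval env m = z := rfl
@[simp] theorem Term.eval_var (i : ℕ) : (Term.var i).eval env m = env.getD i 0 := rfl
@[simp] theorem Term.eval_load : (Term.load a).eval env m = m (a.eval env m) := rfl
@[simp] theorem Term.eval_ite : (Term.ite c a b).eval env m =
    if 0 < c.eval env m then a.eval env m else b.eval env m := rfl
@[simp] theorem Term.eval_letE :
    (Term.letE a b).eval env m = b.eval (a.eval env m :: env) m := rfl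
@[simp] theorem Term.eval_sum : (Term.sum a b).eval env m =
    ∑ i ∈ Finset.range (a.eval env m).toNat, b.eval ((i : ℤ) :: env) m := rfl
@[simp] theorem Terms.evals_nil : Terms.nil.evals env m = [] := rfl
@[simp] theorem Terms.evals_cons (es : Terms) :
    (Terms.cons a es).evals env m = a.eval env m :: es.evals env m := rfl

end eval

theorem Term.PBd.add {a b : Term} : a.PBd → b.PBd → (a + b).PBd := Term.PBd.op _
theorem Term.PBd.sub {a b : Term} : a.PBd → b.PBd → (a - b).PBd := Term.PBd.op _
theorem Term.PBd.mul {a b : Term} : a.PBd → b.PBd → (a * b).PBd := Term.PBd.op _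
theorem Term.PBd.div {a b : Term} : a.PBd → b.PBd → (a / b).PBd := Term.PBd.op _
theorem Term.PBd.ofNat (n : ℕ) : (OfNat.ofNat n : Term).PBd := Term.PBd.const _
theorem Term.PBd.neg {a : Term} (h : a.PBd) : (-a).PBd := (Term.PBd.ofNat 0).sub h

section Fast
variable {H : (ℤ → ℤ) → ℕ → Prop} {G : (ℤ → ℤ) → ℕ → ℕ} {a b : Term}
theorem Term.Fast.add : a.Fast H G → b.Fast H G → (a + b).Fast H G := Term.Fast.op _
theorem Term.Fast.sub : a.Fast H G → b.Fast H G → (a - b).Fast H G := Term.Fast.op _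
theorem Term.Fast.mul : a.Fast H G → b.Fast H G → (a * b).Fast H G := Term.Fast.op _
theorem Term.Fast.ofNat (n : ℕ) : (OfNat.ofNat n : Term).Fast H G := Term.Fast.const _
theorem Term.Fast.neg (h : a.Fast H G) : (-a).Fast H G := (Term.Fast.ofNat 0).sub h
end Fast

/-- The number of instructions in the evaluation of the term is bounded. -/
def Term.Flat (e : Term) : Prop := ∃ c, ∀ env m, e.steps env m ≤ c

/-- The same for a tuple of terms. -/
def Terms.Flats (e : Terms) : Prop := ∃ c, ∀ env m, e.stepss env m ≤ c

section Flat
variable {a b c : Term}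

theorem Term.Flat.var (i : ℕ) : (Term.var i).Flat := ⟨2, fun _ _ => le_rfl⟩
theorem Term.Flat.const (z : ℤ) : (Term.const z).Flat := ⟨1, fun _ _ => le_rfl⟩
theorem Term.Flat.ofNat (n : ℕ) : (OfNat.ofNat n : Term).Flat := .const _

theorem Term.Flat.op (o : Op) : a.Flat → b.Flat → (Term.op o a b).Flat := by
  rintro ⟨x, hx⟩ ⟨y, hy⟩
  exact ⟨x + y + 1, fun env m => by simp only [Term.steps]; have := hx env m; have := hy env m; omega⟩

theorem Term.Flat.add : a.Flat → b.Flat → (a + b).Flat := Term.Flat.op _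
theorem Term.Flat.sub : a.Flat → b.Flat → (a - b).Flat := Term.Flat.op _
theorem Term.Flat.mul : a.Flat → b.Flat → (a * b).Flat := Term.Flat.op _
theorem Term.Flat.div : a.Flat → b.Flat → (a / b).Flat := Term.Flat.op _
theorem Term.Flat.neg (h : a.Flat) : (-a).Flat := (Term.Flat.ofNat 0).sub h

theorem Term.Flat.load : a.Flat → (Term.load a).Flat := by
  rintro ⟨x, hx⟩
  exact ⟨x + 1, fun env m => by simp only [Term.steps]; have := hx env m; omega⟩

theorem Term.Flat.ite : c.Flat → a.Flat → b.Flat → (Term.ite c a b).Flat := by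
  rintro ⟨x, hx⟩ ⟨y, hy⟩ ⟨z, hz⟩
  refine ⟨x + y + z + 2, fun env m => ?_⟩
  simp only [Term.steps]
  have := hx env m; have := hy env m; have := hz env m
  split_ifs <;> omega

theorem Terms.Flats.nil : Terms.nil.Flats := ⟨0, fun _ _ => le_rfl⟩

theorem Terms.Flats.cons {es : Terms} : a.Flat → es.Flats → (Terms.cons a es).Flats := by
  rintro ⟨x, hx⟩ ⟨y, hy⟩
  exact ⟨x + y, fun env m => by simp only [Terms.stepss]; have := hx env m; have := hy env m; omega⟩

theorem Term.Flat.fast {H : (ℤ → ℤ) → ℕ → Prop} {G : (ℤ → ℤ) → ℕ → ℕ} : a.Flat → a.Fast H G := by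
  rintro ⟨x, hx⟩
  refine ⟨x, fun w env m r h _ hG => (hx env m).trans ?_⟩
  rw [mul_assoc]
  exact Nat.le_mul_of_pos_right _ (one_le_mul_of_small h hG)

end Flat

/-- The number of instructions of a loop that stops after `N` iterations, if the evaluations of the
condition and of the update take a bounded number of instructions. -/
theorem loopSteps_le {c : List ℤ → ℤ} {u : List ℤ → List ℤ} {sc su : List ℤ → ℕ} {k C U : ℕ}
    (hc : ∀ st, sc st ≤ C) (hu : ∀ st, su st ≤ U) {N : ℕ} :
    ∀ (n : ℕ) (st : List ℤ), ¬ 0 < c (loopVal c u N st) →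
      loopSteps c u sc su k n st ≤ (N + 1) * (5 + C + U + 2 * k) := by
  induction N with
  | zero =>
    intro n st h
    rcases n with _ | n
    · simp only [loopSteps]; omega
    · simp only [loopVal] at h
      simp only [loopSteps, if_neg h]
      have := hc st; omega
  | succ N ih =>
    intro n st h
    rcases n with _ | n
    · simp only [loopSteps]
      have : 1 * (5 + C + U + 2 * k) ≤ (N + 1 + 1) * (5 + C + U + 2 * k) :=
        Nat.mul_le_mul_right _ (by omega)
      omega
    · simp only [loopSteps]
      have h1 := hc st
      have h2 := hu st
      have e : (N + 1 + 1) * (5 + C + U + 2 * k) = (N + 1) * (5 + C + U + 2 * k) +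
        (5 + C + U + 2 * k) := by ring
      by_cases hcs : 0 < c st
      · simp only [loopVal, if_pos hcs] at h
        have := ih n (u st) h
        rw [if_pos hcs]
        omega
      · rw [if_neg hcs]; omega

/-- A loop is fast if the number of its iterations is at most proportional to the number of
digits of the variables. -/
theorem Term.Fast.loop {H : (ℤ → ℤ) → ℕ → Prop} {G : (ℤ → ℤ) → ℕ → ℕ} {f c r : Term}
    {is us : Terms} : f.Flat → is.Flats → c.Flat → us.Flats → r.Flat →
    (∃ K, ∀ w env m, Small w env m → ∃ N ≤ K * w, ¬ 0 < c.eval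
      (loopVal (fun st => c.eval (st ++ env) m) (fun st => us.evals (st ++ env) m) N
        (is.evals env m) ++ env) m) →
    (Term.loop f is c us r).Fast H G := by
  rintro ⟨cf, hf⟩ ⟨ci, hi⟩ ⟨cc, hc⟩ ⟨cu, hu⟩ ⟨cr, hr⟩ ⟨K, hK⟩
  refine ⟨cf + ci + (K + 1) * (5 + cc + cu + 2 * is.length) + cr + 2, fun w env m ρ h _ hG => ?_⟩
  obtain ⟨N, hN, hcond⟩ := hK w env m h
  simp only [Term.steps]
  have h1 := loopSteps_le (C := cc) (U := cu) (k := is.length)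
    (c := fun st => c.eval (st ++ env) m) (u := fun st => us.evals (st ++ env) m)
    (sc := fun st => c.steps (st ++ env) m) (su := fun st => us.stepss (st ++ env) m)
    (fun st => hc _ _) (fun st => hu _ _) (f.eval env m).toNat _ hcond
  have h2 : (N + 1) * (5 + cc + cu + 2 * is.length) ≤
      (K * w + w) * (5 + cc + cu + 2 * is.length) :=
    Nat.mul_le_mul_right _ (by have := h.1; omega)
  have h3 := hf env m
  have h4 := hi env m
  have h5 := hr (loopVal (fun st => c.eval (st ++ env) m) (fun st => us.evals (st ++ env) m)
        (f.eval env m).toNat (is.evals env m) ++ env) m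
  have h6 : (cf + ci + (K + 1) * (5 + cc + cu + 2 * is.length) + cr + 2) * w ≤
      (cf + ci + (K + 1) * (5 + cc + cu + 2 * is.length) + cr + 2) * w * G m ρ :=
    Nat.le_mul_of_pos_right _ hG
  refine le_trans ?_ h6
  have h7 : cf + ci + cr + 2 ≤ (cf + ci + cr + 2) * w := Nat.le_mul_of_pos_right _ h.1
  have e : (cf + ci + (K + 1) * (5 + cc + cu + 2 * is.length) + cr + 2) * w =
    (cf + ci + cr + 2) * w + (K * w + w) * (5 + cc + cu + 2 * is.length) := by ring
  rw [e]
  omega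

/-! ### Sums of integer parts of linear functions -/

/-- The sum of the integer parts of `(a * i + c) / m` over `i < n`. -/
def linSum (n m a c : ℤ) : ℤ := ∑ i ∈ Finset.range n.toNat, (a * i + c) / m

theorem sum_range_id_int (n : ℕ) : ∑ i ∈ Finset.range n, (i : ℤ) = n * (n - 1) / 2 := by
  have h := Finset.sum_range_id_mul_two n
  rcases n with _ | n
  · simp
  · zify at h
    rw [eq_comm]
    apply Int.ediv_eq_of_eq_mul_left (by norm_num)
    rw [h]; push_cast; ring

/-- The division step of the Euclidean algorithm. -/
theorem linSum_reduce {n m : ℤ} (hn : 0 ≤ n) (hm : 0 < m) (a c : ℤ) :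
    linSum n m a c = a / m * (n * (n - 1) / 2) + n * (c / m) + linSum n m (a % m) (c % m) := by
  obtain ⟨N, rfl⟩ := Int.eq_ofNat_of_zero_le hn
  have h : ∀ i : ℕ, (a * i + c) / m = a / m * i + c / m + (a % m * i + c % m) / m := by
    intro i
    have e : a * i + c = (a % m * i + c % m) + m * (a / m * i + c / m) := by
      have h1 := Int.emod_add_mul_ediv a m
      have h2 := Int.emod_add_mul_ediv c m
      calc a * i + c = (a % m + m * (a / m)) * i + (c % m + m * (c / m)) := by rw [h1, h2]
        _ = _ := by ring
    rw [e, Int.add_mul_ediv_left _ _ hm.ne']; ring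
  simp only [linSum, Int.toNat_natCast]
  rw [Finset.sum_congr rfl fun i _ => h i, Finset.sum_add_distrib, Finset.sum_add_distrib,
    ← Finset.mul_sum, sum_range_id_int]
  simp

/-- The number of `i < n` that satisfy `i < z`. -/
theorem sum_range_lt {n : ℕ} {z : ℤ} (h0 : 0 ≤ z) (hn : z ≤ n) :
    ∑ i ∈ Finset.range n, (if (i : ℤ) < z then (1 : ℤ) else 0) = z := by
  obtain ⟨k, rfl⟩ := Int.eq_ofNat_of_zero_le h0
  have hk : k ≤ n := by exact_mod_cast hn
  rw [← Finset.sum_filter, Finset.sum_const, nsmul_one]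
  have : {i ∈ Finset.range n | ((i : ℕ) : ℤ) < k} = Finset.range k := by
    ext i; simp; omega
  rw [this, Finset.card_range]

/-- Counting the same lattice triangle along the other axis. -/
theorem linSum_swap {n m a c : ℤ} (hn : 0 ≤ n) (hm : 0 < m) (ha0 : 0 ≤ a) (ham : a < m)
    (hc0 : 0 ≤ c) (hcm : c < m) :
    linSum n m a c = linSum ((a * n + c) / m) a m ((a * n + c) % m) := by
  obtain ⟨N, rfl⟩ := Int.eq_ofNat_of_zero_le hn
  have hy0 : 0 ≤ a * N + c := by positivity
  set y := a * N + c with hy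
  obtain ⟨M, hM⟩ := Int.eq_ofNat_of_zero_le (Int.ediv_nonneg hy0 hm.le)
  have hmod := Int.emod_add_mul_ediv y m
  have hr0 := Int.emod_nonneg y hm.ne'
  rw [hM] at hmod ⊢
  set r := y % m with hr
  simp only [linSum, Int.toNat_natCast]
  rcases ha0.eq_or_lt with rfl | ha
  · have : (M : ℤ) = 0 := by
      rw [← hM]; apply Int.ediv_eq_zero_of_lt hy0; rw [hy]; linarith
    have : M = 0 := by exact_mod_cast this
    subst this
    have h2 : c / m = 0 := Int.ediv_eq_zero_of_lt hc0 hcm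
    simp [h2]
  have h1 : ∀ i ∈ Finset.range N, (a * i + c) / m =
      ∑ j ∈ Finset.range M, if m * (j + 1) ≤ a * i + c then (1 : ℤ) else 0 := by
    intro i hi
    rw [Finset.mem_range] at hi
    have hi' : (i : ℤ) ≤ N := by exact_mod_cast hi.le
    rw [← sum_range_lt (n := M) (Int.ediv_nonneg (by positivity) hm.le) (by
      rw [← hM]
      exact Int.ediv_le_ediv hm (by nlinarith))]
    refine Finset.sum_congr rfl fun j _ => ?_
    have : ((j : ℤ) < (a * i + c) / m) ↔ m * (j + 1) ≤ a * i + c := by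
      rw [← Int.add_one_le_iff, Int.le_ediv_iff_mul_le hm, mul_comm]
    simp only [this]
  have h2 : ∀ j ∈ Finset.range M, (m * j + r) / a =
      ∑ i ∈ Finset.range N, if a * (i + 1) ≤ m * j + r then (1 : ℤ) else 0 := by
    intro j hj
    rw [Finset.mem_range] at hj
    have hj' : (j : ℤ) + 1 ≤ M := by exact_mod_cast hj
    rw [← sum_range_lt (n := N) (Int.ediv_nonneg (by positivity) ha.le) (by
      rw [← Int.lt_add_one_iff]
      apply Int.ediv_lt_of_lt_mul ha
      nlinarith)]
    refine Finset.sum_congr rfl fun i _ => ?_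
    have : ((i : ℤ) < (m * j + r) / a) ↔ a * (i + 1) ≤ m * j + r := by
      rw [← Int.add_one_le_iff, Int.le_ediv_iff_mul_le ha, mul_comm]
    simp only [this]
  rw [Finset.sum_congr rfl h1, Finset.sum_congr rfl h2, Finset.sum_comm, ← Finset.sum_range_reflect]
  refine Finset.sum_congr rfl fun j hj => ?_
  rw [← Finset.sum_range_reflect]
  refine Finset.sum_congr rfl fun i hi => ?_
  rw [Finset.mem_range] at hi hj
  have e1 : ((N - 1 - i : ℕ) : ℤ) = N - 1 - i := by omega
  have e2 : ((M - 1 - j : ℕ) : ℤ) = M - 1 - j := by omega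
  rw [e1, e2]
  have : m * ((M : ℤ) - 1 - j + 1) ≤ a * (N - 1 - i) + c ↔ a * ((i : ℤ) + 1) ≤ m * j + r := by
    constructor <;> intro h <;> nlinarith
  simp only [this]

/-- The loop condition in the computation of `linSum`: `n` and `m` are positive. -/
def linSumCond : Term := .ite (.var 0) (.var 1) 0

/-- One step of the Euclidean algorithm that computes `linSum`, on a tuple `n, m, a, c, s`. The
value of `s + linSum n m a c` does not change. -/
def linSumStep : Terms :=
  let a' : Term := .var 2 - .var 1 * (.var 2 / .var 1)
  let c' : Term := .var 3 - .var 1 * (.var 3 / .var 1)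
  let y : Term := a' * .var 0 + c'
  .cons (y / .var 1) (.cons a' (.cons (.var 1) (.cons (y - .var 1 * (y / .var 1)) (.cons
    (.var 4 + (.var 2 / .var 1 * (.var 0 * (.var 0 - 1) / 2) + .var 0 * (.var 3 / .var 1))) .nil))))

/-- The term that computes `linSum` for the values `n, m, a, c` of the first variables. -/
def linSumTerm : Term :=
  .loop (.var 1 + 1) (.cons (.var 0) (.cons (.var 1) (.cons (.var 2) (.cons (.var 3)
    (.cons 0 .nil))))) linSumCond linSumStep (.var 4)

section linSum
variable (env : List ℤ) (μ : ℤ → ℤ)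

theorem eval_linSumCond (n m a c s : ℤ) : 0 < linSumCond.eval ([n, m, a, c, s] ++ env) μ ↔
    0 < n ∧ 0 < m := by
  simp only [linSumCond, Term.eval_ite, Term.eval_var, Term.eval_zero]
  simp only [List.cons_append, List.getD_cons_zero, List.getD_cons_succ]
  split_ifs with h <;> simp [h]

theorem evals_linSumStep (n m a c s : ℤ) : linSumStep.evals ([n, m, a, c, s] ++ env) μ =
    [(a % m * n + c % m) / m, a % m, m, (a % m * n + c % m) % m,
      s + (a / m * (n * (n - 1) / 2) + n * (c / m))] := by
  simp [linSumStep, Int.emod_def]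

/-- In every iteration the state keeps the value of `s + linSum n m a c`, and the modulus
decreases. -/
theorem loopVal_linSum (k : ℕ) : ∀ n m a c s : ℤ, 0 ≤ n → 0 ≤ m → (0 < n → 0 < m) → m < k →
    (loopVal (fun st => linSumCond.eval (st ++ env) μ) (fun st => linSumStep.evals (st ++ env) μ) k
      [n, m, a, c, s]).getD 4 0 = s + linSum n m a c := by
  induction k with
  | zero => intro n m a c s _ h1 _ h2; simp at h2; omega
  | succ k ih =>
    intro n m a c s hn hm hnm hk
    rw [loopVal]
    simp only [eval_linSumCond, evals_linSumStep]
    split_ifs with h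
    · have ha0 := Int.emod_nonneg a h.2.ne'
      have ham := Int.emod_lt_of_pos a h.2
      have hc0 := Int.emod_nonneg c h.2.ne'
      have hcm := Int.emod_lt_of_pos c h.2
      rw [ih _ _ _ _ _ (Int.ediv_nonneg (by positivity) hm) ha0 ?_ (by push_cast at hk; omega),
        linSum_reduce hn h.2, linSum_swap hn h.2 ha0 ham hc0 hcm]
      · ring
      · intro h1
        by_contra h2
        have : a % m = 0 := by omega
        rw [this, zero_mul, zero_add, Int.ediv_eq_zero_of_lt hc0 hcm] at h1
        omega
    · have : n = 0 := by
        by_contra h1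
        exact h ⟨by omega, hnm (by omega)⟩
      simp [linSum, this]

theorem eval_linSumTerm {n m : ℤ} (hn : 0 ≤ n) (hm : 0 < m) (a c : ℤ) :
    linSumTerm.eval ([n, m, a, c] ++ env) μ = linSum n m a c := by
  have h := loopVal_linSum ([n, m, a, c] ++ env) μ (m + 1).toNat n m a c 0 hn hm.le (fun _ => hm)
    (by omega)
  rw [zero_add] at h
  rw [← h]
  simp only [linSumTerm, Term.eval]
  have e : ∀ l l' : List ℤ, 4 < l.length → (l ++ l').getD 4 0 = l.getD 4 0 := by
    intro l l' hl
    rw [List.getD_append _ _ _ _ hl]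
  have hlen : ∀ k : ℕ, ∀ st : List ℤ, st.length = 5 → (loopVal
      (fun st => linSumCond.eval (st ++ ([n, m, a, c] ++ env)) μ)
      (fun st => linSumStep.evals (st ++ ([n, m, a, c] ++ env)) μ) k st).length = 5 := by
    intro k
    induction k with
    | zero => intro st h; exact h
    | succ k ih =>
      intro st h
      rw [loopVal]
      split_ifs
      · exact ih _ (by rw [Terms.length_evals]; rfl)
      · exact h
  rw [e]
  · rfl
  · rw [hlen _ _ rfl]; norm_num

/-- The numbers `n, m, a, c` stay small in the computation of `linSum`. -/
theorem loopVal_linSum_bound {w : ℕ} (k : ℕ) : ∀ n m a c s : ℤ, |n| < 2 ^ w → |m| < 2 ^ w →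
    |a| < 2 ^ w → |c| < 2 ^ w → ∃ n' m' a' c' s' : ℤ,
      loopVal (fun st => linSumCond.eval (st ++ env) μ)
        (fun st => linSumStep.evals (st ++ env) μ) k [n, m, a, c, s] = [n', m', a', c', s'] ∧
      |n'| < 2 ^ w ∧ |m'| < 2 ^ w ∧ |a'| < 2 ^ w ∧ |c'| < 2 ^ w ∧
      |s'| ≤ |s| + k * (2 * 2 ^ (3 * w)) := by
  induction k with
  | zero => intro n m a c s h1 h2 h3 h4; exact ⟨n, m, a, c, s, rfl, h1, h2, h3, h4, by simp⟩
  | succ k ih =>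
    intro n m a c s h1 h2 h3 h4
    have hp : (0 : ℤ) < 2 ^ w := by positivity
    have hp1 : (1 : ℤ) ≤ 2 ^ w := one_le_pow₀ (by norm_num)
    have hpos : (0 : ℤ) < 2 ^ (3 * w) := by positivity
    rw [loopVal]
    simp only [eval_linSumCond, evals_linSumStep]
    split_ifs with h
    · have ha0 := Int.emod_nonneg a h.2.ne'
      have ham := Int.emod_lt_of_pos a h.2
      have hc0 := Int.emod_nonneg c h.2.ne'
      have hcm := Int.emod_lt_of_pos c h.2
      have hy0 : 0 ≤ a % m * n + c % m := by have := h.1; positivity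
      have hyn : (a % m * n + c % m) / m < n + 1 := by
        apply Int.ediv_lt_of_lt_mul h.2
        nlinarith [h.1]
      have h5 := le_abs_self n
      have h6 := le_abs_self m
      obtain ⟨n', m', a', c', s', e, b1, b2, b3, b4, b5⟩ := ih ((a % m * n + c % m) / m) (a % m) m
        ((a % m * n + c % m) % m) (s + (a / m * (n * (n - 1) / 2) + n * (c / m)))
        (by rw [abs_of_nonneg (Int.ediv_nonneg hy0 h.2.le)]; omega)
        (by rw [abs_of_nonneg ha0]; omega) h2
        (by
          rw [abs_of_nonneg (Int.emod_nonneg _ h.2.ne')]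
          have := Int.emod_lt_of_pos (a % m * n + c % m) h.2
          omega)
      refine ⟨n', m', a', c', s', e, b1, b2, b3, b4, b5.trans ?_⟩
      have q1 : |a / m| ≤ 2 ^ w := by
        have : |a / m| ≤ |a| := by
          rw [Int.abs_eq_natAbs, Int.abs_eq_natAbs]
          exact_mod_cast Int.natAbs_ediv_le_natAbs a m
        omega
      have q2 : |c / m| ≤ 2 ^ w := by
        have : |c / m| ≤ |c| := by
          rw [Int.abs_eq_natAbs, Int.abs_eq_natAbs]
          exact_mod_cast Int.natAbs_ediv_le_natAbs c m
        omega
      have q3 : |n * (n - 1) / 2| ≤ 2 ^ w * 2 ^ w := by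
        have hnn : 0 ≤ n * (n - 1) := mul_nonneg h.1.le (by linarith [h.1])
        rw [abs_of_nonneg (Int.ediv_nonneg hnn (by norm_num))]
        have : n * (n - 1) / 2 ≤ n * (n - 1) := Int.ediv_le_self _ hnn
        nlinarith
      have q4 : |a / m * (n * (n - 1) / 2)| ≤ 2 ^ (3 * w) := by
        rw [abs_mul, show (2 : ℤ) ^ (3 * w) = 2 ^ w * (2 ^ w * 2 ^ w) by ring]
        exact mul_le_mul q1 q3 (abs_nonneg _) hp.le
      have q5 : |n * (c / m)| ≤ 2 ^ (3 * w) := by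
        rw [abs_mul, show (2 : ℤ) ^ (3 * w) = 2 ^ w * 2 ^ w * 2 ^ w by ring]
        calc |n| * |c / m| ≤ 2 ^ w * 2 ^ w := mul_le_mul h1.le q2 (abs_nonneg _) hp.le
          _ ≤ 2 ^ w * 2 ^ w * 2 ^ w := le_mul_of_one_le_right (by positivity) hp1
      have q6 := abs_add_le s (a / m * (n * (n - 1) / 2) + n * (c / m))
      have q7 := abs_add_le (a / m * (n * (n - 1) / 2)) (n * (c / m))
      push_cast
      linarith
    · refine ⟨n, m, a, c, s, rfl, h1, h2, h3, h4, ?_⟩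
      have : (0 : ℤ) ≤ ((k + 1 : ℕ) : ℤ) * (2 * 2 ^ (3 * w)) := by positivity
      linarith

theorem loopVal_succ {c : List ℤ → ℤ} {u : List ℤ → List ℤ} {st : List ℤ} (n : ℕ) (h : 0 < c st) :
    loopVal c u (n + 1) st = loopVal c u n (u st) := by
  rw [loopVal, if_pos h]

/-- The Euclidean algorithm stops after at most `N` steps if `m * a < 2 ^ N`. -/
theorem linSum_stops (N : ℕ) : ∀ n m a c s : ℤ, m < a → m * a < 2 ^ N → ∃ N' ≤ N,
    ¬ 0 < linSumCond.eval (loopVal (fun st => linSumCond.eval (st ++ env) μ)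
      (fun st => linSumStep.evals (st ++ env) μ) N' [n, m, a, c, s] ++ env) μ := by
  induction N with
  | zero =>
    intro n m a c s h1 h2
    refine ⟨0, le_rfl, ?_⟩
    rw [loopVal, eval_linSumCond]
    rintro ⟨-, h⟩
    nlinarith
  | succ N ih =>
    intro n m a c s h1 h2
    by_cases h : 0 < n ∧ 0 < m
    · have ham := Int.emod_lt_of_pos a h.2
      have hdiv : 1 ≤ a / m := (Int.le_ediv_iff_mul_le h.2).2 (by linarith)
      have hea := Int.emod_add_mul_ediv a m
      obtain ⟨N', hN', hc⟩ := ih ((a % m * n + c % m) / m) (a % m) m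
        ((a % m * n + c % m) % m) (s + (a / m * (n * (n - 1) / 2) + n * (c / m))) ham (by
          have h3 : 2 * (a % m) ≤ a := by nlinarith [h.2]
          have : 2 * (a % m * m) ≤ m * a := by nlinarith [h.2]
          rw [pow_succ] at h2
          linarith)
      refine ⟨N' + 1, by omega, ?_⟩
      rw [loopVal_succ N' (by rw [eval_linSumCond]; exact h)]
      simp only [evals_linSumStep]
      exact hc
    · refine ⟨0, by omega, ?_⟩
      rw [loopVal, eval_linSumCond]
      exact h

end linSum

theorem Small.abs_lt {w : ℕ} {env : List ℤ} {m : ℤ → ℤ} (h : Small w env m) (i : ℕ) :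
    |env.getD i 0| < 2 ^ w := by
  rw [← bitLength_le]
  rcases lt_or_ge i env.length with hi | hi
  · rw [List.getD_eq_getElem _ _ hi]
    exact h.2.1 _ (List.getElem_mem hi)
  · rw [List.getD_eq_default _ _ hi]; simp

theorem pbd_linSumTerm : linSumTerm.PBd := by
  refine Term.PBd.loop rfl ?_ ?_ ?_ ?_ ?_ ⟨6, fun w env m h j hj z hz => ?_⟩
  iterate 5
    repeat' first
      | apply Term.PBd.var | apply Term.PBd.ofNat | apply Term.PBd.add | apply Term.PBd.sub
      | apply Term.PBd.mul | apply Term.PBd.div | apply Term.PBd.ite | apply Terms.PBds.cons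
      | apply Terms.PBds.nil
  obtain ⟨n', m', a', c', s', e, b1, b2, b3, b4, b5⟩ := loopVal_linSum_bound env m j _ _ _ _ 0
    (h.abs_lt 0) (h.abs_lt 1) (h.abs_lt 2) (h.abs_lt 3)
  have e' : (Terms.cons (.var 0) (.cons (.var 1) (.cons (.var 2) (.cons (.var 3)
    (.cons 0 .nil))))).evals env m = [env.getD 0 0, env.getD 1 0, env.getD 2 0, env.getD 3 0, 0] :=
    rfl
  rw [e', e] at hz
  have hw := h.1
  have hmono : ∀ x : ℤ, |x| < 2 ^ w → bitLength x ≤ 6 * w := fun x hx =>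
    (bitLength_le.2 hx).trans (by omega)
  have hs : bitLength s' ≤ 6 * w := by
    rw [bitLength_le]
    have h1 := h.abs_lt 1
    have h2 : (j : ℤ) ≤ 2 ^ w := by
      have h3 := le_abs_self (env.getD 1 0)
      have h4 : (Term.var 1 + 1).eval env m = env.getD 1 0 + 1 := rfl
      rw [h4] at hj
      have : (0 : ℤ) < 2 ^ w := by positivity
      omega
    have h5 : (0 : ℤ) < 2 ^ (3 * w) := by positivity
    calc |s'| ≤ j * (2 * 2 ^ (3 * w)) := by simpa using b5
      _ ≤ 2 ^ w * (2 * 2 ^ (3 * w)) := mul_le_mul_of_nonneg_right h2 (by positivity)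
      _ = 2 ^ (w + 3 * w + 1) := by ring
      _ < 2 ^ (6 * w) := pow_lt_pow_right₀ (by norm_num) (by omega)
  simp only [List.mem_cons, List.not_mem_nil, or_false] at hz
  rcases hz with rfl | rfl | rfl | rfl | rfl
  exacts [hmono _ b1, hmono _ b2, hmono _ b3, hmono _ b4, hs]

theorem fast_linSumTerm {H : (ℤ → ℤ) → ℕ → Prop} {G : (ℤ → ℤ) → ℕ → ℕ} :
    linSumTerm.Fast H G := by
  refine Term.Fast.loop ?_ ?_ ?_ ?_ ?_ ⟨3, fun w env m h => ?_⟩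
  iterate 5
    repeat' first
      | apply Term.Flat.var | apply Term.Flat.ofNat | apply Term.Flat.add | apply Term.Flat.sub
      | apply Term.Flat.mul | apply Term.Flat.div | apply Term.Flat.ite | apply Terms.Flats.cons
      | apply Terms.Flats.nil
  have e' : (Terms.cons (.var 0) (.cons (.var 1) (.cons (.var 2) (.cons (.var 3)
    (.cons 0 .nil))))).evals env m = [env.getD 0 0, env.getD 1 0, env.getD 2 0, env.getD 3 0, 0] :=
    rfl
  rw [e']
  have h1 := h.abs_lt 1
  generalize env.getD 0 0 = n
  generalize env.getD 1 0 = M at *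
  generalize env.getD 2 0 = a
  generalize env.getD 3 0 = c
  have hw := h.1
  by_cases hc : 0 < n ∧ 0 < M
  · have ham := Int.emod_lt_of_pos a hc.2
    have ha0 := Int.emod_nonneg a hc.2.ne'
    rw [abs_of_pos hc.2] at h1
    obtain ⟨N', hN', hc'⟩ := linSum_stops env m (2 * w) ((a % M * n + c % M) / M) (a % M) M
        ((a % M * n + c % M) % M) (0 + (a / M * (n * (n - 1) / 2) + n * (c / M))) ham (by
      rw [show (2 : ℤ) ^ (2 * w) = 2 ^ w * 2 ^ w by ring]
      nlinarith)
    refine ⟨N' + 1, by omega, ?_⟩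
    rw [loopVal_succ N' (by rw [eval_linSumCond]; exact hc)]
    simp only [evals_linSumStep]
    exact hc'
  · refine ⟨0, by omega, ?_⟩
    rw [loopVal, eval_linSumCond]
    exact hc

/-! ### Values of the Mertens function from a table -/

/-- The memory holds a bound `B` for the abscissas and ordinates, an integer `r` with `B ≤ r ^ 7`,
and the values of the Mertens function up to `r ^ 6`. -/
structure Table (m : ℤ → ℤ) (B r : ℕ) : Prop where
  bound : m (-1) = B
  root : m (-2) = r
  one_le : 1 ≤ r
  le : B ≤ r ^ 7
  val : ∀ n ≤ r ^ 6, m (-3 - n) = mertens n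

/-- The part of `Table` on which the running times depend. -/
def Sized (m : ℤ → ℤ) (r : ℕ) : Prop := m (-2) = r ∧ m (-1) ≤ r ^ 7 ∧ 1 ≤ r

theorem Table.sized {m : ℤ → ℤ} {B r : ℕ} (h : Table m B r) : Sized m r :=
  ⟨h.root, by rw [h.bound]; exact_mod_cast h.le, h.one_le⟩

section steps
variable (a b : Term) (env : List ℤ) (m : ℤ → ℤ)

theorem Term.steps_sub : (a - b).steps env m = a.steps env m + b.steps env m + 1 := rfl
theorem Term.steps_mul : (a * b).steps env m = a.steps env m + b.steps env m + 1 := rfl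
theorem Term.steps_letE : (Term.letE a b).steps env m =
    a.steps env m + b.steps (a.eval env m :: env) m + 2 := rfl
theorem Term.steps_ite (c : Term) : (Term.ite c a b).steps env m =
    c.steps env m + 2 + if 0 < c.eval env m then a.steps env m else b.steps env m := rfl
theorem Term.steps_sum : (Term.sum a b).steps env m = a.steps env m + 7 +
    ∑ i ∈ Finset.range (a.eval env m).toNat, (b.steps ((i : ℤ) :: env) m + 6) := rfl

end steps

theorem Term.Flat.steps_sum_le {n b : Term} : n.Flat → b.Flat →
    ∃ C, ∀ env m, (Term.sum n b).steps env m ≤ C * (1 + (n.eval env m).toNat) := by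
  rintro ⟨x, hx⟩ ⟨y, hy⟩
  refine ⟨x + 7 + (y + 6), fun env m => ?_⟩
  rw [Term.steps_sum]
  have h := Finset.sum_le_card_nsmul (Finset.range (n.eval env m).toNat)
    (fun i => b.steps ((i : ℤ) :: env) m + 6) (y + 6) (fun i _ => by have := hy ((i : ℤ) :: env) m; omega)
  rw [Finset.card_range, smul_eq_mul] at h
  have := hx env m
  nlinarith

/-- The term for `r`. -/
def rootTerm : Term := .load (.const (-2))
/-- The term for `r ^ 6`, the number of the last table entry. -/
def topTerm : Term := rootTerm * rootTerm * rootTerm * rootTerm * rootTerm * rootTerm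
/-- The term for `r ^ 3`. -/
def cubeTerm : Term := rootTerm * rootTerm * rootTerm
/-- The term for `B`. -/
def boundTerm : Term := .load (.const (-1))
/-- The table entry number `n`. -/
def entry (n : Term) : Term := .load (.const (-3) - n)

/-- The first inner sum in the formula of `mertens_eq_sum`, where `y` is the variable `0`. -/
def querySum₁ : Term :=
  .sum (.var 0 / cubeTerm - .var 0 / topTerm) (entry (.var 1 / (.var 0 + .var 1 / topTerm + 1)))

/-- The second inner sum in the formula of `mertens_eq_sum`. -/
def querySum₂ : Term :=
  .sum (cubeTerm - 1) (entry (.var 0 + 1) * (.var 1 / (.var 0 + 1) - .var 1 / (.var 0 + 2)))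

/-- The outer summand in the formula of `mertens_eq_sum`. -/
def queryBody : Term :=
  .letE (.var 1 / (.var 0 + 1))
    ((entry (.var 1 + 1) - entry (.var 1)) * (1 - querySum₁ - querySum₂))

/-- The value of the Mertens function at the variable `0`, cut off at the bound. -/
def queryTerm : Term :=
  .letE (.ite (.var 0 - boundTerm) boundTerm (.var 0))
    (.ite (.var 0 - topTerm) (.sum (.var 0 / topTerm) queryBody) (entry (.var 0)))

theorem eval_entry {m : ℤ → ℤ} {B r : ℕ} (h : Table m B r) {e : Term} {env : List ℤ} {n : ℕ}
    (he : e.eval env m = n) (hn : n ≤ r ^ 6) : (entry e).eval env m = mertens n := by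
  rw [entry, Term.eval_load, Term.eval_sub, he, Term.eval_const, h.val n hn]

theorem eval_rootTerm {m : ℤ → ℤ} {r : ℕ} (h : m (-2) = r) (env : List ℤ) :
    rootTerm.eval env m = r := by simp [rootTerm, h]

theorem eval_topTerm {m : ℤ → ℤ} {r : ℕ} (h : m (-2) = r) (env : List ℤ) :
    topTerm.eval env m = (r ^ 6 : ℕ) := by
  simp only [topTerm, Term.eval_mul, eval_rootTerm h]; push_cast; ring

theorem eval_cubeTerm {m : ℤ → ℤ} {r : ℕ} (h : m (-2) = r) (env : List ℤ) :
    cubeTerm.eval env m = (r ^ 3 : ℕ) := by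
  simp only [cubeTerm, Term.eval_mul, eval_rootTerm h]; push_cast; ring

theorem sum_range_sub_eq_sum_Ioc (f : ℕ → ℤ) {a b : ℕ} (h : a ≤ b) :
    ∑ i ∈ Finset.range (b - a), f (i + a + 1) = ∑ e ∈ Finset.Ioc a b, f e := by
  refine Finset.sum_nbij' (fun i => i + a + 1) (fun e => e - a - 1) ?_ ?_ ?_ ?_ ?_ <;>
    simp only [Finset.mem_range, Finset.mem_Ioc] <;> intros <;> first | omega | rfl | trivial

section query
variable {m : ℤ → ℤ} {B r : ℕ} (h : Table m B r)
include h

theorem eval_querySum₁ (y : ℕ) (env : List ℤ) : querySum₁.eval ((y : ℤ) :: env) m =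
    ∑ e ∈ Finset.Ioc (y / r ^ 6) (y / r ^ 3), mertens (y / e) := by
  have hle : y / r ^ 6 ≤ y / r ^ 3 :=
    Nat.div_le_div_left (Nat.pow_le_pow_right h.one_le (by norm_num)) (Nat.pow_pos h.one_le)
  rw [querySum₁, Term.eval_sum, ← sum_range_sub_eq_sum_Ioc (fun e => mertens (y / e)) hle]
  refine Finset.sum_congr ?_ fun i _ => ?_
  · congr 1
    simp only [Term.eval_sub, Term.eval_div, Term.eval_var, List.getD_cons_zero,
      eval_cubeTerm h.root, eval_topTerm h.root]
    rw [← Int.natCast_div, ← Int.natCast_div, Int.toNat_sub]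
  · refine eval_entry h (n := y / (i + y / r ^ 6 + 1)) ?_ ?_
    · simp only [Term.eval_add, Term.eval_div, Term.eval_var, List.getD_cons_zero,
        List.getD_cons_succ, eval_topTerm h.root, Term.eval_one]
      push_cast; rfl
    · have hT : 0 < r ^ 6 := Nat.pow_pos h.one_le
      apply Nat.le_of_lt
      rw [Nat.div_lt_iff_lt_mul (Nat.succ_pos _)]
      have := Nat.lt_mul_div_succ y hT
      nlinarith

theorem eval_querySum₂ (y : ℕ) (env : List ℤ) : querySum₂.eval ((y : ℤ) :: env) m =
    ∑ v ∈ Finset.Ico 1 (r ^ 3), mertens v * ((y / v : ℕ) - (y / (v + 1) : ℕ) : ℤ) := by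
  rw [querySum₂, Term.eval_sum, Finset.sum_Ico_eq_sum_range]
  refine Finset.sum_congr ?_ fun i hi => ?_
  · rw [Term.eval_sub, Term.eval_one, eval_cubeTerm h.root]
    congr 1
    omega
  · have hi' : i < r ^ 3 - 1 := by
      rwa [Finset.mem_range] at hi
    have hle : r ^ 3 ≤ r ^ 6 := Nat.pow_le_pow_right h.one_le (by norm_num)
    rw [Term.eval_mul, eval_entry h (n := 1 + i) (by simp [add_comm]) (by omega)]
    simp only [Term.eval_sub, Term.eval_div, Term.eval_add, Term.eval_var, List.getD_cons_zero,
        List.getD_cons_succ, Term.eval_one, Term.eval_two]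
    push_cast
    rw [add_comm (i : ℤ) 1, show 1 + (i : ℤ) + 1 = i + 2 by ring]

theorem eval_queryTerm {x : ℕ} (hx : x ≤ B) (env : List ℤ) :
    queryTerm.eval ((x : ℤ) :: env) m = mertens x := by
  have hT : 0 < r ^ 6 := Nat.pow_pos h.one_le
  have hclip : (Term.ite (.var 0 - boundTerm) boundTerm (.var 0)).eval ((x : ℤ) :: env) m = x := by
    simp only [Term.eval_ite, Term.eval_sub, Term.eval_var, List.getD_cons_zero, boundTerm,
      Term.eval_load, Term.eval_const, h.bound]
    rw [if_neg (by omega)]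
  rw [queryTerm, Term.eval_letE, hclip, Term.eval_ite, Term.eval_sub, eval_topTerm h.root,
    Term.eval_var, List.getD_cons_zero]
  split_ifs with h1
  · have hTx : r ^ 6 ≤ x := by omega
    rw [mertens_eq_sum (T := r ^ 6) (V := r ^ 3) (Nat.pow_pos h.one_le)
      (Nat.pow_le_pow_right h.one_le (by norm_num)) hTx, Term.eval_sum]
    have e := sum_range_sub_eq_sum_Ioc (fun d => ArithmeticFunction.moebius d *
      (1 - ∑ e ∈ Finset.Ioc (x / d / r ^ 6) (x / d / r ^ 3), mertens (x / d / e) -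
        ∑ v ∈ Finset.Ico 1 (r ^ 3), mertens v * ((x / d / v : ℕ) - (x / d / (v + 1) : ℕ) : ℤ)))
      (Nat.zero_le (x / r ^ 6))
    rw [← e]
    have htrip : ((Term.var 0 / topTerm).eval ((x : ℤ) :: (x : ℤ) :: env) m).toNat =
        x / r ^ 6 - 0 := by
      simp only [Term.eval_div, Term.eval_var, List.getD_cons_zero, eval_topTerm h.root]
      omega
    rw [htrip]
    refine Finset.sum_congr rfl fun i hi => ?_
    have hi' : i + 1 ≤ r ^ 6 := by
      rw [Finset.mem_range, Nat.sub_zero, Nat.lt_div_iff_mul_lt hT] at hi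
      have h2 : x ≤ r ^ 7 := hx.trans h.le
      have h3 : i * r ^ 6 < r * r ^ 6 := by
        calc i * r ^ 6 < x := by
              have := hT; omega
          _ ≤ r ^ 7 := h2
          _ = r * r ^ 6 := by ring
      have h4 : i < r := Nat.lt_of_mul_lt_mul_right h3
      exact h4.trans_le (Nat.le_self_pow (by norm_num) r)
    have hy : (Term.var 1 / (.var 0 + 1)).eval ((i : ℤ) :: (x : ℤ) :: (x : ℤ) :: env) m =
        (x / (i + 1) : ℕ) := by
      simp
    rw [queryBody, Term.eval_letE, hy, Term.eval_mul, Term.eval_sub, Term.eval_sub, Term.eval_sub,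
      eval_querySum₁ h, eval_querySum₂ h, eval_entry h (n := i + 1) (by simp) hi',
      eval_entry h (n := i) (by simp) (by omega), mertens_succ]
    simp
  · exact eval_entry h rfl (by omega)

end query

/-- A bound for a harmonic sum, by dyadic intervals. -/
theorem sum_div_le (K w : ℕ) : ∑ i ∈ Finset.range (2 ^ w - 1), K / (i + 1) ≤ K * w := by
  induction w with
  | zero => simp
  | succ w ih =>
    have h1 : 2 ^ (w + 1) - 1 = (2 ^ w - 1) + 2 ^ w := by have := Nat.one_le_two_pow (n := w); omega
    rw [h1, Finset.sum_range_add]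
    have h2 : ∑ i ∈ Finset.range (2 ^ w), K / (2 ^ w - 1 + i + 1) ≤ 2 ^ w * (K / 2 ^ w) := by
      have := Finset.sum_le_card_nsmul (Finset.range (2 ^ w)) (fun i => K / (2 ^ w - 1 + i + 1))
        (K / 2 ^ w) (fun i _ => Nat.div_le_div_left (by omega) (by positivity))
      simpa using this
    have h3 : 2 ^ w * (K / 2 ^ w) ≤ K := Nat.mul_div_le K _
    have h4 : K * (w + 1) = K * w + K := by ring
    omega

theorem pbd_rootTerm : rootTerm.PBd := (Term.PBd.const _).load
theorem pbd_topTerm : topTerm.PBd := by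
  unfold topTerm
  repeat' first | apply Term.PBd.mul | apply pbd_rootTerm
theorem pbd_cubeTerm : cubeTerm.PBd := by
  unfold cubeTerm
  repeat' first | apply Term.PBd.mul | apply pbd_rootTerm
theorem pbd_boundTerm : boundTerm.PBd := (Term.PBd.const _).load
theorem Term.PBd.entry {e : Term} (h : e.PBd) : (entry e).PBd := ((Term.PBd.const _).sub h).load

theorem flat_rootTerm : rootTerm.Flat := (Term.Flat.const _).load
theorem flat_topTerm : topTerm.Flat := by
  unfold topTerm
  repeat' first | apply Term.Flat.mul | apply flat_rootTerm
theorem flat_cubeTerm : cubeTerm.Flat := by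
  unfold cubeTerm
  repeat' first | apply Term.Flat.mul | apply flat_rootTerm
theorem flat_boundTerm : boundTerm.Flat := (Term.Flat.const _).load
theorem Term.Flat.entry {e : Term} (h : e.Flat) : (entry e).Flat :=
  ((Term.Flat.const _).sub h).load

theorem pbd_queryTerm : queryTerm.PBd := by
  unfold queryTerm queryBody querySum₁ querySum₂
  repeat' first
    | apply pbd_topTerm | apply pbd_cubeTerm | apply pbd_boundTerm | apply Term.PBd.entry
    | apply Term.PBd.var | apply Term.PBd.ofNat | apply Term.PBd.add | apply Term.PBd.sub
    | apply Term.PBd.mul | apply Term.PBd.div | apply Term.PBd.ite | apply Term.PBd.letE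
    | apply Term.PBd.sum

theorem steps_querySum₁ : ∃ C, ∀ env m, querySum₁.steps env m ≤ C * (1 +
    ((Term.var 0 / cubeTerm - .var 0 / topTerm).eval env m).toNat) := by
  refine Term.Flat.steps_sum_le (Term.Flat.sub ?_ ?_) (Term.Flat.entry (Term.Flat.div ?_ ?_))
  all_goals repeat' first
      | apply flat_topTerm | apply flat_cubeTerm
      | apply Term.Flat.var | apply Term.Flat.ofNat | apply Term.Flat.add

theorem steps_querySum₂ : ∃ C, ∀ env m, querySum₂.steps env m ≤ C * (1 +
    ((cubeTerm - 1).eval env m).toNat) := by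
  refine Term.Flat.steps_sum_le (Term.Flat.sub ?_ ?_) (Term.Flat.mul ?_ ?_)
  all_goals repeat' first
      | apply flat_cubeTerm | apply Term.Flat.entry
      | apply Term.Flat.var | apply Term.Flat.ofNat | apply Term.Flat.add

theorem steps_queryBody : ∃ C, ∀ (i : ℕ) (x : ℤ) (env : List ℤ) (m : ℤ → ℤ) (r : ℕ),
    m (-2) = r → 1 ≤ r → 0 ≤ x → x ≤ r ^ 7 →
    queryBody.steps ((i : ℤ) :: x :: env) m ≤ C * (r ^ 3 + r ^ 4 / (i + 1)) := by
  obtain ⟨C1, h1⟩ := steps_querySum₁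
  obtain ⟨C2, h2⟩ := steps_querySum₂
  have hy : (Term.var 1 / (.var 0 + 1)).Flat := by
    repeat' first
      | apply Term.Flat.var | apply Term.Flat.ofNat | apply Term.Flat.add
  have hf : (entry (.var 1 + 1) - entry (.var 1)).Flat := by
    apply Term.Flat.sub
    all_goals apply Term.Flat.entry
    all_goals repeat' first
      | apply Term.Flat.var | apply Term.Flat.ofNat | apply Term.Flat.add
  obtain ⟨C3, h3⟩ := hy
  obtain ⟨C4, h4⟩ := hf
  refine ⟨C1 + C1 + C2 + C2 + C3 + C4 + 6, fun i x env m r hr hr1 hx0 hx => ?_⟩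
  obtain ⟨X, rfl⟩ := Int.eq_ofNat_of_zero_le hx0
  have hX : X ≤ r ^ 7 := by exact_mod_cast hx
  have hev : (Term.var 1 / (.var 0 + 1)).eval ((i : ℤ) :: (X : ℤ) :: env) m = (X / (i + 1) : ℕ) := by
    simp
  rw [queryBody, Term.steps_letE, hev]
  simp only [Term.steps_mul, Term.steps_sub]
  have e1 : (1 : Term).steps ((X / (i + 1) : ℕ) :: (i : ℤ) :: (X : ℤ) :: env) m = 1 := rfl
  have b1 := h1 ((X / (i + 1) : ℕ) :: (i : ℤ) :: (X : ℤ) :: env) m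
  have b2 := h2 ((X / (i + 1) : ℕ) :: (i : ℤ) :: (X : ℤ) :: env) m
  have b3 := h3 ((i : ℤ) :: (X : ℤ) :: env) m
  have b4 := h4 ((X / (i + 1) : ℕ) :: (i : ℤ) :: (X : ℤ) :: env) m
  rw [Term.steps_sub] at b4
  have t1 : ((Term.var 0 / cubeTerm - .var 0 / topTerm).eval
      ((X / (i + 1) : ℕ) :: (i : ℤ) :: (X : ℤ) :: env) m).toNat ≤ r ^ 4 / (i + 1) := by
    simp only [Term.eval_sub, Term.eval_div, Term.eval_var, List.getD_cons_zero,
      eval_cubeTerm hr, eval_topTerm hr]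
    rw [← Int.natCast_div, ← Int.natCast_div, Int.toNat_sub]
    refine (Nat.sub_le _ _).trans ?_
    have : X / (i + 1) / r ^ 3 ≤ r ^ 4 / (i + 1) := by
      rw [Nat.div_div_eq_div_mul, mul_comm, ← Nat.div_div_eq_div_mul]
      apply Nat.div_le_div_right
      apply Nat.div_le_of_le_mul
      rw [← pow_add]
      exact hX
    exact this
  have t2 : ((cubeTerm - 1).eval ((X / (i + 1) : ℕ) :: (i : ℤ) :: (X : ℤ) :: env) m).toNat ≤
      r ^ 3 := by
    simp only [Term.eval_sub, eval_cubeTerm hr, Term.eval_one]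
    omega
  have hpos : 1 ≤ r ^ 3 := Nat.pow_pos hr1
  generalize r ^ 4 / (i + 1) = g at *
  generalize r ^ 3 = q at *
  have t3 := Nat.mul_le_mul_left C1 t1
  have t4 := Nat.mul_le_mul_left C2 t2
  have t5 : C1 ≤ C1 * q := Nat.le_mul_of_pos_right _ hpos
  have t6 : C2 ≤ C2 * q := Nat.le_mul_of_pos_right _ hpos
  have t7 : C3 + C4 + 6 ≤ (C3 + C4 + 6) * q := Nat.le_mul_of_pos_right _ hpos
  have e : (C1 + C1 + C2 + C2 + C3 + C4 + 6) * (q + g) = C1 * q + C1 * g + C1 * q + C1 * g +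
    C2 * q + C2 * q + (C3 + C4 + 6) * q + (C2 + C2 + C3 + C4 + 6) * g := by ring
  rw [mul_add, mul_one] at b1 b2
  rw [e, e1]
  omega

/-- The time for one value: the number of the innermost operations is at most
`r * r ^ 3 + ∑ i < r, r ^ 4 / (i + 1)`. -/
theorem fast_queryTerm : queryTerm.Fast Sized fun _ r => r ^ 4 := by
  obtain ⟨C, hC⟩ := steps_queryBody
  have h1 : (Term.ite (.var 0 - boundTerm) boundTerm (.var 0)).Flat :=
    Term.Flat.ite ((Term.Flat.var 0).sub flat_boundTerm) flat_boundTerm (.var 0)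
  have h2 : (Term.var 0 - topTerm).Flat := (Term.Flat.var 0).sub flat_topTerm
  have h3 : (Term.var 0 / topTerm).Flat := (Term.Flat.var 0).div flat_topTerm
  have h4 : (entry (.var 0)).Flat := (Term.Flat.var 0).entry
  obtain ⟨C1, h1⟩ := h1
  obtain ⟨C2, h2⟩ := h2
  obtain ⟨C3, h3⟩ := h3
  obtain ⟨C4, h4⟩ := h4
  refine ⟨C1 + C2 + C3 + C4 + 2 * C + 17, fun w env m r hs ⟨hr, hB, hr1⟩ hG => ?_⟩
  rw [queryTerm, Term.steps_letE]
  have b1 := h1 env m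
  set x := (Term.ite (.var 0 - boundTerm) boundTerm (.var 0)).eval env m with hx
  have hxB : x ≤ r ^ 7 := by
    rw [hx]
    change (if 0 < env.getD 0 0 - m (-1) then m (-1) else env.getD 0 0) ≤ _
    split_ifs with h
    · exact hB
    · linarith
  have b2 := h2 (x :: env) m
  have b3 := h3 (x :: env) m
  have b4 := h4 (x :: env) m
  generalize (Term.ite (.var 0 - boundTerm) boundTerm (.var 0)).steps env m = g at b1 ⊢
  rw [Term.steps_ite, Term.steps_sum]
  have hw : 1 ≤ w * r ^ 4 := Nat.mul_pos hs.1 hG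
  have key : (if 0 < (Term.var 0 - topTerm).eval (x :: env) m then
      (Term.var 0 / topTerm).steps (x :: env) m + 7 +
        ∑ i ∈ Finset.range ((Term.var 0 / topTerm).eval (x :: env) m).toNat,
          (queryBody.steps ((i : ℤ) :: x :: env) m + 6)
      else (entry (.var 0)).steps (x :: env) m) ≤ C3 + C4 + 7 + (2 * C + 6) * (w * r ^ 4) := by
    split_ifs with hc
    · simp only [Term.eval_sub, Term.eval_var, List.getD_cons_zero, eval_topTerm hr] at hc
      have hx0 : 0 ≤ x := by linarith [Int.natCast_nonneg (r ^ 6)]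
      obtain ⟨X, hX⟩ := Int.eq_ofNat_of_zero_le hx0
      have htrip : ((Term.var 0 / topTerm).eval (x :: env) m).toNat ≤ r := by
        simp only [Term.eval_div, Term.eval_var, List.getD_cons_zero, eval_topTerm hr]
        rw [hX, ← Int.natCast_div, Int.toNat_natCast]
        apply Nat.div_le_of_le_mul
        rw [hX] at hxB
        rw [← pow_succ]
        exact_mod_cast hxB
      have hrw : r ≤ 2 ^ w - 1 := by
        have := bitLength_le.1 (hs.2.2 (-2))
        rw [hr, abs_of_nonneg (by positivity)] at this
        have : r < 2 ^ w := by exact_mod_cast this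
        omega
      have hsum : ∑ i ∈ Finset.range ((Term.var 0 / topTerm).eval (x :: env) m).toNat,
          (queryBody.steps ((i : ℤ) :: x :: env) m + 6) ≤ (2 * C + 6) * (w * r ^ 4) := by
        calc _ ≤ ∑ i ∈ Finset.range ((Term.var 0 / topTerm).eval (x :: env) m).toNat,
              (C * (r ^ 3 + r ^ 4 / (i + 1)) + 6) :=
              Finset.sum_le_sum fun i _ =>
                Nat.add_le_add_right (hC i x env m r hr hr1 hx0 hxB) 6
          _ ≤ ∑ i ∈ Finset.range r, (C * (r ^ 3 + r ^ 4 / (i + 1)) + 6) :=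
              Finset.sum_le_sum_of_subset (Finset.range_subset_range.2 htrip)
          _ = C * r ^ 4 + C * ∑ i ∈ Finset.range r, r ^ 4 / (i + 1) + 6 * r := by
              rw [Finset.sum_add_distrib, ← Finset.mul_sum, Finset.sum_add_distrib]
              simp only [Finset.sum_const, Finset.card_range, smul_eq_mul]
              ring
          _ ≤ C * (w * r ^ 4) + C * (w * r ^ 4) + 6 * (w * r ^ 4) := by
              have t1 : r ^ 4 ≤ w * r ^ 4 := Nat.le_mul_of_pos_left _ hs.1
              have t2 : ∑ i ∈ Finset.range r, r ^ 4 / (i + 1) ≤ w * r ^ 4 := by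
                rw [mul_comm]
                exact (Finset.sum_le_sum_of_subset (Finset.range_subset_range.2 hrw)).trans
                  (sum_div_le _ _)
              have t3 : r ≤ r ^ 4 := Nat.le_self_pow (by norm_num) r
              exact Nat.add_le_add (Nat.add_le_add (Nat.mul_le_mul_left _ t1)
                (Nat.mul_le_mul_left _ t2)) (Nat.mul_le_mul_left _ (t3.trans t1))
          _ = _ := by ring
      omega
    · omega
  have e : (C1 + C2 + C3 + C4 + 2 * C + 17) * w * r ^ 4 =
    (C1 + C2 + C3 + C4 + 11) * (w * r ^ 4) + (2 * C + 6) * (w * r ^ 4) := by ring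
  have t : C1 + C2 + C3 + C4 + 11 ≤ (C1 + C2 + C3 + C4 + 11) * (w * r ^ 4) :=
    Nat.le_mul_of_pos_right _ hw
  rw [e]
  omega

/-! ### The contribution of a slab as a term -/

/-- The smaller end of the part of the interval `(l, h]` where `α * d ≤ β`. -/
def narrowLo (l α β : ℤ) : ℤ :=
  if 0 < -α then (if 0 < (-β - 1) / -α - l then (-β - 1) / -α else l) else l

/-- The larger end of the part of the interval `(l, h]` where `α * d ≤ β`. -/
def narrowHi (l h α β : ℤ) : ℤ :=
  if 0 < α then (if 0 < h - β / α then β / α else h)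
  else if 0 < -α then h else if 0 < β + 1 then h else l

theorem le_narrowLo (l α β : ℤ) : l ≤ narrowLo l α β := by
  unfold narrowLo; split_ifs <;> omega

/-- Within the interval from `l` to `h`, the narrowed ends describe the solutions of `α * d ≤ β`. -/
theorem narrow_iff (l h α β d : ℤ) :
    (narrowLo l α β < d ∧ d ≤ narrowHi l h α β) ↔ (l < d ∧ d ≤ h) ∧ α * d ≤ β := by
  unfold narrowLo narrowHi
  rcases lt_trichotomy α 0 with hα | rfl | hα
  · rw [if_pos (show 0 < -α by omega), if_neg (show ¬ 0 < α by omega),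
      if_pos (show 0 < -α by omega)]
    have h1 : α * d ≤ β ↔ (-β - 1) / -α < d := by
      rw [Int.ediv_lt_iff_lt_mul (by omega)]
      constructor <;> intro h <;> nlinarith
    rw [h1]
    generalize (-β - 1) / -α = q
    split_ifs <;> omega
  · simp only [neg_zero, lt_irrefl, if_false, zero_mul]
    split_ifs <;> omega
  · rw [if_neg (show ¬ 0 < -α by omega), if_pos hα]
    have h1 : α * d ≤ β ↔ d ≤ β / α := by
      rw [Int.le_ediv_iff_mul_le hα, mul_comm]
    rw [h1]
    split_ifs <;> omega

/-- The term for `narrowLo`. -/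
def narrowLoTerm (l α β : Term) : Term :=
  .ite (-α) (.ite ((-β - 1) / -α - l) ((-β - 1) / -α) l) l

/-- The term for `narrowHi`. -/
def narrowHiTerm (l h α β : Term) : Term :=
  .ite α (.ite (h - β / α) (β / α) h) (.ite (-α) h (.ite (β + 1) h l))

theorem eval_narrowLoTerm (l α β : Term) (env : List ℤ) (m : ℤ → ℤ) :
    (narrowLoTerm l α β).eval env m =
      narrowLo (l.eval env m) (α.eval env m) (β.eval env m) := by
  simp [narrowLoTerm, narrowLo]

theorem eval_narrowHiTerm (l h α β : Term) (env : List ℤ) (m : ℤ → ℤ) :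
    (narrowHiTerm l h α β).eval env m =
      narrowHi (l.eval env m) (h.eval env m) (α.eval env m) (β.eval env m) := by
  simp [narrowHiTerm, narrowHi]

section closure
variable {l h α β : Term}

theorem Term.PBd.narrowLo (hl : l.PBd) (hα : α.PBd) (hβ : β.PBd) : (narrowLoTerm l α β).PBd := by
  have h1 := ((hβ.neg).sub (.ofNat 1)).div hα.neg
  exact .ite hα.neg (.ite (h1.sub hl) h1 hl) hl

theorem Term.PBd.narrowHi (hl : l.PBd) (hh : h.PBd) (hα : α.PBd) (hβ : β.PBd) :
    (narrowHiTerm l h α β).PBd :=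
  .ite hα (.ite (hh.sub (hβ.div hα)) (hβ.div hα) hh) (.ite hα.neg hh (.ite (hβ.add (.ofNat 1)) hh hl))

theorem Term.Flat.narrowLo (hl : l.Flat) (hα : α.Flat) (hβ : β.Flat) :
    (narrowLoTerm l α β).Flat := by
  have h1 := ((hβ.neg).sub (.ofNat 1)).div hα.neg
  exact .ite hα.neg (.ite (h1.sub hl) h1 hl) hl

theorem Term.Flat.narrowHi (hl : l.Flat) (hh : h.Flat) (hα : α.Flat) (hβ : β.Flat) :
    (narrowHiTerm l h α β).Flat :=
  .ite hα (.ite (hh.sub (hβ.div hα)) (hβ.div hα) hh) (.ite hα.neg hh (.ite (hβ.add (.ofNat 1)) hh hl))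

end closure

/-- The term for `Slab.count`, where the divisor is the successor of the variable `0`, and the
variables `1, …, 6` give the slab. -/
def countTerm : Term :=
  let d : Term := .var 0 + 1
  let x₀ : Term := -(-.var 1 / (.var 3 * d))
  let n : Term := -(-.var 2 / (.var 3 * d)) - x₀
  .call (.cons (.ite n n 0) (.cons (.var 6 * d) (.cons (.var 4 * d)
    (.cons (.var 4 * d * x₀ + .var 5) .nil)))) linSumTerm

/-- Whether the origin belongs to the slab. -/
def originTerm : Term := .ite (1 - .var 1) (.ite (.var 2) (.ite (.var 5 + 1) 1 0) 0) 0

/-- The contribution of the divisors up to `r ^ 6` to `Slab.prim`. -/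
def nearTerm : Term :=
  .sum topTerm ((entry (.var 0 + 1) - entry (.var 0)) * (countTerm - originTerm))

/-- The contribution of a lattice point to the second sum of `Slab.prim`. The divisors for which the
multiple of the point belongs to the slab form an interval. -/
def farBody : Term :=
  let x : Term := .var 1 - rootTerm
  let y : Term := .var 0 - rootTerm
  let α₁ : Term := -(.var 4 * x)
  let β₁ : Term := -.var 2
  let α₂ : Term := .var 4 * x
  let β₂ : Term := .var 3 - 1
  let α₃ : Term := .var 7 * y - .var 5 * x
  let β₃ : Term := .var 6
  let l₁ : Term := narrowLoTerm topTerm α₁ β₁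
  let h₁ : Term := narrowHiTerm topTerm boundTerm α₁ β₁
  let l₂ : Term := narrowLoTerm l₁ α₂ β₂
  let h₂ : Term := narrowHiTerm l₁ h₁ α₂ β₂
  let l₃ : Term := narrowLoTerm l₂ α₃ β₃
  let h₃ : Term := narrowHiTerm l₂ h₂ α₃ β₃
  .ite (x * x + y * y) (.ite (h₃ - l₃)
    (.call (.cons h₃ .nil) queryTerm - .call (.cons l₃ .nil) queryTerm) 0) 0

/-- The second sum of `Slab.prim`. -/
def farTerm : Term := .sum (2 * rootTerm + 1) (.sum (2 * rootTerm + 1) farBody)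

/-- The term for `Slab.prim`, where the variables `0, …, 5` give the slab. -/
def primTerm : Term := nearTerm + farTerm

theorem mertens_sub {a b : ℕ} (h : a ≤ b) :
    ∑ d ∈ Finset.Ioc a b, ArithmeticFunction.moebius d = mertens b - mertens a := by
  rw [mertens, mertens, ← Finset.sum_Ioc_consecutive _ (Nat.zero_le a) h]
  ring

section eval
variable {m : ℤ → ℤ} {B r : ℕ} (S : Slab) (env : List ℤ)

theorem eval_countTerm (hm : 0 < S.m) (i : ℕ) :
    countTerm.eval ((i : ℤ) :: [S.lo, S.hi, S.Q, S.a, S.c, S.m] ++ env) m =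
      S.count ((i + 1 : ℕ) : ℤ) := by
  rw [countTerm, Term.eval_call]
  simp only [Terms.evals_cons, Terms.evals_nil, Term.eval_ite, Term.eval_neg, Term.eval_sub,
    Term.eval_div, Term.eval_mul, Term.eval_add, Term.eval_var, Term.eval_one, Term.eval_zero,
    List.cons_append, List.nil_append, List.getD_cons_zero, List.getD_cons_succ]
  set d : ℤ := (i : ℤ) + 1 with hd
  have hd' : ((i + 1 : ℕ) : ℤ) = d := by push_cast; rfl
  have hd0 : 0 < d := by positivity
  have h := eval_linSumTerm ((i : ℤ) :: S.lo :: S.hi :: S.Q :: S.a :: S.c :: S.m :: env) m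
    (n := if 0 < -(-S.hi / (S.Q * d)) - -(-S.lo / (S.Q * d)) then
      -(-S.hi / (S.Q * d)) - -(-S.lo / (S.Q * d)) else 0) (by split_ifs <;> omega)
    (mul_pos hm hd0) (S.a * d) (S.a * d * -(-S.lo / (S.Q * d)) + S.c)
  simp only [List.cons_append, List.nil_append] at h
  rw [h, linSum, Slab.count, hd']
  congr 2
  split_ifs <;> omega

theorem eval_originTerm (i : ℤ) :
    originTerm.eval (i :: [S.lo, S.hi, S.Q, S.a, S.c, S.m] ++ env) m = S.ind 0 := by
  simp only [originTerm, Slab.ind, Term.eval_ite, Term.eval_sub, Term.eval_add, Term.eval_var,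
    Term.eval_one, Term.eval_zero, List.cons_append, List.getD_cons_zero, List.getD_cons_succ,
    Prod.fst_zero, Prod.snd_zero, mul_zero, zero_add]
  split_ifs <;> first | rfl | omega

theorem eval_nearTerm (h : Table m B r) (hm : 0 < S.m) :
    nearTerm.eval ([S.lo, S.hi, S.Q, S.a, S.c, S.m] ++ env) m =
      ∑ d ∈ Finset.Ioc 0 (r ^ 6), ArithmeticFunction.moebius d * (S.count d - S.ind 0) := by
  rw [nearTerm, Term.eval_sum, eval_topTerm h.root, Int.toNat_natCast,
    ← sum_range_sub_eq_sum_Ioc _ (Nat.zero_le _), Nat.sub_zero]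
  refine Finset.sum_congr rfl fun i hi => ?_
  rw [Finset.mem_range] at hi
  rw [Term.eval_mul, Term.eval_sub, Term.eval_sub, eval_entry h (n := i + 1) (by simp) (by omega),
    eval_entry h (n := i) (by simp) (by omega), mertens_succ, ← List.cons_append,
    eval_countTerm S env hm, eval_originTerm]
  simp

theorem eval_farBody (h : Table m B r) (x' y' : ℕ) :
    farBody.eval ((y' : ℤ) :: (x' : ℤ) :: [S.lo, S.hi, S.Q, S.a, S.c, S.m] ++ env) m =
      if ((x' : ℤ) - r, (y' : ℤ) - r) = 0 then 0 else
        ∑ d ∈ Finset.Ioc (r ^ 6) B, ArithmeticFunction.moebius d *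
          S.ind (scale d ((x' : ℤ) - r, (y' : ℤ) - r)) := by
  have hB : ∀ env, boundTerm.eval env m = B := fun env => by simp [boundTerm, h.bound]
  simp only [farBody, Term.eval_ite, Term.eval_sub, Term.eval_call, Terms.evals_cons,
    Terms.evals_nil, eval_narrowLoTerm, eval_narrowHiTerm, Term.eval_add, Term.eval_mul,
    Term.eval_neg, eval_topTerm h.root, eval_rootTerm h.root, hB, Term.eval_var, Term.eval_one,
    Term.eval_zero, List.cons_append, List.nil_append, List.getD_cons_zero, List.getD_cons_succ]
  set x : ℤ := (x' : ℤ) - r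
  set y : ℤ := (y' : ℤ) - r
  have hxy : (x, y) = 0 ↔ ¬ 0 < x * x + y * y := by
    rw [Prod.ext_iff]
    simp only [Prod.fst_zero, Prod.snd_zero]
    constructor
    · rintro ⟨h1, h2⟩; simp [h1, h2]
    · intro h1; constructor <;> nlinarith [mul_self_nonneg x, mul_self_nonneg y]
  simp only [hxy]
  by_cases h0 : 0 < x * x + y * y
  swap
  · simp [h0]
  rw [if_pos h0, if_neg (not_not.2 h0)]
  set l₁ := narrowLo (r ^ 6 : ℕ) (-(S.Q * x)) (-S.lo) with hl₁
  set h₁ := narrowHi (r ^ 6 : ℕ) B (-(S.Q * x)) (-S.lo) with hh₁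
  set l₂ := narrowLo l₁ (S.Q * x) (S.hi - 1) with hl₂
  set h₂ := narrowHi l₁ h₁ (S.Q * x) (S.hi - 1) with hh₂
  set l₃ := narrowLo l₂ (S.m * y - S.a * x) S.c with hl₃
  set h₃ := narrowHi l₂ h₂ (S.m * y - S.a * x) S.c with hh₃
  have hiff : ∀ d : ℤ, (l₃ < d ∧ d ≤ h₃) ↔ ((((r ^ 6 : ℕ) < d ∧ d ≤ B) ∧ -(S.Q * x) * d ≤ -S.lo) ∧
      S.Q * x * d ≤ S.hi - 1) ∧ (S.m * y - S.a * x) * d ≤ S.c := by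
    intro d
    rw [hl₃, hh₃, narrow_iff, hl₂, hh₂, narrow_iff, hl₁, hh₁, narrow_iff]
  have hlow : ((r ^ 6 : ℕ) : ℤ) ≤ l₃ :=
    (le_narrowLo _ _ _).trans ((le_narrowLo _ _ _).trans (le_narrowLo _ _ _))
  have hind : ∀ d ∈ Finset.Ioc (r ^ 6) B, ArithmeticFunction.moebius d * S.ind (scale d (x, y)) =
      if l₃ < d ∧ (d : ℤ) ≤ h₃ then ArithmeticFunction.moebius d else 0 := by
    intro d hd
    rw [Finset.mem_Ioc] at hd
    have e : (S.lo ≤ S.Q * (d * x) ∧ S.Q * (d * x) < S.hi ∧ S.m * (d * y) ≤ S.a * (d * x) + S.c) ↔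
        l₃ < d ∧ (d : ℤ) ≤ h₃ := by
      rw [hiff]
      have h1 : ((r ^ 6 : ℕ) : ℤ) < d := by exact_mod_cast hd.1
      have h2 : (d : ℤ) ≤ B := by exact_mod_cast hd.2
      constructor
      · rintro ⟨g1, g2, g3⟩
        exact ⟨⟨⟨⟨h1, h2⟩, by linarith⟩, by linarith⟩, by linarith⟩
      · rintro ⟨⟨⟨-, g1⟩, g2⟩, g3⟩
        exact ⟨by linarith, by linarith, by linarith⟩
    simp only [Slab.ind, scale, e]
    split_ifs <;> simp
  rw [Finset.sum_congr rfl hind, ← Finset.sum_filter]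
  split_ifs with h1
  · have h2 := (hiff h₃).1 ⟨by omega, le_rfl⟩
    obtain ⟨L, hL⟩ := Int.eq_ofNat_of_zero_le (show 0 ≤ l₃ by omega)
    obtain ⟨N, hN⟩ := Int.eq_ofNat_of_zero_le (show 0 ≤ h₃ by omega)
    have hNB := h2.1.1.1.2
    rw [hN] at hNB h1
    rw [hL] at h1 hlow
    rw [hN, hL, eval_queryTerm h (by exact_mod_cast hNB),
      eval_queryTerm h (by omega), ← mertens_sub (by omega)]
    refine Finset.sum_congr ?_ fun _ _ => rfl
    ext d
    simp only [Finset.mem_filter, Finset.mem_Ioc]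
    omega
  · rw [Finset.filter_false_of_mem, Finset.sum_empty]
    intro d _ hd
    omega

theorem sum_box_erase (r : ℕ) (f : ℤ × ℤ → ℤ) : ∑ z ∈ (box r).erase 0, f z =
    ∑ x ∈ Finset.range (2 * r + 1), ∑ y ∈ Finset.range (2 * r + 1),
      if ((x : ℤ) - r, (y : ℤ) - r) = 0 then 0 else f ((x : ℤ) - r, (y : ℤ) - r) := by
  have h : ∀ g : ℤ → ℤ, ∑ x ∈ Finset.Icc (-(r : ℤ)) r, g x =
      ∑ x ∈ Finset.range (2 * r + 1), g ((x : ℤ) - r) := by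
    intro g
    refine Finset.sum_nbij' (fun x => (x + r).toNat) (fun x => (x : ℤ) - r) ?_ ?_ ?_ ?_ ?_ <;>
      simp only [Finset.mem_Icc, Finset.mem_range] <;> intro x hx
    · omega
    · omega
    · omega
    · omega
    · congr 1; omega
  have h0 : ∑ z ∈ (box r).erase 0, f z = ∑ z ∈ box r, if z = 0 then 0 else f z := by
    rw [← Finset.sum_filter_add_sum_filter_not (box r) (· = 0)]
    rw [Finset.sum_eq_zero (s := {z ∈ box r | z = 0}), zero_add]
    · rw [Finset.filter_ne' (box r) 0]
      exact Finset.sum_congr rfl fun z hz => (if_neg (Finset.ne_of_mem_erase hz)).symm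
    · intro z hz
      exact if_pos (Finset.mem_filter.1 hz).2
  rw [h0, box, Finset.sum_product, h]
  exact Finset.sum_congr rfl fun x _ => h _

theorem eval_primTerm (h : Table m B r) (hm : 0 < S.m) :
    primTerm.eval ([S.lo, S.hi, S.Q, S.a, S.c, S.m] ++ env) m = S.prim B r (r ^ 6) := by
  rw [primTerm, Term.eval_add, eval_nearTerm S env h hm, Slab.prim, sum_box_erase, farTerm,
    Term.eval_sum]
  congr 1
  have htrip : ∀ env, ((2 * rootTerm + 1).eval env m).toNat = 2 * r + 1 := by
    intro env
    simp only [Term.eval_add, Term.eval_mul, Term.eval_two, Term.eval_one, eval_rootTerm h.root]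
    omega
  rw [htrip]
  refine Finset.sum_congr rfl fun x _ => ?_
  rw [Term.eval_sum, htrip]
  refine Finset.sum_congr rfl fun y _ => ?_
  exact eval_farBody S env h x y

end eval

theorem pbd_countTerm : countTerm.PBd := by
  refine Term.PBd.call ?_ pbd_linSumTerm
  repeat' first
    | apply Term.PBd.var | apply Term.PBd.ofNat | apply Term.PBd.add | apply Term.PBd.sub
    | apply Term.PBd.neg | apply Term.PBd.mul | apply Term.PBd.div | apply Term.PBd.ite
    | apply Terms.PBds.cons | apply Terms.PBds.nil

theorem pbd_originTerm : originTerm.PBd := by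
  unfold originTerm
  repeat' first
    | apply Term.PBd.var | apply Term.PBd.ofNat | apply Term.PBd.add | apply Term.PBd.sub
    | apply Term.PBd.ite

theorem flat_originTerm : originTerm.Flat := by
  refine .ite (.sub (.ofNat 1) (.var 1)) (.ite (.var 2) (.ite (.add (.var 5) (.ofNat 1)) ?_ ?_) ?_) ?_
  all_goals apply Term.Flat.ofNat

theorem pbd_nearTerm : nearTerm.PBd := by
  unfold nearTerm
  repeat' first
    | apply pbd_topTerm | apply pbd_countTerm | apply pbd_originTerm | apply Term.PBd.entry
    | apply Term.PBd.var | apply Term.PBd.ofNat | apply Term.PBd.add | apply Term.PBd.sub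
    | apply Term.PBd.mul | apply Term.PBd.sum

theorem pbd_farTerm : farTerm.PBd := by
  unfold farTerm farBody
  repeat' first
    | apply pbd_topTerm | apply pbd_rootTerm | apply pbd_boundTerm | apply pbd_queryTerm
    | apply Term.PBd.narrowLo | apply Term.PBd.narrowHi | apply Term.PBd.call
    | apply Term.PBd.var | apply Term.PBd.ofNat | apply Term.PBd.add | apply Term.PBd.sub
    | apply Term.PBd.neg | apply Term.PBd.mul | apply Term.PBd.sum | apply Term.PBd.ite
    | apply Terms.PBds.cons | apply Terms.PBds.nil

theorem pbd_primTerm : primTerm.PBd := pbd_nearTerm.add pbd_farTerm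

theorem fast_countTerm {H : (ℤ → ℤ) → ℕ → Prop} {G : (ℤ → ℤ) → ℕ → ℕ} : countTerm.Fast H G := by
  refine Term.Fast.call ?_ ?_ fast_linSumTerm
  · repeat' first
      | apply Term.PBd.var | apply Term.PBd.ofNat | apply Term.PBd.add | apply Term.PBd.sub
      | apply Term.PBd.neg | apply Term.PBd.mul | apply Term.PBd.div | apply Term.PBd.ite
      | apply Terms.PBds.cons | apply Terms.PBds.nil
  · repeat' first
      | apply Term.Fast.var | apply Term.Fast.ofNat | apply Term.Fast.add | apply Term.Fast.sub
      | apply Term.Fast.neg | apply Term.Fast.mul | apply Term.Fast.ite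
      | apply Terms.Fasts.cons

theorem fast_nearTerm : nearTerm.Fast Sized fun _ r => r ^ 6 := by
  have hb : ((entry (.var 0 + 1) - entry (.var 0)) * (countTerm - originTerm)).Fast Sized
      fun _ _ => 1 := by
    refine .mul (.sub ?_ ?_) (.sub fast_countTerm flat_originTerm.fast)
    · exact (Term.Flat.entry (.add (.var 0) (.ofNat 1))).fast
    · exact (Term.Flat.entry (.var 0)).fast
  refine (Term.Fast.sum (q := fun _ r => r ^ 6) pbd_topTerm ⟨1, fun w env m r _ h => ?_⟩
    flat_topTerm.fast hb).mono fun m r _ h => ?_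
  · rw [eval_topTerm h.1, Int.toNat_natCast, one_mul]
  · simpa using h

/-- A lattice point needs two values of the Mertens function. -/
theorem fast_farBody : farBody.Fast Sized fun _ r => r ^ 4 := by
  have hx : (Term.var 1 - rootTerm).Flat := (Term.Flat.var 1).sub flat_rootTerm
  have hy : (Term.var 0 - rootTerm).Flat := (Term.Flat.var 0).sub flat_rootTerm
  have hx' : (Term.var 1 - rootTerm).PBd := (Term.PBd.var 1).sub pbd_rootTerm
  have hy' : (Term.var 0 - rootTerm).PBd := (Term.PBd.var 0).sub pbd_rootTerm
  have a1 := (Term.Flat.mul (.var 4) hx).neg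
  have b1 := (Term.Flat.var 2).neg
  have a2 := Term.Flat.mul (.var 4) hx
  have b2 := (Term.Flat.var 3).sub (.ofNat 1)
  have a3 := ((Term.Flat.var 7).mul hy).sub ((Term.Flat.var 5).mul hx)
  have b3 := Term.Flat.var 6
  have l1 := flat_topTerm.narrowLo a1 b1
  have h1 := flat_topTerm.narrowHi flat_boundTerm a1 b1
  have l2 := l1.narrowLo a2 b2
  have h2 := l1.narrowHi h1 a2 b2
  have l3 := l2.narrowLo a3 b3
  have h3 := l2.narrowHi h2 a3 b3
  have a1' := (Term.PBd.mul (.var 4) hx').neg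
  have b1' := (Term.PBd.var 2).neg
  have a2' := Term.PBd.mul (.var 4) hx'
  have b2' := (Term.PBd.var 3).sub (.ofNat 1)
  have a3' := ((Term.PBd.var 7).mul hy').sub ((Term.PBd.var 5).mul hx')
  have b3' := Term.PBd.var 6
  have l1' := pbd_topTerm.narrowLo a1' b1'
  have h1' := pbd_topTerm.narrowHi pbd_boundTerm a1' b1'
  have l2' := l1'.narrowLo a2' b2'
  have h2' := l1'.narrowHi h1' a2' b2'
  have l3' := l2'.narrowLo a3' b3'
  have h3' := l2'.narrowHi h2' a3' b3'
  exact .ite ((hx.mul hx).add (hy.mul hy)).fast (.ite (h3.sub l3).fast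
    (.sub (.call (.cons h3' .nil) (.cons h3.fast .nil) fast_queryTerm)
      (.call (.cons l3' .nil) (.cons l3.fast .nil) fast_queryTerm)) (.ofNat 0)) (.ofNat 0)

theorem fast_farTerm : farTerm.Fast Sized fun _ r => r ^ 6 := by
  have hp : (2 * rootTerm + 1).PBd := ((Term.PBd.ofNat 2).mul pbd_rootTerm).add (.ofNat 1)
  have hf : (2 * rootTerm + 1).Flat := ((Term.Flat.ofNat 2).mul flat_rootTerm).add (.ofNat 1)
  have hq : ∃ k, ∀ w env m r, Small w env m → Sized m r →
      ((2 * rootTerm + 1).eval env m).toNat ≤ k * r := by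
    refine ⟨3, fun w env m r _ h => ?_⟩
    have := h.2.2
    simp only [Term.eval_add, Term.eval_mul, Term.eval_two, Term.eval_one, eval_rootTerm h.1]
    omega
  have h1 := Term.Fast.sum (q := fun _ r => r) hp hq hf.fast fast_farBody
  have h2 := Term.Fast.sum (q := fun _ r => r) hp hq hf.fast h1
  refine h2.mono fun m r _ h => ?_
  have e : r * (r * r ^ 4) = r ^ 6 := by ring
  exact ⟨by rw [e]; exact h, e.le⟩

theorem fast_primTerm : primTerm.Fast Sized fun _ r => r ^ 6 := fast_nearTerm.add fast_farTerm

end Ram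

/-! ### Primitive points of a rational polygon -/

/-- The point of the plane with the given rational coordinates. -/
noncomputable def ratPoint (u : ℚ × ℚ) : Plane := !₂[(u.1 : ℝ), (u.2 : ℝ)]

/-- A lattice point as a point of the plane. -/
noncomputable def latticePoint (z : ℤ × ℤ) : Plane := !₂[(z.1 : ℝ), (z.2 : ℝ)]

@[simp] theorem ratPoint_zero (u : ℚ × ℚ) : ratPoint u 0 = u.1 := rfl
@[simp] theorem ratPoint_one (u : ℚ × ℚ) : ratPoint u 1 = u.2 := rfl
@[simp] theorem latticePoint_zero (z : ℤ × ℤ) : latticePoint z 0 = z.1 := rfl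
@[simp] theorem latticePoint_one (z : ℤ × ℤ) : latticePoint z 1 = z.2 := rfl

theorem plane_ext {p q : Plane} (h0 : p 0 = q 0) (h1 : p 1 = q 1) : p = q := by
  ext j
  fin_cases j
  · exact h0
  · exact h1

/-- The lattice points below the segment from `(xa / Q, ya / Q)` to `(xb / Q, yb / Q)`, without
those below the right endpoint. -/
def Slab.trap (Q xa ya xb yb : ℤ) : Slab :=
  ⟨xa, xb, Q, Q * (yb - ya), ya * (xb - xa) - xa * (yb - ya), Q * (xb - xa)⟩

/-- Two slabs (for `t = 0` and `t = 1`) whose difference is the segment from `(xa / Q, ya / Q)` to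
`(xb / Q, yb / Q)` without its endpoints. -/
def Slab.edge (Q xa ya xb yb t : ℤ) : Slab :=
  if xa < xb then
    ⟨xa + 1, xb, Q, Q * (yb - ya), ya * (xb - xa) - xa * (yb - ya) - t, Q * (xb - xa)⟩
  else ⟨xa, xa + 1, Q, 0, if t = 0 then yb - 1 else ya, Q⟩

/-- Two slabs (for `t = 0` and `t = 1`) whose difference is the point `(n / d, n' / d')`. -/
def Slab.point (n d n' d' t : ℤ) : Slab := ⟨n, n + 1, d, 0, n' - t, d'⟩

/-- Two slabs with the same strip: their difference is a set of points whose primitive points are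
counted. -/
theorem Slab.prim_sub {B r T : ℕ} (hrT : B ≤ r * T) {S S' : Slab} (hlo : S.lo = S'.lo)
    (hhi : S.hi = S'.hi) (hQ : S.Q = S'.Q) (hQ0 : 0 < S.Q) (hm : 0 < S.m) (hm' : 0 < S'.m)
    (hV : ∀ z, S.ind z - S'.ind z ≠ 0 → z ∈ box B) :
    S.prim B r T - S'.prim B r T =
      ∑ z ∈ box B with Int.gcd z.1 z.2 = 1, (S.ind z - S'.ind z) := by
  have h := Slab.sum_prim (s := Finset.univ) (S := fun i : Bool => if i then S else S')
    (w := fun i => if i then 1 else -1) hrT (by simp [← hQ, hQ0]) (by simp [hm, hm'])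
    (by
      intro x
      simp only [Slab.strip, Fintype.sum_bool, if_true, Bool.false_eq_true, if_false, hlo, hhi, hQ]
      ring) (by
      intro z hz
      apply hV
      simpa [← sub_eq_add_neg] using hz)
  simpa [← sub_eq_add_neg] using h

section segment
variable {a b : Plane}

theorem mem_openSegment_of_lt (h : a 0 < b 0) {p : Plane} :
    p ∈ openSegment ℝ a b ↔ a 0 < p 0 ∧ p 0 < b 0 ∧ p 1 = lineHeight a b (p 0) := by
  rw [mem_openSegment_iff]
  have hd : 0 < b 0 - a 0 := by linarith
  constructor
  · rintro ⟨t, h0, h1, rfl⟩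
    simp only [PiLp.add_apply, PiLp.smul_apply, PiLp.sub_apply, smul_eq_mul, lineHeight]
    refine ⟨by nlinarith, by nlinarith, ?_⟩
    field_simp
    ring
  · rintro ⟨h1, h2, h3⟩
    refine ⟨(p 0 - a 0) / (b 0 - a 0), div_pos (by linarith) hd,
      (div_lt_one hd).2 (by linarith), plane_ext ?_ ?_⟩
    · simp only [PiLp.add_apply, PiLp.smul_apply, PiLp.sub_apply, smul_eq_mul]
      field_simp; ring
    · simp only [PiLp.add_apply, PiLp.smul_apply, PiLp.sub_apply, smul_eq_mul]
      rw [h3, lineHeight]; field_simp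

theorem mem_openSegment_of_eq (h : a 0 = b 0) (h' : a 1 < b 1) {p : Plane} :
    p ∈ openSegment ℝ a b ↔ p 0 = a 0 ∧ a 1 < p 1 ∧ p 1 < b 1 := by
  rw [mem_openSegment_iff]
  have hd : 0 < b 1 - a 1 := by linarith
  constructor
  · rintro ⟨t, h0, h1, rfl⟩
    simp only [PiLp.add_apply, PiLp.smul_apply, PiLp.sub_apply, smul_eq_mul, ← h, sub_self,
      mul_zero, add_zero, true_and]
    exact ⟨by nlinarith, by nlinarith⟩
  · rintro ⟨h1, h2, h3⟩
    refine ⟨(p 1 - a 1) / (b 1 - a 1), div_pos (by linarith) hd,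
      (div_lt_one hd).2 (by linarith), plane_ext ?_ ?_⟩
    · simp [h1, ← h]
    · simp only [PiLp.add_apply, PiLp.smul_apply, PiLp.sub_apply, smul_eq_mul]
      field_simp; ring

variable {Q xa ya xb yb : ℤ} (hQ : 0 < Q) (hxa : (xa : ℝ) = Q * a 0) (hya : (ya : ℝ) = Q * a 1)
  (hxb : (xb : ℝ) = Q * b 0) (hyb : (yb : ℝ) = Q * b 1)
include hQ hxa hxb

theorem cast_lt_iff : xa < xb ↔ a 0 < b 0 := by
  have hQ' : (0 : ℝ) < Q := by exact_mod_cast hQ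
  rw [← Int.cast_lt (R := ℝ), hxa, hxb, mul_lt_mul_iff_right₀ hQ']

theorem trap_strip (x : ℤ) : (Slab.trap Q xa ya xb yb).strip x =
    if a 0 ≤ x ∧ (x : ℝ) < b 0 then 1 else 0 := by
  have hQ' : (0 : ℝ) < Q := by exact_mod_cast hQ
  have h1 : xa ≤ Q * x ↔ a 0 ≤ x := by
    rw [← Int.cast_le (R := ℝ), hxa, Int.cast_mul, mul_le_mul_iff_right₀ hQ']
  have h2 : Q * x < xb ↔ (x : ℝ) < b 0 := by
    rw [← Int.cast_lt (R := ℝ), hxb, Int.cast_mul, mul_lt_mul_iff_right₀ hQ']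
  simp only [Slab.strip, Slab.trap, h1, h2]

include hya hyb

theorem line_eq (x y : ℝ) (h : a 0 < b 0) :
    (Q * (xb - xa) : ℝ) * y - ((Q * (yb - ya)) * x + (ya * (xb - xa) - xa * (yb - ya))) =
      (Q : ℝ) ^ 2 * (b 0 - a 0) * (y - lineHeight a b x) := by
  have hd : b 0 - a 0 ≠ 0 := by linarith
  rw [hxa, hya, hxb, hyb, lineHeight]
  field_simp
  ring

theorem trap_ind (h : a 0 < b 0) (z : ℤ × ℤ) : (Slab.trap Q xa ya xb yb).ind z =
    if a 0 ≤ z.1 ∧ (z.1 : ℝ) < b 0 ∧ (z.2 : ℝ) ≤ lineHeight a b z.1 then 1 else 0 := by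
  have hQ' : (0 : ℝ) < Q := by exact_mod_cast hQ
  have h1 : xa ≤ Q * z.1 ↔ a 0 ≤ z.1 := by
    rw [← Int.cast_le (R := ℝ), hxa, Int.cast_mul, mul_le_mul_iff_right₀ hQ']
  have h2 : Q * z.1 < xb ↔ (z.1 : ℝ) < b 0 := by
    rw [← Int.cast_lt (R := ℝ), hxb, Int.cast_mul, mul_lt_mul_iff_right₀ hQ']
  have h3 : Q * (xb - xa) * z.2 ≤ Q * (yb - ya) * z.1 + (ya * (xb - xa) - xa * (yb - ya)) ↔
      (z.2 : ℝ) ≤ lineHeight a b z.1 := by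
    have e := line_eq hQ hxa hya hxb hyb z.1 z.2 h
    have hpos : 0 < (Q : ℝ) ^ 2 * (b 0 - a 0) := mul_pos (by positivity) (by linarith)
    rw [← Int.cast_le (R := ℝ), ← sub_nonpos]
    push_cast
    rw [e, ← sub_nonpos (b := lineHeight a b z.1)]
    constructor
    · intro h; by_contra h'
      have := mul_pos hpos (not_le.1 h'); linarith
    · intro h; exact mul_nonpos_of_nonneg_of_nonpos hpos.le h
  simp only [Slab.ind, Slab.trap, h1, h2, h3]

open Classical in
theorem edge_ind (h : a 0 < b 0 ∨ (a 0 = b 0 ∧ a 1 < b 1)) (z : ℤ × ℤ) :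
    (Slab.edge Q xa ya xb yb 0).ind z - (Slab.edge Q xa ya xb yb 1).ind z =
      if latticePoint z ∈ openSegment ℝ a b then 1 else 0 := by
  have hQ' : (0 : ℝ) < Q := by exact_mod_cast hQ
  rcases h with h | ⟨h, h'⟩
  · have hlt := (cast_lt_iff hQ hxa hxb).2 h
    have h1 : xa + 1 ≤ Q * z.1 ↔ a 0 < z.1 := by
      rw [Int.add_one_le_iff, ← Int.cast_lt (R := ℝ), hxa, Int.cast_mul, mul_lt_mul_iff_right₀ hQ']
    have h2 : Q * z.1 < xb ↔ (z.1 : ℝ) < b 0 := by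
      rw [← Int.cast_lt (R := ℝ), hxb, Int.cast_mul, mul_lt_mul_iff_right₀ hQ']
    have h3 : Q * (xb - xa) * z.2 = Q * (yb - ya) * z.1 + (ya * (xb - xa) - xa * (yb - ya)) ↔
        (z.2 : ℝ) = lineHeight a b z.1 := by
      have e := line_eq hQ hxa hya hxb hyb z.1 z.2 h
      have hpos : 0 < (Q : ℝ) ^ 2 * (b 0 - a 0) := mul_pos (by positivity) (by linarith)
      rw [← Int.cast_inj (α := ℝ), ← sub_eq_zero]
      push_cast
      rw [e, ← sub_eq_zero (b := lineHeight a b z.1)]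
      constructor
      · intro h; exact (mul_eq_zero.1 h).resolve_left hpos.ne'
      · intro h; rw [h, mul_zero]
    rw [mem_openSegment_of_lt h, latticePoint_zero, latticePoint_one, ← h1, ← h2, ← h3]
    simp only [Slab.edge, if_pos hlt, Slab.ind]
    generalize Q * (xb - xa) * z.2 = L
    generalize Q * (yb - ya) * z.1 = R
    generalize ya * (xb - xa) - xa * (yb - ya) = c
    split_ifs <;> omega
  · have hlt : ¬ xa < xb := by rw [cast_lt_iff hQ hxa hxb, h]; exact lt_irrefl _
    have h1 : Q * z.1 = xa ↔ (z.1 : ℝ) = a 0 := by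
      rw [← Int.cast_inj (α := ℝ), hxa, Int.cast_mul, mul_right_inj' hQ'.ne']
    have h2 : ya < Q * z.2 ↔ a 1 < z.2 := by
      rw [← Int.cast_lt (R := ℝ), hya, Int.cast_mul, mul_lt_mul_iff_right₀ hQ']
    have h3 : Q * z.2 < yb ↔ (z.2 : ℝ) < b 1 := by
      rw [← Int.cast_lt (R := ℝ), hyb, Int.cast_mul, mul_lt_mul_iff_right₀ hQ']
    have h4 : ya < yb := by
      rw [← Int.cast_lt (R := ℝ), hya, hyb, mul_lt_mul_iff_right₀ hQ']; exact h'
    rw [mem_openSegment_of_eq h h', latticePoint_zero, latticePoint_one, ← h1, ← h2, ← h3]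
    simp only [Slab.edge, if_neg hlt, Slab.ind]
    generalize Q * z.1 = X
    generalize Q * z.2 = Y
    split_ifs <;> omega

end segment

theorem point_ind {n d n' d' : ℤ} (hd : 0 < d) (hd' : 0 < d') {p : Plane} (h0 : (n : ℝ) = d * p 0)
    (h1 : (n' : ℝ) = d' * p 1) (z : ℤ × ℤ) [Decidable (latticePoint z = p)] :
    (Slab.point n d n' d' 0).ind z - (Slab.point n d n' d' 1).ind z =
      if latticePoint z = p then 1 else 0 := by
  have hd0 : (d : ℝ) ≠ 0 := by exact_mod_cast hd.ne'
  have hd0' : (d' : ℝ) ≠ 0 := by exact_mod_cast hd'.ne'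
  have e0 : d * z.1 = n ↔ (z.1 : ℝ) = p 0 := by
    rw [← Int.cast_inj (α := ℝ), h0, Int.cast_mul, mul_right_inj' hd0]
  have e1 : d' * z.2 = n' ↔ (z.2 : ℝ) = p 1 := by
    rw [← Int.cast_inj (α := ℝ), h1, Int.cast_mul, mul_right_inj' hd0']
  have e : latticePoint z = p ↔ d * z.1 = n ∧ d' * z.2 = n' := by
    rw [e0, e1]
    exact ⟨fun h => by rw [← h]; exact ⟨rfl, rfl⟩, fun h => plane_ext h.1 h.2⟩
  by_cases hp : latticePoint z = p
  · rw [if_pos hp]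
    rw [e] at hp
    simp only [Slab.point, Slab.ind, sub_zero, hp.1, hp.2]
    split_ifs <;> omega
  · rw [if_neg hp]
    rw [e] at hp
    simp only [Slab.point, Slab.ind, sub_zero]
    split_ifs <;> omega

/-- The common denominator of the coordinates of two points. -/
def commonDen (u v : ℚ × ℚ) : ℤ := u.1.den * u.2.den * (v.1.den * v.2.den)

/-- The abscissa of `u`, multiplied by `commonDen u v`. -/
def scaledX (u v : ℚ × ℚ) : ℤ := u.1.num * u.2.den * (v.1.den * v.2.den)

/-- The ordinate of `u`, multiplied by `commonDen u v`. -/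
def scaledY (u v : ℚ × ℚ) : ℤ := u.1.den * u.2.num * (v.1.den * v.2.den)

theorem commonDen_comm (u v : ℚ × ℚ) : commonDen u v = commonDen v u := mul_comm _ _

theorem commonDen_pos (u v : ℚ × ℚ) : 0 < commonDen u v := by
  have := u.1.den_pos; have := u.2.den_pos; have := v.1.den_pos; have := v.2.den_pos
  unfold commonDen; positivity

theorem num_eq_den_mul (q : ℚ) : (q.num : ℝ) = q.den * q := by
  have h : (q.num : ℚ) = q.den * q := (Rat.den_mul_eq_num q).symm
  exact_mod_cast h

theorem scaledX_eq (u v : ℚ × ℚ) : (scaledX u v : ℝ) = commonDen u v * ratPoint u 0 := by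
  simp only [scaledX, commonDen, ratPoint_zero]
  push_cast
  rw [num_eq_den_mul]; ring

theorem scaledY_eq (u v : ℚ × ℚ) : (scaledY u v : ℝ) = commonDen u v * ratPoint u 1 := by
  simp only [scaledY, commonDen, ratPoint_one]
  push_cast
  rw [num_eq_den_mul]; ring

/-- The rational version of `descent`. -/
def ratDescent (u v : ℚ × ℚ) : ℤ := if v.1 < u.1 ∨ (v.1 = u.1 ∧ v.2 < u.2) then 1 else 0

theorem descent_ratPoint (u v : ℚ × ℚ) : descent (ratPoint u) (ratPoint v) = ratDescent u v := by
  simp only [descent, ratDescent, ratPoint_zero, ratPoint_one, Rat.cast_lt, Rat.cast_inj]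

/-- The determinant of the directions of two consecutive edges. -/
def ratTurn (u v w : ℚ × ℚ) : ℚ :=
  (v.1 - u.1) * (w.2 - v.2) - (v.2 - u.2) * (w.1 - v.1)

/-- The rational version of `vertexDescent`. -/
def ratVertexDescent (u v w : ℚ × ℚ) : ℤ :=
  if 0 ≤ ratTurn u v w then min (ratDescent u v) (ratDescent v w)
  else max (ratDescent u v) (ratDescent v w)

theorem vertexDescent_ratPoint (u v w : ℚ × ℚ) :
    vertexDescent (ratPoint u) (ratPoint v) (ratPoint w) = ratVertexDescent u v w := by
  have h : det2 (ratPoint v - ratPoint u) (ratPoint w - ratPoint v) = (ratTurn u v w : ℝ) := by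
    simp only [det2, PiLp.sub_apply, ratPoint_zero, ratPoint_one, ratTurn]; push_cast; ring
  simp only [vertexDescent, ratVertexDescent, h, descent_ratPoint, Rat.cast_nonneg]

/-- The lexicographically smaller endpoint. -/
def lexMin (u v : ℚ × ℚ) : ℚ × ℚ := if 0 < ratDescent u v then v else u

/-- The lexicographically larger endpoint. -/
def lexMax (u v : ℚ × ℚ) : ℚ × ℚ := if 0 < ratDescent u v then u else v

/-- The slab below an edge. -/
def trapSlab (u v : ℚ × ℚ) : Slab :=
  .trap (commonDen u v) (scaledX (lexMin u v) (lexMax u v)) (scaledY (lexMin u v) (lexMax u v))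
    (scaledX (lexMax u v) (lexMin u v)) (scaledY (lexMax u v) (lexMin u v))

/-- The slabs whose difference is an edge without its endpoints. -/
def edgeSlab (u v : ℚ × ℚ) (t : ℤ) : Slab :=
  .edge (commonDen u v) (scaledX (lexMin u v) (lexMax u v)) (scaledY (lexMin u v) (lexMax u v))
    (scaledX (lexMax u v) (lexMin u v)) (scaledY (lexMax u v) (lexMin u v)) t

/-- The slabs whose difference is a point. -/
def pointSlab (v : ℚ × ℚ) (t : ℤ) : Slab := .point v.1.num v.1.den v.2.num v.2.den t

theorem lex_lt {u v : ℚ × ℚ} (h : u ≠ v) : (lexMin u v).1 < (lexMax u v).1 ∨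
    ((lexMin u v).1 = (lexMax u v).1 ∧ (lexMin u v).2 < (lexMax u v).2) := by
  unfold lexMin lexMax ratDescent
  split_ifs with h1 h2 h2
  · exact h1
  · simp at h2
  · simp at h2
  · rcases lt_trichotomy u.1 v.1 with h3 | h3 | h3
    · exact Or.inl h3
    · rcases lt_trichotomy u.2 v.2 with h4 | h4 | h4
      · exact Or.inr ⟨h3, h4⟩
      · exact absurd (Prod.ext h3 h4) h
      · exact absurd (Or.inr ⟨h3.symm, h4⟩) h1
    · exact absurd (Or.inl h3) h1

theorem commonDen_lex (u v : ℚ × ℚ) :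
    commonDen (lexMin u v) (lexMax u v) = commonDen u v := by
  unfold lexMin lexMax
  split_ifs
  · exact commonDen_comm _ _
  · rfl

section slabs
variable (u v : ℚ × ℚ)

theorem scaled_lex :
    (scaledX (lexMin u v) (lexMax u v) : ℝ) = commonDen u v * ratPoint (lexMin u v) 0 ∧
    (scaledY (lexMin u v) (lexMax u v) : ℝ) = commonDen u v * ratPoint (lexMin u v) 1 ∧
    (scaledX (lexMax u v) (lexMin u v) : ℝ) = commonDen u v * ratPoint (lexMax u v) 0 ∧
    (scaledY (lexMax u v) (lexMin u v) : ℝ) = commonDen u v * ratPoint (lexMax u v) 1 := by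
  rw [← commonDen_lex u v]
  refine ⟨scaledX_eq _ _, scaledY_eq _ _, ?_, ?_⟩
  · rw [commonDen_comm]; exact scaledX_eq _ _
  · rw [commonDen_comm]; exact scaledY_eq _ _

open Classical in
theorem trapSlab_strip (x : ℤ) : (1 - 2 * ratDescent u v) *
    (if (lexMin u v).1 < (lexMax u v).1 then (trapSlab u v).strip x else 0) =
      (if u.1 ≤ x then 1 else 0) - (if v.1 ≤ x then 1 else 0) := by
  obtain ⟨h1, h2, h3, h4⟩ := scaled_lex u v
  rw [trapSlab, trap_strip (commonDen_pos u v) h1 h3]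
  have e : ∀ a : ℚ, ((a : ℝ) ≤ x ↔ a ≤ x) := fun a => by exact_mod_cast Iff.rfl
  have e' : ∀ a : ℚ, ((x : ℝ) < a ↔ (x : ℚ) < a) := fun a => by exact_mod_cast Iff.rfl
  simp only [ratPoint_zero, e, e', lexMin, lexMax, ratDescent]
  split_ifs <;> first | rfl | grind

theorem trapSlab_ind (z : ℤ × ℤ) : (1 - 2 * ratDescent u v) *
    (if (lexMin u v).1 < (lexMax u v).1 then (trapSlab u v).ind z else 0) =
      crossing (ratPoint u) (ratPoint v) (latticePoint z) := by
  obtain ⟨h1, h2, h3, h4⟩ := scaled_lex u v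
  have hline : ∀ x, u.1 ≠ v.1 → lineHeight (ratPoint v) (ratPoint u) x =
      lineHeight (ratPoint u) (ratPoint v) x := by
    intro x h
    have h5 : (u.1 : ℝ) - v.1 ≠ 0 := sub_ne_zero.2 (by exact_mod_cast h)
    have h6 : (v.1 : ℝ) - u.1 ≠ 0 := sub_ne_zero.2 (by exact_mod_cast h.symm)
    simp only [lineHeight, ratPoint_zero, ratPoint_one]
    field_simp
    ring
  have ha : ∀ a : ℚ, ((a : ℝ) ≤ z.1 ↔ a ≤ z.1) := fun a => by exact_mod_cast Iff.rfl
  have ha' : ∀ a : ℚ, ((z.1 : ℝ) < a ↔ (z.1 : ℚ) < a) := fun a => by exact_mod_cast Iff.rfl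
  by_cases hlt : (lexMin u v).1 < (lexMax u v).1
  · rw [if_pos hlt, trapSlab, trap_ind (commonDen_pos u v) h1 h2 h3 h4
      (by simpa only [ratPoint_zero, Rat.cast_lt] using hlt), crossing, latticePoint_zero,
      latticePoint_one]
    simp only [ratPoint_zero, ha, ha']
    rcases lt_trichotomy u.1 v.1 with h5 | h5 | h5
    · have h6 : ratDescent u v = 0 := by simp [ratDescent, h5.not_gt, h5.ne']
      have h7 : lexMin u v = u := by simp [lexMin, h6]
      have h8 : lexMax u v = v := by simp [lexMax, h6]
      rw [h6, h7, h8]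
      split_ifs <;> first | rfl | grind
    · exfalso
      unfold lexMin lexMax at hlt
      split_ifs at hlt <;> simp [h5] at hlt
    · have h6 : ratDescent u v = 1 := by simp [ratDescent, h5]
      have h7 : lexMin u v = v := by simp [lexMin, h6]
      have h8 : lexMax u v = u := by simp [lexMax, h6]
      rw [h6, h7, h8, hline _ h5.ne']
      split_ifs <;> first | rfl | grind
  · have h5 : u.1 = v.1 := by
      unfold lexMin lexMax ratDescent at hlt
      split_ifs at hlt <;> first | simp_all; done | grind
    rw [if_neg hlt, crossing]
    simp [h5]

open Classical in
theorem edgeSlab_ind (h : u ≠ v) (z : ℤ × ℤ) : (edgeSlab u v 0).ind z - (edgeSlab u v 1).ind z =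
    if latticePoint z ∈ openSegment ℝ (ratPoint u) (ratPoint v) then 1 else 0 := by
  obtain ⟨h1, h2, h3, h4⟩ := scaled_lex u v
  rw [edgeSlab, edgeSlab, edge_ind (commonDen_pos u v) h1 h2 h3 h4 (by
    simpa only [ratPoint_zero, ratPoint_one, Rat.cast_lt, Rat.cast_inj] using lex_lt h)]
  have : openSegment ℝ (ratPoint (lexMin u v)) (ratPoint (lexMax u v)) =
      openSegment ℝ (ratPoint u) (ratPoint v) := by
    unfold lexMin lexMax
    split_ifs
    · exact openSegment_symm _ _ _
    · rfl
  rw [this]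

open Classical in
theorem pointSlab_ind (z : ℤ × ℤ) : (pointSlab v 0).ind z - (pointSlab v 1).ind z =
    if latticePoint z = ratPoint v then 1 else 0 := by
  rw [pointSlab, pointSlab, point_ind (p := ratPoint v) (by exact_mod_cast v.1.den_pos)
    (by exact_mod_cast v.2.den_pos)]
  · simp only [ratPoint_zero]; exact_mod_cast num_eq_den_mul v.1
  · simp only [ratPoint_one]; exact_mod_cast num_eq_den_mul v.2

end slabs

theorem edgeSlab_m_pos (u v : ℚ × ℚ) (t : ℤ) : 0 < (edgeSlab u v t).m := by
  unfold edgeSlab Slab.edge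
  have := commonDen_pos u v
  split_ifs with h
  · exact mul_pos this (by linarith)
  all_goals exact this

theorem edgeSlab_Q (u v : ℚ × ℚ) (t : ℤ) : (edgeSlab u v t).Q = commonDen u v := by
  unfold edgeSlab Slab.edge; split_ifs <;> rfl

theorem trapSlab_m_pos {u v : ℚ × ℚ} (h : (lexMin u v).1 < (lexMax u v).1) :
    0 < (trapSlab u v).m := by
  obtain ⟨h1, h2, h3, h4⟩ := scaled_lex u v
  have := (cast_lt_iff (commonDen_pos u v) h1 h3).2
    (by simpa only [ratPoint_zero, Rat.cast_lt] using h)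
  exact mul_pos (commonDen_pos u v) (by linarith)

section prims
variable (B r T : ℕ) (u v : ℚ × ℚ)

/-- The contribution of an edge to the signed number of primitive points. -/
noncomputable def trapPrim : ℤ :=
  if (lexMin u v).1 < (lexMax u v).1 then (trapSlab u v).prim B r T else 0

/-- The number of primitive points on an edge without its endpoints. -/
noncomputable def edgePrim : ℤ := (edgeSlab u v 0).prim B r T - (edgeSlab u v 1).prim B r T

/-- `1` for a primitive lattice point, else `0`. -/
noncomputable def pointPrim : ℤ := (pointSlab v 0).prim B r T - (pointSlab v 1).prim B r T

variable {B r T u v}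

theorem mem_box_of_abs {z : ℤ × ℤ} (h0 : |latticePoint z 0| ≤ B) (h1 : |latticePoint z 1| ≤ B) :
    z ∈ box B := by
  rw [mem_box]
  simp only [latticePoint_zero, latticePoint_one] at h0 h1
  exact ⟨by exact_mod_cast h0, by exact_mod_cast h1⟩

theorem abs_le_of_mem_segment {a b p : Plane} {M : ℝ} (j : Fin 2) (ha : |a j| ≤ M) (hb : |b j| ≤ M)
    (hp : p ∈ segment ℝ a b) : |p j| ≤ M := by
  rw [segment_eq_image'] at hp
  obtain ⟨t, ⟨h0, h1⟩, rfl⟩ := hp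
  have e : (a + t • (b - a)) j = (1 - t) * a j + t * b j := by
    simp only [PiLp.add_apply, PiLp.smul_apply, PiLp.sub_apply, smul_eq_mul]; ring
  rw [e]
  rw [abs_le] at *
  constructor <;> nlinarith

open Classical in
theorem edgePrim_eq (hrT : B ≤ r * T) (huv : u ≠ v)
    (hu : |ratPoint u 0| ≤ B ∧ |ratPoint u 1| ≤ B) (hv : |ratPoint v 0| ≤ B ∧ |ratPoint v 1| ≤ B) :
    edgePrim B r T u v = ∑ z ∈ box B with Int.gcd z.1 z.2 = 1,
      if latticePoint z ∈ openSegment ℝ (ratPoint u) (ratPoint v) then 1 else 0 := by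
  rw [edgePrim, Slab.prim_sub hrT]
  · exact Finset.sum_congr rfl fun z _ => edgeSlab_ind u v huv z
  · unfold edgeSlab Slab.edge; split_ifs <;> rfl
  · unfold edgeSlab Slab.edge; split_ifs <;> rfl
  · simp only [edgeSlab_Q]
  · rw [edgeSlab_Q]; exact commonDen_pos u v
  · exact edgeSlab_m_pos u v 0
  · exact edgeSlab_m_pos u v 1
  · intro z hz
    rw [edgeSlab_ind u v huv] at hz
    have hz' := openSegment_subset_segment ℝ _ _ (of_not_not fun h => hz (if_neg h))
    exact mem_box_of_abs (abs_le_of_mem_segment 0 hu.1 hv.1 hz')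
      (abs_le_of_mem_segment 1 hu.2 hv.2 hz')

open Classical in
theorem pointPrim_eq (hrT : B ≤ r * T) (hv : |ratPoint v 0| ≤ B ∧ |ratPoint v 1| ≤ B) :
    pointPrim B r T v = ∑ z ∈ box B with Int.gcd z.1 z.2 = 1,
      if latticePoint z = ratPoint v then 1 else 0 := by
  have h1 : 0 < (v.1.den : ℤ) := by exact_mod_cast v.1.den_pos
  have h2 : 0 < (v.2.den : ℤ) := by exact_mod_cast v.2.den_pos
  rw [pointPrim, Slab.prim_sub (S := pointSlab v 0) (S' := pointSlab v 1) hrT rfl rfl rfl h1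
    h2 h2]
  · exact Finset.sum_congr rfl fun z _ => pointSlab_ind v z
  · intro z hz
    rw [pointSlab_ind] at hz
    have hz' : latticePoint z = ratPoint v := of_not_not fun h => hz (if_neg h)
    exact mem_box_of_abs (hz' ▸ hv.1) (hz' ▸ hv.2)

end prims

namespace Polygon
variable {k : ℕ} (P : Polygon (ℚ × ℚ) k) (B r T : ℕ)

/-- The sum of the crossing numbers of the primitive points. -/
noncomputable def signedSum : ℤ :=
  ∑ i, (1 - 2 * ratDescent (P i) (P (finRotate k i))) * trapPrim B r T (P i) (P (finRotate k i))

/-- The number of the primitive points on the boundary whose crossing number differs by one from the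
value on the right side. -/
noncomputable def descSum : ℤ :=
  ∑ i, (ratDescent (P i) (P (finRotate k i)) * edgePrim B r T (P i) (P (finRotate k i)) +
    ratVertexDescent (P i) (P (finRotate k i)) (P (finRotate k (finRotate k i))) *
      pointPrim B r T (P (finRotate k i)))

/-- The number of the other primitive points on the boundary. -/
noncomputable def ascSum : ℤ :=
  ∑ i, ((1 - ratDescent (P i) (P (finRotate k i))) * edgePrim B r T (P i) (P (finRotate k i)) +
    (1 - ratVertexDescent (P i) (P (finRotate k i)) (P (finRotate k (finRotate k i)))) *
      pointPrim B r T (P (finRotate k i)))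

/-- The number of primitive points in the region of the polygon. The sign of the sum of the crossing
numbers tells the orientation; it vanishes only if no primitive point has a crossing number other
than zero. -/
noncomputable def primCount : ℤ :=
  if 0 < P.signedSum B r T then P.signedSum B r T + P.descSum B r T
  else if 0 < -P.signedSum B r T then -P.signedSum B r T + P.ascSum B r T
  else P.descSum B r T + P.ascSum B r T

variable {P B r T}

/-- The strips cancel in the signed sum over the edges, as the polygon is closed. -/
theorem signedSum_eq (hrT : B ≤ r * T)
    (hB : ∀ i, |P.toPlane i 0| ≤ B ∧ |P.toPlane i 1| ≤ B) :
    P.signedSum B r T = ∑ z ∈ box B with Int.gcd z.1 z.2 = 1, P.toPlane.winding (latticePoint z) := by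
  classical
  set s : Finset (Fin k) := {i | (lexMin (P i) (P (finRotate k i))).1 <
    (lexMax (P i) (P (finRotate k i))).1} with hs
  have hw : ∀ z : ℤ × ℤ, ∑ i ∈ s, (1 - 2 * ratDescent (P i) (P (finRotate k i))) *
      (trapSlab (P i) (P (finRotate k i))).ind z = P.toPlane.winding (latticePoint z) := by
    intro z
    rw [hs, Finset.sum_filter, winding]
    refine Finset.sum_congr rfl fun i _ => ?_
    have := trapSlab_ind (P i) (P (finRotate k i)) z
    rw [mul_ite, mul_zero] at this
    exact this
  have h := Slab.sum_prim (s := s) (B := B) (r := r) (T := T)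
    (S := fun i => trapSlab (P i) (P (finRotate k i)))
    (w := fun i => 1 - 2 * ratDescent (P i) (P (finRotate k i))) hrT
    (fun i _ => commonDen_pos _ _) (fun i hi => trapSlab_m_pos (Finset.mem_filter.1 hi).2)
    (by
      intro x
      rw [hs, Finset.sum_filter]
      have h1 : ∀ i, (if (lexMin (P i) (P (finRotate k i))).1 < (lexMax (P i) (P (finRotate k i))).1
          then (1 - 2 * ratDescent (P i) (P (finRotate k i))) *
            (trapSlab (P i) (P (finRotate k i))).strip x else 0) =
          (fun j => if (P j).1 ≤ x then (1 : ℤ) else 0) i -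
          (fun j => if (P j).1 ≤ x then (1 : ℤ) else 0) (finRotate k i) := by
        intro i
        have := trapSlab_strip (P i) (P (finRotate k i)) x
        rw [mul_ite, mul_zero] at this
        exact this
      rw [Finset.sum_congr rfl fun i _ => h1 i, Finset.sum_sub_distrib,
        Equiv.sum_comp (finRotate k) fun j => if (P j).1 ≤ x then (1 : ℤ) else 0]
      exact sub_self _)
    (by
      intro z hz
      rw [hw] at hz
      obtain ⟨h0, h1⟩ := P.toPlane.winding_eq_zero hB hz
      exact mem_box_of_abs h0 h1)
  rw [← Finset.sum_congr rfl fun z _ => hw z, ← h, hs, Finset.sum_filter, signedSum]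
  refine Finset.sum_congr rfl fun i _ => ?_
  rw [trapPrim, mul_ite, mul_zero]

open Classical in
/-- Each point of the boundary lies on exactly one edge without its endpoints, or is exactly one
vertex. -/
theorem sum_boundary_ind {P : Polygon Plane k} (hP : P.IsSimple) (p : Plane) (a b : Fin k → ℤ) :
    (p ∉ P.boundary ℝ ∧ ∑ i, (a i * (if p ∈ openSegment ℝ (P i) (P (finRotate k i)) then 1 else 0) +
      b i * (if p = P (finRotate k i) then 1 else 0)) = 0) ∨
    (p ∈ P.boundary ℝ ∧ ∃ i,
      (p ∈ openSegment ℝ (P i) (P (finRotate k i)) ∧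
        ∑ i, (a i * (if p ∈ openSegment ℝ (P i) (P (finRotate k i)) then 1 else 0) +
          b i * (if p = P (finRotate k i) then 1 else 0)) = a i) ∨
      (p = P (finRotate k i) ∧
        ∑ i, (a i * (if p ∈ openSegment ℝ (P i) (P (finRotate k i)) then 1 else 0) +
          b i * (if p = P (finRotate k i) then 1 else 0)) = b i)) := by
  by_cases hp : p ∈ P.boundary ℝ
  · refine Or.inr ⟨hp, ?_⟩
    by_cases hv : ∃ i, p = P (finRotate k i)
    · obtain ⟨i, rfl⟩ := hv
      refine ⟨i, Or.inr ⟨rfl, ?_⟩⟩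
      have h1 : ∀ j, P (finRotate k i) ∉ openSegment ℝ (P j) (P (finRotate k j)) := by
        intro j hj
        by_cases hji : i = j
        · subst hji
          exact hP.not_mem_of_mem_openSegment (finRotate_ne (by have := hP.1; omega) i) hj
            (left_mem_segment _ _ _)
        · exact hP.not_mem_of_mem_openSegment hji hj (right_mem_segment _ _ _)
      rw [Finset.sum_eq_single i]
      · rw [if_neg (h1 i)]; simp
      · intro j _ hji
        rw [if_neg (h1 j), if_neg]
        · simp
        · intro h
          exact hji ((finRotate k).injective (hP.2.1 h)).symm
      · simp
    · push Not at hv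
      obtain ⟨i, hi⟩ := Set.mem_iUnion.1 hp
      have hpo : p ∈ openSegment ℝ (P i) (P (finRotate k i)) := by
        rw [edgeSet_eq] at hi
        refine mem_openSegment_of_ne_left_right ?_ (hv i).symm hi
        intro h
        apply hv ((finRotate k).symm i)
        rw [Equiv.apply_symm_apply, h]
      refine ⟨i, Or.inl ⟨hpo, ?_⟩⟩
      rw [Finset.sum_eq_single i]
      · rw [if_pos hpo, if_neg (hv i)]; simp
      · intro j _ hji
        rw [if_neg (hv j), if_neg]
        · simp
        · intro h
          exact hP.not_mem_of_mem_openSegment hji hpo (openSegment_subset_segment _ _ _ h)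
      · simp
  · refine Or.inl ⟨hp, Finset.sum_eq_zero fun i _ => ?_⟩
    rw [if_neg, if_neg]
    · simp
    · rintro rfl
      exact hp (Set.mem_iUnion.2 ⟨i, by rw [edgeSet_eq]; exact right_mem_segment _ _ _⟩)
    · intro h
      exact hp (Set.mem_iUnion.2 ⟨i, by
        rw [edgeSet_eq]; exact openSegment_subset_segment _ _ _ h⟩)

theorem abs_le_of_mem_region {P : Polygon Plane k} (hP : P.IsSimple) {M : ℝ}
    (hM : ∀ i, |P i 0| ≤ M ∧ |P i 1| ≤ M) {p : Plane} (hp : p ∈ P.region) :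
    |p 0| ≤ M ∧ |p 1| ≤ M := by
  by_cases hb : p ∈ P.boundary ℝ
  · obtain ⟨i, hi⟩ := Set.mem_iUnion.1 hb
    rw [edgeSet_eq] at hi
    exact ⟨abs_le_of_mem_segment 0 (hM i).1 (hM _).1 hi,
      abs_le_of_mem_segment 1 (hM i).2 (hM _).2 hi⟩
  · obtain ⟨h, h01, hin, -⟩ := hP.exists_winding
    rcases hin p hb with ⟨-, h1⟩ | ⟨h1, -⟩
    · exact P.winding_eq_zero hM (by rw [h1]; omega)
    · exact absurd hp h1

/-- The number of primitive points in the region of a simple polygon. -/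
theorem encard_primitivePoints (hP : P.toPlane.IsSimple) (hrT : B ≤ r * T)
    (hB : ∀ i, |P.toPlane i 0| ≤ B ∧ |P.toPlane i 1| ≤ B) :
    ∃ N : ℕ, (primitivePoints P.toPlane.region).encard = (N : ℕ∞) ∧ (N : ℤ) = P.primCount B r T := by
  classical
  set A : Finset (ℤ × ℤ) := {z ∈ box B | Int.gcd z.1 z.2 = 1} with hA
  have hset : primitivePoints P.toPlane.region =
      ((A.filter fun z => latticePoint z ∈ P.toPlane.region : Finset (ℤ × ℤ)) : Set (ℤ × ℤ)) := by
    ext z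
    simp only [primitivePoints, hA, Set.mem_ofPred_eq, Finset.coe_filter, Finset.mem_filter]
    constructor
    · rintro ⟨h1, h2⟩
      obtain ⟨h3, h4⟩ := abs_le_of_mem_region hP hB h2
      exact ⟨⟨mem_box_of_abs h3 h4, h1⟩, h2⟩
    · rintro ⟨⟨-, h1⟩, h2⟩
      exact ⟨h1, h2⟩
  refine ⟨_, by rw [hset, Set.encard_coe_eq_coe_finsetCard], ?_⟩
  obtain ⟨h, h01, hin, hbd⟩ := hP.exists_winding
  set n := finRotate k
  set lam : Fin k → ℤ := fun i => ratDescent (P i) (P (n i)) with hlam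
  set lamV : Fin k → ℤ := fun i => ratVertexDescent (P i) (P (n i)) (P (n (n i))) with hlamV
  set e : Fin k → ℤ × ℤ → ℤ := fun i z =>
    if latticePoint z ∈ openSegment ℝ (P.toPlane i) (P.toPlane (n i)) then 1 else 0 with he
  set v : Fin k → ℤ × ℤ → ℤ := fun i z =>
    if latticePoint z = P.toPlane (n i) then 1 else 0 with hv
  set inn : ℤ × ℤ → ℤ := fun z => if latticePoint z ∈ P.toPlane.region ∧
    latticePoint z ∉ P.toPlane.boundary ℝ then 1 else 0 with hinn
  have hsub : P.toPlane.boundary ℝ ⊆ P.toPlane.region := Set.subset_union_left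
  have hl1 : ∀ i, descent (P.toPlane i) (P.toPlane (n i)) = lam i := fun i =>
    descent_ratPoint (P i) (P (n i))
  have hl2 : ∀ i, vertexDescent (P.toPlane i) (P.toPlane (n i)) (P.toPlane (n (n i))) = lamV i :=
    fun i => vertexDescent_ratPoint (P i) (P (n i)) (P (n (n i)))
  have hw : ∀ z, P.toPlane.winding (latticePoint z) =
      (2 * h - 1) * inn z + ∑ i, ((h - lam i) * e i z + (h - lamV i) * v i z) := by
    intro z
    rcases sum_boundary_ind hP (latticePoint z) (fun i => h - lam i) (fun i => h - lamV i) with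
      ⟨h1, h2⟩ | ⟨h1, i, ⟨h2, h3⟩ | ⟨h2, h3⟩⟩
    · rw [show ∑ i, ((h - lam i) * e i z + (h - lamV i) * v i z) = 0 from h2]
      rcases hin _ h1 with ⟨h3, h4⟩ | ⟨h3, h4⟩
      · simp [hinn, h1, h3, h4]
      · simp [hinn, h3, h4]
    · rw [show ∑ i, ((h - lam i) * e i z + (h - lamV i) * v i z) = h - lam i from h3,
        (hbd i).1 _ h2, hl1]
      simp [hinn, h1]
    · rw [show ∑ i, ((h - lam i) * e i z + (h - lamV i) * v i z) = h - lamV i from h3,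
        h2, (hbd i).2, hl2]
      simp only [hinn]
      rw [if_neg (fun h => h.2 h1)]
      ring
  have hone : ∀ z, (if latticePoint z ∈ P.toPlane.region then (1 : ℤ) else 0) =
      inn z + ∑ i, (e i z + v i z) := by
    intro z
    have hs : ∑ i, (e i z + v i z) = ∑ i, (1 * e i z + 1 * v i z) := by simp
    rw [hs]
    rcases sum_boundary_ind hP (latticePoint z) (fun _ => 1) (fun _ => 1) with
      ⟨h1, h2⟩ | ⟨h1, i, ⟨h2, h3⟩ | ⟨h2, h3⟩⟩
    · rw [show ∑ i, (1 * e i z + 1 * v i z) = 0 from h2]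
      simp [hinn, h1]
    · rw [show ∑ i, (1 * e i z + 1 * v i z) = 1 from h3]
      simp [hinn, h1, hsub h1]
    · rw [show ∑ i, (1 * e i z + 1 * v i z) = 1 from h3]
      simp [hinn, h1, hsub h1]
  have hE : ∀ i, edgePrim B r T (P i) (P (n i)) = ∑ z ∈ A, e i z := fun i =>
    edgePrim_eq hrT (fun h => hP.vertex_ne i (congrArg ratPoint h)) (hB i) (hB (n i))
  have hV : ∀ i, pointPrim B r T (P (n i)) = ∑ z ∈ A, v i z := fun i =>
    pointPrim_eq hrT (hB (n i))
  have swap : ∀ (a b : Fin k → ℤ), ∑ z ∈ A, ∑ i, (a i * e i z + b i * v i z) =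
      ∑ i, (a i * edgePrim B r T (P i) (P (n i)) + b i * pointPrim B r T (P (n i))) := by
    intro a b
    rw [Finset.sum_comm]
    refine Finset.sum_congr rfl fun i _ => ?_
    rw [hE, hV, Finset.sum_add_distrib, Finset.mul_sum, Finset.mul_sum]
  have hI0 : 0 ≤ ∑ z ∈ A, inn z := Finset.sum_nonneg fun z _ => by
    simp only [hinn]; split_ifs <;> norm_num
  have hE0 : ∀ i, 0 ≤ edgePrim B r T (P i) (P (n i)) := fun i => by
    rw [hE]; exact Finset.sum_nonneg fun z _ => by simp only [he]; split_ifs <;> norm_num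
  have hV0 : ∀ i, 0 ≤ pointPrim B r T (P (n i)) := fun i => by
    rw [hV]; exact Finset.sum_nonneg fun z _ => by simp only [hv]; split_ifs <;> norm_num
  have hlam01 : ∀ i, lam i = 0 ∨ lam i = 1 := fun i => hl1 i ▸ descent_eq _ _
  have hlamV01 : ∀ i, lamV i = 0 ∨ lamV i = 1 := fun i => hl2 i ▸ vertexDescent_eq _ _ _
  have hdesc : P.descSum B r T = ∑ i, (lam i * edgePrim B r T (P i) (P (n i)) +
    lamV i * pointPrim B r T (P (n i))) := rfl
  have hasc : P.ascSum B r T = ∑ i, ((1 - lam i) * edgePrim B r T (P i) (P (n i)) +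
    (1 - lamV i) * pointPrim B r T (P (n i))) := rfl
  have hdesc0 : 0 ≤ P.descSum B r T := by
    rw [hdesc]
    refine Finset.sum_nonneg fun i _ => add_nonneg (mul_nonneg ?_ (hE0 i)) (mul_nonneg ?_ (hV0 i))
    · rcases hlam01 i with h | h <;> omega
    · rcases hlamV01 i with h | h <;> omega
  have hasc0 : 0 ≤ P.ascSum B r T := by
    rw [hasc]
    refine Finset.sum_nonneg fun i _ => add_nonneg (mul_nonneg ?_ (hE0 i)) (mul_nonneg ?_ (hV0 i))
    · rcases hlam01 i with h | h <;> omega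
    · rcases hlamV01 i with h | h <;> omega
  have hS : P.signedSum B r T = (2 * h - 1) * ∑ z ∈ A, inn z +
      (h * P.ascSum B r T - (1 - h) * P.descSum B r T) := by
    have h1 : h * P.ascSum B r T - (1 - h) * P.descSum B r T = ∑ i, ((h - lam i) *
        edgePrim B r T (P i) (P (n i)) + (h - lamV i) * pointPrim B r T (P (n i))) := by
      rw [hdesc, hasc, Finset.mul_sum, Finset.mul_sum, ← Finset.sum_sub_distrib]
      refine Finset.sum_congr rfl fun i _ => ?_
      ring
    rw [signedSum_eq hrT hB, Finset.sum_congr rfl fun z _ => hw z, Finset.sum_add_distrib,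
      ← Finset.mul_sum, swap, h1]
  have hN : ((A.filter fun z => latticePoint z ∈ P.toPlane.region).card : ℤ) =
      ∑ z ∈ A, inn z + (P.descSum B r T + P.ascSum B r T) := by
    have h1 := swap (fun _ => 1) (fun _ => 1)
    simp only [one_mul] at h1
    rw [Finset.card_filter]
    push_cast
    rw [Finset.sum_congr rfl fun z _ => hone z, Finset.sum_add_distrib, h1, hdesc, hasc,
      ← Finset.sum_add_distrib]
    congr 1
    refine Finset.sum_congr rfl fun i _ => ?_
    ring
  rw [hN, primCount]
  generalize P.signedSum B r T = S at *
  generalize P.descSum B r T = D at *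
  generalize P.ascSum B r T = E at *
  generalize ∑ z ∈ A, inn z = I at *
  rcases h01 with rfl | rfl <;> split_ifs <;> omega

end Polygon

namespace Ram

/-! ### The number of primitive points as a term -/

/-- The term for `Slab.prim` of the slab with the given entries. -/
def slabTerm (lo hi Q a c m : Term) : Term :=
  .call (.cons lo (.cons hi (.cons Q (.cons a (.cons c (.cons m .nil)))))) primTerm

theorem eval_slabTerm {μ : ℤ → ℤ} {B r : ℕ} (h : Table μ B r) {lo hi Q a c m : Term} {env : List ℤ}
    (S : Slab) (hm : 0 < S.m) (h1 : lo.eval env μ = S.lo) (h2 : hi.eval env μ = S.hi)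
    (h3 : Q.eval env μ = S.Q) (h4 : a.eval env μ = S.a) (h5 : c.eval env μ = S.c)
    (h6 : m.eval env μ = S.m) : (slabTerm lo hi Q a c m).eval env μ = S.prim B r (r ^ 6) := by
  rw [slabTerm, Term.eval_call, ← eval_primTerm S env h hm]
  simp only [Terms.evals_cons, Terms.evals_nil, h1, h2, h3, h4, h5, h6]

theorem Term.PBd.slab {lo hi Q a c m : Term} (h1 : lo.PBd) (h2 : hi.PBd) (h3 : Q.PBd) (h4 : a.PBd)
    (h5 : c.PBd) (h6 : m.PBd) : (slabTerm lo hi Q a c m).PBd :=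
  .call (.cons h1 (.cons h2 (.cons h3 (.cons h4 (.cons h5 (.cons h6 .nil)))))) pbd_primTerm

theorem Term.Fast.slab {lo hi Q a c m : Term} (p1 : lo.PBd) (p2 : hi.PBd) (p3 : Q.PBd) (p4 : a.PBd)
    (p5 : c.PBd) (p6 : m.PBd) (h1 : lo.Flat) (h2 : hi.Flat) (h3 : Q.Flat) (h4 : a.Flat)
    (h5 : c.Flat) (h6 : m.Flat) : (slabTerm lo hi Q a c m).Fast Sized fun _ r => r ^ 6 :=
  .call (.cons p1 (.cons p2 (.cons p3 (.cons p4 (.cons p5 (.cons p6 .nil))))))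
    (.cons h1.fast (.cons h2.fast (.cons h3.fast (.cons h4.fast (.cons h5.fast
      (.cons h6.fast .nil)))))) fast_primTerm

/-- The term for `trapPrim`; the variables are the scaled coordinates of the endpoints. -/
def trapTerm : Term :=
  .ite (.var 3 - .var 1) (slabTerm (.var 1) (.var 3) (.var 0) (.var 0 * (.var 4 - .var 2))
    (.var 2 * (.var 3 - .var 1) - .var 1 * (.var 4 - .var 2)) (.var 0 * (.var 3 - .var 1))) 0

/-- The term for `edgePrim`; the variables are the scaled coordinates of the endpoints. -/
def edgeTerm : Term :=
  .ite (.var 3 - .var 1)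
    (slabTerm (.var 1 + 1) (.var 3) (.var 0) (.var 0 * (.var 4 - .var 2))
        (.var 2 * (.var 3 - .var 1) - .var 1 * (.var 4 - .var 2)) (.var 0 * (.var 3 - .var 1)) -
      slabTerm (.var 1 + 1) (.var 3) (.var 0) (.var 0 * (.var 4 - .var 2))
        (.var 2 * (.var 3 - .var 1) - .var 1 * (.var 4 - .var 2) - 1)
        (.var 0 * (.var 3 - .var 1)))
    (slabTerm (.var 1) (.var 1 + 1) (.var 0) 0 (.var 4 - 1) (.var 0) -
      slabTerm (.var 1) (.var 1 + 1) (.var 0) 0 (.var 2) (.var 0))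

/-- The term for `pointPrim` of the second of three points. -/
def pointTerm : Term :=
  slabTerm (.var 4) (.var 4 + 1) (.var 5) 0 (.var 6) (.var 7) -
    slabTerm (.var 4) (.var 4 + 1) (.var 5) 0 (.var 6 - 1) (.var 7)

/-- The term for `ratDescent` of the points whose entries begin at the variables `i` and `j`. -/
def descentTerm (i j : ℕ) : Term :=
  let x : Term := .var j * .var (i + 1) - .var i * .var (j + 1)
  let y : Term := .var (j + 2) * .var (i + 3) - .var (i + 2) * .var (j + 3)
  .ite (-x) 1 (.ite x 0 (.ite (-y) 1 0))

/-- The numerator of `ratTurn` of three points. -/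
def turnTerm : Term :=
  (.var 4 * .var 1 - .var 0 * .var 5) * (.var 10 * .var 7 - .var 6 * .var 11) * (.var 3 * .var 9) -
    (.var 6 * .var 3 - .var 2 * .var 7) * (.var 8 * .var 5 - .var 4 * .var 9) * (.var 1 * .var 11)

/-- The term for `ratVertexDescent` of three points. -/
def vertexDescentTerm : Term :=
  .ite (turnTerm + 1) (descentTerm 0 4 * descentTerm 4 8)
    (descentTerm 0 4 + descentTerm 4 8 - descentTerm 0 4 * descentTerm 4 8)

/-- The scaled coordinates of the endpoints of an edge, in lexicographic order. -/
def edgeArgs : Terms :=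
  let xu : Term := .var 0 * .var 3 * (.var 5 * .var 7)
  let yu : Term := .var 1 * .var 2 * (.var 5 * .var 7)
  let xv : Term := .var 4 * .var 7 * (.var 1 * .var 3)
  let yv : Term := .var 5 * .var 6 * (.var 1 * .var 3)
  .cons (.var 1 * .var 3 * (.var 5 * .var 7)) (.cons (.ite (descentTerm 0 4) xv xu)
    (.cons (.ite (descentTerm 0 4) yv yu) (.cons (.ite (descentTerm 0 4) xu xv)
      (.cons (.ite (descentTerm 0 4) yu yv) .nil))))

/-- The summand of `signedSum` for three consecutive vertices. -/
def signedBody : Term := (1 - 2 * descentTerm 0 4) * .call edgeArgs trapTerm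

/-- The summand of `descSum` for three consecutive vertices. -/
def descBody : Term :=
  descentTerm 0 4 * .call edgeArgs edgeTerm + vertexDescentTerm * pointTerm

/-- The summand of `ascSum` for three consecutive vertices. -/
def ascBody : Term :=
  (1 - descentTerm 0 4) * .call edgeArgs edgeTerm + (1 - vertexDescentTerm) * pointTerm

/-- The number of the vertex after the given one. -/
def nextTerm (i : Term) : Term := .ite (.load 0 - (i + 1)) (i + 1) 0

/-- The entries of three consecutive vertices; the variable `0` is the number of the first. -/
def vertexArgs : Terms :=
  let i : Term := .var 0
  let j : Term := nextTerm i
  let l : Term := nextTerm j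
  .cons (.load (4 * i + 1)) (.cons (.load (4 * i + 2)) (.cons (.load (4 * i + 3))
    (.cons (.load (4 * i + 4)) (.cons (.load (4 * j + 1)) (.cons (.load (4 * j + 2))
      (.cons (.load (4 * j + 3)) (.cons (.load (4 * j + 4)) (.cons (.load (4 * l + 1))
        (.cons (.load (4 * l + 2)) (.cons (.load (4 * l + 3)) (.cons (.load (4 * l + 4))
          .nil)))))))))))

/-- The sum of `body` over all edges. -/
def overEdges (body : Term) : Term := .sum (.load 0) (.call vertexArgs body)

/-- The term for `Polygon.primCount`. -/
def primCountTerm : Term :=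
  .letE (overEdges signedBody) (.ite (.var 0) (.var 0 + overEdges descBody)
    (.ite (-.var 0) (-.var 0 + overEdges ascBody) (overEdges descBody + overEdges ascBody)))

/-- The numbers that represent a point in the input. -/
def pointCode (u : ℚ × ℚ) : List ℤ := [u.1.num, u.1.den, u.2.num, u.2.den]

/-- The memory holds the polygon in the cells from `0` on. -/
structure Loaded {k : ℕ} (m : ℤ → ℤ) (P : Polygon (ℚ × ℚ) k) : Prop where
  card : m 0 = k
  num₁ : ∀ i : Fin k, m (4 * (i : ℕ) + 1) = (P i).1.num
  den₁ : ∀ i : Fin k, m (4 * (i : ℕ) + 2) = (P i).1.den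
  num₂ : ∀ i : Fin k, m (4 * (i : ℕ) + 3) = (P i).2.num
  den₂ : ∀ i : Fin k, m (4 * (i : ℕ) + 4) = (P i).2.den

section eval
variable {m : ℤ → ℤ} {B r : ℕ} (u v w : ℚ × ℚ) (env : List ℤ)

theorem lt_iff_code (p q : ℚ) : q < p ↔ 0 < -(q.num * p.den - p.num * q.den) := by
  rw [Rat.lt_iff]; constructor <;> intro h <;> linarith

theorem eval_descent_aux : (if 0 < -(v.1.num * u.1.den - u.1.num * v.1.den) then (1 : ℤ)
    else if 0 < v.1.num * u.1.den - u.1.num * v.1.den then 0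
    else if 0 < -(v.2.num * u.2.den - u.2.num * v.2.den) then 1 else 0) = ratDescent u v := by
  have h1 := lt_iff_code u.1 v.1
  have h2 := lt_iff_code v.1 u.1
  have h3 := lt_iff_code u.2 v.2
  have h4 : 0 < v.1.num * u.1.den - u.1.num * v.1.den ↔ u.1 < v.1 := by
    rw [h2]; constructor <;> intro h <;> linarith
  simp only [ratDescent, ← h1, ← h3, h4]
  rcases lt_trichotomy u.1 v.1 with h | h | h
  · simp [h, h.not_gt, h.ne']
  · simp [h]
  · simp [h]

theorem eval_descentTerm₁ : (descentTerm 0 4).eval (pointCode u ++ (pointCode v ++ env)) m =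
    ratDescent u v := by
  rw [← eval_descent_aux]
  simp [descentTerm, pointCode]

theorem eval_descentTerm₂ :
    (descentTerm 4 8).eval (pointCode u ++ (pointCode v ++ (pointCode w ++ env))) m =
      ratDescent v w := by
  rw [← eval_descent_aux]
  simp [descentTerm, pointCode]

theorem eval_turnTerm :
    0 < (turnTerm + 1).eval (pointCode u ++ (pointCode v ++ (pointCode w ++ env))) m ↔
      0 ≤ ratTurn u v w := by
  have e : ((turnTerm.eval (pointCode u ++ (pointCode v ++ (pointCode w ++ env))) m : ℤ) : ℚ) =
      u.1.den * v.1.den * v.2.den * w.2.den * u.2.den * w.1.den * ratTurn u v w := by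
    simp only [turnTerm, pointCode, Term.eval_sub, Term.eval_mul, Term.eval_var, List.cons_append,
      List.nil_append, List.getD_cons_zero, List.getD_cons_succ]
    push_cast
    rw [← Rat.den_mul_eq_num u.1, ← Rat.den_mul_eq_num u.2, ← Rat.den_mul_eq_num v.1,
      ← Rat.den_mul_eq_num v.2, ← Rat.den_mul_eq_num w.1, ← Rat.den_mul_eq_num w.2, ratTurn]
    ring
  have hpos : (0 : ℚ) < u.1.den * v.1.den * v.2.den * w.2.den * u.2.den * w.1.den := by
    have := u.1.den_pos; have := u.2.den_pos; have := v.1.den_pos; have := v.2.den_pos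
    have := w.1.den_pos; have := w.2.den_pos
    positivity
  have hz : ∀ z : ℤ, 0 ≤ z ↔ (0 : ℚ) ≤ z := fun z => by norm_cast
  rw [Term.eval_add, Term.eval_one, Int.lt_add_one_iff, hz, e]
  exact ⟨fun h => nonneg_of_mul_nonneg_right h hpos, fun h => mul_nonneg hpos.le h⟩

theorem eval_vertexDescentTerm :
    vertexDescentTerm.eval (pointCode u ++ (pointCode v ++ (pointCode w ++ env))) m =
      ratVertexDescent u v w := by
  rw [vertexDescentTerm, Term.eval_ite, ratVertexDescent]
  simp only [eval_turnTerm]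
  rw [Term.eval_sub, Term.eval_add, Term.eval_mul, eval_descentTerm₁, eval_descentTerm₂]
  have h1 : ratDescent u v = 0 ∨ ratDescent u v = 1 := by unfold ratDescent; split_ifs <;> simp
  have h2 : ratDescent v w = 0 ∨ ratDescent v w = 1 := by unfold ratDescent; split_ifs <;> simp
  split_ifs <;> rcases h1 with h1 | h1 <;> rcases h2 with h2 | h2 <;> rw [h1, h2] <;> rfl

theorem evals_edgeArgs : edgeArgs.evals (pointCode u ++ (pointCode v ++ env)) m =
    [commonDen u v, scaledX (lexMin u v) (lexMax u v), scaledY (lexMin u v) (lexMax u v),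
      scaledX (lexMax u v) (lexMin u v), scaledY (lexMax u v) (lexMin u v)] := by
  simp only [edgeArgs, Terms.evals_cons, Terms.evals_nil, Term.eval_ite, eval_descentTerm₁, lexMin,
    lexMax]
  split_ifs <;> simp [pointCode, commonDen, scaledX, scaledY]

variable {env}

theorem eval_trapTerm (h : Table m B r) :
    (Term.call edgeArgs trapTerm).eval (pointCode u ++ (pointCode v ++ env)) m =
      trapPrim B r (r ^ 6) u v := by
  rw [Term.eval_call, evals_edgeArgs, trapPrim, trapTerm, Term.eval_ite, Term.eval_sub]
  obtain ⟨h1, h2, h3, h4⟩ := scaled_lex u v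
  have hlt := cast_lt_iff (commonDen_pos u v) h1 h3
  simp only [ratPoint_zero, Rat.cast_lt] at hlt
  simp only [Term.eval_var, List.cons_append, List.getD_cons_zero, List.getD_cons_succ, sub_pos, hlt,
    Term.eval_zero]
  split_ifs with hc
  · exact eval_slabTerm h (trapSlab u v) (trapSlab_m_pos hc) rfl rfl rfl rfl rfl rfl
  · rfl

theorem eval_edgeTerm (h : Table m B r) :
    (Term.call edgeArgs edgeTerm).eval (pointCode u ++ (pointCode v ++ env)) m =
      edgePrim B r (r ^ 6) u v := by
  rw [Term.eval_call, evals_edgeArgs, edgePrim, edgeTerm, Term.eval_ite, Term.eval_sub]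
  have p0 := edgeSlab_m_pos u v 0
  have p1 := edgeSlab_m_pos u v 1
  simp only [Term.eval_var, List.cons_append, List.getD_cons_zero, List.getD_cons_succ, sub_pos]
  by_cases hc : scaledX (lexMin u v) (lexMax u v) < scaledX (lexMax u v) (lexMin u v)
  · simp only [edgeSlab, Slab.edge, if_pos hc] at p0 p1 ⊢
    rw [Term.eval_sub]
    congr 1
    · exact eval_slabTerm h _ p0 rfl rfl rfl rfl (sub_zero _).symm rfl
    · exact eval_slabTerm h _ p1 rfl rfl rfl rfl rfl rfl
  · simp only [edgeSlab, Slab.edge, if_neg hc, if_true, if_neg one_ne_zero] at p0 p1 ⊢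
    rw [Term.eval_sub]
    congr 1
    · exact eval_slabTerm h _ p0 rfl rfl rfl rfl rfl rfl
    · exact eval_slabTerm h _ p1 rfl rfl rfl rfl rfl rfl

theorem eval_pointTerm (h : Table m B r) :
    pointTerm.eval (pointCode u ++ (pointCode v ++ env)) m = pointPrim B r (r ^ 6) v := by
  have p : 0 < (v.2.den : ℤ) := by exact_mod_cast v.2.den_pos
  rw [pointTerm, Term.eval_sub, pointPrim]
  congr 1
  · exact eval_slabTerm h (pointSlab v 0) p rfl rfl rfl rfl (sub_zero _).symm rfl
  · exact eval_slabTerm h (pointSlab v 1) p rfl rfl rfl rfl rfl rfl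

variable {k : ℕ} {P : Polygon (ℚ × ℚ) k} (hP : Loaded m P)
include hP

theorem eval_nextTerm {i : Fin k} {e : Term} (he : e.eval env m = (i : ℕ)) :
    (nextTerm e).eval env m = ((finRotate k i : Fin k) : ℕ) := by
  simp only [nextTerm, Term.eval_ite, Term.eval_sub, Term.eval_load, Term.eval_zero, Term.eval_add,
    Term.eval_one, he, hP.card, Polygon.finRotate_val]
  have := i.2
  split_ifs <;> omega

theorem evals_vertexArgs (i : Fin k) : vertexArgs.evals ((i : ℕ) :: env) m =
    pointCode (P i) ++ (pointCode (P (finRotate k i)) ++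
      (pointCode (P (finRotate k (finRotate k i))) ++ [])) := by
  have h0 : (Term.var 0).eval ((i : ℕ) :: env) m = (i : ℕ) := rfl
  have h1 := eval_nextTerm hP h0
  have h2 := eval_nextTerm hP h1
  simp only [vertexArgs, Terms.evals_cons, Terms.evals_nil, Term.eval_load, Term.eval_add,
    Term.eval_mul, Term.eval_one, Term.eval_two, Term.eval_three, Term.eval_four, h0, h1, h2,
    hP.num₁, hP.den₁, hP.num₂, hP.den₂, pointCode, List.cons_append, List.nil_append]

theorem eval_overEdges {body : Term} {f : Fin k → ℤ} (hf : ∀ i env, body.eval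
    (pointCode (P i) ++ (pointCode (P (finRotate k i)) ++
      (pointCode (P (finRotate k (finRotate k i))) ++ env))) m = f i) :
    (overEdges body).eval env m = ∑ i, f i := by
  rw [overEdges, Term.eval_sum, Term.eval_load, Term.eval_zero, hP.card, Int.toNat_natCast,
    Finset.sum_range]
  refine Finset.sum_congr rfl fun i _ => ?_
  rw [Term.eval_call, evals_vertexArgs hP, ← hf i ((i : ℕ) :: env)]
  simp only [List.append_assoc, List.nil_append]

theorem eval_primCountTerm (h : Table m B r) :
    primCountTerm.eval env m = P.primCount B r (r ^ 6) := by
  have h1 : ∀ env, (overEdges signedBody).eval env m = P.signedSum B r (r ^ 6) := fun env =>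
    eval_overEdges hP fun i env => by
      rw [signedBody, Term.eval_mul, Term.eval_sub, Term.eval_mul, eval_descentTerm₁,
        eval_trapTerm _ _ h]
      rfl
  have h2 : ∀ env, (overEdges descBody).eval env m = P.descSum B r (r ^ 6) := fun env =>
    eval_overEdges hP fun i env => by
      rw [descBody, Term.eval_add, Term.eval_mul, Term.eval_mul, eval_descentTerm₁,
        eval_vertexDescentTerm, eval_edgeTerm _ _ h, eval_pointTerm _ _ h]
  have h3 : ∀ env, (overEdges ascBody).eval env m = P.ascSum B r (r ^ 6) := fun env =>
    eval_overEdges hP fun i env => by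
      rw [ascBody, Term.eval_add, Term.eval_mul, Term.eval_mul, Term.eval_sub, Term.eval_sub,
        eval_descentTerm₁, eval_vertexDescentTerm, eval_edgeTerm _ _ h, eval_pointTerm _ _ h]
      rfl
  simp only [primCountTerm, Term.eval_letE, Term.eval_ite, Term.eval_add, Term.eval_neg,
    Term.eval_var, List.getD_cons_zero, h1, h2, h3, Polygon.primCount]

end eval

section bounds

theorem pbd_descentTerm (i j : ℕ) : (descentTerm i j).PBd := by
  unfold descentTerm
  repeat' first
    | apply Term.PBd.var | apply Term.PBd.ofNat | apply Term.PBd.sub | apply Term.PBd.neg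
    | apply Term.PBd.mul | apply Term.PBd.ite

theorem flat_descentTerm (i j : ℕ) : (descentTerm i j).Flat := by
  have hx : (.var j * .var (i + 1) - .var i * .var (j + 1) : Term).Flat :=
    .sub (.mul (.var _) (.var _)) (.mul (.var _) (.var _))
  have hy : (.var (j + 2) * .var (i + 3) - .var (i + 2) * .var (j + 3) : Term).Flat :=
    .sub (.mul (.var _) (.var _)) (.mul (.var _) (.var _))
  exact .ite hx.neg (.ofNat 1) (.ite hx (.ofNat 0) (.ite hy.neg (.ofNat 1) (.ofNat 0)))

theorem pbd_vertexDescentTerm : vertexDescentTerm.PBd := by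
  unfold vertexDescentTerm turnTerm
  repeat' first
    | apply pbd_descentTerm
    | apply Term.PBd.var | apply Term.PBd.ofNat | apply Term.PBd.sub | apply Term.PBd.add
    | apply Term.PBd.mul | apply Term.PBd.ite

theorem flat_vertexDescentTerm : vertexDescentTerm.Flat := by
  have h1 := flat_descentTerm 0 4
  have h2 := flat_descentTerm 4 8
  have h3 : turnTerm.Flat := by
    unfold turnTerm
    repeat' first | apply Term.Flat.var | apply Term.Flat.op
  exact .ite (h3.add (.ofNat 1)) (h1.mul h2) ((h1.add h2).sub (h1.mul h2))

theorem pbds_edgeArgs : edgeArgs.PBds := by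
  unfold edgeArgs
  repeat' first
    | apply pbd_descentTerm
    | apply Term.PBd.var | apply Term.PBd.mul | apply Term.PBd.ite
    | apply Terms.PBds.cons | apply Terms.PBds.nil

theorem fasts_edgeArgs {H : (ℤ → ℤ) → ℕ → Prop} {G : (ℤ → ℤ) → ℕ → ℕ} : edgeArgs.Fasts H G := by
  have h := (flat_descentTerm 0 4).fast (H := H) (G := G)
  unfold edgeArgs
  repeat' first
    | exact h
    | apply Term.Fast.var | apply Term.Fast.mul | apply Term.Fast.ite
    | apply Terms.Fasts.cons

theorem pbd_trapTerm : trapTerm.PBd := by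
  unfold trapTerm
  repeat' first
    | apply Term.PBd.slab
    | apply Term.PBd.var | apply Term.PBd.ofNat | apply Term.PBd.sub
    | apply Term.PBd.mul | apply Term.PBd.ite

theorem pbd_edgeTerm : edgeTerm.PBd := by
  unfold edgeTerm
  repeat' first
    | apply Term.PBd.slab
    | apply Term.PBd.var | apply Term.PBd.ofNat | apply Term.PBd.sub | apply Term.PBd.add
    | apply Term.PBd.mul | apply Term.PBd.ite

theorem pbd_pointTerm : pointTerm.PBd := by
  unfold pointTerm
  repeat' first
    | apply Term.PBd.slab
    | apply Term.PBd.var | apply Term.PBd.ofNat | apply Term.PBd.sub | apply Term.PBd.add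

theorem fast_trapTerm : trapTerm.Fast Sized fun _ r => r ^ 6 := by
  unfold trapTerm
  refine .ite (.sub (.var _) (.var _)) (.slab ?_ ?_ ?_ ?_ ?_ ?_ ?_ ?_ ?_ ?_ ?_ ?_) (.ofNat 0)
  all_goals repeat' first
    | apply Term.PBd.var | apply Term.PBd.sub | apply Term.PBd.mul
    | apply Term.Flat.var | apply Term.Flat.op

theorem fast_edgeTerm : edgeTerm.Fast Sized fun _ r => r ^ 6 := by
  unfold edgeTerm
  refine .ite (.sub (.var _) (.var _))
    (.sub (.slab ?_ ?_ ?_ ?_ ?_ ?_ ?_ ?_ ?_ ?_ ?_ ?_) (.slab ?_ ?_ ?_ ?_ ?_ ?_ ?_ ?_ ?_ ?_ ?_ ?_))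
    (.sub (.slab ?_ ?_ ?_ ?_ ?_ ?_ ?_ ?_ ?_ ?_ ?_ ?_) (.slab ?_ ?_ ?_ ?_ ?_ ?_ ?_ ?_ ?_ ?_ ?_ ?_))
  all_goals repeat' first
    | apply Term.PBd.var | apply Term.PBd.ofNat | apply Term.PBd.add | apply Term.PBd.sub
    | apply Term.PBd.mul | apply Term.Flat.var | apply Term.Flat.ofNat | apply Term.Flat.op

theorem fast_pointTerm : pointTerm.Fast Sized fun _ r => r ^ 6 := by
  unfold pointTerm
  refine .sub (.slab ?_ ?_ ?_ ?_ ?_ ?_ ?_ ?_ ?_ ?_ ?_ ?_) (.slab ?_ ?_ ?_ ?_ ?_ ?_ ?_ ?_ ?_ ?_ ?_ ?_)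
  all_goals repeat' first
    | apply Term.PBd.var | apply Term.PBd.ofNat | apply Term.PBd.add | apply Term.PBd.sub
    | apply Term.Flat.var | apply Term.Flat.ofNat | apply Term.Flat.op

theorem pbd_signedBody : signedBody.PBd :=
  .mul (.sub (.ofNat 1) (.mul (.ofNat 2) (pbd_descentTerm 0 4))) (.call pbds_edgeArgs pbd_trapTerm)

theorem pbd_descBody : descBody.PBd :=
  .add (.mul (pbd_descentTerm 0 4) (.call pbds_edgeArgs pbd_edgeTerm))
    (.mul pbd_vertexDescentTerm pbd_pointTerm)

theorem pbd_ascBody : ascBody.PBd :=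
  .add (.mul (.sub (.ofNat 1) (pbd_descentTerm 0 4)) (.call pbds_edgeArgs pbd_edgeTerm))
    (.mul (.sub (.ofNat 1) pbd_vertexDescentTerm) pbd_pointTerm)

theorem fast_signedBody : signedBody.Fast Sized fun _ r => r ^ 6 :=
  .mul (.sub (.ofNat 1) (.mul (.ofNat 2) (flat_descentTerm 0 4).fast))
    (.call pbds_edgeArgs fasts_edgeArgs fast_trapTerm)

theorem fast_descBody : descBody.Fast Sized fun _ r => r ^ 6 :=
  .add (.mul (flat_descentTerm 0 4).fast (.call pbds_edgeArgs fasts_edgeArgs fast_edgeTerm))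
    (.mul flat_vertexDescentTerm.fast fast_pointTerm)

theorem fast_ascBody : ascBody.Fast Sized fun _ r => r ^ 6 :=
  .add (.mul (.sub (.ofNat 1) (flat_descentTerm 0 4).fast)
    (.call pbds_edgeArgs fasts_edgeArgs fast_edgeTerm))
    (.mul (.sub (.ofNat 1) flat_vertexDescentTerm.fast) fast_pointTerm)

theorem pbds_vertexArgs : vertexArgs.PBds := by
  unfold vertexArgs nextTerm
  repeat' first
    | apply Term.PBd.var | apply Term.PBd.ofNat | apply Term.PBd.add | apply Term.PBd.sub
    | apply Term.PBd.mul | apply Term.PBd.ite | apply Term.PBd.load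
    | apply Terms.PBds.cons | apply Terms.PBds.nil

theorem fasts_vertexArgs {H : (ℤ → ℤ) → ℕ → Prop} {G : (ℤ → ℤ) → ℕ → ℕ} :
    vertexArgs.Fasts H G := by
  have next : ∀ {e : Term}, e.Flat → (nextTerm e).Flat := fun h =>
    .ite (((Term.Flat.ofNat 0).load).sub (h.add (.ofNat 1))) (h.add (.ofNat 1)) (.ofNat 0)
  have cell : ∀ {e : Term} (n : ℕ), e.Flat →
      (Term.load (4 * e + (OfNat.ofNat n : Term))).Fast H G := fun n h =>
    (((Term.Flat.ofNat 4).mul h).add (.ofNat n)).load.fast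
  have hi : (Term.var 0).Flat := .var 0
  have hj := next hi
  have hl := next hj
  exact .cons (cell 1 hi) (.cons (cell 2 hi) (.cons (cell 3 hi) (.cons (cell 4 hi)
    (.cons (cell 1 hj) (.cons (cell 2 hj) (.cons (cell 3 hj) (.cons (cell 4 hj)
      (.cons (cell 1 hl) (.cons (cell 2 hl) (.cons (cell 3 hl) (.cons (cell 4 hl) .nil)))))))))))

theorem Term.PBd.overEdges {b : Term} (h : b.PBd) : (overEdges b).PBd :=
  .sum (.load (.ofNat 0)) (.call pbds_vertexArgs h)

theorem Term.Fast.overEdges {b : Term} (h : b.Fast Sized fun _ r => r ^ 6) :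
    (overEdges b).Fast Sized fun m r => (m 0).toNat * r ^ 6 :=
  .sum (q := fun m _ => (m 0).toNat) (.load (.ofNat 0))
    ⟨1, fun w env m r _ _ => by rw [one_mul]; exact le_rfl⟩ (.load (.ofNat 0))
    (.call pbds_vertexArgs fasts_vertexArgs h)

theorem pbd_primCountTerm : primCountTerm.PBd :=
  .letE pbd_signedBody.overEdges (.ite (.var 0) (.add (.var 0) pbd_descBody.overEdges)
    (.ite (.neg (.var 0)) (.add (.neg (.var 0)) pbd_ascBody.overEdges)
      (.add pbd_descBody.overEdges pbd_ascBody.overEdges)))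

theorem fast_primCountTerm : primCountTerm.Fast Sized fun m r => (m 0).toNat * r ^ 6 :=
  .letE pbd_signedBody.overEdges fast_signedBody.overEdges
    (.ite (.var 0) (.add (.var 0) fast_descBody.overEdges)
      (.ite (.neg (.var 0)) (.add (.neg (.var 0)) fast_ascBody.overEdges)
        (.add fast_descBody.overEdges fast_ascBody.overEdges)))

end bounds

/-! ### A sieve for the Möbius function -/

section sieve
open ArithmeticFunction (moebius)

/-- What is left of the Möbius function at `n` (or of `0` at `0`) when its defining recursion has
used the divisors up to `j` of `n`. -/
def sieveRest (j n : ℕ) : ℤ := (if n = 1 then 1 else 0) - ∑ e ∈ n.divisors with e ≤ j, moebius e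

theorem sieveRest_zero (n : ℕ) : sieveRest 0 n = if n = 1 then 1 else 0 := by
  have h : {e ∈ n.divisors | e ≤ 0} = ∅ := by
    refine Finset.filter_eq_empty_iff.2 fun e he => ?_
    have := Nat.pos_of_mem_divisors he
    omega
  rw [sieveRest, h, Finset.sum_empty, sub_zero]

theorem sieveRest_succ (j n : ℕ) : sieveRest (j + 1) n =
    sieveRest j n - if j + 1 ∈ n.divisors then moebius (j + 1) else 0 := by
  rw [sieveRest, sieveRest, sub_sub, Finset.sum_filter, Finset.sum_filter,
    ← Finset.sum_ite_eq' n.divisors (j + 1) fun e => moebius e, ← Finset.sum_add_distrib]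
  congr 1
  refine Finset.sum_congr rfl fun e _ => ?_
  split_ifs <;> omega

/-- When all proper divisors of `j + 1` have been used, the Möbius function is left. -/
theorem sieveRest_self (j : ℕ) : sieveRest j (j + 1) = moebius (j + 1) := by
  have h := sum_moebius_divisors (j + 1)
  rw [← Nat.insert_self_properDivisors (Nat.succ_ne_zero j),
    Finset.sum_insert Nat.self_notMem_properDivisors] at h
  have e : {e ∈ (j + 1).divisors | e ≤ j} = (j + 1).properDivisors := by
    ext e
    simp only [Finset.mem_filter, Nat.mem_divisors, Nat.mem_properDivisors]
    constructor
    · rintro ⟨⟨h, -⟩, h'⟩; exact ⟨h, by omega⟩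
    · rintro ⟨h, h'⟩; exact ⟨⟨h, by omega⟩, by omega⟩
  rw [sieveRest, e, ← h]; ring

theorem abs_moebius_sum_le (s : Finset ℕ) {n : ℕ} (h : s ⊆ Finset.Ioc 0 n) :
    |∑ e ∈ s, moebius e| ≤ n := by
  refine (Finset.abs_sum_le_sum_abs _ _).trans ?_
  have h1 := Finset.sum_le_card_nsmul s (fun e => |moebius e|) 1
    fun e _ => ArithmeticFunction.abs_moebius_le_one
  have h2 := Finset.card_le_card h
  rw [Nat.card_Ioc, Nat.sub_zero] at h2
  rw [nsmul_eq_mul, mul_one] at h1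
  exact h1.trans (by exact_mod_cast h2)

theorem abs_mertens_le (n : ℕ) : |mertens n| ≤ n := abs_moebius_sum_le _ subset_rfl

theorem abs_sieveRest_le (j n : ℕ) : |sieveRest j n| ≤ n + 1 := by
  have h := abs_moebius_sum_le {e ∈ n.divisors | e ≤ j} (n := n) (by
    intro e he
    have he' := Finset.mem_of_mem_filter e he
    exact Finset.mem_Ioc.2 ⟨Nat.pos_of_mem_divisors he', Nat.divisor_le he'⟩)
  rw [sieveRest]
  rw [abs_le] at h ⊢
  split_ifs <;> constructor <;> linarith [h.1, h.2]

/-- The table after `j` rounds of the sieve. -/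
def sieveTable (j n : ℕ) : ℤ := if n ≤ j then mertens n else sieveRest j n

/-- The table in the midst of the round that deals with the multiples of `j + 1`, when `i` of them
have been treated. -/
def sieveMid (j i n : ℕ) : ℤ :=
  if n ≤ j then mertens n
  else if j + 1 < n ∧ n < (i + 2) * (j + 1) then sieveRest (j + 1) n else sieveRest j n

theorem sieveMid_zero (j n : ℕ) : sieveMid j 0 n = sieveTable j n := by
  rw [sieveMid, sieveTable]
  split_ifs with h1 h2
  · rfl
  · rw [sieveRest_succ, if_neg, sub_zero]
    intro h
    obtain ⟨c, rfl⟩ := Nat.dvd_of_mem_divisors h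
    have h3 : 1 < c := by
      by_contra h4
      have : c = 0 ∨ c = 1 := by omega
      rcases this with rfl | rfl <;> omega
    nlinarith [h2.2]
  · rfl

/-- The effect of `sieveStep` on the table. -/
theorem sieveMid_succ (j i : ℕ) : sieveMid j (i + 1) =
    Function.update (sieveMid j i) ((i + 2) * (j + 1))
      (sieveMid j i ((i + 2) * (j + 1)) - sieveMid j i (j + 1)) := by
  have hlt : j + 1 < (i + 2) * (j + 1) := by nlinarith
  have hs : sieveMid j i (j + 1) = moebius (j + 1) := by
    rw [sieveMid, if_neg (by omega), if_neg (by omega), sieveRest_self]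
  have hm : sieveMid j i ((i + 2) * (j + 1)) = sieveRest j ((i + 2) * (j + 1)) := by
    rw [sieveMid, if_neg (by omega), if_neg (by omega)]
  funext n
  rw [hs, hm]
  by_cases hn : n = (i + 2) * (j + 1)
  · subst hn
    rw [Function.update_self, sieveMid, if_neg (by omega), if_pos ⟨hlt, by nlinarith⟩,
      sieveRest_succ, if_pos]
    exact Nat.mem_divisors.2 ⟨Dvd.intro_left _ rfl, by omega⟩
  · rw [Function.update_of_ne hn, sieveMid, sieveMid]
    have hle : (i + 2) * (j + 1) ≤ (i + 1 + 2) * (j + 1) := by nlinarith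
    split_ifs with h1 h2 h3 h3
    · rfl
    · rfl
    · rw [sieveRest_succ, if_neg, sub_zero]
      intro h
      obtain ⟨c, rfl⟩ := Nat.dvd_of_mem_divisors h
      have h4 : i + 2 < c := by
        by_contra h5
        have h6 : (j + 1) * c ≤ (j + 1) * (i + 2) := Nat.mul_le_mul_left _ (by omega)
        have h7 : (j + 1) * (i + 2) = (i + 2) * (j + 1) := mul_comm _ _
        omega
      nlinarith [h2.2]
    · omega
    · rfl

/-- After the multiples of `j + 1`, the entry number `j + 1` itself becomes a value of the Mertens
function. -/
theorem sieveTable_succ {j T n : ℕ} (hj : j < T) (hn : n ≤ T) : sieveTable (j + 1) n =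
    Function.update (sieveMid j (T / (j + 1) - 1)) (j + 1)
      (sieveMid j (T / (j + 1) - 1) (j + 1) + sieveMid j (T / (j + 1) - 1) j) n := by
  have h1 : 1 ≤ T / (j + 1) := Nat.div_pos hj (by omega)
  have h2 : T < (T / (j + 1) - 1 + 2) * (j + 1) := by
    have := Nat.lt_mul_div_succ T (Nat.succ_pos j)
    have e : T / (j + 1) - 1 + 2 = T / (j + 1) + 1 := by omega
    rw [e, mul_comm]; exact this
  generalize T / (j + 1) - 1 = i at *
  by_cases hnj : n = j + 1
  · subst hnj
    rw [Function.update_self, sieveTable, if_pos le_rfl, mertens_succ, sieveMid, sieveMid,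
      if_neg (by omega), if_neg (by omega), if_pos le_rfl, sieveRest_self, add_comm]
  · rw [Function.update_of_ne hnj, sieveTable, sieveMid]
    split_ifs <;> first | rfl | omega

theorem abs_sieveMid_le (j i n : ℕ) : |sieveMid j i n| ≤ n + 1 := by
  have := abs_mertens_le n
  rw [sieveMid]
  split_ifs
  · linarith
  · exact abs_sieveRest_le _ _
  · exact abs_sieveRest_le _ _

theorem abs_sieveTable_le (j n : ℕ) : |sieveTable j n| ≤ n + 1 := by
  rw [← sieveMid_zero]; exact abs_sieveMid_le _ _ _

end sieve

/-! ### Preparation of the memory -/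

/-- The statement respects the bound `W` for the number of digits, takes at most `S` instructions,
and leaves a memory with the property `Q`. -/
def Stmt.Ensures (W S : ℕ) (a : Stmt) (env : List ℤ) (m : ℤ → ℤ) (Q : (ℤ → ℤ) → Prop) : Prop :=
  a.Bd W env m ∧ a.steps env m ≤ S ∧ Q (a.exec env m)

theorem Stmt.Ensures.seq {W S S' : ℕ} {a b : Stmt} {env : List ℤ} {m : ℤ → ℤ}
    {Q Q' : (ℤ → ℤ) → Prop} (ha : a.Ensures W S env m Q)
    (hb : ∀ m', Q m' → b.Ensures W S' env m' Q') : (a.seq b).Ensures W (S + S') env m Q' := by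
  obtain ⟨b1, b2, b3⟩ := hb _ ha.2.2
  exact ⟨⟨ha.1, b1⟩, Nat.add_le_add ha.2.1 b2, b3⟩

theorem Stmt.Bd.mono {W W' : ℕ} (h : W ≤ W') : ∀ {a : Stmt} {env : List ℤ} {m : ℤ → ℤ},
    a.Bd W env m → a.Bd W' env m
  | .store _ _, _, _, ha => ⟨ha.1.mono h, ha.2.mono h⟩
  | .seq _ _, _, _, ha => ⟨mono h ha.1, mono h ha.2⟩
  | .forE _ _, _, _, ha => ⟨ha.1.mono h, fun j hj => mono h (ha.2 j hj)⟩

theorem Stmt.Ensures.mono {W W' S S' : ℕ} {a : Stmt} {env : List ℤ} {m : ℤ → ℤ}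
    {Q Q' : (ℤ → ℤ) → Prop} (ha : a.Ensures W S env m Q) (hW : W ≤ W') (hS : S ≤ S')
    (hQ : ∀ m', Q m' → Q' m') : a.Ensures W' S' env m Q' :=
  ⟨ha.1.mono hW, ha.2.1.trans hS, hQ _ ha.2.2⟩

/-- A loop maintains an invariant. -/
theorem Stmt.Ensures.forE {W S N : ℕ} {n : Term} {b : Stmt} {env : List ℤ} {m : ℤ → ℤ}
    {I : ℕ → (ℤ → ℤ) → Prop} {s : ℕ → ℕ} (hn : n.Bd W env m) (hS : n.steps env m ≤ S)
    (hN : n.eval env m = N) (h0 : I 0 m)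
    (hb : ∀ j < N, ∀ m', I j m' → b.Ensures W (s j) ((j : ℤ) :: env) m' (I (j + 1))) :
    (Stmt.forE n b).Ensures W (S + 4 + ∑ j ∈ Finset.range N, (s j + 5)) env m (I N) := by
  have key : ∀ j ≤ N, I j (forMem (fun j m => b.exec ((j : ℤ) :: env) m) j m) := by
    intro j
    induction j with
    | zero => exact fun _ => h0
    | succ j ih => exact fun hj => (hb j (by omega) _ (ih (by omega))).2.2
  have hN' : (n.eval env m).toNat = N := by rw [hN, Int.toNat_natCast]
  refine ⟨⟨hn, fun j hj => ?_⟩, ?_, ?_⟩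
  · rw [hN'] at hj
    exact (hb j hj _ (key j hj.le)).1
  · rw [Stmt.steps, hN']
    refine Nat.add_le_add (Nat.add_le_add_right hS 4) (Finset.sum_le_sum fun j hj => ?_)
    rw [Finset.mem_range] at hj
    exact Nat.add_le_add_right (hb j hj _ (key j hj.le)).2.1 5
  · rw [Stmt.exec, hN']
    exact key N le_rfl

/-- A term whose evaluation takes at most a constant times `w` instructions, on numbers with at most
a constant times `w` digits, where `w` bounds the digits of the variables and memory cells. -/
def Term.Light (c : ℕ) (e : Term) : Prop :=
  ∀ w env m, Small w env m → e.Bd (c * w) env m ∧ e.steps env m ≤ c * w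

theorem Term.PBd.light {e : Term} (h : e.PBd)
    (h' : e.Fast (fun _ _ => True) fun _ _ => 1) : ∃ c, e.Light c := by
  obtain ⟨c, hc⟩ := h
  obtain ⟨c', hc'⟩ := h'
  refine ⟨c + c', fun w env m hs => ⟨(hc w env m hs).mono (by nlinarith), ?_⟩⟩
  have := hc' w env m 0 hs trivial le_rfl
  nlinarith

theorem Term.Light.mono {c c' : ℕ} {e : Term} (h : e.Light c) (hc : c ≤ c') : e.Light c' :=
  fun w env m hs => by
    have hw := Nat.mul_le_mul_right w hc
    exact ⟨(h w env m hs).1.mono hw, (h w env m hs).2.trans hw⟩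

theorem Stmt.Ensures.store {c w : ℕ} {p v : Term} {env : List ℤ} {m : ℤ → ℤ}
    {Q : (ℤ → ℤ) → Prop} (hp : p.Light c) (hv : v.Light c) (hs : Small w env m)
    (hQ : Q (Function.update m (p.eval env m) (v.eval env m))) :
    (Stmt.store p v).Ensures (c * w) (2 * (c * w) + 1) env m Q := by
  obtain ⟨p1, p2⟩ := hp w env m hs
  obtain ⟨v1, v2⟩ := hv w env m hs
  exact ⟨⟨p1, v1⟩, by rw [Stmt.steps]; omega, hQ⟩

/-- The table is `f` up to `T`, and `0` beyond; the cells from `-2` on are those of `m₀`. -/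
structure Holds (m₀ : ℤ → ℤ) (T : ℕ) (f : ℕ → ℤ) (m : ℤ → ℤ) : Prop where
  keep : ∀ a, -2 ≤ a → m a = m₀ a
  cell : ∀ n : ℕ, m (-3 - n) = if n ≤ T then f n else 0

theorem Holds.congr {m₀ m : ℤ → ℤ} {T : ℕ} {f g : ℕ → ℤ} (h : Holds m₀ T f m)
    (hfg : ∀ n ≤ T, f n = g n) : Holds m₀ T g m :=
  ⟨h.keep, fun n => by rw [h.cell]; split_ifs with hn; exacts [hfg n hn, rfl]⟩

theorem Holds.update {m₀ m : ℤ → ℤ} {T : ℕ} {f : ℕ → ℤ} (h : Holds m₀ T f m) {n : ℕ} (hn : n ≤ T)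
    (z : ℤ) : Holds m₀ T (Function.update f n z) (Function.update m (-3 - n) z) := by
  refine ⟨fun a ha => ?_, fun n' => ?_⟩
  · rw [Function.update_of_ne (by omega), h.keep a ha]
  · by_cases hn' : n' = n
    · subst hn'; rw [Function.update_self, Function.update_self, if_pos hn]
    · rw [Function.update_of_ne hn', Function.update_of_ne (by omega), h.cell]

theorem Holds.small {m₀ m : ℤ → ℤ} {T w : ℕ} {f : ℕ → ℤ} {env : List ℤ} (h : Holds m₀ T f m)
    (h0 : Small w env m₀) (hT : T + 1 < 2 ^ w) (hf : ∀ n ≤ T, |f n| ≤ n + 1) : Small w env m := by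
  refine ⟨h0.1, h0.2.1, fun a => ?_⟩
  rcases le_or_gt (-2) a with ha | ha
  · rw [h.keep a ha]; exact h0.2.2 a
  · obtain ⟨n, rfl⟩ : ∃ n : ℕ, a = -3 - n := ⟨(-3 - a).toNat, by omega⟩
    rw [h.cell]
    split_ifs with hn
    · rw [bitLength_le]
      have h2 : ((T + 1 : ℕ) : ℤ) < 2 ^ w := by exact_mod_cast hT
      have h3 := hf n hn
      push_cast at h2
      omega
    · simp

/-- The cell of the table entry number `n`. -/
def cellTerm (n : Term) : Term := .const (-3) - n

/-- Subtract the entry number `j + 1` from the entry number `(i + 2) * (j + 1)`, where `i` and `j`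
are the variables. -/
def sieveStep : Stmt :=
  .store (cellTerm ((.var 0 + 2) * (.var 1 + 1)))
    (entry ((.var 0 + 2) * (.var 1 + 1)) - entry (.var 1 + 1))

/-- The round of the sieve that deals with the divisor `j + 1`, where `j` is the variable. -/
def sieveRound : Stmt :=
  .seq (.forE (topTerm / (.var 0 + 1) - 1) sieveStep)
    (.store (cellTerm (.var 0 + 1)) (entry (.var 0 + 1) + entry (.var 0)))

/-- The computation of the table of the Mertens function. -/
def sieveStmt : Stmt := .seq (.store (.const (-4)) 1) (.forE topTerm sieveRound)

/-- A common constant for all terms that occur in the sieve. -/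
theorem light_sieve : ∃ c, (cellTerm ((.var 0 + 2) * (.var 1 + 1))).Light c ∧
    (entry ((.var 0 + 2) * (.var 1 + 1)) - entry (.var 1 + 1)).Light c ∧
    (topTerm / (.var 0 + 1) - 1).Light c ∧ (cellTerm (.var 0 + 1)).Light c ∧
    (entry (.var 0 + 1) + entry (.var 0)).Light c ∧ (Term.const (-4)).Light c ∧
    (1 : Term).Light c ∧ topTerm.Light c := by
  have l : ∀ e : Term, e.PBd → e.Flat → ∃ c, e.Light c := fun e h h' => h.light h'.fast
  have b1 := (((Term.PBd.var 0).add (.ofNat 2)).mul ((Term.PBd.var 1).add (.ofNat 1)))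
  have f1 := (((Term.Flat.var 0).add (.ofNat 2)).mul ((Term.Flat.var 1).add (.ofNat 1)))
  have bt : topTerm.PBd := by
    have h : rootTerm.PBd := .load (.const _)
    exact ((((h.mul h).mul h).mul h).mul h).mul h
  have ft : topTerm.Flat := by
    have h : rootTerm.Flat := .load (.const _)
    exact ((((h.mul h).mul h).mul h).mul h).mul h
  have bc : ∀ {e : Term}, e.PBd → (cellTerm e).PBd := fun h => (Term.PBd.const _).sub h
  have fc : ∀ {e : Term}, e.Flat → (cellTerm e).Flat := fun h => (Term.Flat.const _).sub h
  have be : ∀ {e : Term}, e.PBd → (entry e).PBd := fun h => .load (bc h)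
  have fe : ∀ {e : Term}, e.Flat → (entry e).Flat := fun h => .load (fc h)
  obtain ⟨c1, h1⟩ := l _ (bc b1) (fc f1)
  obtain ⟨c2, h2⟩ := l _ ((be b1).sub (be ((Term.PBd.var 1).add (.ofNat 1))))
    ((fe f1).sub (fe ((Term.Flat.var 1).add (.ofNat 1))))
  obtain ⟨c3, h3⟩ := l _ ((bt.div ((Term.PBd.var 0).add (.ofNat 1))).sub (.ofNat 1))
    ((ft.div ((Term.Flat.var 0).add (.ofNat 1))).sub (.ofNat 1))
  obtain ⟨c4, h4⟩ := l _ (bc ((Term.PBd.var 0).add (.ofNat 1)))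
    (fc ((Term.Flat.var 0).add (.ofNat 1)))
  obtain ⟨c5, h5⟩ := l _ ((be ((Term.PBd.var 0).add (.ofNat 1))).add (be (.var 0)))
    ((fe ((Term.Flat.var 0).add (.ofNat 1))).add (fe (.var 0)))
  obtain ⟨c6, h6⟩ := l _ (Term.PBd.const (-4)) (.const _)
  obtain ⟨c7, h7⟩ := l _ (Term.PBd.ofNat 1) (.ofNat 1)
  obtain ⟨c8, h8⟩ := l _ bt ft
  exact ⟨c1 + c2 + c3 + c4 + c5 + c6 + c7 + c8, h1.mono (by omega), h2.mono (by omega),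
    h3.mono (by omega), h4.mono (by omega), h5.mono (by omega), h6.mono (by omega),
    h7.mono (by omega), h8.mono (by omega)⟩

theorem eval_entry_of_holds {m₀ m : ℤ → ℤ} {T n : ℕ} {f : ℕ → ℤ} (h : Holds m₀ T f m) {e : Term}
    {env : List ℤ} (he : e.eval env m = n) (hn : n ≤ T) : (entry e).eval env m = f n := by
  rw [entry, Term.eval_load, Term.eval_sub, Term.eval_const, he, h.cell, if_pos hn]

theorem eval_cellTerm {m : ℤ → ℤ} {n : ℕ} {e : Term} {env : List ℤ} (he : e.eval env m = n) :
    (cellTerm e).eval env m = -3 - n := by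
  rw [cellTerm, Term.eval_sub, Term.eval_const, he]

/-- The sieve fills the table with the values of the Mertens function. The factor `w` beyond the
length of the numbers comes from the harmonic sum of the numbers of multiples. -/
theorem ensures_sieve : ∃ c, ∀ (m₀ : ℤ → ℤ) (r w : ℕ), 1 ≤ r → m₀ (-2) = r → Small w [] m₀ →
    r ^ 6 + 1 < 2 ^ w → (∀ n : ℕ, m₀ (-3 - n) = 0) →
    sieveStmt.Ensures (c * w) (c * w * (w * r ^ 6)) [] m₀ (Holds m₀ (r ^ 6) mertens) := by
  obtain ⟨c, l1, l2, l3, l4, l5, l6, l7, l8⟩ := light_sieve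
  refine ⟨c + (22 * c + 40), fun m₀ r w hr hr2 hs hT hz => ?_⟩
  have hw := hs.1
  set T := r ^ 6 with hTdef
  have hT1 : 1 ≤ T := Nat.one_le_pow _ _ hr
  have small : ∀ {f : ℕ → ℤ} {m : ℤ → ℤ}, Holds m₀ T f m → (∀ n ≤ T, |f n| ≤ n + 1) →
      Small w [] m := fun h hf => h.small hs hT hf
  have idx : ∀ j : ℕ, j < T → bitLength (j : ℤ) ≤ w := by
    intro j hj
    rw [bitLength_le, abs_of_nonneg (by positivity)]
    exact_mod_cast (show j < 2 ^ w by omega)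
  have top : ∀ {f : ℕ → ℤ} {m : ℤ → ℤ} (env), Holds m₀ T f m → topTerm.eval env m = T :=
    fun env h => by rw [eval_topTerm (r := r) (by rw [h.keep _ le_rfl, hr2])]
  have step : ∀ j < T, ∀ i < T / (j + 1) - 1, ∀ m, Holds m₀ T (sieveMid j i) m →
      sieveStep.Ensures (c * w) (2 * (c * w) + 1) ((i : ℤ) :: (j : ℤ) :: []) m
        (Holds m₀ T (sieveMid j (i + 1))) := by
    intro j hj i hi m hm
    have hle : (i + 2) * (j + 1) ≤ T :=
      (Nat.mul_le_mul_right _ (by omega)).trans (Nat.div_mul_le_self T (j + 1))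
    have hi' : i < T := by nlinarith
    refine .store l1 l2 (((small hm fun n _ => abs_sieveMid_le j i n).cons (idx j hj)).cons
      (idx i hi')) ?_
    have e1 : ((.var 0 + 2) * (.var 1 + 1) : Term).eval ((i : ℤ) :: (j : ℤ) :: []) m =
        ((i + 2) * (j + 1) : ℕ) := by
      simp
    have e2 : (.var 1 + 1 : Term).eval ((i : ℤ) :: (j : ℤ) :: []) m = (j + 1 : ℕ) := by simp
    rw [eval_cellTerm e1, Term.eval_sub, eval_entry_of_holds hm e1 hle,
      eval_entry_of_holds hm e2 hj, sieveMid_succ]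
    exact hm.update hle _
  have round : ∀ j < T, ∀ m, Holds m₀ T (sieveTable j) m →
      sieveRound.Ensures (c * w) ((10 * c + 20) * w * (T / (j + 1))) ((j : ℤ) :: []) m
        (Holds m₀ T (sieveTable (j + 1))) := by
    intro j hj m hm
    have hm' : Holds m₀ T (sieveMid j 0) m := hm.congr fun n _ => (sieveMid_zero j n).symm
    have hsm := (small hm fun n _ => abs_sieveTable_le j n).cons (idx j hj)
    have h1 : 1 ≤ T / (j + 1) := Nat.div_pos hj (by omega)
    have hloop := Stmt.Ensures.forE (W := c * w) (b := sieveStep) (env := (j : ℤ) :: [])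
      (N := T / (j + 1) - 1) (n := topTerm / (.var 0 + 1) - 1) (I := fun i => Holds m₀ T (sieveMid j i))
      (l3 w _ m hsm).1 (l3 w _ m hsm).2 (by
        rw [Term.eval_sub, Term.eval_div, top _ hm, Term.eval_add, Term.eval_var,
          List.getD_cons_zero, Term.eval_one]
        push_cast [Nat.cast_sub h1]; rfl) hm' (fun i hi m hm => step j hj i hi m hm)
    refine (Stmt.Ensures.seq hloop (S' := 2 * (c * w) + 1) fun m hm => ?_).mono le_rfl ?_ fun _ => id
    · refine .store l4 l5 ((small hm fun n _ => abs_sieveMid_le j _ n).cons (idx j hj)) ?_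
      have e1 : (.var 0 + 1 : Term).eval ((j : ℤ) :: []) m = (j + 1 : ℕ) := by simp
      have e2 : (.var 0 : Term).eval ((j : ℤ) :: []) m = (j : ℕ) := by simp
      rw [eval_cellTerm e1, Term.eval_add, eval_entry_of_holds hm e1 hj,
        eval_entry_of_holds hm e2 hj.le]
      exact (hm.update hj _).congr fun n hn => (sieveTable_succ hj hn).symm
    · rw [Finset.sum_const, Finset.card_range, smul_eq_mul]
      obtain ⟨q, hq⟩ : ∃ q, T / (j + 1) = q + 1 := ⟨_, (Nat.sub_add_cancel h1).symm⟩
      rw [hq, Nat.add_sub_cancel]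
      have e : (10 * c + 20) * w * (q + 1) = q * (10 * (c * w)) + 20 * (q * w) + 10 * (c * w) +
        20 * w := by ring
      have e' : q * (2 * (c * w) + 1 + 5) = q * (2 * (c * w)) + 6 * q := by ring
      have h2 : q ≤ q * w := Nat.le_mul_of_pos_right _ hw
      have h3 : q * (2 * (c * w)) ≤ q * (10 * (c * w)) := Nat.mul_le_mul_left _ (by omega)
      omega
  have hstart : Holds m₀ T (sieveTable 0) (Function.update m₀ (-4) 1) := by
    have h0 : Holds m₀ T (fun _ => 0) m₀ := ⟨fun _ _ => rfl, fun n => by rw [hz, ite_self]⟩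
    have h1 := h0.update hT1 1
    refine Holds.congr (by simpa using h1) fun n _ => ?_
    rw [sieveTable, sieveRest_zero, Function.update_apply]
    split_ifs <;> first | omega | rfl | simp_all
  have hbase : (Stmt.store (.const (-4)) 1).Ensures (c * w) (2 * (c * w) + 1) [] m₀
      (Holds m₀ T (sieveTable 0)) := .store l6 l7 hs hstart
  have hall := hbase.seq (b := .forE topTerm sieveRound) (W := c * w)
    (Q' := Holds m₀ T (sieveTable T)) fun m hm =>
      Stmt.Ensures.forE (I := fun j => Holds m₀ T (sieveTable j)) (N := T)
        (l8 w [] m (small hm fun n _ => abs_sieveTable_le 0 n)).1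
        (l8 w [] m (small hm fun n _ => abs_sieveTable_le 0 n)).2 (top _ hm) hm
        (fun j hj m hm => round j hj m hm)
  have hsum : ∑ j ∈ Finset.range T, ((10 * c + 20) * w * (T / (j + 1)) + 5) ≤
      (10 * c + 20) * w * (T * w) + 5 * T := by
    rw [Finset.sum_add_distrib, ← Finset.mul_sum, Finset.sum_const, Finset.card_range, smul_eq_mul,
      mul_comm T 5]
    refine Nat.add_le_add_right (Nat.mul_le_mul_left _ ((Finset.sum_le_sum_of_subset ?_).trans
      (sum_div_le T w))) _
    exact Finset.range_mono (by omega)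
  refine hall.mono (Nat.mul_le_mul_right _ (by omega)) ?_ fun m hm =>
    hm.congr fun n hn => if_pos hn
  have h1 : 1 ≤ w * T := Nat.mul_pos hw hT1
  have h2 : c * w * 1 ≤ c * w * (w * T) := Nat.mul_le_mul_left _ h1
  have h3 : 1 * (w * T) ≤ w * (w * T) := Nat.mul_le_mul_right _ hw
  have h4 : T * 1 ≤ T * w := Nat.mul_le_mul_left _ hw
  have e1 : (10 * c + 20) * w * (T * w) = 10 * (c * w * (w * T)) + 20 * (w * (w * T)) := by ring
  have e2 : (c + (22 * c + 40)) * w * (w * T) = 23 * (c * w * (w * T)) + 40 * (w * (w * T)) := by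
    ring
  rw [mul_one] at h2
  have h5 : T ≤ w * T := by rw [mul_comm]; omega
  omega

/-! ### The bound for the coordinates and its seventh root -/

/-- The absolute value of a term. -/
def absTerm (e : Term) : Term := .ite e e (-e)

/-- The maximum of two terms. -/
def maxTerm (a b : Term) : Term := .ite (a - b) a b

/-- An upper bound for the absolute value of the fraction whose numerator and denominator stand in
the given cells. -/
def ceilTerm (p q : Term) : Term := absTerm (.load p) / .load q + 1

/-- The value of `ceilTerm`. -/
def ceilAbs (x : ℚ) : ℕ := x.num.natAbs / x.den + 1

theorem eval_maxTerm (a b : Term) (env : List ℤ) (m : ℤ → ℤ) :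
    (maxTerm a b).eval env m = max (a.eval env m) (b.eval env m) := by
  rw [maxTerm, Term.eval_ite, Term.eval_sub]
  split_ifs with h
  · rw [max_eq_left]; omega
  · rw [max_eq_right]; omega

theorem eval_ceilTerm {p q : Term} {env : List ℤ} {m : ℤ → ℤ} {x : ℚ}
    (hp : m (p.eval env m) = x.num) (hq : m (q.eval env m) = x.den) :
    (ceilTerm p q).eval env m = ceilAbs x := by
  have h : (absTerm (.load p)).eval env m = x.num.natAbs := by
    rw [absTerm, Term.eval_ite, Term.eval_neg, Term.eval_load, hp]
    split_ifs <;> omega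
  rw [ceilTerm, Term.eval_add, Term.eval_div, h, Term.eval_load, hq, Term.eval_one, ceilAbs]
  push_cast; rfl

theorem abs_eq_natAbs_div (x : ℚ) : |(x : ℝ)| = (x.num.natAbs : ℝ) / x.den := by
  rw [Rat.cast_def, abs_div, Nat.abs_cast, Nat.cast_natAbs, Int.cast_abs]

theorem abs_le_ceilAbs (x : ℚ) : |(x : ℝ)| ≤ ceilAbs x := by
  have hd : (0 : ℝ) < x.den := by exact_mod_cast x.den_pos
  rw [abs_eq_natAbs_div, div_le_iff₀ hd, ceilAbs]
  have h := (Nat.lt_mul_div_succ x.num.natAbs x.den_pos).le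
  rw [mul_comm] at h
  exact_mod_cast h

theorem ceilAbs_le (x : ℚ) : (ceilAbs x : ℝ) ≤ |(x : ℝ)| + 1 := by
  rw [abs_eq_natAbs_div, ceilAbs]
  push_cast
  gcongr
  exact Nat.cast_div_le

theorem ceilAbs_le_num (x : ℚ) : ceilAbs x ≤ x.num.natAbs + 1 :=
  Nat.add_le_add_right (Nat.div_le_self _ _) 1

/-- Compute a bound for the absolute values of all coordinates. -/
def boundStmt : Stmt :=
  .seq (.store (.const (-1)) 1) (.forE (.load 0) (.store (.const (-1))
    (maxTerm (maxTerm boundTerm (ceilTerm (4 * .var 0 + 1) (4 * .var 0 + 2)))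
      (ceilTerm (4 * .var 0 + 3) (4 * .var 0 + 4)))))

/-- `B` is the bound computed from the first `j` vertices. -/
structure IsRadius {k : ℕ} (P : Polygon (ℚ × ℚ) k) (j B : ℕ) : Prop where
  one_le : 1 ≤ B
  le : ∀ i : Fin k, (i : ℕ) < j → ceilAbs (P i).1 ≤ B ∧ ceilAbs (P i).2 ≤ B
  eq : B = 1 ∨ ∃ i, B = ceilAbs (P i).1 ∨ B = ceilAbs (P i).2

theorem IsRadius.succ {k : ℕ} {P : Polygon (ℚ × ℚ) k} {B : ℕ} (i : Fin k) (h : IsRadius P i B) :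
    IsRadius P (i + 1) (max (max B (ceilAbs (P i).1)) (ceilAbs (P i).2)) where
  one_le := h.one_le.trans ((le_max_left _ _).trans (le_max_left _ _))
  le i' hi' := by
    rcases Nat.lt_succ_iff_lt_or_eq.1 hi' with hi' | hi'
    · have := h.le i' hi'; omega
    · rw [Fin.ext hi']; omega
  eq := by
    rcases max_choice (max B (ceilAbs (P i).1)) (ceilAbs (P i).2) with e | e
    · rw [e]
      rcases max_choice B (ceilAbs (P i).1) with e | e
      · rw [e]; exact h.eq
      · exact .inr ⟨i, .inl e⟩
    · exact .inr ⟨i, .inr e⟩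

/-- One pass through the vertices finds the bound and writes it into the cell `-1`. -/
theorem ensures_bound : ∃ c, ∀ {k : ℕ} (P : Polygon (ℚ × ℚ) k) (m₀ : ℤ → ℤ) (w : ℕ),
    Loaded m₀ P → Small w [] m₀ → boundStmt.Ensures (c * w) (c * w * (k + 1)) [] m₀ fun m =>
      ∃ B : ℕ, IsRadius P k B ∧ m = Function.update m₀ (-1) B ∧ Small (2 * w) [] m := by
  have l : ∀ e : Term, e.PBd → e.Flat → ∃ c, e.Light c := fun e h h' => h.light h'.fast
  have bm : ∀ {a b : Term}, a.PBd → b.PBd → (maxTerm a b).PBd := fun h h' => .ite (h.sub h') h h'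
  have fm : ∀ {a b : Term}, a.Flat → b.Flat → (maxTerm a b).Flat :=
    fun h h' => .ite (h.sub h') h h'
  have bc : ∀ {a b : Term}, a.PBd → b.PBd → (ceilTerm a b).PBd := fun h h' =>
    (Term.PBd.div (.ite h.load h.load h.load.neg) h'.load).add (.ofNat 1)
  have fc : ∀ {a b : Term}, a.Flat → b.Flat → (ceilTerm a b).Flat := fun h h' =>
    (Term.Flat.div (.ite h.load h.load h.load.neg) h'.load).add (.ofNat 1)
  have ba : ∀ n : ℕ, (4 * .var 0 + (OfNat.ofNat n : Term)).PBd := fun n =>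
    ((Term.PBd.ofNat 4).mul (.var 0)).add (.ofNat n)
  have fa : ∀ n : ℕ, (4 * .var 0 + (OfNat.ofNat n : Term)).Flat := fun n =>
    ((Term.Flat.ofNat 4).mul (.var 0)).add (.ofNat n)
  obtain ⟨c1, h1⟩ := l (.const (-1)) (.const _) (.const _)
  obtain ⟨c2, h2⟩ := l 1 (.ofNat 1) (.ofNat 1)
  obtain ⟨c3, h3⟩ := l (.load 0) (.load (.ofNat 0)) (.load (.ofNat 0))
  obtain ⟨c4, h4⟩ := l _ (bm (bm (.load (.const (-1))) (bc (ba 1) (ba 2))) (bc (ba 3) (ba 4)))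
    (fm (fm (.load (.const (-1))) (fc (fa 1) (fa 2))) (fc (fa 3) (fa 4)))
  obtain ⟨c, hc⟩ : ∃ c, c = c1 + c2 + c3 + c4 := ⟨_, rfl⟩
  replace h1 := h1.mono (show c1 ≤ c by omega)
  replace h2 := h2.mono (show c2 ≤ c by omega)
  replace h3 := h3.mono (show c3 ≤ c by omega)
  replace h4 := h4.mono (show c4 ≤ c by omega)
  refine ⟨10 * (2 * c) + 20, fun {k} P m₀ w hP hs => ?_⟩
  have hw := hs.1
  -- the bound may have one digit more than the coordinates
  have small : ∀ {j B : ℕ}, IsRadius P j B → Small (2 * w) [] (Function.update m₀ (-1) B) := by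
    intro j B hB
    refine ⟨by omega, by simp, fun a => ?_⟩
    rw [Function.update_apply]
    split_ifs
    · rw [bitLength_le, Nat.abs_cast]
      have hpow : (2 : ℤ) * 2 ^ w ≤ 2 ^ (2 * w) := by
        rw [← pow_succ']; exact pow_le_pow_right₀ (by norm_num) (by omega)
      have h0 : (1 : ℤ) ≤ 2 ^ w := one_le_pow₀ (by norm_num)
      rcases hB.eq with rfl | ⟨i, rfl | rfl⟩
      · push_cast; linarith
      · have := ceilAbs_le_num (P i).1
        have h5 := bitLength_le.1 (hs.2.2 (4 * (i : ℕ) + 1))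
        rw [hP.num₁] at h5
        zify at this
        linarith
      · have := ceilAbs_le_num (P i).2
        have h5 := bitLength_le.1 (hs.2.2 (4 * (i : ℕ) + 3))
        rw [hP.num₂] at h5
        zify at this
        linarith
    · exact (hs.2.2 a).trans (by omega)
  have hk : ∀ i : Fin k, bitLength ((i : ℕ) : ℤ) ≤ 2 * w := by
    intro i
    have h5 := hs.2.2 0
    rw [hP.card] at h5
    refine (bitLength_mono ?_).trans (h5.trans (by omega))
    rw [Nat.abs_cast, Nat.abs_cast]
    exact_mod_cast i.2.le
  have keep : ∀ (B : ℕ) (a : ℕ), Function.update m₀ (-1) (B : ℤ) a = m₀ a := fun B a =>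
    Function.update_of_ne (by omega) _ _
  have hbase : (Stmt.store (.const (-1)) 1).Ensures (c * (2 * w)) (2 * (c * (2 * w)) + 1) [] m₀
      fun m => ∃ B : ℕ, IsRadius P 0 B ∧ m = Function.update m₀ (-1) B :=
    .store h1 h2 (hs.mono (by omega)) ⟨1, ⟨le_rfl, fun i hi => absurd hi (Nat.not_lt_zero _),
      .inl rfl⟩, rfl⟩
  have hall := hbase.seq (b := .forE (.load 0) _) (W := c * (2 * w))
    (Q' := fun m => ∃ B : ℕ, IsRadius P k B ∧ m = Function.update m₀ (-1) B) fun m hm => by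
      obtain ⟨B, hB, rfl⟩ := hm
      exact Stmt.Ensures.forE (N := k) (s := fun _ => 2 * (c * (2 * w)) + 1)
        (I := fun j m => ∃ B : ℕ, IsRadius P j B ∧ m = Function.update m₀ (-1) B)
        (h3 _ [] _ (small hB)).1 (h3 _ [] _ (small hB)).2
        ((keep B 0).trans hP.card) ⟨B, hB, rfl⟩ (fun j hj m hm => by
          obtain ⟨B, hB, rfl⟩ := hm
          obtain ⟨i, rfl⟩ : ∃ i : Fin k, (i : ℕ) = j := ⟨⟨j, hj⟩, rfl⟩
          refine .store h1 h4 ((small hB).cons (hk i)) ⟨_, hB.succ i, ?_⟩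
          have k1 := (keep B (4 * i + 1)).trans (by exact_mod_cast hP.num₁ i)
          have k2 := (keep B (4 * i + 2)).trans (by exact_mod_cast hP.den₁ i)
          have k3 := (keep B (4 * i + 3)).trans (by exact_mod_cast hP.num₂ i)
          have k4 := (keep B (4 * i + 4)).trans (by exact_mod_cast hP.den₂ i)
          rw [Term.eval_const, Function.update_idem, eval_maxTerm, eval_maxTerm,
            Term.eval_load, Term.eval_const, Function.update_self,
            eval_ceilTerm (x := (P i).1) (by simpa using k1) (by simpa using k2),
            eval_ceilTerm (x := (P i).2) (by simpa using k3) (by simpa using k4)]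
          push_cast; rfl)
  refine hall.mono ?_ ?_ fun m ⟨B, hB, e⟩ => ⟨B, hB, e, e ▸ small hB⟩
  · nlinarith
  · rw [Finset.sum_const, Finset.card_range, smul_eq_mul]
    have e : (10 * (2 * c) + 20) * w * (k + 1) = 20 * (c * w) * k + 20 * (c * w) + 20 * (w * k) +
      20 * w := by ring
    have e' : k * (2 * (c * (2 * w)) + 1 + 5) = 4 * (c * w) * k + 6 * k := by ring
    have e'' : c * (2 * w) = 2 * (c * w) := by ring
    have h5 : k ≤ w * k := Nat.le_mul_of_pos_left _ hw
    rw [e, e', e'']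
    nlinarith

/-- The least power of `2` whose seventh power is not below the bound. -/
def rootLoop : Term :=
  .loop boundTerm (.cons 1 .nil)
    (boundTerm - .var 0 * .var 0 * .var 0 * .var 0 * .var 0 * .var 0 * .var 0)
    (.cons (.var 0 + .var 0) .nil) (.var 0)

theorem loopVal_root (B : ℤ) (n i : ℕ) (hi : i = 0 ∨ (2 ^ i) ^ 7 < 2 ^ 7 * B) :
    ∃ i' : ℕ, loopVal (fun st => B - (st.getD 0 0) ^ 7) (fun st => [st.getD 0 0 + st.getD 0 0]) n
      [2 ^ i] = [2 ^ i'] ∧ (i' = 0 ∨ (2 ^ i') ^ 7 < 2 ^ 7 * B) ∧ (i' = i + n ∨ B ≤ (2 ^ i') ^ 7) := by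
  induction n generalizing i with
  | zero => exact ⟨i, rfl, hi, .inl rfl⟩
  | succ n ih =>
    rw [loopVal, List.getD_cons_zero]
    split_ifs with h
    · have e : [(2 : ℤ) ^ i + 2 ^ i] = [2 ^ (i + 1)] := by rw [pow_succ]; ring_nf
      rw [e]
      obtain ⟨i', h1, h2, h3⟩ := ih (i + 1) (.inr (by rw [pow_succ 2 i, mul_pow]; linarith))
      exact ⟨i', h1, h2, h3.imp (fun h => by omega) id⟩
    · exact ⟨i, rfl, hi, .inr (by linarith)⟩

section rootLoop
variable (env : List ℤ) (m : ℤ → ℤ)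

/-- The loop stops at a power of `2` that exceeds the seventh root of the bound by a factor of at
most `2`, unless it is `1`. -/
theorem loopVal_rootLoop (n : ℕ) : ∃ i : ℕ, loopVal
      (fun st => (boundTerm - .var 0 * .var 0 * .var 0 * .var 0 * .var 0 * .var 0 * .var 0).eval
        (st ++ env) m)
      (fun st => (Terms.cons (.var 0 + .var 0) .nil).evals (st ++ env) m) n
      ((Terms.cons 1 .nil).evals env m) = [2 ^ i] ∧
    (i = 0 ∨ (2 ^ i) ^ 7 < 2 ^ 7 * m (-1)) ∧ (i = n ∨ m (-1) ≤ (2 ^ i) ^ 7) := by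
  have key : ∀ (n : ℕ) (z : ℤ), loopVal
      (fun st => (boundTerm - .var 0 * .var 0 * .var 0 * .var 0 * .var 0 * .var 0 * .var 0).eval
        (st ++ env) m)
      (fun st => (Terms.cons (.var 0 + .var 0) .nil).evals (st ++ env) m) n [z] =
      loopVal (fun st => m (-1) - (st.getD 0 0) ^ 7) (fun st => [st.getD 0 0 + st.getD 0 0]) n [z] := by
    intro n
    induction n with
    | zero => exact fun _ => rfl
    | succ n ih =>
      intro z
      have e : (boundTerm - .var 0 * .var 0 * .var 0 * .var 0 * .var 0 * .var 0 * .var 0 : Term).eval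
          ([z] ++ env) m = m (-1) - z ^ 7 := by
        simp only [boundTerm, Term.eval_sub, Term.eval_mul, Term.eval_load, Term.eval_const,
          Term.eval_var, List.cons_append, List.getD_cons_zero]
        ring
      have e' : (Terms.cons (.var 0 + .var 0) .nil).evals ([z] ++ env) m = [z + z] := rfl
      rw [loopVal, loopVal, e, e', ih, List.getD_cons_zero]
  obtain ⟨i, h1, h2, h3⟩ := loopVal_root (m (-1)) n 0 (.inl rfl)
  refine ⟨i, ?_, h2, h3.imp_left fun h => by omega⟩
  rw [← h1, ← key]
  rfl

theorem eval_rootLoop : ∃ i : ℕ, rootLoop.eval env m = 2 ^ i ∧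
    (i = 0 ∨ (2 ^ i) ^ 7 < 2 ^ 7 * m (-1)) ∧ m (-1) ≤ (2 ^ i) ^ 7 := by
  obtain ⟨i, h1, h2, h3⟩ := loopVal_rootLoop env m (m (-1)).toNat
  refine ⟨i, ?_, h2, ?_⟩
  · have h4 : boundTerm.eval env m = m (-1) := rfl
    rw [rootLoop, Term.eval, h4, h1]
    rfl
  · rcases h3 with rfl | h3
    · have h4 : (m (-1)).toNat < 2 ^ (m (-1)).toNat := Nat.lt_two_pow_self
      have h5 : m (-1) ≤ 2 ^ (m (-1)).toNat := by
        refine (Int.self_le_toNat _).trans ?_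
        exact_mod_cast h4.le
      exact h5.trans (le_self_pow₀ (one_le_pow₀ (by norm_num)) (by norm_num))
    · exact h3

end rootLoop

theorem pow_seven_lt {w i : ℕ} {z : ℤ} (h : i = 0 ∨ ((2 : ℤ) ^ i) ^ 7 < 2 ^ 7 * z)
    (hz : bitLength z ≤ w) : ((2 : ℤ) ^ i) ^ 7 < 2 ^ (w + 7) := by
  rcases h with rfl | h
  · rw [pow_zero, one_pow]
    exact one_lt_pow₀ (by norm_num) (by omega)
  · have := (le_abs_self z).trans_lt (bitLength_le.1 hz)
    rw [pow_add]; linarith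

theorem light_rootLoop : ∃ c, rootLoop.Light c := by
  have pv : (.var 0 * .var 0 * .var 0 * .var 0 * .var 0 * .var 0 * .var 0 : Term).PBd := by
    have h := Term.PBd.var 0
    exact ((((((h.mul h).mul h).mul h).mul h).mul h).mul h)
  have fv : (.var 0 * .var 0 * .var 0 * .var 0 * .var 0 * .var 0 * .var 0 : Term).Flat := by
    have h := Term.Flat.var 0
    exact ((((((h.mul h).mul h).mul h).mul h).mul h).mul h)
  refine Term.PBd.light ?_ ?_
  · refine Term.PBd.loop rfl (.load (.const _)) (.cons (.ofNat 1) .nil)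
      (.sub (.load (.const _)) pv) (.cons (.add (.var 0) (.var 0)) .nil) (.var 0)
      ⟨8, fun w env m h j _ z hz => ?_⟩
    obtain ⟨i, h1, h2, -⟩ := loopVal_rootLoop env m j
    rw [h1, List.mem_singleton] at hz
    subst hz
    have h3 := pow_seven_lt h2 (h.2.2 _)
    rw [bitLength_le, abs_of_pos (by positivity)]
    refine ((le_self_pow₀ (one_le_pow₀ (by norm_num)) (by norm_num)).trans_lt h3).trans_le ?_
    exact pow_le_pow_right₀ (by norm_num) (by have := h.1; omega)
  · refine Term.Fast.loop (.load (.const _)) (.cons (.ofNat 1) .nil)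
      (.sub (.load (.const _)) fv) (.cons (.add (.var 0) (.var 0)) .nil) (.var 0)
      ⟨1, fun w env m h => ⟨w, by omega, ?_⟩⟩
    obtain ⟨i, h1, -, h3⟩ := loopVal_rootLoop env m w
    rw [h1]
    have e : (boundTerm - .var 0 * .var 0 * .var 0 * .var 0 * .var 0 * .var 0 * .var 0 : Term).eval
        ([2 ^ i] ++ env) m = m (-1) - (2 ^ i) ^ 7 := by
      simp only [boundTerm, Term.eval_sub, Term.eval_mul, Term.eval_load, Term.eval_const,
        Term.eval_var, List.cons_append, List.getD_cons_zero]
      ring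
    rw [e, not_lt, sub_nonpos]
    rcases h3 with rfl | h3
    · have h4 := (le_abs_self _).trans (bitLength_le.1 (h.2.2 (-1))).le
      exact h4.trans (le_self_pow₀ (one_le_pow₀ (by norm_num)) (by norm_num))
    · exact h3

/-- The preparation of the memory: the bound, its root, and the table. -/
def setup : Stmt := .seq boundStmt (.seq (.store (.const (-2)) rootLoop) sieveStmt)

/-- After the preparation, the memory still holds the polygon, and it holds the table, where the
root is at most twice the seventh root of the bound, or `1`. -/
structure Ready {k : ℕ} (P : Polygon (ℚ × ℚ) k) (w B r : ℕ) (m : ℤ → ℤ) : Prop where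
  loaded : Loaded m P
  table : Table m B r
  radius : IsRadius P k B
  root : r = 1 ∨ r ^ 7 < 2 ^ 7 * B
  small : Small w [] m

/-- The preparation takes the time of the pass through the vertices and of the sieve. -/
theorem ensures_setup : ∃ c, ∀ {k : ℕ} (P : Polygon (ℚ × ℚ) k) (m₀ : ℤ → ℤ) (w : ℕ),
    Loaded m₀ P → Small w [] m₀ → (∀ a < 0, m₀ a = 0) → ∃ B r, Ready P (c * w) B r
      (setup.exec [] m₀) ∧ setup.Bd (c * w) [] m₀ ∧
      setup.steps [] m₀ ≤ c * w * w * (k + r ^ 6) := by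
  obtain ⟨c1, h1⟩ := ensures_bound
  obtain ⟨c2, h2⟩ := ensures_sieve
  obtain ⟨c3, h3⟩ := light_rootLoop
  obtain ⟨c4, h4⟩ := (Term.PBd.const (-2)).light (Term.Fast.const (-2))
  obtain ⟨d, hd⟩ : ∃ d, d = c1 + c2 + c3 + c4 := ⟨_, rfl⟩
  refine ⟨200 * d + 100, fun {k} P m₀ w hP hs hz => ?_⟩
  have hw := hs.1
  obtain ⟨a1, a2, B, hB, em, hs1⟩ := h1 P m₀ w hP hs
  obtain ⟨m₁, hm₁⟩ : ∃ m, boundStmt.exec [] m₀ = m := ⟨_, rfl⟩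
  rw [hm₁] at em hs1
  obtain ⟨i, hi, hi2, hi3⟩ := eval_rootLoop [] m₁
  have hi4 := pow_seven_lt hi2 (hs1.2.2 (-1))
  have hB1 : m₁ (-1) = B := by rw [em, Function.update_self]
  obtain ⟨r, hr⟩ : ∃ r : ℕ, r = 2 ^ i := ⟨_, rfl⟩
  have hrz : (2 : ℤ) ^ i = r := by rw [hr]; push_cast; rfl
  have hr1 : 1 ≤ r := hr ▸ Nat.one_le_two_pow
  rw [hrz] at hi hi2 hi3 hi4
  rw [hB1] at hi2 hi3
  have hr7 : r ^ 7 < 2 ^ (2 * w + 7) := by exact_mod_cast hi4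
  have hr6 : r ^ 6 ≤ r ^ 7 := Nat.pow_le_pow_right hr1 (by norm_num)
  -- one bound for the digits of the coordinates, of `B`, and of the table entries
  have hr6' : r ^ 6 + 1 < 2 ^ (10 * w) := by
    have h5 : 2 ^ (2 * w + 7) * 2 ≤ 2 ^ (10 * w) := by
      rw [← pow_succ]; exact Nat.pow_le_pow_right (by norm_num) (by omega)
    have := Nat.one_le_two_pow (n := 2 * w + 7)
    omega
  -- the memory with the root
  have hst := Stmt.Ensures.store (Q := fun m => m = Function.update m₁ (-2) r)
    (h4.mono (show c4 ≤ d by omega)) (h3.mono (show c3 ≤ d by omega)) hs1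
    (by rw [hi, Term.eval_const])
  obtain ⟨b1, b2, em2⟩ := hst
  obtain ⟨m₂, hm₂⟩ : ∃ m, (Stmt.store (.const (-2)) rootLoop).exec [] m₁ = m := ⟨_, rfl⟩
  rw [hm₂] at em2
  have hs2 : Small (10 * w) [] m₂ := by
    refine ⟨by omega, by simp, fun a => ?_⟩
    rw [em2, Function.update_apply]
    split_ifs
    · rw [bitLength_le, Nat.abs_cast]
      have h5 : r ≤ r ^ 6 := Nat.le_self_pow (by norm_num) r
      have h6 : r < 2 ^ (10 * w) := by omega
      exact_mod_cast h6
    · exact (hs1.2.2 a).trans (by omega)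
  have hneg : ∀ n : ℕ, m₂ (-3 - n) = 0 := fun n => by
    rw [em2, em, Function.update_of_ne (by omega), Function.update_of_ne (by omega),
      hz _ (by omega)]
  have hnn : ∀ a : ℤ, 0 ≤ a → m₂ a = m₀ a := fun a ha => by
    rw [em2, em, Function.update_of_ne (by omega), Function.update_of_ne (by omega)]
  obtain ⟨g1, g2, g3⟩ := h2 m₂ r (10 * w) hr1 (by rw [em2, Function.update_self]) hs2 hr6' hneg
  have hfin := g3.small hs2 hr6' fun n _ => (abs_mertens_le n).trans (by omega)
  have hload : ∀ a : ℤ, 0 ≤ a → sieveStmt.exec [] m₂ a = m₀ a := fun a ha => by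
    rw [g3.keep a (by omega), hnn a ha]
  have hle : ∀ x y : ℕ, x ≤ d → y ≤ 10 → x * (y * w) ≤ (200 * d + 100) * w := fun x y hx hy => by
    rw [← mul_assoc]
    refine Nat.mul_le_mul_right w ?_
    have := Nat.mul_le_mul hx hy
    omega
  have hex : setup.exec [] m₀ = sieveStmt.exec [] m₂ := by
    rw [setup, Stmt.exec, Stmt.exec, hm₁, hm₂]
  have hbd : setup.Bd ((200 * d + 100) * w) [] m₀ := by
    rw [setup, Stmt.Bd, Stmt.Bd, hm₁, hm₂]
    exact ⟨a1.mono (by simpa using hle c1 1 (by omega) (by norm_num)),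
      b1.mono (hle d 2 le_rfl (by norm_num)), g1.mono (hle c2 10 (by omega) (by norm_num))⟩
  have hstep : setup.steps [] m₀ ≤ c1 * w * (k + 1) + (2 * (d * (2 * w)) + 1 +
      c2 * (10 * w) * (10 * w * r ^ 6)) := by
    rw [setup, Stmt.steps, Stmt.steps, hm₁, hm₂]
    exact Nat.add_le_add a2 (Nat.add_le_add b2 g2)
  rw [hex]
  refine ⟨B, r, ⟨⟨?_, fun i => ?_, fun i => ?_, fun i => ?_, fun i => ?_⟩, ⟨?_, ?_, hr1, ?_, ?_⟩, hB,
    ?_, hfin.mono (Nat.mul_le_mul_right _ (by omega))⟩, hbd, hstep.trans ?_⟩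
  · exact (hload _ le_rfl).trans hP.card
  · exact (hload _ (by omega)).trans (hP.num₁ i)
  · exact (hload _ (by omega)).trans (hP.den₁ i)
  · exact (hload _ (by omega)).trans (hP.num₂ i)
  · exact (hload _ (by omega)).trans (hP.den₂ i)
  · exact (g3.keep _ (by norm_num)).trans (by rw [em2, Function.update_of_ne (by norm_num), hB1])
  · exact (g3.keep _ le_rfl).trans (by rw [em2, Function.update_self])
  · exact_mod_cast hi3
  · intro n hn
    exact (g3.cell n).trans (if_pos hn)
  · rcases hi2 with rfl | hi2
    · exact .inl hr
    · exact .inr (by exact_mod_cast hi2)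
  · have hT : 1 ≤ r ^ 6 := Nat.one_le_pow _ _ hr1
    have hk : k + 1 ≤ k + r ^ 6 := by omega
    generalize r ^ 6 = T at *
    have q1 : c1 * w * (k + 1) ≤ d * w * w * (k + T) :=
      Nat.mul_le_mul ((Nat.mul_le_mul_right w (by omega)).trans (Nat.le_mul_of_pos_right _ hw)) hk
    have q2 : d * w * 1 ≤ d * w * w * (k + T) :=
      Nat.mul_le_mul (Nat.le_mul_of_pos_right _ hw) (by omega)
    have q3 : 1 ≤ w * w * (k + T) := Nat.mul_pos (Nat.mul_pos hw hw) (by omega)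
    have q4 : c2 * w * (w * T) ≤ d * w * w * (k + T) := by
      rw [← mul_assoc]
      refine Nat.mul_le_mul (Nat.mul_le_mul_right _ (Nat.mul_le_mul_right _ ?_)) ?_ <;> omega
    have e1 : (200 * d + 100) * w * w * (k + T) =
        200 * (d * w * w * (k + T)) + 100 * (w * w * (k + T)) := by ring
    have e2 : c2 * (10 * w) * (10 * w * T) = 100 * (c2 * w * (w * T)) := by ring
    have e3 : d * (2 * w) = 2 * (d * w) := by ring
    rw [e1, e2, e3]
    omega

end Ram

/-! ### The running time -/

namespace Ram

theorem getD_flatten {n : ℕ} : ∀ (l : List (List ℤ)), (∀ u ∈ l, u.length = n) →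
    ∀ i j : ℕ, j < n → l.flatten.getD (n * i + j) 0 = (l.getD i []).getD j 0
  | [], _, i, j, _ => by simp
  | u :: l, h, i, j, hj => by
    have hu := h u (List.mem_cons_self ..)
    rw [List.flatten_cons]
    cases i with
    | zero =>
      rw [mul_zero, zero_add, List.getD_append _ _ _ _ (by omega), List.getD_cons_zero]
    | succ i =>
      rw [List.getD_append_right _ _ _ _ (by rw [hu, Nat.mul_succ]; omega), List.getD_cons_succ, hu,
        ← getD_flatten l (fun u hu => h u (List.mem_cons_of_mem _ hu)) i j hj]
      congr 1
      rw [Nat.mul_succ]; omega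

section input
variable {k : ℕ} (P : Polygon (ℚ × ℚ) k)

theorem init_encode (i : Fin k) {j : ℕ} (hj : j < 4) :
    (init P.encode).mem (4 * (i : ℕ) + (j + 1 : ℕ)) = (pointCode (P i)).getD j 0 := by
  have e : ((4 * (i : ℕ) + (j + 1 : ℕ) : ℤ)).toNat = 4 * i + j + 1 := by omega
  simp only [init]
  rw [if_pos (by positivity), e, Polygon.encode, List.getD_cons_succ,
    getD_flatten (n := 4) _ (by simp [List.mem_ofFn]) i j hj]
  congr 1
  rw [List.getD_eq_getElem _ _ (by simp)]
  simp [pointCode]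

theorem loaded_init : Loaded (init P.encode).mem P where
  card := rfl
  num₁ i := init_encode P i (j := 0) (by norm_num)
  den₁ i := init_encode P i (j := 1) (by norm_num)
  num₂ i := init_encode P i (j := 2) (by norm_num)
  den₂ i := init_encode P i (j := 3) (by norm_num)

variable {P} {b : ℕ}

/-- There are only so many points with short coordinates. -/
theorem card_le_of_hasBits (hP : P.toPlane.IsSimple) (hb : P.HasBits b) : k ≤ 2 ^ (4 * b + 2) := by
  have hinj : Function.Injective fun i : Fin k =>
      ((((P i).1.num, (P i).1.den), ((P i).2.num, (P i).2.den)) : (ℤ × ℕ) × ℤ × ℕ) := by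
    intro i j h
    simp only [Prod.mk.injEq] at h
    refine hP.2.1 ?_
    have h1 : (P i).1 = (P j).1 := Rat.ext h.1.1 h.1.2
    have h2 : (P i).2 = (P j).2 := Rat.ext h.2.1 h.2.2
    simp only [Polygon.toPlane, h1, h2]
  have hsub : Finset.univ.image (fun i : Fin k =>
      ((((P i).1.num, (P i).1.den), ((P i).2.num, (P i).2.den)) : (ℤ × ℕ) × ℤ × ℕ)) ⊆
      (Finset.Ioo (-2 ^ b : ℤ) (2 ^ b) ×ˢ Finset.range (2 ^ b)) ×ˢ
        (Finset.Ioo (-2 ^ b : ℤ) (2 ^ b) ×ˢ Finset.range (2 ^ b)) := by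
    intro z hz
    obtain ⟨i, -, rfl⟩ := Finset.mem_image.1 hz
    obtain ⟨h1, h2, h3, h4⟩ := hb i
    zify at h1 h3
    rw [abs_lt] at h1 h3
    simp only [Finset.mem_product, Finset.mem_Ioo, Finset.mem_range]
    exact ⟨⟨h1, h2⟩, h3, h4⟩
  have h := Finset.card_le_card hsub
  rw [Finset.card_image_of_injective _ hinj, Finset.card_univ, Fintype.card_fin, Finset.card_product,
    Finset.card_product, Int.card_Ioo, Finset.card_range] at h
  have h1 : ((2 : ℤ) ^ b - -2 ^ b - 1).toNat ≤ 2 ^ (b + 1) := by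
    rw [Int.toNat_le]; push_cast; rw [pow_succ]; linarith
  calc k ≤ 2 ^ (b + 1) * 2 ^ b * (2 ^ (b + 1) * 2 ^ b) := h.trans (by gcongr)
    _ = 2 ^ (4 * b + 2) := by ring

theorem small_init (hP : P.toPlane.IsSimple) (hb : P.HasBits b) (h1 : 1 ≤ b) :
    Small (7 * b) [] (init P.encode).mem := by
  refine ⟨by omega, by simp, fun a => ?_⟩
  have hmem : ∀ z ∈ P.encode, bitLength z ≤ 7 * b := by
    intro z hz
    rw [Polygon.encode, List.mem_cons, List.mem_flatten] at hz
    have hpow : (2 : ℤ) ^ b ≤ 2 ^ (7 * b) := pow_le_pow_right₀ (by norm_num) (by omega)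
    rw [bitLength_le]
    rcases hz with rfl | ⟨l, hl, hz⟩
    · have hlt : k < 2 ^ (7 * b) := (card_le_of_hasBits hP hb).trans_lt
        (Nat.pow_lt_pow_right (by norm_num) (by omega))
      rw [Nat.abs_cast]
      exact_mod_cast hlt
    · obtain ⟨i, rfl⟩ := List.mem_ofFn.1 hl
      obtain ⟨h1, h2, h3, h4⟩ := hb i
      zify at h1 h2 h3 h4
      simp only [List.mem_cons, List.not_mem_nil, or_false] at hz
      rcases hz with rfl | rfl | rfl | rfl
      · exact h1.trans_le hpow
      · rw [Nat.abs_cast]; exact h2.trans_le hpow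
      · exact h3.trans_le hpow
      · rw [Nat.abs_cast]; exact h4.trans_le hpow
  simp only [init]
  split_ifs
  · rcases lt_or_ge a.toNat P.encode.length with h | h
    · rw [List.getD_eq_getElem _ _ h]; exact hmem _ (List.getElem_mem h)
    · rw [List.getD_eq_default _ _ h]; simp
  · simp

end input

/-- The program outputs the number of primitive points, at a cost that is bounded in terms of the
approximate root `r`. -/
theorem exists_outputs : ∃ C : ℕ, ∀ {k b : ℕ} (P : Polygon (ℚ × ℚ) k), P.toPlane.IsSimple →
    P.HasBits b → ∃ N t B r : ℕ, (primitivePoints P.toPlane.region).encard = (N : ℕ∞) ∧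
      Outputs (fullProgram setup primCountTerm) P.encode (N : ℤ) t ∧ t ≤ C * b ^ 3 * k * r ^ 6 ∧
      IsRadius P k B ∧ (r = 1 ∨ r ^ 7 < 2 ^ 7 * B) ∧ 1 ≤ b := by
  obtain ⟨c1, h1⟩ := ensures_setup
  obtain ⟨c2, h2⟩ := pbd_primCountTerm
  obtain ⟨c3, h3⟩ := fast_primCountTerm
  refine ⟨(2 * c1 + c3 * c1) * (4 * (c1 + c2 * c1 + 1)) * 343, fun {k b} P hP hb => ?_⟩
  have hk : 3 ≤ k := hP.1
  -- a denominator is a positive number below `2 ^ b`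
  have hb1 : 1 ≤ b := by
    by_contra h0
    have h4 := (hb ⟨0, by omega⟩).2.1
    have h5 := (P ⟨0, by omega⟩).1.den_pos
    obtain rfl : b = 0 := by omega
    rw [pow_zero] at h4
    omega
  -- digits: `b` for the coordinates, and `4 * b + 2` for the number of vertices
  have hs := small_init hP hb hb1
  obtain ⟨w, hw⟩ : ∃ w, w = 7 * b := ⟨_, rfl⟩
  rw [← hw] at hs
  obtain ⟨B, r, hr, hbd, hst⟩ := h1 P _ w (loaded_init P) hs fun a ha => if_neg (by omega)
  have hle : B ≤ r * r ^ 6 := by rw [← pow_succ']; exact hr.table.le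
  obtain ⟨N, hN, hNe⟩ := Polygon.encard_primitivePoints hP hle fun i => by
    obtain ⟨l1, l2⟩ := hr.radius.le i i.2
    exact ⟨(abs_le_ceilAbs _).trans (by exact_mod_cast l1),
      (abs_le_ceilAbs _).trans (by exact_mod_cast l2)⟩
  have hw1 := hs.1
  have hr1 : 1 ≤ r ^ 6 := Nat.one_le_pow _ _ hr.table.one_le
  have hcard : ((setup.exec [] (init P.encode).mem) 0).toNat = k := by rw [hr.loaded.card]; rfl
  have hev := eval_primCountTerm (env := []) hr.loaded hr.table
  have he := h2 _ _ _ hr.small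
  have hest := h3 _ _ _ r hr.small hr.table.sized (by
    show 1 ≤ _ * _
    rw [hcard]; nlinarith)
  simp only [hcard] at hest
  obtain ⟨W, hW⟩ : ∃ W, W = (c1 + c2 * c1 + 1) * w := ⟨_, rfl⟩
  obtain ⟨t, ht, hout⟩ := fullProgram_outputs (W := W) (hW ▸ Nat.mul_pos (Nat.succ_pos _) hw1)
    setup primCountTerm P.encode (hbd.mono (by rw [hW]; exact Nat.mul_le_mul_right _ (by omega)))
    (he.mono (by rw [hW, ← mul_assoc]; exact Nat.mul_le_mul_right _ (by omega)))
  refine ⟨N, t, B, r, hN, by rwa [hNe, ← hev], ?_, hr.radius, hr.root, hb1⟩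
  have hsum : k + r ^ 6 ≤ 2 * (k * r ^ 6) := by nlinarith
  generalize r ^ 6 = T at *
  have q1 : c1 * w * w * (k + T) ≤ c1 * w * w * (2 * (k * T)) := Nat.mul_le_mul_left _ hsum
  have q2 : c3 * (c1 * w) * (k * T) ≤ c3 * (c1 * w) * w * (k * T) :=
    Nat.mul_le_mul_right _ (Nat.le_mul_of_pos_right _ hw1)
  have q3 : 3 * W + 1 ≤ 4 * W := by
    have : 1 ≤ W := hW ▸ Nat.mul_pos (Nat.succ_pos _) hw1
    omega
  calc t ≤ _ := ht
    _ ≤ (c1 * w * w * (2 * (k * T)) + c3 * (c1 * w) * w * (k * T)) * (4 * W) :=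
      Nat.mul_le_mul (Nat.add_le_add (hst.trans q1) (hest.trans q2)) q3
    _ = _ := by rw [hW, hw]; ring

end Ram

namespace Polygon

theorem isBounded_region {k : ℕ} {P : Polygon Plane k} (hP : P.IsSimple) :
    Bornology.IsBounded P.region := by
  obtain ⟨M, hM⟩ : ∃ M : ℝ, ∀ i, |P i 0| ≤ M ∧ |P i 1| ≤ M := by
    refine ⟨∑ i, (|P i 0| + |P i 1|), fun i => ?_⟩
    have := Finset.single_le_sum (f := fun i => |P i 0| + |P i 1|) (fun i _ => by positivity)
      (Finset.mem_univ i)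
    have h1 := abs_nonneg (P i 0)
    have h2 := abs_nonneg (P i 1)
    simp only at this
    constructor <;> linarith
  refine (Metric.isBounded_closedBall (x := (0 : Plane)) (r := √(M ^ 2 + M ^ 2))).subset ?_
  intro p hp
  obtain ⟨h0, h1⟩ := abs_le_of_mem_region hP hM hp
  rw [mem_closedBall_zero_iff, EuclideanSpace.norm_eq]
  apply Real.sqrt_le_sqrt
  simp only [Fin.sum_univ_two, Real.norm_eq_abs]
  gcongr

theorem abs_apply_le_diam {k : ℕ} {P : Polygon Plane k} (hP : P.IsSimple)
    (h0 : (0 : Plane) ∈ P.region) (i : Fin k) (c : Fin 2) : |P i c| ≤ Metric.diam P.region := by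
  have hi : P i ∈ P.region :=
    .inl (Set.mem_iUnion.2 ⟨i, by rw [edgeSet_eq]; exact left_mem_segment ℝ _ _⟩)
  have h1 := Metric.dist_le_diam_of_mem (isBounded_region hP) hi h0
  rw [dist_zero_right] at h1
  exact (PiLp.norm_apply_le (P i) c).trans h1

end Polygon

namespace Ram

/-- The root is small in terms of the diameter: the bound is `1` or exceeds a coordinate by at most
`1`, and the coordinates are at most the diameter, as the region contains the origin. -/
theorem root_pow_le {k B r : ℕ} {P : Polygon (ℚ × ℚ) k} (hP : P.toPlane.IsSimple)
    (h0 : (0 : Plane) ∈ P.toPlane.region) (hB : IsRadius P k B) (hr : r = 1 ∨ r ^ 7 < 2 ^ 7 * B) :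
    (r : ℝ) ^ 6 ≤ 2 ^ 8 * max 1 (Metric.diam P.toPlane.region) ^ (6 / 7 : ℝ) := by
  have hD := Polygon.abs_apply_le_diam hP h0
  set M := max 1 (Metric.diam P.toPlane.region)
  have hM1 : 1 ≤ M := le_max_left _ _
  have hDM : Metric.diam P.toPlane.region ≤ M := le_max_right _ _
  have hBM : (B : ℝ) ≤ 2 * M := by
    rcases hB.eq with rfl | ⟨i, rfl | rfl⟩
    · push_cast; linarith
    · have h1 : |((P i).1 : ℝ)| ≤ _ := hD i 0
      linarith [ceilAbs_le (P i).1]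
    · have h1 : |((P i).2 : ℝ)| ≤ _ := hD i 1
      linarith [ceilAbs_le (P i).2]
  have h7 : (r : ℝ) ^ 7 ≤ 2 ^ 8 * M := by
    rcases hr with rfl | hr
    · push_cast; linarith
    · have h2 : (r : ℝ) ^ 7 < 2 ^ 7 * B := by exact_mod_cast hr
      linarith
  have hr0 : (0 : ℝ) ≤ r := Nat.cast_nonneg r
  calc (r : ℝ) ^ 6 = ((r : ℝ) ^ 7) ^ (6 / 7 : ℝ) := by
        rw [← Real.rpow_natCast, ← Real.rpow_natCast, ← Real.rpow_mul hr0]; norm_num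
    _ ≤ (2 ^ 8 * M) ^ (6 / 7 : ℝ) := Real.rpow_le_rpow (by positivity) h7 (by norm_num)
    _ = (2 ^ 8) ^ (6 / 7 : ℝ) * M ^ (6 / 7 : ℝ) := Real.mul_rpow (by norm_num) (by linarith)
    _ ≤ 2 ^ 8 * M ^ (6 / 7 : ℝ) := by
      gcongr
      exact Real.rpow_le_self_of_one_le (by norm_num) (by norm_num)

end Ram

theorem theorem1 :
    ∃ (prog : Ram.Program) (C : ℕ),
      ∀ (k b : ℕ) (P : Polygon (ℚ × ℚ) k),
        P.toPlane.IsSimple → P.HasBits b → (0 : Plane) ∈ P.toPlane.region →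
        ∃ N t : ℕ,
          (primitivePoints P.toPlane.region).encard = (N : ℕ∞) ∧
          Ram.Outputs prog P.encode (N : ℤ) t ∧
          (t : ℝ) ≤ (C : ℝ) * max 1 (Metric.diam P.toPlane.region) ^ (6 / 7 : ℝ)
            * (k : ℝ) * (b : ℝ) ^ C := by
  obtain ⟨C, hC⟩ := Ram.exists_outputs
  refine ⟨Ram.fullProgram Ram.setup Ram.primCountTerm, C * 2 ^ 8 + 3, fun k b P hP hb h0 => ?_⟩
  obtain ⟨N, t, B, r, hN, hout, ht, hB, hr, hb1⟩ := hC P hP hb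
  refine ⟨N, t, hN, hout, ?_⟩
  have hrD := Ram.root_pow_le hP h0 hB hr
  set M := max 1 (Metric.diam P.toPlane.region) ^ (6 / 7 : ℝ) with hM
  have hM0 : 0 ≤ M := by positivity
  have hb1' : (1 : ℝ) ≤ b := by exact_mod_cast hb1
  -- at most `b ^ 2` instructions for each of the `k * r ^ 6` parts, each of a cost linear in `b`
  calc (t : ℝ) ≤ C * b ^ 3 * k * r ^ 6 := by exact_mod_cast ht
    _ ≤ C * b ^ 3 * k * (2 ^ 8 * M) := by gcongr
    _ = (C * 2 ^ 8 : ℕ) * M * k * b ^ 3 := by push_cast; ring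
    _ ≤ (C * 2 ^ 8 + 3 : ℕ) * M * k * b ^ (C * 2 ^ 8 + 3) := by
      gcongr <;> omega
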